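/- Let $M$ be a smooth compact connected surface without boundary and let $h:T^*M\setminus 0\to\mathbb R$ be smooth, positively homogeneous of degree $0$ ($h(q,\lambda p)=h(q,p)$ for $\lambda>0$), such that $0$ is not a critical value of $h$. Let $\Sigma_0=h^{-1}(0)$, let $\mathcal X_h=\partial_p h\,\partial_q-\partial_q h\,\partial_p$ be the Hamiltonian vector field, so that $\mathcal X_h f=\{h,f\}$, and let $Z_0=\Sigma_0/\mathbb R^+$ be the closed smooth surface obtained from $\Sigma_0$ by dividing by the dilations $(q,p)\mapsto(q,\lambda p)$, $\lambda>0$. A smooth vector field $W$ on an open set $V\subset Z_0$ is said to generate the oriented (singular) foliation $\mathcal F$ on $V$ if, over $V$, it is the projection to $Z_0$ of $c\,\mathcal X_h$ for a smooth positive function $c$, homogeneous of degree $1$. *Definitions.* An escape function is a smooth function $k:\Sigma_0\to\mathbb R$, positively homogeneous of degree $1$, such that $\{h,k\}>\delta$ on $\Sigma_0$ for some constant $\delta>0$. The foliation $\mathcal F$ is Morse–Smale if for some vector field $W$ generating $\mathcal F$ on $Z_0$, with flow $\phi_t$, every non-wandering point is a hyperbolic singular point or lies on a hyperbolic closed cycle,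 and no non-constant orbit has a saddle point as limit both for $t\to-\infty$ and for $t\to+\infty$ (a point $x$ is wandering if it has a neighbourhood $U$ with $\phi_t(U)\cap U=\emptyset$ for all large $t$). A saddle point is weakly stable (resp. weakly unstable) if the trace of the linearization of $W$ at it is negative (resp. positive). A compact invariant set $K$ is an attractor if $K=\bigcap_{t\ge0}\phi_t(U)$ for some open neighbourhood $U$ of $K$, and a repellor if it is an attractor for the reversed flow. A simple structure is a pair $(K_+,K_-)$ of disjoint subsets of $Z_0$ such that $K_+$ is an attractor, $K_-$ is a repellor, and for every $x\notin K_+\cup K_-$ one has $\phi_t(x)\to K_+$ as $t\to+\infty$ and $\phi_t(x)\to K_-$ as $t\to-\infty$. A compact invariant set $K_+$ (resp. $K_-$) is weakly hyperbolic as a sink (resp. as a source) if on some open neighbourhood of it there are a vector field $W'$ generating $\mathcal F$ and a smooth positive density $\mu$ with $\operatorname{div}_\mu W'<0$ (resp. $\operatorname{div}_\mu W'>0$). **Theorem.** If $\mathcal F$ is Morse–Smale, then there exists an escape function. Moreover, for every vector field $W$ generating $\mathcal F$ on $Z_0$, with flow $\phi_t$, there is exactly one simple structure $(K_+,K_-)$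 such that $K_+$ is weakly hyperbolic as a sink and $K_-$ is weakly hyperbolic as a source, and it is given as follows: $K_+$ is the union of all attracting cycles, all attracting singular points, and the unstable manifolds of all weakly stable saddle points; $K_-$ is the union of all repelling cycles, all repelling singular points, and the stable manifolds of all weakly unstable saddle points. -/

import Mathlib

open scoped Manifold ContDiff Topology
open Set Filter Bundle

set_option linter.unusedSectionVars false

noncomputable section

namespace DegreeZero

/-- The model plane `ℝ²`. -/
abbrev Plane := EuclideanSpace ℝ (Fin 2)

/-- The dual of the model plane. -/
abbrev CoPlane := Plane →L[ℝ] ℝ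

section Cotangent

variable (M : Type*) [TopologicalSpace M] [ChartedSpace Plane M] [IsManifold (𝓡 2) ∞ M]

/-- The cotangent bundle of a surface, with the manifold structure of the bundle of linear forms
on the tangent spaces.  Its preferred charts are the canonical coordinates `(q, p)`. -/
abbrev Cotangent := TotalSpace CoPlane (fun x : M => TangentSpace (𝓡 2) x →L[ℝ] Trivial M ℝ x)

/-- The model with corners of the cotangent bundle. -/
abbrev cotModel := (𝓡 2).prod 𝓘(ℝ, CoPlane)

variable {M}

/-- The dilation `(q, p) ↦ (q, c p)`. -/
def dil (c : ℝ) (z : Cotangent M) : Cotangent M := ⟨z.proj, c • z.2⟩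

/-- The Hamiltonian vector field `∂f/∂p ∂_q - ∂f/∂q ∂_p`.  The tangent space at `z` is read in the
preferred chart at `z`, which consists of canonical coordinates `(q, p)`. -/
def hamVec (f : Cotangent M → ℝ) (z : Cotangent M) : TangentSpace cotModel z :=
  let df : Plane × CoPlane →L[ℝ] ℝ := mfderiv cotModel 𝓘(ℝ) f z
  ((∑ i : Fin 2, df (0, EuclideanSpace.proj i) • EuclideanSpace.single i (1 : ℝ),
    -(df.comp (ContinuousLinearMap.inl ℝ Plane CoPlane))) : Plane × CoPlane)

/-- The Poisson bracket `{f, g} = 𝒳_f g`. -/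
def poisson (f g : Cotangent M → ℝ) (z : Cotangent M) : ℝ :=
  mfderiv cotModel 𝓘(ℝ) g z (hamVec f z)

end Cotangent

/-- A smooth Hamiltonian on `T^*M` minus the zero section, positively homogeneous of degree `0`,
for which `0` is not a critical value.  (The values of `toFun` on the zero section are
irrelevant.) -/
structure Hamiltonian (M : Type*) [TopologicalSpace M] [ChartedSpace Plane M]
    [IsManifold (𝓡 2) ∞ M] where
  toFun : Cotangent M → ℝ
  smooth : ContMDiffOn cotModel 𝓘(ℝ) ∞ toFun {z | z.2 ≠ 0}
  homogeneous : ∀ z : Cotangent M, z.2 ≠ 0 → ∀ c : ℝ, 0 < c → toFun (dil c z) = toFun z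
  regular : ∀ z : Cotangent M, z.2 ≠ 0 → toFun z = 0 → mfderiv cotModel 𝓘(ℝ) toFun z ≠ 0

section Shell

variable {M : Type*} [TopologicalSpace M] [ChartedSpace Plane M] [IsManifold (𝓡 2) ∞ M]

namespace Hamiltonian

/-- The energy shell `Σ₀ = h⁻¹(0)` in `T^*M` minus the zero section, as a set. -/
def shellSet (h : Hamiltonian M) : Set (Cotangent M) := {z | z.2 ≠ 0 ∧ h.toFun z = 0}

/-- The energy shell `Σ₀`, as a topological space. -/
abbrev Shell (h : Hamiltonian M) := h.shellSet

lemma dil_mem_shellSet (h : Hamiltonian M) {z : Cotangent M} (hz : z ∈ h.shellSet) {c : ℝ}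
    (hc : 0 < c) : dil c z ∈ h.shellSet :=
  ⟨smul_ne_zero hc.ne' hz.1, by rw [h.homogeneous z hz.1 c hc]; exact hz.2⟩

lemma dil_dil (a b : ℝ) (z : Cotangent M) : dil a (dil b z) = dil (a * b) z := by
  simp only [dil, mul_smul]
  rfl

lemma dil_one (z : Cotangent M) : dil 1 z = z := by
  simp only [dil, one_smul]

/-- Two points of the shell are equivalent if they differ by a positive dilation. -/
def dilSetoid (h : Hamiltonian M) : Setoid h.Shell where
  r z w := ∃ c : ℝ, 0 < c ∧ w.1 = dil c z.1
  iseqv :=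
    { refl := fun z => ⟨1, one_pos, (dil_one z.1).symm⟩
      symm := by
        rintro z w ⟨c, hc, hw⟩
        refine ⟨c⁻¹, inv_pos.2 hc, ?_⟩
        rw [hw, dil_dil, inv_mul_cancel₀ hc.ne', dil_one]
      trans := by
        rintro z w u ⟨c, hc, hw⟩ ⟨d, hd, hu⟩
        exact ⟨d * c, mul_pos hd hc, by rw [hu, hw, dil_dil]⟩ }

/-- `Z₀ = Σ₀ / ℝ⁺`. -/
def Z (h : Hamiltonian M) : Type _ := Quotient h.dilSetoid

instance (h : Hamiltonian M) : TopologicalSpace h.Z :=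
  inferInstanceAs (TopologicalSpace (Quotient h.dilSetoid))

/-- The projection `Σ₀ → Z₀`. -/
def proj (h : Hamiltonian M) (z : h.Shell) : h.Z := Quotient.mk h.dilSetoid z

/-- `g` is a local smooth extension near `z`, to the cotangent bundle, of the function `f` on the
energy shell. -/
def IsLocalExt (h : Hamiltonian M) {F : Type*} [NormedAddCommGroup F] [NormedSpace ℝ F]
    (f : h.Shell → F) (g : Cotangent M → F) (z : h.Shell) : Prop :=
  ContMDiffAt cotModel 𝓘(ℝ, F) ∞ g z.1 ∧
    ∀ᶠ w in 𝓝 z.1, ∀ hw : w ∈ h.shellSet, g w = f ⟨w, hw⟩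

/-- Smoothness at `z` of a function on the shell. -/
def ShellSmoothAt (h : Hamiltonian M) {F : Type*} [NormedAddCommGroup F] [NormedSpace ℝ F]
    (f : h.Shell → F) (z : h.Shell) : Prop :=
  ∃ g, h.IsLocalExt f g z

/-- Smoothness at `y` of a map from the plane to `Z₀`: local existence of a smooth lift to the
shell. -/
def HasSmoothLiftAt (h : Hamiltonian M) (f : Plane → h.Z) (y : Plane) : Prop :=
  ∃ s : Plane → Cotangent M, ContMDiffAt 𝓘(ℝ, Plane) cotModel ∞ s y ∧
    ∀ᶠ x in 𝓝 y, ∃ hs : s x ∈ h.shellSet, h.proj ⟨s x, hs⟩ = f x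

/-- The smooth charts of `Z₀`: the local homeomorphisms `e` to the plane that are smooth when
pulled back to the shell and the inverses of which lift smoothly to the shell. -/
def smoothCharts (h : Hamiltonian M) : Set (OpenPartialHomeomorph h.Z Plane) :=
  {e | (∀ z : h.Shell, h.proj z ∈ e.source → h.ShellSmoothAt (fun w => e (h.proj w)) z) ∧
    ∀ y ∈ e.target, h.HasSmoothLiftAt e.symm y}


/-- The normalization `(x, ξ) ↦ (x, ξ / ξ(v))`. -/
def normalize (v : Plane) (u : Plane × CoPlane) : Plane × CoPlane := (u.1, (u.2 v)⁻¹ • u.2)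

/-- Canonical coordinates at `z₀`, as a local homeomorphism to a vector space. -/
def canon (z₀ : Cotangent M) : OpenPartialHomeomorph (Cotangent M) (Plane × CoPlane) :=
  chartAt (ModelProd Plane CoPlane) z₀

lemma canon_source (z₀ z : Cotangent M) :
    z ∈ (canon z₀).source ↔ z.proj ∈ (chartAt Plane z₀.proj).source := by
  simp only [canon, FiberBundle.chartedSpace_chartAt, mfld_simps]
  constructor
  · exact fun h => h.1.1
  · intro h
    refine ⟨⟨h, mem_univ _⟩, ?_⟩
    rw [Trivialization.coe_fst' _ (by simpa [mfld_simps] using h)]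
    exact h

lemma canon_apply (z₀ z : Cotangent M) (hz : z ∈ (canon z₀).source) :
    canon z₀ z = (chartAt Plane z₀.proj z.proj,
      (trivializationAt CoPlane (fun x : M => TangentSpace (𝓡 2) x →L[ℝ] Trivial M ℝ x)
        z₀.proj).continuousLinearEquivAt ℝ z.proj
          (by simpa [mfld_simps] using (canon_source z₀ z).1 hz) z.2) := by
  have h := (canon_source z₀ z).1 hz
  simp only [canon, FiberBundle.chartedSpace_chartAt, mfld_simps]
  rw [Trivialization.coe_fst' _ (by simpa [mfld_simps] using h)]
  rfl

lemma canon_dil (z₀ z : Cotangent M) (hz : z ∈ (canon z₀).source) (c : ℝ) :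
    canon z₀ (dil c z) = ((canon z₀ z).1, c • (canon z₀ z).2) := by
  rw [canon_apply z₀ z hz, canon_apply z₀ (dil c z) ((canon_source _ _).2
    ((canon_source _ _).1 hz))]
  refine Prod.ext rfl ?_
  exact map_smul _ c z.2

lemma canon_snd_ne (z₀ z : Cotangent M) (hz : z ∈ (canon z₀).source) :
    (canon z₀ z).2 ≠ 0 ↔ z.2 ≠ 0 := by
  rw [canon_apply z₀ z hz]
  exact not_congr (map_eq_zero_iff _ (ContinuousLinearEquiv.injective _))

lemma canon_smoothAt (z₀ z : Cotangent M) (hz : z ∈ (canon z₀).source) :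
    ContMDiffAt cotModel 𝓘(ℝ, Plane × CoPlane) ∞ (canon z₀) z := by
  have := contMDiffOn_extChartAt (I := cotModel) (n := ∞) (x := z₀) (M := Cotangent M)
  exact this.contMDiffAt ((canon z₀).open_source.mem_nhds hz)

lemma canon_symm_smoothAt (z₀ : Cotangent M) (u : Plane × CoPlane) (hu : u ∈ (canon z₀).target) :
    ContMDiffAt 𝓘(ℝ, Plane × CoPlane) cotModel ∞ (canon z₀).symm u := by
  have := contMDiffOn_extChartAt_symm (I := cotModel) (n := ∞) (M := Cotangent M) z₀
  have ht : (extChartAt cotModel z₀).target = (canon z₀).target := by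
    simp [extChartAt, canon, OpenPartialHomeomorph.extend, cotModel]
    rfl
  exact this.contMDiffAt (x := u) (by rw [ht]; exact (canon z₀).open_target.mem_nhds hu)

/-- Two independent linear forms on a four-dimensional space extend to linear coordinates. -/
lemma exists_coords {V : Type*} [NormedAddCommGroup V] [NormedSpace ℝ V] [FiniteDimensional ℝ V]
    (hV : Module.finrank ℝ V = 4) (a b : V →L[ℝ] ℝ) (u v : V)
    (hav : a v = 0) (hau : a u ≠ 0) (hbv : b v ≠ 0) :
    ∃ (A : V →L[ℝ] Plane) (T : V ≃L[ℝ] ℝ × ℝ × Plane), ∀ w, T w = (a w, b w, A w) := by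
  let f : V →ₗ[ℝ] ℝ × ℝ := (a : V →ₗ[ℝ] ℝ).prod b
  have hf : Function.Surjective f := by
    rintro ⟨s, t⟩
    refine ⟨(s / a u) • u + ((t - s / a u * b u) / b v) • v, ?_⟩
    refine Prod.ext ?_ ?_
    · simp [f, hav, hau]
    · simp [f, hbv]
  have hk : Module.finrank ℝ (LinearMap.ker f) = 2 := by
    have := LinearMap.finrank_range_add_finrank_ker f
    rw [LinearMap.range_eq_top.2 hf, finrank_top, hV] at this
    simp at this
    omega
  obtain ⟨P, hP⟩ := LinearMap.exists_leftInverse_of_injective (LinearMap.ker f).subtype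
    (Submodule.ker_subtype _)
  let K : LinearMap.ker f ≃ₗ[ℝ] Plane := LinearEquiv.ofFinrankEq _ _ (by rw [hk]; simp)
  let A : V →ₗ[ℝ] Plane := K.toLinearMap ∘ₗ P
  let T : V →ₗ[ℝ] ℝ × ℝ × Plane := (a : V →ₗ[ℝ] ℝ).prod ((b : V →ₗ[ℝ] ℝ).prod A)
  have hT : Function.Injective T := by
    rw [injective_iff_map_eq_zero]
    intro w hw
    have h1 : a w = 0 := congrArg Prod.fst hw
    have h2 : b w = 0 := congrArg (fun q => q.2.1) hw
    have h3 : A w = 0 := congrArg (fun q => q.2.2) hw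
    have h4 : w ∈ LinearMap.ker f := by
      rw [LinearMap.mem_ker]
      exact Prod.ext h1 h2
    have h5 : P w = 0 := by simpa [A] using h3
    have h6 : P w = ⟨w, h4⟩ := LinearMap.congr_fun hP ⟨w, h4⟩
    rw [h5] at h6
    exact (congrArg Subtype.val h6).symm
  refine ⟨LinearMap.toContinuousLinearMap A, (T.linearEquivOfInjective hT (by
    rw [hV]; simp)).toContinuousLinearEquiv, fun w => rfl⟩

/-- Two functions with independent differentials, the second one linear, extend to local
coordinates in dimension four. -/
lemma exists_local_coords {V : Type*} [NormedAddCommGroup V] [NormedSpace ℝ V]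
    [FiniteDimensional ℝ V] (hV : Module.finrank ℝ V = 4) (H : V → ℝ) (D : Set V) (hDo : IsOpen D)
    (hHs : ContDiffOn ℝ ∞ H D) (u₀ : V) (hu₀D : u₀ ∈ D) (b : V →L[ℝ] ℝ) (r : V)
    (hr : fderiv ℝ H u₀ r = 0) (hb : b r ≠ 0) (hH : fderiv ℝ H u₀ ≠ 0) :
    ∃ (A : V →L[ℝ] Plane) (Θ : OpenPartialHomeomorph V (ℝ × ℝ × Plane)),
      u₀ ∈ Θ.source ∧ Θ.source ⊆ D ∧ (∀ u, Θ u = (H u, b u, A u)) ∧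
      ∀ y ∈ Θ.target, ContDiffAt ℝ ∞ Θ.symm y := by
  have : CompleteSpace V := FiniteDimensional.complete ℝ V
  have hHd : DifferentiableAt ℝ H u₀ :=
    (hHs.contDiffAt (hDo.mem_nhds hu₀D)).differentiableAt (by simp)
  obtain ⟨w, hw⟩ : ∃ w, fderiv ℝ H u₀ w ≠ 0 := by
    by_contra! hcon
    exact hH (ContinuousLinearMap.ext hcon)
  obtain ⟨A, T, hT⟩ := exists_coords hV (fderiv ℝ H u₀) b w r hr hw hb
  let Θ₀ : V → ℝ × ℝ × Plane := fun u => (H u, b u, A u)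
  have hΘs : ContDiffOn ℝ ∞ Θ₀ D := hHs.prodMk (b.contDiff.prodMk A.contDiff).contDiffOn
  have hΘd : HasFDerivAt Θ₀ (T : V →L[ℝ] ℝ × ℝ × Plane) u₀ := by
    have h1 : HasFDerivAt Θ₀ ((fderiv ℝ H u₀).prod (b.prod A)) u₀ :=
      hHd.hasFDerivAt.prodMk (b.hasFDerivAt.prodMk A.hasFDerivAt)
    have h2 : (T : V →L[ℝ] ℝ × ℝ × Plane) = (fderiv ℝ H u₀).prod (b.prod A) :=
      ContinuousLinearMap.ext hT
    rw [h2]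
    exact h1
  have hΘa : ContDiffAt ℝ ∞ Θ₀ u₀ := hΘs.contDiffAt (hDo.mem_nhds hu₀D)
  let Θ₁ := hΘa.toOpenPartialHomeomorph Θ₀ hΘd (by simp)
  let D' : Set V := D ∩ fderiv ℝ Θ₀ ⁻¹'
    range ((↑) : (V ≃L[ℝ] ℝ × ℝ × Plane) → V →L[ℝ] ℝ × ℝ × Plane)
  have hD'o : IsOpen D' := (hΘs.continuousOn_fderiv_of_isOpen hDo (by simp)).isOpen_inter_preimage
    hDo ContinuousLinearEquiv.isOpen
  have hu₀D' : u₀ ∈ D' := ⟨hu₀D, ⟨T, hΘd.fderiv.symm⟩⟩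
  refine ⟨A, Θ₁.restrOpen D' hD'o, ?_, ?_, ?_, ?_⟩
  · rw [OpenPartialHomeomorph.restrOpen_source]
    exact ⟨hΘa.mem_toOpenPartialHomeomorph_source hΘd (by simp), hu₀D'⟩
  · intro u hu
    rw [OpenPartialHomeomorph.restrOpen_source] at hu
    exact hu.2.1
  · intro u
    rfl
  · intro y hy
    have h1 := (Θ₁.restrOpen D' hD'o).map_target hy
    rw [OpenPartialHomeomorph.restrOpen_source] at h1
    obtain ⟨T', hT'⟩ := h1.2.2
    have h2 : ContDiffAt ℝ ∞ Θ₀ ((Θ₁.restrOpen D' hD'o).symm y) :=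
      hΘs.contDiffAt (hDo.mem_nhds h1.2.1)
    refine (Θ₁.restrOpen D' hD'o).contDiffAt_symm (f₀' := T') hy ?_ h2
    rw [hT']
    exact (h2.differentiableAt (by simp)).hasFDerivAt

lemma isOpen_ne_zero : IsOpen {z : Cotangent M | z.2 ≠ 0} := by
  rw [isOpen_iff_mem_nhds]
  intro z hz
  have hs : z ∈ (canon z).source := mem_chart_source (ModelProd Plane CoPlane) z
  have hc : ContinuousAt (fun w => (canon z w).2) z :=
    continuous_snd.continuousAt.comp ((canon z).continuousAt hs)
  have h1 : ∀ᶠ w in 𝓝 z, (canon z w).2 ≠ 0 := hc.eventually_ne ((canon_snd_ne z z hs).2 hz)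
  filter_upwards [h1, (canon z).open_source.mem_nhds hs] with w hw hws
  exact (canon_snd_ne z w hws).1 hw

/-- The shell function in canonical coordinates. -/
lemma canon_ham_smooth (h : Hamiltonian M) (z₀ : Cotangent M) :
    ContDiffOn ℝ ∞ (h.toFun ∘ (canon z₀).symm) ((canon z₀).target ∩ {u | u.2 ≠ 0}) := by
  intro u hu
  have hz : (canon z₀).symm u ∈ (canon z₀).source := (canon z₀).map_target hu.1
  have h1 : ((canon z₀).symm u).2 ≠ 0 := by
    rw [← canon_snd_ne z₀ _ hz, (canon z₀).right_inv hu.1]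
    exact hu.2
  have hopen : IsOpen {z : Cotangent M | z.2 ≠ 0} := isOpen_ne_zero
  have h2 := h.smooth.contMDiffAt (hopen.mem_nhds h1)
  exact (h2.comp u (canon_symm_smoothAt z₀ u hu.1)).contDiffAt.contDiffWithinAt

lemma canon_ham_fderiv (h : Hamiltonian M) (z₀ : Cotangent M) (hz : z₀ ∈ h.shellSet) :
    fderiv ℝ (h.toFun ∘ (canon z₀).symm) (canon z₀ z₀) ≠ 0 := by
  intro h0
  refine h.regular z₀ hz.1 hz.2 ?_
  have hd : MDifferentiableAt cotModel 𝓘(ℝ) h.toFun z₀ :=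
    (h.smooth.contMDiffAt (isOpen_ne_zero.mem_nhds hz.1)).mdifferentiableAt (by simp)
  have hr : range (cotModel : ModelWithCorners ℝ (Plane × CoPlane) _) = univ :=
    ModelWithCorners.Boundaryless.range_eq_univ
  have h1 : fderivWithin ℝ (writtenInExtChartAt cotModel 𝓘(ℝ, ℝ) z₀ h.toFun) (range cotModel)
      (extChartAt cotModel z₀ z₀) = 0 := by
    rw [hr, fderivWithin_univ]
    exact h0
  unfold mfderiv
  exact (if_pos hd).trans h1

/-- The differential of a function that vanishes on a ray vanishes along the ray. -/
lemma fderiv_ray (H : Plane × CoPlane → ℝ) (u : Plane × CoPlane) (hd : DifferentiableAt ℝ H u)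
    (hray : ∀ t : ℝ, 0 < t → H (u.1, t • u.2) = 0) : fderiv ℝ H u (0, u.2) = 0 := by
  have hc : HasDerivAt (fun t : ℝ => ((u.1, t • u.2) : Plane × CoPlane)) (0, u.2) 1 := by
    have h1 : HasDerivAt (fun t : ℝ => t • u.2) ((1 : ℝ) • u.2) 1 :=
      (hasDerivAt_id (1 : ℝ)).smul_const u.2
    rw [one_smul] at h1
    exact (hasDerivAt_const (1 : ℝ) u.1).prodMk h1
  have hH1 : HasFDerivAt H (fderiv ℝ H u) ((fun t : ℝ => ((u.1, t • u.2) :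
      Plane × CoPlane)) 1) := by
    simpa using hd.hasFDerivAt
  have h2 := hH1.comp_hasDerivAt (1 : ℝ) hc
  have h3 : HasDerivAt (H ∘ fun t : ℝ => ((u.1, t • u.2) : Plane × CoPlane)) 0 1 := by
    refine (hasDerivAt_const (1 : ℝ) (0 : ℝ)).congr_of_eventuallyEq ?_
    filter_upwards [lt_mem_nhds (zero_lt_one' ℝ)] with t ht
    exact hray t ht
  exact h2.unique h3

lemma finrank_canon : Module.finrank ℝ (Plane × CoPlane) = 4 := by
  have hco : Module.finrank ℝ CoPlane = 2 := by
    rw [← (LinearMap.toContinuousLinearMap (𝕜 := ℝ) (E := Plane) (F' := ℝ)).finrank_eq]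
    simp
  rw [Module.finrank_prod, hco]
  simp

/-- Adapted coordinates `(h, ξ(v), A)` near a point of the shell. -/
lemma exists_adapted (h : Hamiltonian M) (z₀ : Cotangent M) (hz : z₀ ∈ h.shellSet) :
    ∃ (v : Plane) (A : Plane × CoPlane →L[ℝ] Plane)
      (Θ : OpenPartialHomeomorph (Plane × CoPlane) (ℝ × ℝ × Plane)),
      normalize v (canon z₀ z₀) ∈ Θ.source ∧ 0 < (canon z₀ z₀).2 v ∧
      (∀ u ∈ Θ.source, u ∈ (canon z₀).target ∧ u.2 ≠ 0) ∧
      (∀ u, Θ u = (h.toFun ((canon z₀).symm u), u.2 v, A u)) ∧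
      ∀ y ∈ Θ.target, ContDiffAt ℝ ∞ Θ.symm y := by
  have hs : z₀ ∈ (canon z₀).source := mem_chart_source (ModelProd Plane CoPlane) z₀
  have hne : (canon z₀ z₀).2 ≠ 0 := (canon_snd_ne z₀ z₀ hs).2 hz.1
  have hut : canon z₀ z₀ ∈ (canon z₀).target := (canon z₀).map_source hs
  have hf := canon_ham_fderiv h z₀ hz
  have hHs := canon_ham_smooth h z₀
  have hDo : IsOpen ((canon z₀).target ∩ {u | u.2 ≠ 0}) :=
    (canon z₀).open_target.inter (isOpen_ne_fun continuous_snd continuous_const)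
  have hray : ∀ t : ℝ, 0 < t → (h.toFun ∘ (canon z₀).symm)
      ((canon z₀ z₀).1, t • (canon z₀ z₀).2) = 0 := by
    intro t ht
    have h5 : dil t z₀ ∈ (canon z₀).source :=
      (canon_source _ _).2 ((canon_source _ _).1 hs)
    simp only [Function.comp]
    rw [← canon_dil z₀ z₀ hs t, (canon z₀).left_inv h5]
    exact (h.dil_mem_shellSet hz ht).2
  obtain ⟨v, hv⟩ : ∃ v, (canon z₀ z₀).2 v = 1 := by
    obtain ⟨w, hw⟩ : ∃ w, (canon z₀ z₀).2 w ≠ 0 := by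
      by_contra! hcon
      exact hne (ContinuousLinearMap.ext hcon)
    exact ⟨((canon z₀ z₀).2 w)⁻¹ • w, by simp [hw]⟩
  have hd : DifferentiableAt ℝ (h.toFun ∘ (canon z₀).symm) (canon z₀ z₀) :=
    (hHs.contDiffAt (hDo.mem_nhds ⟨hut, hne⟩)).differentiableAt (by simp)
  have hrad := fderiv_ray _ _ hd hray
  obtain ⟨A, Θ, h1, h2, h3, h4⟩ := exists_local_coords finrank_canon _ _ hDo hHs _ ⟨hut, hne⟩
    ((ContinuousLinearMap.apply ℝ ℝ v).comp (ContinuousLinearMap.snd ℝ Plane CoPlane))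
    (0, (canon z₀ z₀).2) hrad (by simp [hv]) hf
  refine ⟨v, A, Θ, ?_, ?_, fun u hu => h2 hu, h3, h4⟩
  · have h5 : normalize v (canon z₀ z₀) = canon z₀ z₀ := by simp [normalize, hv]
    rw [h5]
    exact h1
  · rw [hv]
    exact one_pos

/-- A chart of the quotient from an invariant function `G` and a local section `σ`. -/
lemma exists_quotient_chart (h : Hamiltonian M) (z₀ : h.Shell) (U : Set (Cotangent M))
    (G : Cotangent M → Plane) (σ : Plane → Cotangent M) (Tg : Set Plane)
    (hUo : IsOpen U) (hTo : IsOpen Tg)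
    (hUdil : ∀ z ∈ U, ∀ c : ℝ, 0 < c → dil c z ∈ U)
    (hGdil : ∀ z ∈ U, ∀ c : ℝ, 0 < c → G (dil c z) = G z)
    (hGs : ∀ z ∈ U, ContMDiffAt cotModel 𝓘(ℝ, Plane) ∞ G z)
    (hσs : ∀ y ∈ Tg, ContMDiffAt 𝓘(ℝ, Plane) cotModel ∞ σ y)
    (hσ : ∀ y ∈ Tg, σ y ∈ h.shellSet ∧ σ y ∈ U ∧ G (σ y) = y)
    (hσG : ∀ z ∈ U, z ∈ h.shellSet → G z ∈ Tg ∧ ∃ c : ℝ, 0 < c ∧ σ (G z) = dil c z) :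
    ∃ e ∈ h.smoothCharts, e.source = h.proj '' {z | z.1 ∈ U} := by
  have hrep : ∀ (z w : h.Shell), h.proj z = h.proj w → ∃ c : ℝ, 0 < c ∧ w.1 = dil c z.1 :=
    fun z w hzw => Quotient.exact hzw
  let g : h.Z → Plane := fun ζ => G (Quotient.out ζ).1
  have hg : ∀ z : h.Shell, z.1 ∈ U → g (h.proj z) = G z.1 := by
    intro z hz
    obtain ⟨c, hc, hcz⟩ := hrep z (Quotient.out (h.proj z)) (Quotient.out_eq (h.proj z)).symm
    simp only [g]
    rw [hcz]
    exact hGdil z.1 hz c hc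
  have hpre : h.proj ⁻¹' (h.proj '' {z | z.1 ∈ U}) = {z : h.Shell | z.1 ∈ U} := by
    refine Subset.antisymm ?_ (subset_preimage_image _ _)
    rintro w ⟨z, hz, hzw⟩
    obtain ⟨c, hc, hcz⟩ := hrep z w hzw
    show w.1 ∈ U
    rw [hcz]
    exact hUdil z.1 hz c hc
  have hso : IsOpen (h.proj '' {z | z.1 ∈ U}) := by
    have h2 : IsOpen (h.proj ⁻¹' (h.proj '' {z | z.1 ∈ U})) := by
      rw [hpre]
      exact hUo.preimage continuous_subtype_val
    exact h2
  classical
  let τ : Plane → h.Z := fun y => if hy : σ y ∈ h.shellSet then h.proj ⟨σ y, hy⟩ else h.proj z₀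
  have hτ : ∀ y, ∀ hy : y ∈ Tg, τ y = h.proj ⟨σ y, (hσ y hy).1⟩ := fun y hy =>
    dif_pos (hσ y hy).1
  let e : OpenPartialHomeomorph h.Z Plane :=
    { toFun := g
      invFun := τ
      source := h.proj '' {z | z.1 ∈ U}
      target := Tg
      map_source' := by
        rintro _ ⟨z, hz, rfl⟩
        rw [hg z hz]
        exact (hσG z.1 hz z.2).1
      map_target' := by
        intro y hy
        rw [hτ y hy]
        exact ⟨_, (hσ y hy).2.1, rfl⟩
      left_inv' := by
        rintro _ ⟨z, hz, rfl⟩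
        obtain ⟨h1, c, hc, h2⟩ := hσG z.1 hz z.2
        rw [hg z hz, hτ _ h1]
        refine (Quotient.sound ?_ : h.proj z = _).symm
        exact ⟨c, hc, h2⟩
      right_inv' := by
        intro y hy
        rw [hτ y hy, hg _ (hσ y hy).2.1]
        exact (hσ y hy).2.2
      open_source := hso
      open_target := hTo
      continuousOn_toFun := by
        have hq : Topology.IsQuotientMap h.proj := isQuotientMap_quot_mk
        rw [hq.continuousOn_isOpen_iff hso]
        have h3 : ContinuousOn (fun z : h.Shell => G z.1) (h.proj ⁻¹' (h.proj '' {z | z.1 ∈ U})) := by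
          intro z hz
          rw [hpre] at hz
          exact ((hGs z.1 hz).continuousAt.comp
            continuous_subtype_val.continuousAt).continuousWithinAt
        refine h3.congr ?_
        intro z hz
        rw [hpre] at hz
        exact hg z hz
      continuousOn_invFun := by
        rw [continuousOn_iff_continuous_domRestrict]
        have h3 : Continuous (fun y : Tg => σ y.1) := by
          rw [continuous_iff_continuousAt]
          intro y
          exact (hσs y.1 y.2).continuousAt.comp continuous_subtype_val.continuousAt
        have hpc : Continuous h.proj := continuous_quot_mk
        have h4 : Continuous (fun y : Tg => h.proj ⟨σ y.1, (hσ y.1 y.2).1⟩) :=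
          hpc.comp (h3.subtype_mk _)
        refine h4.congr ?_
        intro y
        exact (hτ y.1 y.2).symm }
  refine ⟨e, ⟨?_, ?_⟩, rfl⟩
  · rintro z ⟨w, hw, hwz⟩
    obtain ⟨c, hc, hcz⟩ := hrep w z hwz
    have hz : z.1 ∈ U := by
      rw [hcz]
      exact hUdil w.1 hw c hc
    refine ⟨G, hGs z.1 hz, ?_⟩
    filter_upwards [hUo.mem_nhds hz] with x hx hxs
    exact (hg ⟨x, hxs⟩ hx).symm
  · intro y hy
    refine ⟨σ, hσs y hy, ?_⟩
    filter_upwards [hTo.mem_nhds hy] with x hx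
    exact ⟨(hσ x hx).1, (hτ x hx).symm⟩

/-- Every point of `Z₀` lies in the domain of a smooth chart. -/
lemma exists_smoothChart (h : Hamiltonian M) (ζ : h.Z) : ∃ e ∈ h.smoothCharts, ζ ∈ e.source := by
  obtain ⟨⟨z₀, hz₀⟩, rfl⟩ : ∃ z, h.proj z = ζ := Quotient.exists_rep ζ
  obtain ⟨v, A, Θ, hmem, hpos, hsrc, hΘ, hΘs⟩ := exists_adapted h z₀ hz₀
  have hs₀ : z₀ ∈ (canon z₀).source := mem_chart_source (ModelProd Plane CoPlane) z₀
  -- the conic open set of the cotangent bundle on which the chart lives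
  let U : Set (Cotangent M) := {z | (z ∈ (canon z₀).source ∧ 0 < (canon z₀ z).2 v) ∧
    normalize v (canon z₀ z) ∈ Θ.source}
  let G : Cotangent M → Plane := fun z => A (normalize v (canon z₀ z))
  have hnorm : ∀ z ∈ (canon z₀).source, ∀ c : ℝ, 0 < c →
      normalize v (canon z₀ (dil c z)) = normalize v (canon z₀ z) := by
    intro z hz c hc
    rw [canon_dil z₀ z hz c]
    refine Prod.ext rfl ?_
    simp only [normalize, smul_apply, smul_eq_mul, smul_smul]
    congr 1
    rw [mul_inv, mul_comm, ← mul_assoc, mul_inv_cancel₀ hc.ne', one_mul]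
  have hUdil : ∀ z ∈ U, ∀ c : ℝ, 0 < c → dil c z ∈ U := by
    intro z hz c hc
    refine ⟨⟨(canon_source _ _).2 ((canon_source _ _).1 hz.1.1), ?_⟩, ?_⟩
    · rw [canon_dil z₀ z hz.1.1 c]
      exact mul_pos hc hz.1.2
    · rw [hnorm z hz.1.1 c hc]
      exact hz.2
  have hGdil : ∀ z ∈ U, ∀ c : ℝ, 0 < c → G (dil c z) = G z := by
    intro z hz c hc
    simp only [G, hnorm z hz.1.1 c hc]
  have hnsm : ∀ z ∈ (canon z₀).source, 0 < (canon z₀ z).2 v →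
      ContMDiffAt cotModel 𝓘(ℝ, Plane × CoPlane) ∞ (fun z => normalize v (canon z₀ z)) z := by
    intro z hz hv
    have h1 : ContDiffAt ℝ ∞ (normalize v) (canon z₀ z) := by
      refine contDiffAt_fst.prodMk ?_
      have h2 : ContDiffAt ℝ ∞ (fun u : Plane × CoPlane => u.2 v) (canon z₀ z) :=
        contDiffAt_snd.clm_apply contDiffAt_const
      exact (h2.inv hv.ne').smul contDiffAt_snd
    exact h1.contMDiffAt.comp z (canon_smoothAt z₀ z hz)
  have hUo : IsOpen U := by
    rw [isOpen_iff_mem_nhds]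
    intro z hz
    have hc : ContinuousAt (fun w => (canon z₀ w).2 v) z := by
      have h1 : Continuous (fun u : Plane × CoPlane => u.2 v) := by fun_prop
      exact h1.continuousAt.comp ((canon z₀).continuousAt hz.1.1)
    filter_upwards [(canon z₀).open_source.mem_nhds hz.1.1, hc.eventually (lt_mem_nhds hz.1.2),
      (hnsm z hz.1.1 hz.1.2).continuousAt.eventually (Θ.open_source.mem_nhds hz.2)] with w h1 h2 h3
    exact ⟨⟨h1, h2⟩, h3⟩
  have hGs : ∀ z ∈ U, ContMDiffAt cotModel 𝓘(ℝ, Plane) ∞ G z := fun z hz =>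
    A.contDiff.contMDiff.contMDiffAt.comp z (hnsm z hz.1.1 hz.1.2)
  -- the local section
  let σ : Plane → Cotangent M := fun y => (canon z₀).symm (Θ.symm (0, 1, y))
  let Tg : Set Plane := {y | ((0, 1, y) : ℝ × ℝ × Plane) ∈ Θ.target}
  have hTo : IsOpen Tg := Θ.open_target.preimage (by fun_prop)
  have hσ : ∀ y ∈ Tg, σ y ∈ h.shellSet ∧ σ y ∈ U ∧ G (σ y) = y := by
    intro y hy
    have h1 : Θ.symm (0, 1, y) ∈ Θ.source := Θ.map_target hy
    obtain ⟨h2, h3⟩ := hsrc _ h1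
    have h4 := Θ.right_inv hy
    rw [hΘ] at h4
    have h5 : h.toFun (σ y) = 0 := congrArg Prod.fst h4
    have h6 : (Θ.symm (0, 1, y)).2 v = 1 := congrArg (fun q => q.2.1) h4
    have h7 : A (Θ.symm (0, 1, y)) = y := congrArg (fun q => q.2.2) h4
    have h8 : σ y ∈ (canon z₀).source := (canon z₀).map_target h2
    have h9 : canon z₀ (σ y) = Θ.symm (0, 1, y) := (canon z₀).right_inv h2
    have h10 : normalize v (canon z₀ (σ y)) = Θ.symm (0, 1, y) := by
      rw [h9]
      simp [normalize, h6]
    refine ⟨⟨?_, h5⟩, ⟨⟨h8, ?_⟩, ?_⟩, ?_⟩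
    · rw [← canon_snd_ne z₀ _ h8, h9]
      exact h3
    · rw [h9, h6]
      exact one_pos
    · rw [h10]
      exact h1
    · simp only [G, h10, h7]
  have hσG : ∀ z ∈ U, z ∈ h.shellSet → G z ∈ Tg ∧ ∃ c : ℝ, 0 < c ∧ σ (G z) = dil c z := by
    intro z hz hzs
    have hc : 0 < ((canon z₀ z).2 v)⁻¹ := inv_pos.2 hz.1.2
    have h1 : normalize v (canon z₀ z) = canon z₀ (dil ((canon z₀ z).2 v)⁻¹ z) := by
      rw [canon_dil z₀ z hz.1.1]
      rfl
    have h2 : dil ((canon z₀ z).2 v)⁻¹ z ∈ (canon z₀).source := (hUdil z hz _ hc).1.1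
    have h3 : Θ (normalize v (canon z₀ z)) = (0, 1, G z) := by
      rw [hΘ]
      refine Prod.ext ?_ (Prod.ext ?_ rfl)
      · simp only
        rw [h1, (canon z₀).left_inv h2]
        exact (h.dil_mem_shellSet hzs hc).2
      · simp [normalize, hz.1.2.ne']
    have h4 : Θ.symm (0, 1, G z) = normalize v (canon z₀ z) := by
      rw [← h3, Θ.left_inv hz.2]
    refine ⟨?_, _, hc, ?_⟩
    · show ((0, 1, G z) : ℝ × ℝ × Plane) ∈ Θ.target
      rw [← h3]
      exact Θ.map_source hz.2
    · simp only [σ]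
      rw [h4, h1, (canon z₀).left_inv h2]
  have hσs : ∀ y ∈ Tg, ContMDiffAt 𝓘(ℝ, Plane) cotModel ∞ σ y := by
    intro y hy
    have h1 : ContDiffAt ℝ ∞ (fun y : Plane => ((0, 1, y) : ℝ × ℝ × Plane)) y := by fun_prop
    have h2 : ContDiffAt ℝ ∞ (fun y : Plane => Θ.symm (0, 1, y)) y := (hΘs _ hy).comp y h1
    exact (canon_symm_smoothAt z₀ _ (hsrc _ (Θ.map_target hy)).1).comp y h2.contMDiffAt
  obtain ⟨e, he, hes⟩ := exists_quotient_chart h ⟨z₀, hz₀⟩ U G σ Tg hUo hTo hUdil hGdil hGs hσs hσ hσG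
  refine ⟨e, he, ?_⟩
  rw [hes]
  exact ⟨⟨z₀, hz₀⟩, ⟨⟨hs₀, hpos⟩, hmem⟩, rfl⟩

instance (h : Hamiltonian M) : ChartedSpace Plane h.Z where
  atlas := h.smoothCharts
  chartAt ζ := (h.exists_smoothChart ζ).choose
  mem_chart_source ζ := (h.exists_smoothChart ζ).choose_spec.2
  chart_mem_atlas ζ := (h.exists_smoothChart ζ).choose_spec.1

instance (h : Hamiltonian M) : IsManifold (𝓡 2) ∞ h.Z := by
  refine isManifold_of_contDiffOn _ _ _ ?_
  intro e e' he he' y hy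
  have hy1 : y ∈ (e.symm.trans e').source := hy.1
  rw [OpenPartialHomeomorph.trans_source] at hy1
  obtain ⟨s, hs, hse⟩ := he.2 y hy1.1
  obtain ⟨hsy, hsy'⟩ := hse.self_of_nhds
  obtain ⟨g, hg, hge⟩ := he'.1 ⟨s y, hsy⟩ (by rw [hsy']; exact hy1.2)
  have h1 : ContMDiffAt 𝓘(ℝ, Plane) 𝓘(ℝ, Plane) ∞ (g ∘ s) y := hg.comp y hs
  refine (h1.contDiffAt.congr_of_eventuallyEq ?_).contDiffWithinAt
  filter_upwards [hse, hs.continuousAt.eventually hge] with x hx hgx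
  obtain ⟨hx1, hx2⟩ := hx
  show e' (e.symm x) = g (s x)
  rw [hgx hx1, hx2]

end Hamiltonian

end Shell

/-! ### Vector fields, flows and densities on a surface -/

section Dynamics

variable {X : Type*} [TopologicalSpace X] [ChartedSpace Plane X]

/-- The expression of a vector field in a chart. -/
def chartField (W : ∀ x : X, TangentSpace (𝓡 2) x) (e : OpenPartialHomeomorph X Plane)
    (y : Plane) : Plane :=
  mfderiv (𝓡 2) 𝓘(ℝ, Plane) e (e.symm y) (W (e.symm y))

/-- The linearization of a vector field at a singular point, in the preferred chart. -/
def linearization (W : ∀ x : X, TangentSpace (𝓡 2) x) (a : X) : Plane →L[ℝ] Plane :=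
  fderiv ℝ (chartField W (chartAt Plane a)) (chartAt Plane a a)

/-- The complex eigenvalues of a linear endomorphism of the plane. -/
def eigenvalues (L : Plane →L[ℝ] Plane) : Set ℂ :=
  {μ | Polynomial.aeval μ (LinearMap.charpoly (L : Plane →ₗ[ℝ] Plane)) = 0}

/-- Hyperbolic singular points. -/
def IsHyperbolicPoint (W : ∀ x : X, TangentSpace (𝓡 2) x) (a : X) : Prop :=
  W a = 0 ∧ ∀ μ ∈ eigenvalues (linearization W a), μ.re ≠ 0

/-- Attracting (hyperbolic) singular points. -/
def IsAttractingPoint (W : ∀ x : X, TangentSpace (𝓡 2) x) (a : X) : Prop :=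
  W a = 0 ∧ ∀ μ ∈ eigenvalues (linearization W a), μ.re < 0

/-- Repelling (hyperbolic) singular points. -/
def IsRepellingPoint (W : ∀ x : X, TangentSpace (𝓡 2) x) (a : X) : Prop :=
  W a = 0 ∧ ∀ μ ∈ eigenvalues (linearization W a), 0 < μ.re

/-- Saddle points. -/
def IsSaddle (W : ∀ x : X, TangentSpace (𝓡 2) x) (a : X) : Prop :=
  IsHyperbolicPoint W a ∧ (∃ μ ∈ eigenvalues (linearization W a), μ.re < 0) ∧
    ∃ μ ∈ eigenvalues (linearization W a), 0 < μ.re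

/-- Weakly stable saddle points. -/
def IsWeaklyStableSaddle (W : ∀ x : X, TangentSpace (𝓡 2) x) (a : X) : Prop :=
  IsSaddle W a ∧ LinearMap.trace ℝ Plane (linearization W a : Plane →ₗ[ℝ] Plane) < 0

/-- Weakly unstable saddle points. -/
def IsWeaklyUnstableSaddle (W : ∀ x : X, TangentSpace (𝓡 2) x) (a : X) : Prop :=
  IsSaddle W a ∧ 0 < LinearMap.trace ℝ Plane (linearization W a : Plane →ₗ[ℝ] Plane)

/-- `φ` is the (complete) flow of the vector field `W`. -/
def IsFlowOf (φ : Flow ℝ X) (W : ∀ x : X, TangentSpace (𝓡 2) x) : Prop :=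
  ∀ x, IsMIntegralCurve (fun t => φ t x) W

/-- `x` lies on a cycle (a non-constant closed orbit) the linearized Poincaré map of which is the
multiplication by `m`: if `T` is the least period, the differential of `φ_T` induces the
multiplication by `m` on the line `T_x X / ℝ W(x)`. -/
def HasMultiplier (W : ∀ x : X, TangentSpace (𝓡 2) x) (φ : Flow ℝ X) (x : X) (m : ℝ) : Prop :=
  W x ≠ 0 ∧ ∃ T : ℝ, 0 < T ∧ φ T x = x ∧ (∀ s, 0 < s → s < T → φ s x ≠ x) ∧
    ∀ v : TangentSpace (𝓡 2) x,
      ∃ c : ℝ, (mfderiv (𝓡 2) (𝓡 2) (φ T) x v : Plane) = m • (v : Plane) + c • (W x : Plane)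

/-- `x` lies on a hyperbolic cycle. -/
def OnHyperbolicCycle (W : ∀ x : X, TangentSpace (𝓡 2) x) (φ : Flow ℝ X) (x : X) : Prop :=
  ∃ m, HasMultiplier W φ x m ∧ |m| ≠ 1

/-- `x` lies on an attracting (hyperbolic) cycle. -/
def OnAttractingCycle (W : ∀ x : X, TangentSpace (𝓡 2) x) (φ : Flow ℝ X) (x : X) : Prop :=
  ∃ m, HasMultiplier W φ x m ∧ |m| < 1

/-- `x` lies on a repelling (hyperbolic) cycle. -/
def OnRepellingCycle (W : ∀ x : X, TangentSpace (𝓡 2) x) (φ : Flow ℝ X) (x : X) : Prop :=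
  ∃ m, HasMultiplier W φ x m ∧ 1 < |m|

/-- The unstable manifold of a singular point. -/
def unstableManifold (φ : Flow ℝ X) (a : X) : Set X := {x | Tendsto (fun t => φ t x) atBot (𝓝 a)}

/-- The stable manifold of a singular point. -/
def stableManifold (φ : Flow ℝ X) (a : X) : Set X := {x | Tendsto (fun t => φ t x) atTop (𝓝 a)}

/-- Wandering points. -/
def IsWandering (φ : Flow ℝ X) (x : X) : Prop :=
  ∃ U ∈ 𝓝 x, ∀ᶠ t in atTop, φ t '' U ∩ U = ∅

/-- Morse–Smale vector fields on a surface: the non-wandering points are hyperbolic singular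
points and hyperbolic cycles, and no non-constant orbit has saddle points as both its limits. -/
def IsMorseSmaleField (W : ∀ x : X, TangentSpace (𝓡 2) x) (φ : Flow ℝ X) : Prop :=
  (∀ x, ¬ IsWandering φ x → IsHyperbolicPoint W x ∨ OnHyperbolicCycle W φ x) ∧
    ∀ x a b, W x ≠ 0 → IsSaddle W a → IsSaddle W b →
      ¬ (x ∈ unstableManifold φ a ∧ x ∈ stableManifold φ b)

/-- The union of the attracting cycles, the attracting points and the unstable manifolds of the
weakly stable saddle points. -/
def sinkSet (W : ∀ x : X, TangentSpace (𝓡 2) x) (φ : Flow ℝ X) : Set X :=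
  {x | OnAttractingCycle W φ x} ∪ {x | IsAttractingPoint W x} ∪
    ⋃ a ∈ {a | IsWeaklyStableSaddle W a}, unstableManifold φ a

/-- The union of the repelling cycles, the repelling points and the stable manifolds of the
weakly unstable saddle points. -/
def sourceSet (W : ∀ x : X, TangentSpace (𝓡 2) x) (φ : Flow ℝ X) : Set X :=
  {x | OnRepellingCycle W φ x} ∪ {x | IsRepellingPoint W x} ∪
    ⋃ a ∈ {a | IsWeaklyUnstableSaddle W a}, stableManifold φ a

/-- Attractors: compact invariant sets `K` with `K = ⋂_{t ≥ 0} φ_t(U)` for some open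
neighbourhood `U`. -/
def IsAttractor (φ : Flow ℝ X) (K : Set X) : Prop :=
  IsCompact K ∧ (∀ t, φ t '' K = K) ∧
    ∃ U : Set X, IsOpen U ∧ K ⊆ U ∧ K = ⋂ t ∈ Ici (0 : ℝ), φ t '' U

/-- Repellors: attractors of the reversed flow. -/
def IsRepellor (φ : Flow ℝ X) (K : Set X) : Prop := IsAttractor φ.reverse K

/-- Simple structures `X = K₊ ⊔ K₋ ⊔ Ω`. -/
def IsSimpleStructure (φ : Flow ℝ X) (Kp Km : Set X) : Prop :=
  IsAttractor φ Kp ∧ IsRepellor φ Km ∧ Disjoint Kp Km ∧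
    ∀ x, x ∉ Kp → x ∉ Km → Tendsto (fun t => φ t x) atTop (𝓝ˢ Kp) ∧
      Tendsto (fun t => φ t x) atBot (𝓝ˢ Km)

/-- Smooth positive densities on an open set `V`: in each chart `e` a smooth positive function
`ρ_e` (the density being `ρ_e |dy|`), with the transformation rule of densities. -/
structure SmoothDensity (V : Set X) where
  toFun : OpenPartialHomeomorph X Plane → Plane → ℝ
  smooth : ∀ e ∈ atlas Plane X, ContDiffOn ℝ ∞ (toFun e) (e.target ∩ e.symm ⁻¹' V)
  pos : ∀ e ∈ atlas Plane X, ∀ y ∈ e.target ∩ e.symm ⁻¹' V, 0 < toFun e y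
  transform : ∀ e ∈ atlas Plane X, ∀ e' ∈ atlas Plane X, ∀ x ∈ V ∩ e.source ∩ e'.source,
    toFun e (e x) =
      |LinearMap.det (fderiv ℝ (e' ∘ e.symm) (e x) : Plane →ₗ[ℝ] Plane)| * toFun e' (e' x)

/-- The divergence of a vector field with respect to a density `ρ |dy|`, computed in the preferred
chart: `ρ⁻¹ ∑ᵢ ∂ᵢ (ρ Wⁱ)`. -/
def divergence {V : Set X} (ρ : SmoothDensity V) (W : ∀ x : X, TangentSpace (𝓡 2) x) (x : X) : ℝ :=
  LinearMap.trace ℝ Plane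
    (fderiv ℝ (fun y => ρ.toFun (chartAt Plane x) y • chartField W (chartAt Plane x) y)
      (chartAt Plane x x) : Plane →ₗ[ℝ] Plane) / ρ.toFun (chartAt Plane x) (chartAt Plane x x)

end Dynamics

/-! ### The foliation of `Z₀` and escape functions -/

namespace Hamiltonian

variable {M : Type*} [TopologicalSpace M] [ChartedSpace Plane M] [IsManifold (𝓡 2) ∞ M]

/-- The derivative `𝒳_h f` at `z` of a smooth function `f` on the energy shell, to which `𝒳_h` is
tangent, has the value `d`. -/
def HasHamDerivAt (h : Hamiltonian M) (f : h.Shell → ℝ) (d : ℝ) (z : h.Shell) : Prop :=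
  ∃ g, h.IsLocalExt f g z ∧ poisson h.toFun g z.1 = d

/-- The vector field `W` on `Z₀` generates over the open set `V` the oriented foliation:
it is smooth on `V` and it is there the projection of `c 𝒳_h`, where `c` is a smooth positive
function on the cone over `V`, homogeneous of degree `1`.  Tangent vectors are compared through
their action on smooth functions. -/
def Generates (h : Hamiltonian M) (W : ∀ ζ : h.Z, TangentSpace (𝓡 2) ζ) (V : Set h.Z) : Prop :=
  ContMDiffOn (𝓡 2) (𝓡 2).tangent ∞ (fun ζ => (⟨ζ, W ζ⟩ : TangentBundle (𝓡 2) h.Z)) V ∧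
  ∃ c : h.Shell → ℝ, ∀ z : h.Shell, h.proj z ∈ V →
    0 < c z ∧ h.ShellSmoothAt c z ∧
    (∀ (r : ℝ) (hr : 0 < r), c ⟨dil r z.1, h.dil_mem_shellSet z.2 hr⟩ = r * c z) ∧
    ∀ f : h.Z → ℝ, ContMDiffAt (𝓡 2) 𝓘(ℝ) ∞ f (h.proj z) →
      ∃ d, h.HasHamDerivAt (fun w => f (h.proj w)) d z ∧
        (mfderiv (𝓡 2) 𝓘(ℝ) f (h.proj z) (W (h.proj z)) : ℝ) = c z * d

/-- The oriented foliation of `Z₀` is Morse–Smale. -/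
def IsMorseSmale (h : Hamiltonian M) : Prop :=
  ∃ (W : ∀ ζ : h.Z, TangentSpace (𝓡 2) ζ) (φ : Flow ℝ h.Z),
    h.Generates W univ ∧ IsFlowOf φ W ∧ IsMorseSmaleField W φ

/-- Escape functions: smooth functions `k` on the energy shell, positively homogeneous of degree
`1`, with `{h, k} > δ` for some constant `δ > 0`. -/
def IsEscapeFunction (h : Hamiltonian M) (k : h.Shell → ℝ) : Prop :=
  (∀ z, h.ShellSmoothAt k z) ∧
  (∀ (z : h.Shell) (r : ℝ) (hr : 0 < r), k ⟨dil r z.1, h.dil_mem_shellSet z.2 hr⟩ = r * k z) ∧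
  ∃ δ > 0, ∀ z, ∃ d > δ, h.HasHamDerivAt k d z

/-- Weak hyperbolicity of a sink: near `K` the foliation is generated by a vector field with
negative divergence with respect to some smooth density. -/
def IsWeaklyHyperbolicSink (h : Hamiltonian M) (K : Set h.Z) : Prop :=
  ∃ (V : Set h.Z) (W : ∀ ζ : h.Z, TangentSpace (𝓡 2) ζ) (ρ : SmoothDensity V),
    IsOpen V ∧ K ⊆ V ∧ h.Generates W V ∧ ∀ ζ ∈ V, divergence ρ W ζ < 0

/-- Weak hyperbolicity of a source: near `K` the foliation is generated by a vector field with
positive divergence with respect to some smooth density. -/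
def IsWeaklyHyperbolicSource (h : Hamiltonian M) (K : Set h.Z) : Prop :=
  ∃ (V : Set h.Z) (W : ∀ ζ : h.Z, TangentSpace (𝓡 2) ζ) (ρ : SmoothDensity V),
    IsOpen V ∧ K ⊆ V ∧ h.Generates W V ∧ ∀ ζ ∈ V, 0 < divergence ρ W ζ

end Hamiltonian

end DegreeZero

end

/-! Fix a generator `W`, the projection of `c 𝒳_h`. The hypersurface `c = 1` of the energy shell is
a copy of `Z₀`, and on it `𝒳_h` splits as `W + a E`, where `E = p ∂_p` is the Euler field and `a =
{h, c}` is the growth of the scale `c` (`IsGenerator.hamLin_eq`). If `k = c g` with `g` a function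
on `Z₀`, then `{h, k}` has degree `0` and equals `W g + a g` on this hypersurface. An escape
function therefore amounts to a smooth `g` on `Z₀` with `W g + a g > 0`
(`IsGenerator.isEscapeFunction`).

Symplectic geometry ties `a` to the dynamics. The Liouville form `p dq` restricted to the
hypersurface is the contraction of `W` with a nowhere vanishing signed area density `r dy`, and its
exterior derivative is `-a r dy`. Hence the divergence of `W` for the density `|r| dy` is `-a`
(`exists_ratio`, `IsGenerator.hasDivergence`). This has three consequences. At a singular point `a`
is the opposite of the trace of the linearization, and it is nonzero there because `𝒳_h = a E` does
not vanish. By Liouville's formula, the multiplier of a cycle has absolute value `exp (-∫ a)`. So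
attracting points and cycles and weakly stable saddles are exactly the critical elements with
positive `a` or positive `∫ a`, among those of the relevant index. `FoliationData` records the
consequences used later, and the dynamical part works with any such data.

For a Morse–Smale field let `A`, `R`, `P`, `Q` be the attracting elements, the repelling elements,
the weakly stable saddles and the weakly unstable saddles. They are closed and exhaust the
non-wandering set, and every half-orbit converges to one of them. As no orbit joins saddles, the set
of points whose past tends to `A ∪ P` is closed and disjoint from the set of points whose future
tends to `R ∪ Q`. These two sets are `sinkSet` and `sourceSet`; all other orbits go from the second
to the first, so they form an attractor-repeller pair and a simple structure (`isClosed_sink`,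
`FoliationData.isAttractorRepeller`).

To find `g`, let `f₀` be `1` near the sink and `-1` near the source, and put `f x = ∫₀ᵀ exp (∫₀ˢ a)
f₀ (φ_s x) ds`. Along the flow, `W f + a f = exp (∫₀ᵀ a) f₀ (φ_T x) - f₀ x`. For large `T` the
integrals of `a` are positive on orbits that start away from the source and negative on orbits that
end away from the sink, uniformly by compactness, so the right side is positive
(`IsAttractorRepeller.exists_time`, `weightedAverage_pos`). The function `f` is locally Lipschitz;
mollification in charts and a partition of unity make it smooth while keeping its derivative along
`W` (`exists_mollification`, `IsFlowOf.exists_approx`). This gives `FoliationData.exists_escape`,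
with `g > 0` on the sink and `g < 0` on the source.

The same `g` proves weak hyperbolicity: for the density `|r| dy / |g|` the divergence of `W` is `-(W
g + a g) / g`. For uniqueness, passing to another generator and density replaces `-a` by `u (-a + W
log q)` with `u, q > 0`. Near a weakly hyperbolic source this gives `a < W (log q)`, and integration
over a cycle or at a fixed point forbids the elements of `A` and `P` there; so they lie on the other
side together with their unstable manifolds. Time reversal gives the second inclusion, and the
attractor-repeller property upgrades both to equalities (`simpleStructure_unique`). The same
formula, with a time change, shows that the Morse–Smale property passes from one generator to all
(`morseSmale_of_smul`). -/

noncomputable section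

namespace DegreeZero

/-! ### Topological dynamics of flows on compact spaces -/

section TopologicalDynamics

variable {X : Type*} [TopologicalSpace X]

/-- Invariance of a set under a flow. -/
def Inv (φ : Flow ℝ X) (S : Set X) : Prop := ∀ t, ∀ x ∈ S, φ t x ∈ S

/-- Convergence of the positive half-orbit of `x` to the set `S`. -/
def ToFut (φ : Flow ℝ X) (x : X) (S : Set X) : Prop := Tendsto (fun t => φ t x) atTop (𝓝ˢ S)

/-- Convergence of the negative half-orbit of `x` to the set `S`. -/
def ToPast (φ : Flow ℝ X) (x : X) (S : Set X) : Prop := Tendsto (fun t => φ t x) atBot (𝓝ˢ S)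

lemma flow_neg_apply (φ : Flow ℝ X) (t : ℝ) (x : X) : φ (-t) (φ t x) = x := by
  rw [← Flow.map_add, neg_add_cancel, Flow.map_zero_apply]

lemma flow_apply_neg (φ : Flow ℝ X) (t : ℝ) (x : X) : φ t (φ (-t) x) = x := by
  rw [← Flow.map_add, add_neg_cancel, Flow.map_zero_apply]

lemma reverse_reverse (φ : Flow ℝ X) : φ.reverse.reverse = φ := by
  ext t x
  simp [Flow.reverse_apply]

lemma Inv.reverse {φ : Flow ℝ X} {S : Set X} (h : Inv φ S) : Inv φ.reverse S :=
  fun t x hx => h (-t) x hx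

lemma Inv.image_eq {φ : Flow ℝ X} {S : Set X} (h : Inv φ S) (t : ℝ) : φ t '' S = S :=
  Subset.antisymm (image_subset_iff.2 fun x hx => h t x hx)
    fun x hx => ⟨φ (-t) x, h (-t) x hx, flow_apply_neg φ t x⟩

lemma Inv.mem_iff {φ : Flow ℝ X} {S : Set X} (h : Inv φ S) (t : ℝ) (x : X) :
    φ t x ∈ S ↔ x ∈ S :=
  ⟨fun hx => by simpa [flow_neg_apply] using h (-t) _ hx, h t x⟩

lemma toPast_iff {φ : Flow ℝ X} {x : X} {S : Set X} : ToPast φ x S ↔ ToFut φ.reverse x S := by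
  unfold ToPast ToFut
  constructor
  · exact fun h => h.comp tendsto_neg_atTop_atBot
  · intro h
    have := h.comp tendsto_neg_atBot_atTop
    refine this.congr fun t => ?_
    simp [Flow.reverse_apply]

lemma toPast_reverse_iff {φ : Flow ℝ X} {x : X} {S : Set X} :
    ToPast φ.reverse x S ↔ ToFut φ x S := by
  rw [toPast_iff, reverse_reverse]

lemma ToFut.mono {φ : Flow ℝ X} {x : X} {S T : Set X} (h : ToFut φ x S) (hST : S ⊆ T) :
    ToFut φ x T := h.mono_right (nhdsSet_mono hST)

lemma ToPast.mono {φ : Flow ℝ X} {x : X} {S T : Set X} (h : ToPast φ x S) (hST : S ⊆ T) :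
    ToPast φ x T := h.mono_right (nhdsSet_mono hST)

lemma Inv.toFut {φ : Flow ℝ X} {S : Set X} (h : Inv φ S) {x : X} (hx : x ∈ S) : ToFut φ x S := by
  refine Tendsto.mono_right ?_ principal_le_nhdsSet
  exact tendsto_principal.2 (Eventually.of_forall fun t => h t x hx)

lemma Inv.toPast {φ : Flow ℝ X} {S : Set X} (h : Inv φ S) {x : X} (hx : x ∈ S) : ToPast φ x S :=
  toPast_iff.2 (h.reverse.toFut hx)

lemma ToFut.shift {φ : Flow ℝ X} {x : X} {S : Set X} (h : ToFut φ x S) (s : ℝ) :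
    ToFut φ (φ s x) S := by
  have := h.comp (tendsto_atTop_add_const_right atTop s tendsto_id)
  refine this.congr fun t => ?_
  simp [Flow.map_add]

lemma ToPast.shift {φ : Flow ℝ X} {x : X} {S : Set X} (h : ToPast φ x S) (s : ℝ) :
    ToPast φ (φ s x) S := by
  rw [toPast_iff] at h ⊢
  have := h.shift (-s)
  simpa [Flow.reverse_apply] using this

lemma inv_setOf_toPast (φ : Flow ℝ X) (S : Set X) : Inv φ {x | ToPast φ x S} :=
  fun t _ hx => ToPast.shift hx t

lemma Inv.closure {φ : Flow ℝ X} {S : Set X} (h : Inv φ S) : Inv φ (closure S) := fun t _ hx =>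
  map_mem_closure (φ.continuous_toFun t) hx (h t)

/-- The non-wandering set. -/
def nonwandering (φ : Flow ℝ X) : Set X := {x | ¬ IsWandering φ x}

lemma IsWandering.reverse {φ : Flow ℝ X} {x : X} (h : IsWandering φ x) :
    IsWandering φ.reverse x := by
  obtain ⟨U, hU, ht⟩ := h
  refine ⟨U, hU, ht.mono fun t h0 => ?_⟩
  rw [eq_empty_iff_forall_notMem] at h0 ⊢
  rintro _ ⟨⟨y, hy, rfl⟩, hy'⟩
  refine h0 y ⟨⟨_, hy', ?_⟩, hy⟩
  rw [Flow.reverse_apply]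
  exact flow_apply_neg φ t y

lemma nonwandering_reverse (φ : Flow ℝ X) : nonwandering φ.reverse = nonwandering φ := by
  ext x
  refine not_congr ⟨fun h => ?_, fun h => h.reverse⟩
  simpa [reverse_reverse] using h.reverse

lemma isClosed_nonwandering (φ : Flow ℝ X) : IsClosed (nonwandering φ) := by
  rw [← isOpen_compl_iff, isOpen_iff_mem_nhds]
  intro x hx
  obtain ⟨U, hU, ht⟩ := not_not.1 hx
  filter_upwards [eventually_mem_nhds_iff.2 hU] with y hy
  exact not_not.2 ⟨U, hy, ht⟩

/-- The multiples of the period are arbitrarily late return times of the point itself. -/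
lemma mem_nonwandering_of_periodic {φ : Flow ℝ X} {x : X} {T : ℝ} (hT : 0 < T)
    (hx : φ T x = x) : x ∈ nonwandering φ := by
  rintro ⟨U, hU, ht⟩
  have hn : ∀ n : ℕ, φ (n * T) x = x := by
    intro n
    induction n with
    | zero => simp
    | succ n ih => rw [Nat.cast_succ, add_mul, one_mul, Flow.map_add, hx, ih]
  have h1 : Tendsto (fun n : ℕ => (n : ℝ) * T) atTop atTop :=
    tendsto_natCast_atTop_atTop.atTop_mul_const hT
  obtain ⟨n, h2⟩ := (h1.eventually ht).exists
  have h3 : x ∈ φ (n * T) '' U ∩ U := ⟨⟨x, mem_of_mem_nhds hU, hn n⟩, mem_of_mem_nhds hU⟩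
  rw [h2] at h3
  exact h3

/-- A neighbourhood of a cluster point is visited at arbitrarily late times, so two visits can be
separated by more than any given time; the later one is a late return of the earlier one. -/
lemma mapClusterPt_mem_nonwandering {φ : Flow ℝ X} {x y : X}
    (h : MapClusterPt y atTop (fun t => φ t x)) : y ∈ nonwandering φ := by
  rintro ⟨U, hU, ht⟩
  obtain ⟨T, hT⟩ := eventually_atTop.1 ht
  have hf := h.frequently (p := (· ∈ U)) hU
  obtain ⟨t₁, -, h1⟩ := frequently_atTop.1 hf 0
  obtain ⟨t₂, h2, h3⟩ := frequently_atTop.1 hf (t₁ + T)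
  have h4 : φ t₂ x ∈ φ (t₂ - t₁) '' U ∩ U := by
    refine ⟨⟨_, h1, ?_⟩, h3⟩
    rw [← Flow.map_add]
    congr 1
    ring
  rw [hT _ (by linarith)] at h4
  exact h4

variable [CompactSpace X] [T2Space X]

/-- If the orbit kept leaving a neighbourhood of `S` while staying in the compact set `N`, it would
have a cluster point in `N` off `S`, and cluster points are non-wandering. -/
lemma toFut_of_nonwandering {φ : Flow ℝ X} {x : X} {N S : Set X} (hN : IsClosed N)
    (hx : ∀ᶠ t in atTop, φ t x ∈ N) (hS : nonwandering φ ∩ N ⊆ S) : ToFut φ x S := by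
  intro O hO
  rw [mem_map]
  obtain ⟨V, hVo, hSV, hVO⟩ := mem_nhdsSet_iff_exists.1 hO
  by_contra hcon
  have hfr : ∃ᶠ t in atTop, φ t x ∈ Vᶜ ∩ N := by
    have h1 : ∃ᶠ t in atTop, ¬ φ t x ∈ O :=
      fun h => hcon (h.mono fun t ht => not_not.1 ht)
    exact (h1.and_eventually hx).mono fun t ht => ⟨fun h => ht.1 (hVO h), ht.2⟩
  obtain ⟨y, hy, hyc⟩ := (hVo.isClosed_compl.inter hN).isCompact.exists_mapClusterPt_of_frequently hfr
  exact hy.1 (hSV (hS ⟨mapClusterPt_mem_nonwandering hyc, hy.2⟩))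

lemma ToFut.not_disjoint {φ : Flow ℝ X} {x : X} {S T : Set X} (hS : ToFut φ x S)
    (hT : ToFut φ x T) (hSc : IsClosed S) (hTc : IsClosed T) : ¬ Disjoint S T := by
  intro hd
  obtain ⟨U, V, hU, hV, hSU, hTV, hUV⟩ := normal_separation hSc hTc hd
  have h1 := hS.eventually (hU.mem_nhdsSet.2 hSU)
  have h2 := hT.eventually (hV.mem_nhdsSet.2 hTV)
  obtain ⟨t, h3, h4⟩ := (h1.and h2).exists
  exact hUV.le_bot ⟨h3, h4⟩

lemma ToPast.not_disjoint {φ : Flow ℝ X} {x : X} {S T : Set X} (hS : ToPast φ x S)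
    (hT : ToPast φ x T) (hSc : IsClosed S) (hTc : IsClosed T) : ¬ Disjoint S T :=
  (toPast_iff.1 hS).not_disjoint (toPast_iff.1 hT) hSc hTc

lemma ToFut.inter_nonempty {φ : Flow ℝ X} {x : X} {S F : Set X} (hS : ToFut φ x S)
    (hSc : IsClosed S) (hF : IsClosed F) (hx : ∀ᶠ t in atTop, φ t x ∈ F) : (F ∩ S).Nonempty := by
  by_contra hne
  have hd : Disjoint S F := by
    rw [disjoint_comm, disjoint_iff_inter_eq_empty]
    exact not_nonempty_iff_eq_empty.1 hne
  obtain ⟨U, V, hU, hV, hSU, hTV, hUV⟩ := normal_separation hSc hF hd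
  obtain ⟨t, h3, h4⟩ := ((hS.eventually (hU.mem_nhdsSet.2 hSU)).and hx).exists
  exact hUV.le_bot ⟨h3, hTV h4⟩

lemma ToPast.inter_nonempty {φ : Flow ℝ X} {x : X} {S F : Set X} (hS : ToPast φ x S)
    (hSc : IsClosed S) (hF : IsClosed F) (hx : ∀ᶠ t in atBot, φ t x ∈ F) : (F ∩ S).Nonempty :=
  (toPast_iff.1 hS).inter_nonempty hSc hF (tendsto_neg_atTop_atBot.eventually hx)

/-- A late half-orbit is connected and contained in two disjoint open sets around `S` and `T`, hence
in one of them. -/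
lemma ToFut.or {φ : Flow ℝ X} {x : X} {S T : Set X} (h : ToFut φ x (S ∪ T))
    (hSc : IsClosed S) (hTc : IsClosed T) (hd : Disjoint S T) : ToFut φ x S ∨ ToFut φ x T := by
  obtain ⟨U, V, hU, hV, hSU, hTV, hUV⟩ := normal_separation hSc hTc hd
  have h1 : ∀ᶠ t in atTop, φ t x ∈ U ∪ V :=
    h.eventually ((hU.union hV).mem_nhdsSet.2 (union_subset_union hSU hTV))
  obtain ⟨t₀, ht₀⟩ := eventually_atTop.1 h1
  have hpc : IsPreconnected ((fun t => φ t x) '' Ici t₀) :=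
    isPreconnected_Ici.image _ (φ.continuous continuous_id continuous_const).continuousOn
  have hsub : (fun t => φ t x) '' Ici t₀ ⊆ U ∪ V := by
    rintro _ ⟨t, ht, rfl⟩
    exact ht₀ t ht
  have key : ∀ {A B A' B' : Set X}, IsOpen B → Disjoint A B → A' ⊆ A → B' ⊆ B →
      (fun t => φ t x) '' Ici t₀ ⊆ A → ToFut φ x (A' ∪ B') → ToFut φ x A' := by
    intro A B A' B' hB hAB hA' hB' hs hto O hO
    obtain ⟨O', hO', hAO', hO'O⟩ := mem_nhdsSet_iff_exists.1 hO
    have h2 : (fun t => φ t x) ⁻¹' (Bᶜ) ∈ atTop := by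
      filter_upwards [Ici_mem_atTop t₀] with t ht hB
      exact hAB.le_bot ⟨hs ⟨t, ht, rfl⟩, hB⟩
    have h3 := hto.eventually ((hO'.union hB).mem_nhdsSet.2 (union_subset_union hAO' hB'))
    rw [mem_map]
    filter_upwards [h3, h2] with t h4 h5
    exact h4.elim (fun h => hO'O h) fun h => absurd h h5
  rcases hpc.subset_or_subset hU hV hUV hsub with hs | hs
  · exact Or.inl (key hV hUV hSU hTV hs h)
  · exact Or.inr (key hU hUV.symm hTV hSU hs (by rwa [union_comm]))

end TopologicalDynamics

/-! ### Morse decompositions and attractor-repeller pairs. -/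

section AttractorRepeller

variable {X : Type*} [TopologicalSpace X] [CompactSpace X] [T2Space X]

/-- If no negative half-orbit that starts on the frontier of `N` stays in `N`, then `N` is not left
in positive time by the orbits starting near a point the positive orbit of which is inside `N`. -/
lemma eventually_forall_mem_of_frontier {φ : Flow ℝ X} {N F : Set X} (hN : IsClosed N)
    (hF : IsClosed F) (hFi : Inv φ F) {p : X} (hp : ∀ t, 0 ≤ t → φ t p ∈ interior N)
    (h : ∀ y ∈ frontier N, y ∈ F → ∃ s, 0 ≤ s ∧ φ (-s) y ∉ N) :
    ∀ᶠ x in 𝓝 p, x ∈ F → ∀ t, 0 ≤ t → φ t x ∈ N := by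
  -- Leaving the closed set `N` is an open condition and the frontier is compact, so the backward
  -- exit times on it can be taken bounded by one `T`.
  obtain ⟨T, hT⟩ : ∃ T : ℝ, ∀ y ∈ frontier N ∩ F, ∃ s ∈ Icc 0 T, φ (-s) y ∉ N := by
    refine (isClosed_frontier.inter hF).isCompact.induction_on
      (p := fun A => ∃ T : ℝ, ∀ y ∈ A, ∃ s ∈ Icc 0 T, φ (-s) y ∉ N) ⟨0, by simp⟩ ?_ ?_ ?_
    · rintro A B hAB ⟨T, hT⟩
      exact ⟨T, fun y hy => hT y (hAB hy)⟩
    · rintro A B ⟨T, hT⟩ ⟨T', hT'⟩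
      refine ⟨max T T', ?_⟩
      rintro y (hy | hy)
      · obtain ⟨s, hs, hy⟩ := hT y hy
        exact ⟨s, ⟨hs.1, hs.2.trans (le_max_left _ _)⟩, hy⟩
      · obtain ⟨s, hs, hy⟩ := hT' y hy
        exact ⟨s, ⟨hs.1, hs.2.trans (le_max_right _ _)⟩, hy⟩
    · rintro y ⟨hy, hyF⟩
      obtain ⟨s, hs, hys⟩ := h y hy hyF
      refine ⟨{z | φ (-s) z ∉ N}, mem_nhdsWithin_of_mem_nhds ?_, s, fun z hz => ⟨s, ⟨hs, le_rfl⟩, hz⟩⟩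
      exact (φ.continuous_toFun (-s)).continuousAt.eventually (hN.isOpen_compl.mem_nhds hys)
  have h1 : ∀ᶠ x in 𝓝 p, ∀ t ∈ Icc 0 T, φ t x ∈ interior N := by
    refine isCompact_Icc.eventually_forall_of_forall_eventually fun t ht => ?_
    have hc : Continuous (fun z : X × ℝ => φ z.2 z.1) := φ.continuous continuous_snd continuous_fst
    exact hc.continuousAt.eventually (isOpen_interior.mem_nhds (hp t ht.1))
  filter_upwards [h1, (continuous_id.tendsto p).eventually
    (isOpen_interior.mem_nhds (by simpa using hp 0 le_rfl))] with x hx hx0 hxF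
  by_contra! hcon
  obtain ⟨t, ht0, htN⟩ := hcon
  -- Look at the first exit point. Orbits near `p` stay inside up to time `T`, so the exit occurs
  -- after `T`; but the exit point is on the frontier and must have been outside `N` at most `T`
  -- earlier, before the first exit.
  let E : Set ℝ := {t | 0 ≤ t ∧ φ t x ∉ N}
  have hEb : BddBelow E := ⟨0, fun s hs => hs.1⟩
  have hEne : E.Nonempty := ⟨t, ht0, htN⟩
  have hcx : Continuous (fun t => φ t x) := φ.continuous continuous_id continuous_const
  have h0 : 0 ≤ sInf E := le_csInf hEne fun s hs => hs.1
  have hlt : ∀ s, 0 ≤ s → s < sInf E → φ s x ∈ N := fun s hs hsE => by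
    by_contra hsN
    exact absurd (csInf_le hEb ⟨hs, hsN⟩) (not_le.2 hsE)
  have hni : φ (sInf E) x ∉ interior N := by
    intro hi
    obtain ⟨ε, hε, hball⟩ := Metric.eventually_nhds_iff.1
      (hcx.continuousAt.eventually (isOpen_interior.mem_nhds hi))
    obtain ⟨s, hsE, hs⟩ := exists_lt_of_csInf_lt hEne (lt_add_of_pos_right (sInf E) hε)
    refine hsE.2 (interior_subset (hball ?_))
    rw [Real.dist_eq, abs_lt]
    constructor <;> linarith [csInf_le hEb hsE]
  have hpos : 0 < sInf E := by
    rcases h0.eq_or_lt with h0 | h0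
    · rw [← h0, Flow.map_zero_apply] at hni
      exact absurd hx0 hni
    · exact h0
  have hmem : φ (sInf E) x ∈ N := by
    have h2 : Tendsto (fun t => φ t x) (𝓝[<] sInf E) (𝓝 (φ (sInf E) x)) :=
      hcx.continuousAt.tendsto.mono_left nhdsWithin_le_nhds
    refine hN.mem_of_tendsto h2 ?_
    filter_upwards [Ioo_mem_nhdsLT hpos] with s hs
    exact hlt s hs.1.le hs.2
  have hTlt : T < sInf E := by
    by_contra! hle
    exact hni (hx _ ⟨h0, hle⟩)
  obtain ⟨s, hs, hsN⟩ := hT (φ (sInf E) x) ⟨⟨subset_closure hmem, hni⟩, hFi _ _ hxF⟩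
  refine hsN ?_
  rw [← Flow.map_add]
  rcases hs.1.eq_or_lt with h3 | h3
  · rw [← h3]
    simpa using hmem
  · exact hlt _ (by linarith [hs.2]) (by linarith)

/-- A Morse decomposition into two levels of saddles, with sinks `A` and sources `R`. -/
structure IsMorseDecomposition (φ : Flow ℝ X) (A P Q R : Set X) : Prop where
  closed_A : IsClosed A
  closed_P : IsClosed P
  closed_Q : IsClosed Q
  closed_R : IsClosed R
  inv_A : Inv φ A
  inv_P : Inv φ P
  inv_Q : Inv φ Q
  inv_R : Inv φ R
  AP : Disjoint A P
  AQ : Disjoint A Q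
  AR : Disjoint A R
  PQ : Disjoint P Q
  PR : Disjoint P R
  QR : Disjoint Q R
  nonwandering_subset : nonwandering φ ⊆ (A ∪ R) ∪ (P ∪ Q)
  eq_of_past : ∀ x, ToPast φ x A → x ∈ A
  eq_of_fut : ∀ x, ToFut φ x R → x ∈ R
  no_connection : ∀ x, ToPast φ x (P ∪ Q) → ToFut φ x (P ∪ Q) → x ∈ P ∪ Q

namespace IsMorseDecomposition

variable {φ : Flow ℝ X} {A P Q R : Set X}

lemma reverse (h : IsMorseDecomposition φ A P Q R) : IsMorseDecomposition φ.reverse R Q P A where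
  closed_A := h.closed_R
  closed_P := h.closed_Q
  closed_Q := h.closed_P
  closed_R := h.closed_A
  inv_A := h.inv_R.reverse
  inv_P := h.inv_Q.reverse
  inv_Q := h.inv_P.reverse
  inv_R := h.inv_A.reverse
  AP := h.QR.symm
  AQ := h.PR.symm
  AR := h.AR.symm
  PQ := h.PQ.symm
  PR := h.AQ.symm
  QR := h.AP.symm
  nonwandering_subset := by
    rw [nonwandering_reverse, union_comm R A, union_comm Q P]
    exact h.nonwandering_subset
  eq_of_past x hx := h.eq_of_fut x (toPast_reverse_iff.1 hx)
  eq_of_fut x hx := h.eq_of_past x (toPast_iff.2 hx)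
  no_connection x h1 h2 := by
    rw [union_comm Q P] at *
    exact h.no_connection x (toPast_iff.2 h2) (toPast_reverse_iff.1 h1)

/-- The limits of a half-orbit are non-wandering, and the half-orbit has to choose among the four
disjoint closed pieces. -/
lemma toFut_cases (h : IsMorseDecomposition φ A P Q R) (x : X) :
    ToFut φ x A ∨ ToFut φ x P ∨ ToFut φ x Q ∨ ToFut φ x R := by
  have h1 : ToFut φ x ((A ∪ R) ∪ (P ∪ Q)) := toFut_of_nonwandering isClosed_univ
    (Eventually.of_forall fun _ => mem_univ _) (inter_subset_left.trans h.nonwandering_subset)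
  rcases h1.or (h.closed_A.union h.closed_R) (h.closed_P.union h.closed_Q)
    ((h.AP.union_right h.AQ).union_left (h.PR.symm.union_right h.QR.symm)) with h2 | h2
  · rcases h2.or h.closed_A h.closed_R h.AR with h3 | h3
    · exact Or.inl h3
    · exact Or.inr (Or.inr (Or.inr h3))
  · rcases h2.or h.closed_P h.closed_Q h.PQ with h3 | h3
    · exact Or.inr (Or.inl h3)
    · exact Or.inr (Or.inr (Or.inl h3))

lemma toPast_cases (h : IsMorseDecomposition φ A P Q R) (x : X) :
    ToPast φ x A ∨ ToPast φ x P ∨ ToPast φ x Q ∨ ToPast φ x R := by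
  simp only [toPast_iff]
  rcases h.reverse.toFut_cases x with h1 | h1 | h1 | h1 <;> tauto

/-- A closed set of points of one level, isolated from a closed set `C`, one of whose points is in
the closure of points with past in `C`, is the future of a point of that closure. -/
lemma exists_toFut {S C D F : Set X} (hS : IsClosed S)
    (hC : IsClosed C) (hD : IsClosed D) (hSi : Inv φ S) (hSC : Disjoint S C) (hSD : Disjoint S D)
    (hNW : nonwandering φ ⊆ S ∪ C ∪ D) (hFi : Inv φ F) (hF : ∀ x ∈ F, ToPast φ x C) {p : X}
    (hp : p ∈ closure F) (hpS : p ∈ S) : ∃ y ∈ closure F, y ∉ S ∧ ToFut φ y S := by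
  -- The closed set `Vᶜ` is a neighbourhood of `S` in which the only non-wandering points are those
  -- of `S`.
  obtain ⟨U, V, hU, hV, hSU, hCV, hUV⟩ := normal_separation hS (hC.union hD)
    (hSC.union_right hSD)
  have hSN : S ⊆ interior (Vᶜ) :=
    hSU.trans (interior_maximal (disjoint_left.1 hUV) hU)
  by_contra! hcon
  -- A forward orbit confined to `Vᶜ` would converge to `S`, which is excluded by contradiction. So
  -- the frontier criterion applies to the reversed flow, and points of `F` near `p` would keep
  -- their whole past in `Vᶜ`, away from `C`.
  have h1 : ∀ y ∈ frontier Vᶜ, y ∈ closure F → ∃ s, 0 ≤ s ∧ φ.reverse (-s) y ∉ Vᶜ := by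
    intro y hy hyF
    by_contra! hall
    refine hcon y hyF (fun hyS => hy.2 (hSN hyS)) ?_
    refine toFut_of_nonwandering hV.isClosed_compl (eventually_atTop.2 ⟨0, fun t ht => ?_⟩) ?_
    · simpa [Flow.reverse_apply] using hall t ht
    · rintro z ⟨hz, hzV⟩
      rcases hNW hz with (hz | hz) | hz
      · exact hz
      · exact absurd (hCV (Or.inl hz)) hzV
      · exact absurd (hCV (Or.inr hz)) hzV
  have h2 := eventually_forall_mem_of_frontier (φ := φ.reverse) hV.isClosed_compl isClosed_closure
    hFi.closure.reverse (p := p) (fun t _ => hSN (hSi.reverse t p hpS)) h1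
  obtain ⟨x, hx, hxF⟩ := (mem_closure_iff_frequently.1 hp).and_eventually h2 |>.exists
  have h3 := hxF (subset_closure hx)
  have h4 : ToFut φ.reverse x C := toPast_iff.1 (hF x hx)
  have h5 := h4.eventually (hV.mem_nhdsSet.2 (subset_union_left.trans hCV))
  obtain ⟨t, ht, ht0⟩ := (h5.and (eventually_ge_atTop 0)).exists
  exact h3 t ht0 ht

/-- The union of the sinks, the lower saddles and their unstable manifolds. -/
def sink (φ : Flow ℝ X) (A P : Set X) : Set X := {x | ToPast φ x (A ∪ P)}

/-- A closure point in `R` would yield a point outside `R` with future in `R`, but sources attract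
nothing else. A closure point in `Q` would yield a closure point `y ∉ Q` with future in `Q`; its
past cannot be in `A` (then `y ∈ A`), nor at a saddle (no connections), nor in `R` (the closure
would meet `R`). So the past of any closure point tends to `A` or `P`. -/
lemma isClosed_sink (h : IsMorseDecomposition φ A P Q R) : IsClosed (sink φ A P) := by
  have hFi : Inv φ (sink φ A P) := inv_setOf_toPast φ (A ∪ P)
  have hR : ∀ p ∈ closure (sink φ A P), p ∉ R := by
    intro p hp hpR
    obtain ⟨y, -, hyR, hy⟩ := exists_toFut (C := A ∪ P) (D := Q) h.closed_R
      (h.closed_A.union h.closed_P)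
      h.closed_Q h.inv_R (h.AR.symm.union_right h.PR.symm) h.QR.symm
      (h.nonwandering_subset.trans (by intro x hx; simp only [mem_union] at hx ⊢; tauto))
      hFi (fun x hx => hx) hp hpR
    exact hyR (h.eq_of_fut y hy)
  have hQ : ∀ p ∈ closure (sink φ A P), p ∉ Q := by
    intro p hp hpQ
    obtain ⟨y, hyF, hyQ, hy⟩ := exists_toFut (C := A ∪ P) (D := R) h.closed_Q
      (h.closed_A.union h.closed_P)
      h.closed_R h.inv_Q (h.AQ.symm.union_right h.PQ.symm) h.QR
      (h.nonwandering_subset.trans (by intro x hx; simp only [mem_union] at hx ⊢; tauto))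
      hFi (fun x hx => hx) hp hpQ
    have hsad : ToPast φ y (P ∪ Q) → False := by
      intro h1
      rcases h.no_connection y h1 (hy.mono subset_union_right) with h2 | h2
      · exact (h.inv_P.toFut h2).not_disjoint hy h.closed_P h.closed_Q h.PQ
      · exact hyQ h2
    rcases h.toPast_cases y with h1 | h1 | h1 | h1
    · exact (h.inv_A.toFut (h.eq_of_past y h1)).not_disjoint hy h.closed_A h.closed_Q h.AQ
    · exact hsad (h1.mono subset_union_left)
    · exact hsad (h1.mono subset_union_right)
    · obtain ⟨z, hz, hzR⟩ := h1.inter_nonempty h.closed_R isClosed_closure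
        (Eventually.of_forall fun t => hFi.closure t y hyF)
      exact hR z hz hzR
  refine isClosed_of_closure_subset fun x hx => ?_
  have hnot : ∀ S, IsClosed S → (∀ p ∈ closure (sink φ A P), p ∉ S) → ¬ ToPast φ x S := by
    intro S hS hn hto
    obtain ⟨z, hz, hzS⟩ := hto.inter_nonempty hS isClosed_closure
      (Eventually.of_forall fun t => hFi.closure t x hx)
    exact hn z hz hzS
  rcases h.toPast_cases x with h1 | h1 | h1 | h1
  · exact h1.mono subset_union_left
  · exact h1.mono subset_union_right
  · exact absurd h1 (hnot Q h.closed_Q hQ)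
  · exact absurd h1 (hnot R h.closed_R hR)

end IsMorseDecomposition

/-- Disjoint closed invariant sets such that all other orbits go from `L` to `K`. -/
structure IsAttractorRepeller (φ : Flow ℝ X) (K L : Set X) : Prop where
  closed_K : IsClosed K
  closed_L : IsClosed L
  inv_K : Inv φ K
  inv_L : Inv φ L
  disjoint : Disjoint K L
  toFut : ∀ x, x ∉ K → x ∉ L → ToFut φ x K
  toPast : ∀ x, x ∉ K → x ∉ L → ToPast φ x L

/-- Disjointness is the substantial field: an orbit from `A ∪ P` to `R ∪ Q` is stuck in `A`, or
stuck in `R`, or joins two saddles. The convergence fields follow by discarding cases among the four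
possible limits. -/
lemma IsMorseDecomposition.isAttractorRepeller {φ : Flow ℝ X} {A P Q R : Set X}
    (h : IsMorseDecomposition φ A P Q R) : IsAttractorRepeller φ
      (IsMorseDecomposition.sink φ A P) (IsMorseDecomposition.sink φ.reverse R Q) where
  closed_K := h.isClosed_sink
  closed_L := h.reverse.isClosed_sink
  inv_K := inv_setOf_toPast φ _
  inv_L := by
    have := (inv_setOf_toPast φ.reverse (R ∪ Q)).reverse
    rwa [reverse_reverse] at this
  disjoint := by
    rw [disjoint_left]
    rintro x hx hx'
    have h2 : ToFut φ x (R ∪ Q) := toPast_reverse_iff.1 hx'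
    rcases ToPast.or' h hx with h1 | h1
    · exact (h.inv_A.toFut (h.eq_of_past x h1)).not_disjoint h2 h.closed_A
        (h.closed_R.union h.closed_Q) (h.AR.union_right h.AQ)
    rcases h2.or h.closed_R h.closed_Q h.QR.symm with h3 | h3
    · exact (h.inv_R.toPast (h.eq_of_fut x h3)).not_disjoint h1 h.closed_R h.closed_P h.PR.symm
    rcases h.no_connection x (h1.mono subset_union_left) (h3.mono subset_union_right) with h4 | h4
    · exact (h.inv_P.toFut h4).not_disjoint h3 h.closed_P h.closed_Q h.PQ
    · exact (h.inv_Q.toPast h4).not_disjoint h1 h.closed_Q h.closed_P h.PQ.symm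
  toFut x hx hx' := by
    have h1 : Inv φ (A ∪ P) := fun t y hy => hy.imp (h.inv_A t y) (h.inv_P t y)
    have hs : A ∪ P ⊆ sink φ A P := fun y hy => h1.toPast hy
    have h2 : ¬ ToFut φ x (R ∪ Q) := fun h => hx' (toPast_reverse_iff.2 h)
    rcases h.toFut_cases x with h3 | h3 | h3 | h3
    · exact h3.mono (subset_union_left.trans hs)
    · exact h3.mono (subset_union_right.trans hs)
    · exact absurd (h3.mono subset_union_right) h2
    · exact absurd (h3.mono subset_union_left) h2
  toPast x hx hx' := by
    have h1 : Inv φ (R ∪ Q) := fun t y hy => hy.imp (h.inv_R t y) (h.inv_Q t y)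
    have hs : R ∪ Q ⊆ sink φ.reverse R Q := fun y hy => h1.reverse.toPast hy
    have h2 : ¬ ToPast φ x (A ∪ P) := fun h => hx h
    rcases h.toPast_cases x with h3 | h3 | h3 | h3
    · exact absurd (h3.mono subset_union_left) h2
    · exact absurd (h3.mono subset_union_right) h2
    · exact h3.mono (subset_union_right.trans hs)
    · exact h3.mono (subset_union_left.trans hs)
where
  ToPast.or' {φ : Flow ℝ X} {A P Q R : Set X} (h : IsMorseDecomposition φ A P Q R) {x : X}
      (hx : ToPast φ x (A ∪ P)) : ToPast φ x A ∨ ToPast φ x P := by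
    simp only [toPast_iff] at hx ⊢
    exact hx.or h.closed_A h.closed_P h.AP

namespace IsAttractorRepeller

variable {φ : Flow ℝ X} {K L : Set X}

lemma reverse (h : IsAttractorRepeller φ K L) : IsAttractorRepeller φ.reverse L K where
  closed_K := h.closed_L
  closed_L := h.closed_K
  inv_K := h.inv_L.reverse
  inv_L := h.inv_K.reverse
  disjoint := h.disjoint.symm
  toFut x h1 h2 := toPast_iff.1 (h.toPast x h2 h1)
  toPast x h1 h2 := toPast_reverse_iff.2 (h.toFut x h2 h1)

/-- Take `U` disjoint from a neighbourhood of `L`. A point of all forward images of `U` has its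
whole past in `U`, so this past does not tend to `L`, and the point is in `K`. -/
lemma isAttractor (h : IsAttractorRepeller φ K L) : IsAttractor φ K := by
  refine ⟨h.closed_K.isCompact, h.inv_K.image_eq, ?_⟩
  obtain ⟨U, V, hU, hV, hKU, hLV, hUV⟩ := normal_separation h.closed_K h.closed_L h.disjoint
  refine ⟨U, hU, hKU, Subset.antisymm ?_ ?_⟩
  · intro x hx
    refine mem_iInter₂.2 fun t _ => ⟨φ (-t) x, hKU (h.inv_K _ x hx), flow_apply_neg φ t x⟩
  · intro x hx
    have h1 : ∀ t, 0 ≤ t → φ (-t) x ∈ U := by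
      intro t ht
      obtain ⟨y, hy, rfl⟩ := mem_iInter₂.1 hx t ht
      rwa [flow_neg_apply]
    by_contra hxK
    have hL : ToPast φ x L := by
      by_cases hxL : x ∈ L
      · exact h.inv_L.toPast hxL
      · exact h.toPast x hxK hxL
    have h2 := (toPast_iff.1 hL).eventually (hV.mem_nhdsSet.2 hLV)
    obtain ⟨t, ht, ht0⟩ := (h2.and (eventually_ge_atTop 0)).exists
    exact hUV.le_bot ⟨h1 t ht0, ht⟩

lemma isSimpleStructure (h : IsAttractorRepeller φ K L) : IsSimpleStructure φ K L :=
  ⟨h.isAttractor, h.reverse.isAttractor, h.disjoint, fun x h1 h2 => ⟨h.toFut x h1 h2, h.toPast x h1 h2⟩⟩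

/-- Separate `K` from `L` together with the complement of `O` by an open `V` around the latter. The
past of a frontier point of `Vᶜ` either starts in `L` or tends to `L`, so it leaves `Vᶜ` and the
frontier criterion confines forward orbits near `K`. -/
lemma stable (h : IsAttractorRepeller φ K L) {O : Set X} (hO : IsOpen O) (hKO : K ⊆ O) :
    ∃ O', IsOpen O' ∧ K ⊆ O' ∧ ∀ x ∈ O', ∀ t, 0 ≤ t → φ t x ∈ O := by
  obtain ⟨U, V, hU, hV, hKU, hLV, hUV⟩ := normal_separation h.closed_K
    (h.closed_L.union hO.isClosed_compl) (h.disjoint.union_right (by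
      rw [disjoint_compl_right_iff_subset]; exact hKO))
  have hKN : K ⊆ interior Vᶜ := hKU.trans (interior_maximal (disjoint_left.1 hUV) hU)
  have h1 : ∀ p ∈ K, ∀ᶠ x in 𝓝 p, ∀ t, 0 ≤ t → φ t x ∈ Vᶜ := by
    intro p hp
    have h2 := eventually_forall_mem_of_frontier (φ := φ) hV.isClosed_compl isClosed_univ
      (fun _ _ _ => mem_univ _) (p := p) (fun t _ => hKN (h.inv_K t p hp)) ?_
    · exact h2.mono fun x hx => hx (mem_univ x)
    · intro y hy _
      by_contra! hcon
      have hyL : y ∉ L := by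
        intro hyL
        have := hcon 0 le_rfl
        rw [neg_zero, Flow.map_zero_apply] at this
        exact this (hLV (Or.inl hyL))
      have h3 := toPast_iff.1 (h.toPast y (fun hyK => hy.2 (hKN hyK)) hyL)
      have h4 := h3.eventually (hV.mem_nhdsSet.2 (subset_union_left.trans hLV))
      obtain ⟨t, ht, ht0⟩ := (h4.and (eventually_ge_atTop 0)).exists
      exact hcon t ht0 ht
  refine ⟨interior {x | ∀ t, 0 ≤ t → φ t x ∈ Vᶜ}, isOpen_interior, fun p hp =>
    mem_interior_iff_mem_nhds.2 (h1 p hp), fun x hx t ht => ?_⟩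
  by_contra hxO
  exact interior_subset hx t ht (hLV (Or.inr hxO))

lemma toFut_of_notMem (h : IsAttractorRepeller φ K L) {x : X} (hx : x ∉ L) : ToFut φ x K := by
  by_cases hK : x ∈ K
  · exact h.inv_K.toFut hK
  · exact h.toFut x hK hx

/-- Each point of `Q` enters a neighbourhood of `K` that never leaves `O` afterwards; entering at a
given time is open, and `Q` is compact. -/
lemma uniform (h : IsAttractorRepeller φ K L) {O Q : Set X} (hO : IsOpen O) (hKO : K ⊆ O)
    (hQ : IsClosed Q) (hQL : Disjoint Q L) : ∃ T : ℝ, ∀ t, T ≤ t → ∀ x ∈ Q, φ t x ∈ O := by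
  obtain ⟨O', hO', hKO', hst⟩ := h.stable hO hKO
  refine hQ.isCompact.induction_on (p := fun A => ∃ T : ℝ, ∀ t, T ≤ t → ∀ x ∈ A, φ t x ∈ O)
    ⟨0, by simp⟩ ?_ ?_ ?_
  · rintro A B hAB ⟨T, hT⟩
    exact ⟨T, fun t ht x hx => hT t ht x (hAB hx)⟩
  · rintro A B ⟨T, hT⟩ ⟨T', hT'⟩
    refine ⟨max T T', fun t ht x hx => ?_⟩
    rcases hx with hx | hx
    · exact hT t ((le_max_left _ _).trans ht) x hx
    · exact hT' t ((le_max_right _ _).trans ht) x hx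
  · intro x hx
    have h1 := h.toFut_of_notMem (disjoint_left.1 hQL hx)
    obtain ⟨t, ht⟩ := (h1.eventually (hO'.mem_nhdsSet.2 hKO')).exists
    refine ⟨{y | φ t y ∈ O'}, mem_nhdsWithin_of_mem_nhds
      ((φ.continuous_toFun t).continuousAt.eventually (hO'.mem_nhds ht)), t, fun s hs y hy => ?_⟩
    have h2 := hst _ hy (s - t) (by linarith)
    rwa [← Flow.map_add, sub_add_cancel] at h2

/-- Outside a neighbourhood of the repeller everything stays away from the repeller. -/
lemma exists_forward_invariant (h : IsAttractorRepeller φ K L) {N : Set X} (hN : IsOpen N)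
    (hLN : L ⊆ N) : ∃ Q : Set X, IsClosed Q ∧ Nᶜ ⊆ Q ∧ Disjoint Q L ∧
      ∀ x ∈ Q, ∀ t, 0 ≤ t → φ t x ∈ Q := by
  obtain ⟨O', hO', hLO', hst⟩ := h.reverse.stable hN hLN
  -- All forward images of the complement of `N`. Stability of `L` for the reversed flow keeps them
  -- off a neighbourhood of `L`; the closure inherits both properties.
  let D : Set X := {y | ∃ t, 0 ≤ t ∧ φ (-t) y ∉ N}
  have hDO : D ⊆ O'ᶜ := by
    rintro y ⟨t, ht, hy⟩ hyO
    exact hy (hst y hyO t ht)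
  have hDi : ∀ x ∈ D, ∀ t, 0 ≤ t → φ t x ∈ D := by
    rintro x ⟨s, hs, hx⟩ t ht
    refine ⟨s + t, by positivity, ?_⟩
    rw [← Flow.map_add]
    simpa using hx
  refine ⟨closure D, isClosed_closure, fun x hx => subset_closure ⟨0, le_rfl, by simpa using hx⟩,
    ?_, fun x hx t ht => map_mem_closure (φ.continuous_toFun t) hx fun y hy => hDi y hy t ht⟩
  have h1 : closure D ⊆ O'ᶜ := closure_minimal hDO hO'.isClosed_compl
  exact disjoint_left.2 fun x hx hxL => h1 hx (hLO' hxL)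

end IsAttractorRepeller

end AttractorRepeller

/-! ### Integrals of a function along orbits and weighted averages. -/

section OrbitIntegral

variable {X : Type*} [TopologicalSpace X]

/-- The integral of `a` along the orbit of `x` during the time `t`. -/
def orbInt (φ : Flow ℝ X) (a : X → ℝ) (t : ℝ) (x : X) : ℝ := ∫ s in (0 : ℝ)..t, a (φ s x)

variable {φ : Flow ℝ X} {a : X → ℝ}

lemma continuous_along (ha : Continuous a) (x : X) : Continuous fun s => a (φ s x) :=
  ha.comp (φ.continuous continuous_id continuous_const)

@[simp] lemma orbInt_zero (x : X) : orbInt φ a 0 x = 0 := by simp [orbInt]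

lemma orbInt_add (ha : Continuous a) (s t : ℝ) (x : X) :
    orbInt φ a (s + t) x = orbInt φ a t x + orbInt φ a s (φ t x) := by
  have hi := fun u v => (continuous_along (φ := φ) ha x).intervalIntegrable (μ := MeasureTheory.volume) u v
  unfold orbInt
  rw [← intervalIntegral.integral_add_adjacent_intervals (hi 0 t) (hi t (s + t))]
  congr 1
  simp only [← Flow.map_add]
  rw [intervalIntegral.integral_comp_add_right (fun u => a (φ u x)) t, zero_add]

lemma hasDerivAt_orbInt (ha : Continuous a) (t : ℝ) (x : X) :
    HasDerivAt (fun t => orbInt φ a t x) (a (φ t x)) t :=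
  (continuous_along ha x).integral_hasStrictDerivAt 0 t |>.hasDerivAt

lemma continuous_orbInt (ha : Continuous a) : Continuous fun p : ℝ × X => orbInt φ a p.1 p.2 := by
  unfold orbInt
  refine intervalIntegral.continuous_parametric_intervalIntegral_of_continuous
    (f := fun (p : ℝ × X) s => a (φ s p.2)) ?_ continuous_fst
  exact ha.comp (φ.continuous continuous_snd (continuous_snd.comp continuous_fst))

lemma orbInt_reverse (t : ℝ) (x : X) :
    orbInt φ a t (φ (-t) x) = orbInt φ.reverse a t x := by
  unfold orbInt
  simp only [← Flow.map_add, Flow.reverse_apply]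
  have := intervalIntegral.integral_comp_sub_left (fun s => a (φ (-s) x)) t (a := 0) (b := t)
  rw [sub_zero, sub_self] at this
  rw [← this]
  congr 1
  ext s
  congr 2
  ring

lemma orbInt_neg (t : ℝ) (x : X) : orbInt φ (-a) t x = - orbInt φ a t x := by
  simp [orbInt]

variable [CompactSpace X]

lemma exists_abs_le (ha : Continuous a) : ∃ M : ℝ, 0 < M ∧ ∀ x, |a x| ≤ M := by
  obtain ⟨M, hM⟩ := isCompact_univ.exists_bound_of_continuousOn ha.continuousOn
  exact ⟨max M 1, by positivity, fun x => (hM x (mem_univ x)).trans (le_max_left _ _)⟩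

lemma abs_orbInt_le {M : ℝ} (hM : ∀ x, |a x| ≤ M) (t : ℝ) (ht : 0 ≤ t) (x : X) :
    |orbInt φ a t x| ≤ M * t := by
  have := intervalIntegral.norm_integral_le_of_norm_le_const (a := 0) (b := t)
    (f := fun s => a (φ s x)) (C := M) fun s _ => hM _
  rw [sub_zero, abs_of_nonneg ht] at this
  exact this

/-- If the orbit integrals are positive at suitable times, then they tend to infinity, uniformly. -/
lemma orbInt_uniform (ha : Continuous a) {Q : Set X} (hQ : IsClosed Q)
    (hQi : ∀ x ∈ Q, ∀ t, 0 ≤ t → φ t x ∈ Q) (hpos : ∀ x ∈ Q, ∃ t, 0 < t ∧ 0 < orbInt φ a t x)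
    (C : ℝ) : ∃ T₀ : ℝ, ∀ T, T₀ ≤ T → ∀ x ∈ Q, C < orbInt φ a T x := by
  -- By compactness the gain is at least `ε` over a time between `τ₀` and `τ`, both positive.
  obtain ⟨ε, τ₀, τ, hε, hτ₀, hτ, hcov⟩ : ∃ ε τ₀ τ : ℝ, 0 < ε ∧ 0 < τ₀ ∧ 0 < τ ∧
      ∀ x ∈ Q, ∃ t, τ₀ ≤ t ∧ t ≤ τ ∧ ε ≤ orbInt φ a t x := by
    refine hQ.isCompact.induction_on (p := fun A => ∃ ε τ₀ τ : ℝ, 0 < ε ∧ 0 < τ₀ ∧ 0 < τ ∧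
      ∀ x ∈ A, ∃ t, τ₀ ≤ t ∧ t ≤ τ ∧ ε ≤ orbInt φ a t x)
      ⟨1, 1, 1, one_pos, one_pos, one_pos, by simp⟩ ?_ ?_ ?_
    · rintro A B hAB ⟨ε, τ₀, τ, h1, h2, h3, h4⟩
      exact ⟨ε, τ₀, τ, h1, h2, h3, fun x hx => h4 x (hAB hx)⟩
    · rintro A B ⟨ε, τ₀, τ, h1, h2, h3, h4⟩ ⟨ε', τ₀', τ', h1', h2', h3', h4'⟩
      refine ⟨min ε ε', min τ₀ τ₀', max τ τ', lt_min h1 h1', lt_min h2 h2', lt_max_of_lt_left h3, ?_⟩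
      rintro x (hx | hx)
      · obtain ⟨t, h5, h6, h7⟩ := h4 x hx
        exact ⟨t, (min_le_left _ _).trans h5, h6.trans (le_max_left _ _), (min_le_left _ _).trans h7⟩
      · obtain ⟨t, h5, h6, h7⟩ := h4' x hx
        exact ⟨t, (min_le_right _ _).trans h5, h6.trans (le_max_right _ _),
          (min_le_right _ _).trans h7⟩
    · intro x hx
      obtain ⟨t, ht, htx⟩ := hpos x hx
      have hc : Continuous fun y => orbInt φ a t y := (continuous_orbInt ha).comp
        (continuous_const.prodMk continuous_id)
      refine ⟨{y | orbInt φ a t x / 2 ≤ orbInt φ a t y}, mem_nhdsWithin_of_mem_nhds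
        (hc.continuousAt.eventually (Ici_mem_nhds (by linarith))), orbInt φ a t x / 2, t, t,
        by linarith, ht, ht, fun y hy => ⟨t, le_rfl, le_rfl, hy⟩⟩
  obtain ⟨M, hM0, hM⟩ := exists_abs_le ha
  -- Cut the orbit into blocks with gain at least `ε`. A block lasts at least `τ₀`, which makes the
  -- induction terminate, and at most `τ`, which gives the rate `ε / τ`; the incomplete last block
  -- costs at most `M * τ`.
  have key : ∀ n : ℕ, ∀ T, 0 ≤ T → T ≤ n * τ₀ → ∀ x ∈ Q,
      ε * (T / τ - 1) - M * τ ≤ orbInt φ a T x := by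
    intro n
    induction n with
    | zero =>
      intro T hT0 hT x hx
      have : T = 0 := le_antisymm (by simpa using hT) hT0
      subst this
      have h3 : 0 < M * τ := by positivity
      simp only [zero_div, orbInt_zero]
      linarith
    | succ n ih =>
      intro T hT0 hT x hx
      by_cases hTτ : T ≤ τ
      · have h1 := abs_le.1 (abs_orbInt_le (φ := φ) hM T hT0 x)
        have h2 : T / τ ≤ 1 := (div_le_one hτ).2 hTτ
        have h3 : M * T ≤ M * τ := by gcongr
        have h4 : ε * (T / τ - 1) ≤ 0 := mul_nonpos_of_nonneg_of_nonpos hε.le (by linarith)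
        linarith [h1.1]
      · obtain ⟨t, h1, h2, h3⟩ := hcov x hx
        have h4 := ih (T - t) (by linarith) (by push_cast at hT; linarith) _
          (hQi x hx t (by linarith))
        have h5 := orbInt_add (φ := φ) ha (T - t) t x
        rw [sub_add_cancel] at h5
        have h6 : ε * ((T - t) / τ - 1) = ε * (T / τ - 1) - ε * (t / τ) := by ring
        have h7 : ε * (t / τ) ≤ ε := by
          have : t / τ ≤ 1 := (div_le_one hτ).2 h2
          nlinarith
        linarith
  refine ⟨max 0 (τ * ((C + 1 + M * τ) / ε + 1)), fun T hT x hx => ?_⟩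
  have hT0 : 0 ≤ T := (le_max_left _ _).trans hT
  obtain ⟨n, hn⟩ := exists_nat_ge (T / τ₀)
  have h1 := key n T hT0 ((div_le_iff₀ hτ₀).1 hn) x hx
  have h2 : τ * ((C + 1 + M * τ) / ε + 1) ≤ T := (le_max_right _ _).trans hT
  have h3 : (C + 1 + M * τ) / ε + 1 ≤ T / τ := by
    rw [le_div_iff₀ hτ]
    linarith
  have h4 : (C + 1 + M * τ) / ε ≤ T / τ - 1 := by linarith
  rw [div_le_iff₀ hε] at h4
  linarith

variable [T2Space X]

/-- Positivity of orbit integrals on the limit set implies positivity along the orbit. -/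
lemma exists_orbInt_pos (ha : Continuous a) {A : Set X} (hA : IsClosed A) (hAi : Inv φ A)
    (hpos : ∀ x ∈ A, ∃ t, 0 < t ∧ 0 < orbInt φ a t x) {x : X} (hx : ToFut φ x A) :
    ∃ t, 0 < t ∧ 0 < orbInt φ a t x := by
  obtain ⟨T₀, hT₀⟩ := orbInt_uniform ha hA (fun x hx t _ => hAi t x hx) hpos 1
  obtain ⟨M, hM0, hM⟩ := exists_abs_le ha
  let T := max T₀ 1
  have hT : 0 < T := lt_max_of_lt_right one_pos
  have hc : Continuous fun y => orbInt φ a T y := (continuous_orbInt ha).comp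
    (continuous_const.prodMk continuous_id)
  have hO : IsOpen {y | 1 < orbInt φ a T y} := isOpen_lt continuous_const hc
  have hAO : A ⊆ {y | 1 < orbInt φ a T y} := fun y hy => hT₀ T (le_max_left _ _) y hy
  obtain ⟨t₀, ht₀⟩ := eventually_atTop.1 (hx.eventually (hO.mem_nhdsSet.2 hAO))
  let t₁ := max t₀ 0
  -- After `t₁` each further time `T` contributes more than `1`, which eventually compensates the
  -- possible loss `M * t₁` before `t₁`.
  have h1 : ∀ n : ℕ, orbInt φ a (n * T + t₁) x ≥ n - M * t₁ := by
    intro n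
    induction n with
    | zero =>
      have := abs_le.1 (abs_orbInt_le (φ := φ) hM t₁ (le_max_right _ _) x)
      simp only [Nat.cast_zero, zero_mul, zero_add, zero_sub]
      exact this.1
    | succ n ih =>
      have h2 : ((n + 1 : ℕ) : ℝ) * T + t₁ = T + (n * T + t₁) := by push_cast; ring
      rw [h2, orbInt_add ha]
      have h3 : 1 < orbInt φ a T (φ (n * T + t₁) x) := ht₀ _ (by
        have : 0 ≤ n * T := by positivity
        linarith [le_max_left t₀ 0])
      push_cast
      linarith
  obtain ⟨n, hn⟩ := exists_nat_gt (M * t₁)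
  refine ⟨n * T + t₁ + T, by positivity, ?_⟩
  have h2 := h1 (n + 1)
  have h3 : ((n + 1 : ℕ) : ℝ) * T + t₁ = n * T + t₁ + T := by push_cast; ring
  rw [h3] at h2
  push_cast at h2
  linarith

/-- In an attractor-repeller pair such that the orbit integrals are eventually positive outside the
repeller and eventually negative in the past outside the attractor, this holds uniformly. -/
lemma IsAttractorRepeller.exists_time_aux {K L : Set X} (h : IsAttractorRepeller φ K L)
    (ha : Continuous a) (hpos : ∀ x, x ∉ L → ∃ t, 0 < t ∧ 0 < orbInt φ a t x)
    {Np Nm : Set X} (hNp : IsOpen Np) (hNm : IsOpen Nm) (hKN : K ⊆ Np) (hLN : L ⊆ Nm) :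
    ∃ T₀ : ℝ, ∀ T, T₀ ≤ T → ∀ x, x ∉ Nm → φ T x ∈ Np ∧ 0 < orbInt φ a T x := by
  obtain ⟨Q, hQ, hNQ, hQL, hQi⟩ := h.exists_forward_invariant hNm hLN
  obtain ⟨T₁, hT₁⟩ := h.uniform hNp hKN hQ hQL
  obtain ⟨T₂, hT₂⟩ := orbInt_uniform ha hQ hQi (fun x hx => hpos x (disjoint_left.1 hQL hx)) 0
  exact ⟨max T₁ T₂, fun T hT x hx => ⟨hT₁ T ((le_max_left _ _).trans hT) x (hNQ hx),
    hT₂ T ((le_max_right _ _).trans hT) x (hNQ hx)⟩⟩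

/-- The negative statement is the positive one for the reversed flow and `-a`, applied at the end
point of the orbit segment. -/
lemma IsAttractorRepeller.exists_time {K L : Set X} (h : IsAttractorRepeller φ K L)
    (ha : Continuous a) (hpos : ∀ x, x ∉ L → ∃ t, 0 < t ∧ 0 < orbInt φ a t x)
    (hneg : ∀ x, x ∉ K → ∃ t, 0 < t ∧ orbInt φ.reverse a t x < 0)
    {Np Nm : Set X} (hNp : IsOpen Np) (hNm : IsOpen Nm) (hKN : K ⊆ Np) (hLN : L ⊆ Nm) :
    ∃ T : ℝ, 0 < T ∧ (∀ x, x ∉ Nm → φ T x ∈ Np ∧ 0 < orbInt φ a T x) ∧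
      ∀ x, φ T x ∉ Np → orbInt φ a T x < 0 := by
  obtain ⟨T₁, hT₁⟩ := h.exists_time_aux ha hpos hNp hNm hKN hLN
  obtain ⟨T₂, hT₂⟩ := h.reverse.exists_time_aux ha.neg (fun x hx => by
    obtain ⟨t, ht, hx⟩ := hneg x hx
    exact ⟨t, ht, by rw [orbInt_neg]; linarith⟩) hNm hNp hLN hKN
  refine ⟨max 1 (max T₁ T₂), by positivity, fun x hx => hT₁ _ ((le_max_left _ _).trans
    (le_max_right _ _)) x hx, fun x hx => ?_⟩
  have h1 := (hT₂ (max 1 (max T₁ T₂)) ((le_max_right _ _).trans (le_max_right _ _)) _ hx).2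
  rw [orbInt_neg, ← orbInt_reverse, flow_neg_apply] at h1
  linarith

/-- The weighted time average of `f₀`. -/
def weightedAverage (φ : Flow ℝ X) (a f₀ : X → ℝ) (T : ℝ) (x : X) : ℝ :=
  ∫ s in (0 : ℝ)..T, Real.exp (orbInt φ a s x) * f₀ (φ s x)

/-- Moving the base point by `t` shifts the window of integration to `[t, T + t]` and divides the
weight by `exp (∫₀ᵗ a)`. Differentiating at `0` gives the two boundary values and the term in `-a`.
-/
lemma hasDerivAt_weightedAverage (ha : Continuous a) {f₀ : X → ℝ} (hf₀ : Continuous f₀) (T : ℝ)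
    (x : X) : HasDerivAt (fun t => weightedAverage φ a f₀ T (φ t x))
      (Real.exp (orbInt φ a T x) * f₀ (φ T x) - f₀ x - a x * weightedAverage φ a f₀ T x) 0 := by
  let p : ℝ → ℝ := fun s => Real.exp (orbInt φ a s x) * f₀ (φ s x)
  have hp : Continuous p := by
    refine (Real.continuous_exp.comp ?_).mul (continuous_along hf₀ x)
    exact (continuous_orbInt ha).comp (continuous_id.prodMk continuous_const)
  have h1 : ∀ t, weightedAverage φ a f₀ T (φ t x) = Real.exp (-orbInt φ a t x) *
      ((∫ s in (0 : ℝ)..(T + t), p s) - ∫ s in (0 : ℝ)..t, p s) := by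
    intro t
    rw [intervalIntegral.integral_interval_sub_left (hp.intervalIntegrable _ _)
      (hp.intervalIntegrable _ _)]
    have h2 := intervalIntegral.integral_comp_add_right p t (a := 0) (b := T)
    rw [zero_add] at h2
    rw [← h2, ← intervalIntegral.integral_const_mul]
    unfold weightedAverage
    congr 1
    ext s
    simp only [p]
    rw [orbInt_add ha, ← mul_assoc, ← Real.exp_add, Flow.map_add]
    congr 2
    ring
  simp only [h1]
  have h3 : HasDerivAt (fun t => Real.exp (-orbInt φ a t x)) (Real.exp 0 * -(a x)) 0 := by
    have := (hasDerivAt_orbInt (φ := φ) ha 0 x).neg.exp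
    simpa using this
  have h4 : HasDerivAt (fun t => ∫ s in (0 : ℝ)..(T + t), p s) (p T) 0 := by
    have h5 := (hp.integral_hasStrictDerivAt 0 (T + 0)).hasDerivAt
    have h6 := HasDerivAt.comp_const_add T 0 h5
    simpa using h6
  have h5 := (hp.integral_hasStrictDerivAt 0 0).hasDerivAt
  have h6 := h3.mul (h4.sub h5)
  refine h6.congr_deriv ?_
  simp [p, weightedAverage]
  ring

/-- A continuous solution, differentiable along the flow, of the differential inequality
`W f + a f > 0`. -/
lemma weightedAverage_pos {f₀ : X → ℝ} {T : ℝ} {Np Nm : Set X}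
    (h1 : ∀ x ∈ Np, f₀ x = 1) (h2 : ∀ x ∈ Nm, f₀ x = -1) (h3 : ∀ x, |f₀ x| ≤ 1)
    (hT : ∀ x, x ∉ Nm → φ T x ∈ Np ∧ 0 < orbInt φ a T x)
    (hT' : ∀ x, φ T x ∉ Np → orbInt φ a T x < 0) (x : X) :
    0 < Real.exp (orbInt φ a T x) * f₀ (φ T x) - f₀ x := by
  -- If `x` is in `Nm`, then `-f₀ x = 1`; either `φ T x` is in `Np` and both terms are positive, or
  -- the exponential is less than `1` and cannot outweigh it. If `x` is not in `Nm`, the exponential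
  -- exceeds `1 ≥ f₀ x`.
  by_cases hx : x ∈ Nm
  · rw [h2 x hx]
    by_cases hx' : φ T x ∈ Np
    · rw [h1 _ hx']
      have := Real.exp_pos (orbInt φ a T x)
      linarith
    · have h4 : Real.exp (orbInt φ a T x) < 1 := Real.exp_lt_one_iff.2 (hT' x hx')
      have h5 := abs_le.1 (h3 (φ T x))
      have h6 := Real.exp_pos (orbInt φ a T x)
      nlinarith
  · obtain ⟨h4, h5⟩ := hT x hx
    rw [h1 _ h4]
    have h6 := abs_le.1 (h3 x)
    have h7 := Real.one_lt_exp_iff.2 h5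
    linarith

end OrbitIntegral

/-! ### From hyperbolic critical elements to a Morse decomposition. -/

section CriticalElements

variable {X : Type*} [TopologicalSpace X]

/-- The orbit of a point. -/
def orb (φ : Flow ℝ X) (x : X) : Set X := range fun t => φ t x

/-- Asymptotic stability. -/
def AsympStable (φ : Flow ℝ X) (S : Set X) : Prop :=
  (∀ V, IsOpen V → S ⊆ V → ∃ U, IsOpen U ∧ S ⊆ U ∧ ∀ y ∈ U, ∀ t, 0 ≤ t → φ t y ∈ V) ∧
    ∃ U, IsOpen U ∧ S ⊆ U ∧ ∀ y ∈ U, ToFut φ y S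

lemma mem_orb (φ : Flow ℝ X) (x : X) : x ∈ orb φ x := ⟨0, by simp⟩

lemma inv_orb (φ : Flow ℝ X) (x : X) : Inv φ (orb φ x) := by
  rintro t _ ⟨s, rfl⟩
  exact ⟨t + s, Flow.map_add φ t s x⟩

lemma orb_reverse (φ : Flow ℝ X) (x : X) : orb φ.reverse x = orb φ x := by
  ext y
  constructor
  · rintro ⟨t, rfl⟩
    exact ⟨-t, rfl⟩
  · rintro ⟨t, rfl⟩
    exact ⟨-t, by simp [Flow.reverse_apply]⟩

lemma Inv.orb_subset {φ : Flow ℝ X} {S : Set X} (h : Inv φ S) {x : X} (hx : x ∈ S) :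
    orb φ x ⊆ S := by
  rintro _ ⟨t, rfl⟩
  exact h t x hx

lemma mem_of_orb_inter {φ : Flow ℝ X} {x y : X} (h : (orb φ x ∩ orb φ y).Nonempty) :
    x ∈ orb φ y := by
  obtain ⟨z, ⟨t, rfl⟩, hz⟩ := h
  exact ((inv_orb φ y).mem_iff t x).1 hz

/-- The sinks, sources and saddles of a flow the non-wandering points of which are hyperbolic. -/
structure HyperbolicData (φ : Flow ℝ X) (A R S : Set X) : Prop where
  inv_A : Inv φ A
  inv_R : Inv φ R
  compact_A : ∀ x ∈ A, IsCompact (orb φ x)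
  compact_R : ∀ x ∈ R, IsCompact (orb φ x)
  stable_A : ∀ x ∈ A, AsympStable φ (orb φ x)
  stable_R : ∀ x ∈ R, AsympStable φ.reverse (orb φ x)
  fixed : ∀ x ∈ S, ∀ t, φ t x = x
  isolated : ∀ x ∈ S, ∃ N ∈ 𝓝 x, ∀ y, (∀ t, φ t y ∈ N) → y = x
  nonwandering_eq : nonwandering φ = (A ∪ R) ∪ S
  AR : Disjoint A R
  AS : Disjoint A S
  RS : Disjoint R S
  no_connection : ∀ x, ∀ a ∈ S, ∀ b ∈ S, ToPast φ x {a} → ToFut φ x {b} → x ∈ S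

variable [CompactSpace X] [T2Space X]

namespace HyperbolicData

variable {φ : Flow ℝ X} {A R S : Set X}

lemma inv_subset (h : HyperbolicData φ A R S) {P : Set X} (hP : P ⊆ S) : Inv φ P := by
  intro t x hx
  rwa [h.fixed x (hP hx) t]

lemma reverse (h : HyperbolicData φ A R S) : HyperbolicData φ.reverse R A S where
  inv_A := h.inv_R.reverse
  inv_R := h.inv_A.reverse
  compact_A x hx := by rw [orb_reverse]; exact h.compact_R x hx
  compact_R x hx := by rw [orb_reverse]; exact h.compact_A x hx
  stable_A x hx := by rw [orb_reverse]; exact h.stable_R x hx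
  stable_R x hx := by rw [orb_reverse, reverse_reverse]; exact h.stable_A x hx
  fixed x hx t := h.fixed x hx (-t)
  isolated x hx := by
    obtain ⟨N, hN, hi⟩ := h.isolated x hx
    refine ⟨N, hN, fun y hy => hi y fun t => ?_⟩
    simpa [Flow.reverse_apply] using hy (-t)
  nonwandering_eq := by rw [nonwandering_reverse, h.nonwandering_eq, union_comm A R]
  AR := h.AR.symm
  AS := h.RS
  RS := h.AS
  no_connection x a ha b hb h1 h2 :=
    h.no_connection x b hb a ha (toPast_iff.2 h2) (toPast_reverse_iff.1 h1)

lemma closure_subset (h : HyperbolicData φ A R S) {P : Set X} (hP : P ⊆ (A ∪ R) ∪ S) :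
    closure P ⊆ (A ∪ R) ∪ S := by
  rw [← h.nonwandering_eq] at hP ⊢
  exact closure_minimal hP (isClosed_nonwandering φ)

/-- A compact invariant orbit meets every closed set to which it converges, and orbits that meet
coincide. -/
lemma mem_orb_of_toFut (h : HyperbolicData φ A R S) {x y : X} (hx : IsCompact (orb φ x))
    (hy : y ∈ A) (hxy : ToFut φ x (orb φ y)) : x ∈ orb φ y :=
  mem_of_orb_inter (hxy.inter_nonempty (h.compact_A y hy).isClosed hx.isClosed
    (Eventually.of_forall fun t => inv_orb φ x t x (mem_orb φ x)))

lemma isCompact_orb_saddle (h : HyperbolicData φ A R S) {x : X} (hx : x ∈ S) :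
    IsCompact (orb φ x) := by
  have : orb φ x = {x} := by
    ext y
    simp only [orb, h.fixed x hx, mem_range, mem_singleton_iff]
    exact ⟨fun ⟨_, h⟩ => h.symm, fun h => ⟨0, h.symm⟩⟩
  rw [this]
  exact isCompact_singleton

/-- Points with compact orbits outside of the sinks do not accumulate at the sinks. -/
lemma notMem_closure (h : HyperbolicData φ A R S) {P : Set X}
    (hPc : ∀ x ∈ P, IsCompact (orb φ x)) (hP : Disjoint P A) {p : X} (hp : p ∈ A) :
    p ∉ closure P := by
  intro hpc
  obtain ⟨-, U, hU, hpU, hUa⟩ := h.stable_A p hp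
  obtain ⟨y, hyU, hyP⟩ := mem_closure_iff.1 hpc U hU (hpU (mem_orb φ p))
  have h1 := h.mem_orb_of_toFut (hPc y hyP) hp (hUa y hyU)
  exact disjoint_left.1 hP hyP (h.inv_A.orb_subset hp h1)

/-- Limits of saddles are non-wandering; they are not in `A` or `R`, whose basins contain no other
compact orbit, and not at another saddle, since a fixed point inside an isolating neighbourhood is
its centre. -/
lemma isClosed_of_subset (h : HyperbolicData φ A R S) {P : Set X} (hP : P ⊆ S) : IsClosed P := by
  refine isClosed_of_closure_subset fun p hp => ?_
  rcases h.closure_subset (hP.trans subset_union_right) hp with (hA | hR) | hS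
  · exact absurd hp (h.notMem_closure
      (fun x hx => h.isCompact_orb_saddle (hP hx)) (h.AS.symm.mono_left hP) hA)
  · exact absurd hp (h.reverse.notMem_closure
      (fun x hx => by rw [orb_reverse]; exact h.isCompact_orb_saddle (hP hx))
      (h.RS.symm.mono_left hP) hR)
  · obtain ⟨N, hN, hi⟩ := h.isolated p hS
    obtain ⟨y, hyN, hyP⟩ := mem_closure_iff_nhds.1 hp N hN
    have := hi y fun t => by rwa [h.fixed y (hP hyP) t]
    rwa [← this]

/-- The difficulty is accumulation at a saddle `p`. An orbit of `A` close to `p` must cross the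
frontier of an isolating neighbourhood. The closure of `A` meets that frontier in a compact part of
`A`, covered by finitely many basins, so only finitely many orbits of `A` cross it; these are
compact and avoid a neighbourhood of `p`. -/
lemma isClosed_A (h : HyperbolicData φ A R S) : IsClosed A := by
  refine isClosed_of_closure_subset fun p hp => ?_
  have hR : ∀ q ∈ closure A, q ∉ R := fun q hq hqR =>
    h.reverse.notMem_closure
      (fun x hx => by rw [orb_reverse]; exact h.compact_A x hx) h.AR hqR hq
  rcases h.closure_subset (subset_union_left.trans subset_union_left) hp with (hpA | hpR) | hpS
  · exact hpA
  · exact absurd hpR (hR p hp)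
  exfalso
  obtain ⟨N₀, hN₀, hi⟩ := h.isolated p hpS
  obtain ⟨N, hN, hNc, hNN⟩ := exists_mem_nhds_isClosed_subset hN₀
  have hi' : ∀ y, (∀ t, φ t y ∈ N) → y = p := fun y hy => hi y fun t => hNN (hy t)
  have hCA : closure A ∩ frontier N ⊆ A := by
    rintro q ⟨hq, hqN⟩
    rcases h.closure_subset (subset_union_left.trans subset_union_left) hq with (hqA | hqR) | hqS
    · exact hqA
    · exact absurd hqR (hR q hq)
    · have h1 : q = p := hi' q fun t => by
        rw [h.fixed q hqS]
        exact hNc.frontier_subset hqN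
      rw [h1] at hqN
      exact absurd (mem_interior_iff_mem_nhds.2 hN) hqN.2
  -- Near `z` in `A`, the basin of its orbit contains no other compact orbit; one avoids it by
  -- removing the compact orbit of `z` from the neighbourhood of `p`.
  obtain ⟨O, hO, hOC⟩ : ∃ O ∈ 𝓝 p, ∀ y ∈ A ∩ O, ∀ t, φ t y ∉ closure A ∩ frontier N := by
    refine (isClosed_closure.inter isClosed_frontier).isCompact.induction_on
      (p := fun B => ∃ O ∈ 𝓝 p, ∀ y ∈ A ∩ O, ∀ t, φ t y ∉ B) ⟨univ, univ_mem, by simp⟩ ?_ ?_ ?_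
    · rintro B C hBC ⟨O, hO, h1⟩
      exact ⟨O, hO, fun y hy t ht => h1 y hy t (hBC ht)⟩
    · rintro B C ⟨O, hO, h1⟩ ⟨O', hO', h1'⟩
      refine ⟨O ∩ O', inter_mem hO hO', fun y hy t ht => ?_⟩
      exact ht.elim (h1 y ⟨hy.1, hy.2.1⟩ t) (h1' y ⟨hy.1, hy.2.2⟩ t)
    · intro z hz
      have hzA := hCA hz
      obtain ⟨-, U, hU, hzU, hUa⟩ := h.stable_A z hzA
      refine ⟨U, mem_nhdsWithin_of_mem_nhds (hU.mem_nhds (hzU (mem_orb φ z))), (orb φ z)ᶜ,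
        (h.compact_A z hzA).isClosed.isOpen_compl.mem_nhds fun hpz =>
          disjoint_left.1 h.AS (h.inv_A.orb_subset hzA hpz) hpS, fun y hy t ht => hy.2 ?_⟩
      have h1 : ToFut φ y (orb φ z) := by
        have := (hUa _ ht).shift (-t)
        rwa [flow_neg_apply] at this
      exact h.mem_orb_of_toFut (h.compact_A y hy.1) hzA h1
  obtain ⟨y, hyO, hyA⟩ := mem_closure_iff_nhds.1 hp _
    (inter_mem hO (interior_mem_nhds.2 hN))
  have hfr : ∀ t, φ t y ∉ frontier N := fun t ht =>
    hOC y ⟨hyA, hyO.1⟩ t ⟨subset_closure (h.inv_A t y hyA), ht⟩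
  have hpre : IsPreconnected (orb φ y) :=
    isPreconnected_range (φ.continuous continuous_id continuous_const)
  -- A connected orbit that does not meet the frontier and starts in the interior stays in `N`, so
  -- it is the saddle itself.
  have hsub : orb φ y ⊆ interior N ∪ Nᶜ := by
    rintro _ ⟨t, rfl⟩
    by_contra hcon
    simp only [mem_union, mem_compl_iff, not_or, not_not] at hcon
    exact hfr t ⟨subset_closure hcon.2, hcon.1⟩
  have h2 : orb φ y ⊆ interior N :=
    hpre.subset_left_of_subset_union isOpen_interior hNc.isOpen_compl
      (disjoint_compl_right.mono_left interior_subset) hsub ⟨y, mem_orb φ y, hyO.2⟩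
  have h3 := hi' y fun t => interior_subset (h2 ⟨t, rfl⟩)
  rw [h3] at hyA
  exact disjoint_left.1 h.AS hyA hpS

/-- By Lyapunov stability, if `x` is not in `A`, the orbits of `A` have neighbourhoods whose forward
orbits avoid `x`. A past tending to `A` enters one of them and then flows forward to `x`. -/
lemma eq_of_past (h : HyperbolicData φ A R S) (x : X) (hx : ToPast φ x A) : x ∈ A := by
  by_contra hxA
  have h1 : ∀ z ∈ A, ∃ U, IsOpen U ∧ orb φ z ⊆ U ∧ ∀ y ∈ U, ∀ t, 0 ≤ t → φ t y ∈ ({x}ᶜ : Set X) :=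
    fun z hz => (h.stable_A z hz).1 _ isOpen_compl_singleton fun w hw hwx =>
      hxA (by rw [← mem_singleton_iff.1 hwx]; exact h.inv_A.orb_subset hz hw)
  choose! U hU hzU hUx using h1
  have h2 := (toPast_iff.1 hx).eventually ((isOpen_biUnion hU).mem_nhdsSet.2 fun z hz =>
    mem_biUnion hz (hzU z hz (mem_orb φ z)))
  obtain ⟨t, ht, ht0⟩ := (h2.and (eventually_ge_atTop 0)).exists
  obtain ⟨z, hz, hzt⟩ := mem_iUnion₂.1 ht
  have h3 := hUx z hz _ hzt t ht0
  rw [Flow.reverse_apply, flow_apply_neg] at h3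
  exact h3 rfl

/-- Split `P` into a cluster point `a` of the orbit and the rest. Every subset of saddles is closed,
so the orbit converges to one of the two parts, and the rest does not contain the cluster point. -/
lemma exists_toFut_singleton (h : HyperbolicData φ A R S) {P : Set X} (hP : P ⊆ S) {x : X}
    (hx : ToFut φ x P) : ∃ a ∈ P, ToFut φ x {a} := by
  obtain ⟨a, -, ha⟩ := isCompact_univ.exists_mapClusterPt (u := fun t => φ t x) (f := atTop)
    (by simp)
  have hnot : ∀ Q, IsClosed Q → ToFut φ x Q → a ∈ Q := by
    intro Q hQ hxQ
    by_contra haQ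
    obtain ⟨U, V, hU, hV, hQU, haV, hUV⟩ := SeparatedNhds.of_isCompact_isCompact hQ.isCompact
      isCompact_singleton (disjoint_singleton_right.2 haQ)
    have h1 := hxQ.eventually (hU.mem_nhdsSet.2 hQU)
    have h2 := ha.frequently (p := (· ∈ V)) (hV.mem_nhds (haV rfl))
    obtain ⟨t, h3, h4⟩ := (h2.and_eventually h1).exists
    exact hUV.le_bot ⟨h4, h3⟩
  have haP : a ∈ P := hnot P (h.isClosed_of_subset hP) hx
  refine ⟨a, haP, ?_⟩
  have hd : IsClosed (P \ {a}) := h.isClosed_of_subset (sdiff_subset.trans hP)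
  have h1 : ToFut φ x ({a} ∪ P \ {a}) := hx.mono (by
    intro y hy
    by_cases hya : y = a
    · exact Or.inl hya
    · exact Or.inr ⟨hy, hya⟩)
  rcases h1.or isClosed_singleton hd disjoint_sdiff_right with h2 | h2
  · exact h2
  · exact absurd rfl (hnot _ hd h2).2

lemma isMorseDecomposition (h : HyperbolicData φ A R S) {P Q : Set X} (hS : S = P ∪ Q)
    (hPQ : Disjoint P Q) : IsMorseDecomposition φ A P Q R := by
  have hP : P ⊆ S := hS ▸ subset_union_left
  have hQ : Q ⊆ S := hS ▸ subset_union_right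
  exact
  { closed_A := h.isClosed_A
    closed_P := h.isClosed_of_subset hP
    closed_Q := h.isClosed_of_subset hQ
    closed_R := h.reverse.isClosed_A
    inv_A := h.inv_A
    inv_P := h.inv_subset hP
    inv_Q := h.inv_subset hQ
    inv_R := h.inv_R
    AP := h.AS.mono_right hP
    AQ := h.AS.mono_right hQ
    AR := h.AR
    PQ := hPQ
    PR := (h.RS.mono_right hP).symm
    QR := (h.RS.mono_right hQ).symm
    nonwandering_subset := by rw [← hS, h.nonwandering_eq]
    eq_of_past := h.eq_of_past
    eq_of_fut := fun x hx => h.reverse.eq_of_past x (toPast_reverse_iff.2 hx)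
    no_connection := by
      intro x h1 h2
      rw [← hS] at h1 h2 ⊢
      obtain ⟨b, hb, hxb⟩ := h.exists_toFut_singleton le_rfl h2
      obtain ⟨a, ha, hxa⟩ := h.reverse.exists_toFut_singleton le_rfl (toPast_iff.1 h1)
      exact h.no_connection x a ha b hb (toPast_iff.2 hxa) hxb }

/-- Description of the sink of the Morse decomposition by unstable manifolds. -/
lemma sink_eq (h : HyperbolicData φ A R S) {P : Set X} (hP : P ⊆ S) :
    IsMorseDecomposition.sink φ A P = A ∪ ⋃ a ∈ P, unstableManifold φ a := by
  have hu : ∀ a x, x ∈ unstableManifold φ a ↔ ToPast φ x {a} := fun a x => by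
    rw [unstableManifold, ToPast, nhdsSet_singleton]
    rfl
  ext x
  constructor
  · intro hx
    rcases (toPast_iff.1 hx).or h.isClosed_A (h.isClosed_of_subset hP) (h.AS.mono_right hP)
      with h1 | h1
    · exact Or.inl (h.eq_of_past x (toPast_iff.2 h1))
    · obtain ⟨a, ha, hxa⟩ := h.reverse.exists_toFut_singleton hP h1
      exact Or.inr (mem_biUnion ha ((hu a x).2 (toPast_iff.2 hxa)))
  · rintro (hx | hx)
    · exact (h.inv_A.toPast hx).mono subset_union_left
    · obtain ⟨a, ha, hxa⟩ := mem_iUnion₂.1 hx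
      exact ((hu a x).1 hxa).mono (singleton_subset_iff.2 (Or.inr ha))

end HyperbolicData

end CriticalElements

/-! ### Vector fields and flows in charts. -/

section ChartFields

variable {X : Type*} [TopologicalSpace X] [ChartedSpace Plane X] [IsManifold (𝓡 2) ∞ X]

/-- Smoothness of a vector field on a set. -/
def SmoothFieldOn (W : ∀ x : X, TangentSpace (𝓡 2) x) (V : Set X) : Prop :=
  ContMDiffOn (𝓡 2) (𝓡 2).tangent ∞ (fun x => (⟨x, W x⟩ : TangentBundle (𝓡 2) X)) V

variable {W : ∀ x : X, TangentSpace (𝓡 2) x} {φ : Flow ℝ X} {V : Set X}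
  {e : OpenPartialHomeomorph X Plane}

lemma contMDiffOn_atlas (he : e ∈ atlas Plane X) :
    ContMDiffOn (𝓡 2) 𝓘(ℝ, Plane) ∞ e e.source :=
  contMDiffOn_of_mem_maximalAtlas (IsManifold.subset_maximalAtlas he)

lemma contMDiffOn_atlas_symm (he : e ∈ atlas Plane X) :
    ContMDiffOn 𝓘(ℝ, Plane) (𝓡 2) ∞ e.symm e.target :=
  contMDiffOn_symm_of_mem_maximalAtlas (IsManifold.subset_maximalAtlas he)

lemma mdifferentiableAt_atlas (he : e ∈ atlas Plane X) {x : X} (hx : x ∈ e.source) :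
    MDifferentiableAt (𝓡 2) 𝓘(ℝ, Plane) e x :=
  ((contMDiffOn_atlas he).contMDiffAt (e.open_source.mem_nhds hx)).mdifferentiableAt (by simp)

lemma mdifferentiableAt_atlas_symm (he : e ∈ atlas Plane X) {y : Plane} (hy : y ∈ e.target) :
    MDifferentiableAt 𝓘(ℝ, Plane) (𝓡 2) e.symm y :=
  ((contMDiffOn_atlas_symm he).contMDiffAt (e.open_target.mem_nhds hy)).mdifferentiableAt (by simp)

lemma contDiffOn_chartField (hV : IsOpen V) (hW : SmoothFieldOn W V) (he : e ∈ atlas Plane X) :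
    ContDiffOn ℝ ∞ (chartField W e) (e.target ∩ e.symm ⁻¹' V) := by
  intro y hy
  have hys : e.symm y ∈ e.source := e.map_target hy.1
  have h1 := (contMDiffOn_atlas he).contMDiffOn_tangentMapWithin (m := ∞) (by simp)
    e.open_source.uniqueMDiffOn
  have h2 : ContMDiffAt (𝓡 2) (𝓡 2).tangent ∞ (fun x => (⟨x, W x⟩ : TangentBundle (𝓡 2) X))
      (e.symm y) := hW.contMDiffAt (hV.mem_nhds hy.2)
  have h3 : ContMDiffAt (𝓡 2) (𝓡 2).tangent ∞
      (fun x => tangentMapWithin (𝓡 2) 𝓘(ℝ, Plane) e e.source ⟨x, W x⟩) (e.symm y) := by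
    have h4 : ContMDiffOn (𝓡 2) (𝓡 2).tangent ∞
        (fun x => tangentMapWithin (𝓡 2) 𝓘(ℝ, Plane) e e.source ⟨x, W x⟩) (V ∩ e.source) :=
      h1.comp (hW.mono inter_subset_left) fun x hx => hx.2
    exact h4.contMDiffAt ((hV.inter e.open_source).mem_nhds ⟨hy.2, hys⟩)
  have h4 := (contMDiff_snd_tangentBundle_modelSpace Plane 𝓘(ℝ, Plane) (n := ∞)).contMDiffAt.comp
    (e.symm y) h3
  have h5 := h4.comp y ((contMDiffOn_atlas_symm he).contMDiffAt (e.open_target.mem_nhds hy.1))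
  refine (h5.contDiffAt.congr_of_eventuallyEq ?_).contDiffWithinAt
  filter_upwards [e.open_target.mem_nhds hy.1] with z hz
  simp only [Function.comp, chartField, tangentMapWithin_snd]
  rw [mfderivWithin_of_isOpen e.open_source (e.map_target hz)]

lemma contDiffOn_chartField_univ (hW : SmoothFieldOn W univ) (he : e ∈ atlas Plane X) :
    ContDiffOn ℝ ∞ (chartField W e) e.target := by
  simpa using contDiffOn_chartField isOpen_univ hW he

lemma contDiffAt_chartField (hW : SmoothFieldOn W univ) (he : e ∈ atlas Plane X) {y : Plane}
    (hy : y ∈ e.target) : ContDiffAt ℝ ∞ (chartField W e) y :=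
  (contDiffOn_chartField_univ hW he).contDiffAt (e.open_target.mem_nhds hy)

lemma chartField_apply {x : X} (hx : x ∈ e.source) :
    chartField W e (e x) = mfderiv (𝓡 2) 𝓘(ℝ, Plane) e x (W x) := by
  unfold chartField
  rw [e.left_inv hx]

lemma chartField_eq_zero_iff (he : e ∈ atlas Plane X) {x : X} (hx : x ∈ e.source) :
    chartField W e (e x) = 0 ↔ W x = 0 := by
  rw [chartField_apply hx]
  refine ⟨fun h => ?_, fun h => by rw [h]; exact map_zero _⟩
  have h1 := (mdifferentiable_of_mem_atlas (I := 𝓡 2) he).mfderiv_injective hx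
  exact h1 (h.trans (map_zero _).symm)

/-- Chain rule in a chart. -/
lemma mfderiv_eq_fderiv_chart {E : Type*} [NormedAddCommGroup E] [NormedSpace ℝ E] {f : X → E}
    (he : e ∈ atlas Plane X) {x : X} (hx : x ∈ e.source)
    (hf : MDifferentiableAt (𝓡 2) 𝓘(ℝ, E) f x) (v : TangentSpace (𝓡 2) x) :
    mfderiv (𝓡 2) 𝓘(ℝ, E) f x v =
      fderiv ℝ (f ∘ e.symm) (e x) (mfderiv (𝓡 2) 𝓘(ℝ, Plane) e x v) := by
  have h2 := (mdifferentiableAt_atlas_symm he (e.map_source hx)).hasMFDerivAt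
  have h3 : HasMFDerivAt (𝓡 2) 𝓘(ℝ, E) f (e.symm (e x))
      (mfderiv (𝓡 2) 𝓘(ℝ, E) f (e.symm (e x))) := by
    rw [e.left_inv hx]
    exact hf.hasMFDerivAt
  have h1 := h3.comp (e x) h2
  have h4 := h1.comp x (mdifferentiableAt_atlas he hx).hasMFDerivAt
  have h5 : HasMFDerivAt (𝓡 2) 𝓘(ℝ, E) ((f ∘ e.symm) ∘ e) x (mfderiv (𝓡 2) 𝓘(ℝ, E) f x) := by
    refine hf.hasMFDerivAt.congr_of_eventuallyEq ?_
    filter_upwards [e.open_source.mem_nhds hx] with z hz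
    simp [e.left_inv hz]
  have h6 := hasMFDerivAt_unique h4 h5
  have h7 := h1.mfderiv
  rw [mfderiv_eq_fderiv] at h7
  rw [← h6, h7]
  rfl

lemma mfderiv_field_eq {E : Type*} [NormedAddCommGroup E] [NormedSpace ℝ E] {f : X → E}
    (he : e ∈ atlas Plane X) {x : X} (hx : x ∈ e.source)
    (hf : MDifferentiableAt (𝓡 2) 𝓘(ℝ, E) f x) :
    mfderiv (𝓡 2) 𝓘(ℝ, E) f x (W x) = fderiv ℝ (f ∘ e.symm) (e x) (chartField W e (e x)) := by
  rw [mfderiv_eq_fderiv_chart he hx hf, chartField_apply hx]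

/-- The derivative of a function along the flow. -/
lemma IsFlowOf.hasDerivAt {E : Type*} [NormedAddCommGroup E] [NormedSpace ℝ E] {f : X → E}
    (hφ : IsFlowOf φ W) (t : ℝ) (x : X) (hf : MDifferentiableAt (𝓡 2) 𝓘(ℝ, E) f (φ t x)) :
    HasDerivAt (fun t => f (φ t x)) (mfderiv (𝓡 2) 𝓘(ℝ, E) f (φ t x) (W (φ t x))) t := by
  let L : ℝ →L[ℝ] E := ContinuousLinearMap.comp (mfderiv (𝓡 2) 𝓘(ℝ, E) f (φ t x) : Plane →L[ℝ] E)
    (ContinuousLinearMap.smulRight (1 : ℝ →L[ℝ] ℝ) (W (φ t x) : Plane))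
  have h1 : HasFDerivAt (fun t => f (φ t x)) L t :=
    hasMFDerivAt_iff_hasFDerivAt.1 (hf.hasMFDerivAt.comp t (hφ x t))
  refine h1.hasDerivAt.congr_deriv ?_
  have h3 : ((ContinuousLinearMap.smulRight (1 : ℝ →L[ℝ] ℝ) (W (φ t x) : Plane)) (1 : ℝ) : Plane) =
      W (φ t x) := by simp
  exact congrArg (mfderiv (𝓡 2) 𝓘(ℝ, E) f (φ t x) : Plane →L[ℝ] E) h3

lemma IsFlowOf.hasDerivAt_chart (hφ : IsFlowOf φ W) (he : e ∈ atlas Plane X) (t : ℝ) (x : X)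
    (hx : φ t x ∈ e.source) :
    HasDerivAt (fun t => e (φ t x)) (chartField W e (e (φ t x))) t := by
  rw [chartField_apply hx]
  exact hφ.hasDerivAt t x (mdifferentiableAt_atlas he hx)

lemma IsFlowOf.reverse (hφ : IsFlowOf φ W) : IsFlowOf φ.reverse (-W) := by
  intro x
  have := IsMIntegralCurve.comp_mul (hφ x) (-1)
  have h2 : ((fun t => φ t x) ∘ fun t : ℝ => t * -1) = fun t => φ.reverse t x := by
    ext t
    simp [Flow.reverse_apply]
  rw [h2] at this
  convert this using 1
  ext y
  simp

lemma chartField_neg : chartField (-W) e = -chartField W e := by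
  ext1 y
  exact map_neg (mfderiv (𝓡 2) 𝓘(ℝ, Plane) e (e.symm y)) (W (e.symm y))

end ChartFields

/-! ### Differentiability of local flows and Liouville's formula. -/

section FlowDerivative

open Metric

variable {E : Type*} [NormedAddCommGroup E] [NormedSpace ℝ E]

/-- Uniform `C²`-bounds for a vector field on a ball. -/
structure FieldBounds (F : E → E) (p : E) (r K M : ℝ) : Prop where
  r_pos : 0 < r
  K_pos : 0 < K
  M_nonneg : 0 ≤ M
  hasFDerivAt : ∀ u ∈ ball p r, HasFDerivAt F (fderiv ℝ F u) u
  norm_le : ∀ u ∈ ball p r, ‖fderiv ℝ F u‖ ≤ K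
  lip : ∀ u ∈ ball p r, ∀ v ∈ ball p r, ‖fderiv ℝ F u - fderiv ℝ F v‖ ≤ M * ‖u - v‖

lemma exists_fieldBounds {F : E → E} {p : E} (hF : ContDiffAt ℝ ∞ F p) :
    ∃ r K M, FieldBounds F p r K M := by
  have h1 : ContDiffAt ℝ 1 (fderiv ℝ F) p := hF.fderiv_right (m := 1) (by norm_cast)
  obtain ⟨M, s, hs, hM⟩ := h1.exists_lipschitzOnWith
  have h2 : ∀ᶠ u in 𝓝 p, DifferentiableAt ℝ F u := by
    have := (hF.of_le (m := 1) (by norm_cast)).eventually (by simp)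
    filter_upwards [this] with u hu
    exact hu.differentiableAt (by simp)
  have h3 : ∀ᶠ u in 𝓝 p, ‖fderiv ℝ F u‖ < ‖fderiv ℝ F p‖ + 1 :=
    h1.continuousAt.norm.eventually_lt_const (lt_add_one _)
  obtain ⟨r, hr, hb⟩ := Metric.mem_nhds_iff.1 (inter_mem hs (inter_mem h2 h3))
  refine ⟨r, ‖fderiv ℝ F p‖ + 1, M, hr, by positivity, M.2, fun u hu => (hb hu).2.1.hasFDerivAt,
    fun u hu => (hb hu).2.2.le, fun u hu v hv => ?_⟩
  rw [← dist_eq_norm, ← dist_eq_norm]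
  exact hM.dist_le_mul u (hb hu).1 v (hb hv).1

namespace FieldBounds

variable {F : E → E} {p : E} {r K M : ℝ}

lemma norm_sub_le (h : FieldBounds F p r K M) {u v : E} (hu : u ∈ ball p r) (hv : v ∈ ball p r) :
    ‖F u - F v‖ ≤ K * ‖u - v‖ :=
  (convex_ball p r).norm_image_sub_le_of_norm_hasFDerivWithin_le
    (fun w hw => (h.hasFDerivAt w hw).hasFDerivWithinAt) h.norm_le hv hu

/-- Mean value inequality for `F` minus its linear part at `x`, on the convex part of the ball
within `d` of `x`, where the derivative varies by at most `M * d`. -/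
lemma norm_taylor_le (h : FieldBounds F p r K M) {u v x : E} {d : ℝ} (hu : u ∈ ball p r)
    (hv : v ∈ ball p r) (hx : x ∈ ball p r) (hux : ‖u - x‖ ≤ d) (hvx : ‖v - x‖ ≤ d) :
    ‖F u - F v - fderiv ℝ F x (u - v)‖ ≤ M * d * ‖u - v‖ := by
  have hc : Convex ℝ (ball p r ∩ closedBall x d) := (convex_ball p r).inter (convex_closedBall x d)
  refine hc.norm_image_sub_le_of_norm_hasFDerivWithin_le'
    (fun w hw => (h.hasFDerivAt w hw.1).hasFDerivWithinAt) (fun w hw => ?_)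
    ⟨hv, by simpa [dist_eq_norm] using hvx⟩ ⟨hu, by simpa [dist_eq_norm] using hux⟩
  refine (h.lip w hw.1 x hx).trans ?_
  have := hw.2
  rw [mem_closedBall, dist_eq_norm] at this
  exact mul_le_mul_of_nonneg_left this h.M_nonneg

variable {Φ : ℝ → E → E} {U : Set E} {δ : ℝ}

/-- Trajectories separate at most exponentially. -/
lemma norm_flow_sub_le (h : FieldBounds F p r K M)
    (hΦ : ∀ y ∈ U, ∀ s ∈ Icc 0 δ, Φ s y ∈ ball p r ∧ HasDerivAt (fun s => Φ s y) (F (Φ s y)) s)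
    (h0 : ∀ y ∈ U, Φ 0 y = y) {x y : E} (hx : x ∈ U) (hy : y ∈ U) {s : ℝ} (hs : s ∈ Icc 0 δ) :
    ‖Φ s x - Φ s y‖ ≤ ‖x - y‖ * Real.exp (K * s) := by
  have := norm_le_gronwallBound_of_norm_deriv_right_le (f := fun s => Φ s x - Φ s y)
    (f' := fun s => F (Φ s x) - F (Φ s y)) (δ := ‖x - y‖) (K := K) (ε := 0) (a := 0) (b := δ)
    (fun t ht => ((hΦ x hx t ht).2.continuousAt.sub
      (hΦ y hy t ht).2.continuousAt).continuousWithinAt)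
    (fun t ht => ((hΦ x hx t (Ico_subset_Icc_self ht)).2.sub
      (hΦ y hy t (Ico_subset_Icc_self ht)).2).hasDerivWithinAt)
    (by simp [h0 x hx, h0 y hy])
    (fun t ht => by
      rw [add_zero]
      exact h.norm_sub_le (hΦ x hx t (Ico_subset_Icc_self ht)).1
        (hΦ y hy t (Ico_subset_Icc_self ht)).1) s hs
  rwa [gronwallBound_ε0, sub_zero] at this

/-- Solution of the linearized equation along a trajectory, for small times. -/
lemma exists_linearized [CompleteSpace E] (h : FieldBounds F p r K M)
    (hΦ : ∀ y ∈ U, ∀ s ∈ Icc 0 δ, Φ s y ∈ ball p r ∧ HasDerivAt (fun s => Φ s y) (F (Φ s y)) s)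
    (hδ : 0 ≤ δ) (hδK : 2 * K * δ ≤ 1) {x : E} (hx : x ∈ U) :
    ∃ Y : ℝ → E →L[ℝ] E, Y 0 = ContinuousLinearMap.id ℝ E ∧ ∀ s ∈ Icc 0 δ,
      HasDerivWithinAt Y ((fderiv ℝ F (Φ s x)).comp (Y s)) (Icc 0 δ) s := by
  have hK := h.K_pos
  have hb : ∀ s ∈ Icc 0 δ, ‖fderiv ℝ F (Φ s x)‖ ≤ K := fun s hs => h.norm_le _ (hΦ x hx s hs).1
  have hcont : ContinuousOn (fun s => fderiv ℝ F (Φ s x)) (Icc 0 δ) := by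
    have h1 : ContinuousOn (fderiv ℝ F) (ball p r) := by
      have : LipschitzOnWith ⟨M, h.M_nonneg⟩ (fderiv ℝ F) (ball p r) :=
        LipschitzOnWith.of_dist_le_mul fun u hu v hv => by
          rw [dist_eq_norm, dist_eq_norm]
          exact h.lip u hu v hv
      exact this.continuousOn
    exact h1.comp (fun s hs => (hΦ x hx s hs).2.continuousAt.continuousWithinAt)
      fun s hs => (hΦ x hx s hs).1
  -- Solutions are sought in the unit ball of operators around the identity, where the norm is at
  -- most `2` and the speed at most `2 * K`; the smallness condition on `δ` keeps them in it.
  have hPL : IsPicardLindelof (fun (s : ℝ) (Y : E →L[ℝ] E) => (fderiv ℝ F (Φ s x)).comp Y)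
      (⟨0, ⟨le_rfl, hδ⟩⟩ : Icc 0 δ) (ContinuousLinearMap.id ℝ E) 1 0 ⟨2 * K, by positivity⟩
      ⟨K, hK.le⟩ := by
    refine ⟨fun s hs => LipschitzOnWith.of_dist_le_mul fun Y _ Y' _ => ?_, fun Y _ => ?_,
      fun s hs Y hY => ?_, ?_⟩
    · rw [dist_eq_norm, dist_eq_norm, ← ContinuousLinearMap.comp_sub]
      exact (ContinuousLinearMap.opNorm_comp_le _ _).trans
        (mul_le_mul_of_nonneg_right (hb s hs) (norm_nonneg _))
    · exact hcont.clm_comp continuousOn_const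
    · refine (ContinuousLinearMap.opNorm_comp_le _ _).trans ?_
      have h1 : ‖Y‖ ≤ 2 := by
        have h2 : ‖Y - ContinuousLinearMap.id ℝ E‖ ≤ 1 := by
          rw [← dist_eq_norm]
          simpa using hY
        calc ‖Y‖ = ‖(Y - ContinuousLinearMap.id ℝ E) + ContinuousLinearMap.id ℝ E‖ := by simp
          _ ≤ 1 + 1 := (norm_add_le _ _).trans (add_le_add h2 ContinuousLinearMap.norm_id_le)
          _ = 2 := by norm_num
      calc _ ≤ K * 2 := mul_le_mul (hb s hs) h1 (norm_nonneg _) hK.le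
        _ = 2 * K := mul_comm _ _
    · simp only [sub_zero, NNReal.coe_one, NNReal.coe_zero]
      rw [max_eq_left hδ]
      exact hδK
  obtain ⟨Y, hY0, hY⟩ := hPL.exists_eq_forall_mem_Icc_hasDerivWithinAt₀
  exact ⟨Y, hY0, hY⟩

/-- Differentiability of the flow, for small times. -/
lemma hasStrictFDerivAt_flow (h : FieldBounds F p r K M) (hU : IsOpen U)
    (hΦ : ∀ y ∈ U, ∀ s ∈ Icc 0 δ, Φ s y ∈ ball p r ∧ HasDerivAt (fun s => Φ s y) (F (Φ s y)) s)
    (h0 : ∀ y ∈ U, Φ 0 y = y) {x : E} (hx : x ∈ U) {Y : ℝ → E →L[ℝ] E}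
    (hY0 : Y 0 = ContinuousLinearMap.id ℝ E)
    (hY : ∀ s ∈ Icc 0 δ, HasDerivWithinAt Y ((fderiv ℝ F (Φ s x)).comp (Y s)) (Icc 0 δ) s)
    {t : ℝ} (ht : t ∈ Icc 0 δ) : HasStrictFDerivAt (Φ t) (Y t) x := by
  have hδ : 0 ≤ δ := ht.1.trans ht.2
  have hK := h.K_pos
  have hM := h.M_nonneg
  set C := Real.exp (K * δ) with hC
  have hC0 : 0 < C := Real.exp_pos _
  have hexp : ∀ s ∈ Icc 0 δ, Real.exp (K * s) ≤ C := fun s hs =>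
    Real.exp_le_exp.2 (mul_le_mul_of_nonneg_left hs.2 hK.le)
  set B := M * C * C * ((Real.exp (K * δ) - 1) / K) with hB
  -- Grönwall for the defect between the separation of two trajectories and its linearization along
  -- the trajectory of `x`. Comparing two variable points gives strict differentiability, which
  -- later yields local Lipschitz bounds.
  have hkey : ∀ y ∈ U, ∀ z ∈ U, ∀ d, ‖y - x‖ ≤ d → ‖z - x‖ ≤ d →
      ‖Φ t y - Φ t z - Y t (y - z)‖ ≤ B * d * ‖y - z‖ := by
    intro y hy z hz d hyd hzd
    have hd : 0 ≤ d := (norm_nonneg _).trans hyd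
    have h1 := norm_le_gronwallBound_of_norm_deriv_right_le
      (f := fun s => Φ s y - Φ s z - Y s (y - z))
      (f' := fun s => F (Φ s y) - F (Φ s z) - (fderiv ℝ F (Φ s x)) (Y s (y - z)))
      (δ := 0) (K := K) (ε := M * (d * C) * (‖y - z‖ * C)) (a := 0) (b := δ)
      (fun s hs => (((hΦ y hy s hs).2.continuousAt.sub
        (hΦ z hz s hs).2.continuousAt).continuousWithinAt).sub
        ((hY s hs).continuousWithinAt.clm_apply continuousWithinAt_const))
      (fun s hs => by
        have hs' := Ico_subset_Icc_self hs
        have h2 : HasDerivWithinAt (fun s => Y s (y - z)) ((fderiv ℝ F (Φ s x)) (Y s (y - z)))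
            (Icc 0 δ) s := by
          have := (hY s hs').clm_apply (hasDerivWithinAt_const s (Icc 0 δ) (y - z))
          simpa using this
        have h3 : HasDerivWithinAt (fun s => Y s (y - z)) ((fderiv ℝ F (Φ s x)) (Y s (y - z)))
            (Ici s) s := h2.mono_of_mem_nhdsWithin (Icc_mem_nhdsGE_of_mem hs)
        exact ((hΦ y hy s hs').2.sub (hΦ z hz s hs').2).hasDerivWithinAt.sub h3)
      (by simp [h0 y hy, h0 z hz, hY0])
      (fun s hs => by
        have hs' := Ico_subset_Icc_self hs
        have h2 := h.norm_taylor_le (d := d * C) (hΦ y hy s hs').1 (hΦ z hz s hs').1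
          (hΦ x hx s hs').1
          ((h.norm_flow_sub_le hΦ h0 hy hx hs').trans
            (mul_le_mul hyd (hexp s hs') (Real.exp_pos _).le hd))
          ((h.norm_flow_sub_le hΦ h0 hz hx hs').trans
            (mul_le_mul hzd (hexp s hs') (Real.exp_pos _).le hd))
        have h3 : ‖Φ s y - Φ s z‖ ≤ ‖y - z‖ * C := (h.norm_flow_sub_le hΦ h0 hy hz hs').trans
          (mul_le_mul_of_nonneg_left (hexp s hs') (norm_nonneg _))
        have h4 : F (Φ s y) - F (Φ s z) - (fderiv ℝ F (Φ s x)) (Y s (y - z)) =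
            (F (Φ s y) - F (Φ s z) - (fderiv ℝ F (Φ s x)) (Φ s y - Φ s z)) +
              (fderiv ℝ F (Φ s x)) (Φ s y - Φ s z - Y s (y - z)) := by
          simp only [map_sub]
          abel
        have h5 : ‖(fderiv ℝ F (Φ s x)) (Φ s y - Φ s z - Y s (y - z))‖ ≤
            K * ‖Φ s y - Φ s z - Y s (y - z)‖ :=
          (ContinuousLinearMap.le_opNorm _ _).trans
            (mul_le_mul_of_nonneg_right (h.norm_le _ (hΦ x hx s hs').1) (norm_nonneg _))
        rw [h4]
        refine (norm_add_le _ _).trans ?_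
        have h6 : M * (d * C) * ‖Φ s y - Φ s z‖ ≤ M * (d * C) * (‖y - z‖ * C) :=
          mul_le_mul_of_nonneg_left h3 (by positivity)
        linarith) t ht
    rw [gronwallBound_of_K_ne_0 hK.ne', sub_zero] at h1
    refine h1.trans ?_
    have h2 : Real.exp (K * t) - 1 ≤ Real.exp (K * δ) - 1 := by linarith [hexp t ht]
    have h3 : 0 ≤ M * (d * C) * (‖y - z‖ * C) / K := by positivity
    have h4 := mul_le_mul_of_nonneg_left h2 h3
    simp only [zero_mul, zero_add]
    refine h4.trans (le_of_eq ?_)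
    rw [hB]
    field_simp
  have hB0 : 0 ≤ B := by
    have : 0 ≤ Real.exp (K * δ) - 1 := by
      have := Real.one_le_exp (mul_nonneg hK.le hδ)
      linarith
    positivity
  refine HasStrictFDerivAt.of_isLittleO (Asymptotics.isLittleO_iff.2 fun c hc => ?_)
  have hη : 0 < c / (B + 1) := by positivity
  have hnb : ∀ᶠ y in 𝓝 x, y ∈ U ∧ ‖y - x‖ ≤ c / (B + 1) := by
    filter_upwards [hU.mem_nhds hx, Metric.closedBall_mem_nhds x hη] with y hy hy'
    exact ⟨hy, by rwa [mem_closedBall, dist_eq_norm] at hy'⟩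
  rw [nhds_prod_eq]
  filter_upwards [hnb.prod_mk hnb] with q hq
  refine (hkey q.1 hq.1.1 q.2 hq.2.1 _ hq.1.2 hq.2.2).trans ?_
  refine mul_le_mul_of_nonneg_right ?_ (norm_nonneg _)
  rw [mul_div_assoc', div_le_iff₀ (by positivity)]
  nlinarith

end FieldBounds

/-- Determinants in the plane. -/
lemma det_plane (L : Plane →L[ℝ] Plane) : LinearMap.det (L : Plane →ₗ[ℝ] Plane) =
    L (EuclideanSpace.single 0 1) 0 * L (EuclideanSpace.single 1 1) 1 -
      L (EuclideanSpace.single 1 1) 0 * L (EuclideanSpace.single 0 1) 1 := by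
  rw [← LinearMap.det_toMatrix (EuclideanSpace.basisFun (Fin 2) ℝ).toBasis, Matrix.det_fin_two]
  simp [LinearMap.toMatrix_apply]

/-- Traces in the plane. -/
lemma trace_plane (L : Plane →L[ℝ] Plane) : LinearMap.trace ℝ Plane (L : Plane →ₗ[ℝ] Plane) =
    L (EuclideanSpace.single 0 1) 0 + L (EuclideanSpace.single 1 1) 1 := by
  rw [LinearMap.trace_eq_matrix_trace ℝ (EuclideanSpace.basisFun (Fin 2) ℝ).toBasis,
    Matrix.trace_fin_two]
  simp [LinearMap.toMatrix_apply]

lemma plane_eq (v : Plane) :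
    v = v 0 • EuclideanSpace.single 0 (1 : ℝ) + v 1 • EuclideanSpace.single 1 (1 : ℝ) := by
  ext i
  fin_cases i <;> simp

lemma apply_plane (L : Plane →L[ℝ] Plane) (v : Plane) (i : Fin 2) : L v i =
    v 0 * L (EuclideanSpace.single 0 1) i + v 1 * L (EuclideanSpace.single 1 1) i := by
  conv_lhs => rw [plane_eq v]
  simp

/-- Liouville's formula for the determinant of the solution of a linear equation. -/
lemma hasDerivWithinAt_det {Y : ℝ → Plane →L[ℝ] Plane} {A : Plane →L[ℝ] Plane} {S : Set ℝ} {s : ℝ}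
    (hY : HasDerivWithinAt Y (A.comp (Y s)) S s) :
    HasDerivWithinAt (fun s => LinearMap.det (Y s : Plane →ₗ[ℝ] Plane))
      (LinearMap.trace ℝ Plane (A : Plane →ₗ[ℝ] Plane) *
        LinearMap.det (Y s : Plane →ₗ[ℝ] Plane)) S s := by
  have h1 : ∀ (v : Plane) (i : Fin 2),
      HasDerivWithinAt (fun s => Y s v i) (A (Y s v) i) S s := by
    intro v i
    have h2 := (((EuclideanSpace.proj i : Plane →L[ℝ] ℝ).comp
      (ContinuousLinearMap.apply ℝ Plane v)).hasFDerivAt).comp_hasDerivWithinAt s hY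
    exact h2
  simp only [det_plane]
  refine (((h1 _ 0).mul (h1 _ 1)).sub ((h1 _ 0).mul (h1 _ 1))).congr_deriv ?_
  rw [trace_plane, apply_plane A (Y s (EuclideanSpace.single 0 1)),
    apply_plane A (Y s (EuclideanSpace.single 1 1)),
    apply_plane A (Y s (EuclideanSpace.single 0 1)),
    apply_plane A (Y s (EuclideanSpace.single 1 1))]
  ring

end FlowDerivative

/-! ### The Jacobian of the flow of a field with given divergence. -/

section FlowOnSurface

open Metric

lemma FieldBounds.mono {E : Type*} [NormedAddCommGroup E] [NormedSpace ℝ E] {F : E → E} {p : E}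
    {r K M r' : ℝ} (h : FieldBounds F p r K M) (h0 : 0 < r') (hr : r' ≤ r) :
    FieldBounds F p r' K M :=
  ⟨h0, h.K_pos, h.M_nonneg, fun u hu => h.hasFDerivAt u (ball_subset_ball hr hu),
    fun u hu => h.norm_le u (ball_subset_ball hr hu),
    fun u hu v hv => h.lip u (ball_subset_ball hr hu) v (ball_subset_ball hr hv)⟩

variable {X : Type*} [TopologicalSpace X] [ChartedSpace Plane X] [IsManifold (𝓡 2) ∞ X]

/-- The differential of a self-map, in the preferred charts. -/
def tderiv (f : X → X) (x : X) : Plane →L[ℝ] Plane := mfderiv (𝓡 2) (𝓡 2) f x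

/-- The differential of a chart. -/
def cderiv (e : OpenPartialHomeomorph X Plane) (x : X) : Plane →L[ℝ] Plane :=
  mfderiv (𝓡 2) 𝓘(ℝ, Plane) e x

/-- Strict differentiability of a self-map, in charts. -/
def StrictDiffAt (f : X → X) (x : X) : Prop :=
  ∀ e ∈ atlas Plane X, ∀ e' ∈ atlas Plane X, x ∈ e.source → f x ∈ e'.source →
    ∃ L : Plane →L[ℝ] Plane, HasStrictFDerivAt (e' ∘ f ∘ e.symm) L (e x)

variable {W : ∀ x : X, TangentSpace (𝓡 2) x} {φ : Flow ℝ X} {f g : X → X} {x : X}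
  {e e' : OpenPartialHomeomorph X Plane}

lemma contDiffAt_transition (he : e ∈ atlas Plane X) (he' : e' ∈ atlas Plane X)
    (hx : x ∈ e.source) (hx' : x ∈ e'.source) : ContDiffAt ℝ ∞ (e' ∘ e.symm) (e x) := by
  have h1 := (contMDiffOn_atlas_symm he).contMDiffAt (e.open_target.mem_nhds (e.map_source hx))
  have h2 : ContMDiffAt (𝓡 2) 𝓘(ℝ, Plane) ∞ e' (e.symm (e x)) := by
    rw [e.left_inv hx]
    exact (contMDiffOn_atlas he').contMDiffAt (e'.open_source.mem_nhds hx')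
  exact (h2.comp (e x) h1).contDiffAt

lemma eventually_chart {p : X → Prop} (hx : x ∈ e.source) (h : ∀ᶠ y in 𝓝 x, p y) :
    ∀ᶠ u in 𝓝 (e x), p (e.symm u) :=
  (e.tendsto_symm hx).eventually h

lemma StrictDiffAt.comp (hg : StrictDiffAt g (f x)) (hf : StrictDiffAt f x)
    (hfc : ContinuousAt f x) : StrictDiffAt (g ∘ f) x := by
  intro e he e'' he'' hx hx''
  set e' := chartAt Plane (f x)
  have hx' : f x ∈ e'.source := mem_chart_source Plane (f x)
  obtain ⟨L, hL⟩ := hf e he e' (chart_mem_atlas _ _) hx hx'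
  obtain ⟨L', hL'⟩ := hg e' (chart_mem_atlas _ _) e'' he'' hx' hx''
  have h1 : (e' ∘ f ∘ e.symm) (e x) = e' (f x) := by simp [e.left_inv hx]
  rw [← h1] at hL'
  refine ⟨_, (hL'.comp (e x) hL).congr_of_eventuallyEq ?_⟩
  filter_upwards [eventually_chart hx (hfc.eventually_mem (e'.open_source.mem_nhds hx'))] with u hu
  simp [e'.left_inv hu]

lemma StrictDiffAt.of_exists (hfc : ContinuousAt f x) (he : e ∈ atlas Plane X)
    (he' : e' ∈ atlas Plane X) (hx : x ∈ e.source) (hx' : f x ∈ e'.source)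
    {L : Plane →L[ℝ] Plane} (hL : HasStrictFDerivAt (e' ∘ f ∘ e.symm) L (e x)) :
    StrictDiffAt f x := by
  intro e₁ he₁ e₂ he₂ hx₁ hx₂
  have h1 := (contDiffAt_transition he₁ he hx₁ hx).hasStrictFDerivAt (by simp)
  have h2 := (contDiffAt_transition he' he₂ hx' hx₂).hasStrictFDerivAt (by simp)
  have h3 : (e ∘ e₁.symm) (e₁ x) = e x := by simp [e₁.left_inv hx₁]
  have h4 : (e' ∘ f ∘ e.symm) (e x) = e' (f x) := by simp [e.left_inv hx]
  rw [← h4] at h2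
  have h5 := h2.comp (e x) hL
  rw [← h3] at h5
  refine ⟨_, (h5.comp (e₁ x) h1).congr_of_eventuallyEq ?_⟩
  filter_upwards [eventually_chart hx₁ (hfc.eventually_mem (e'.open_source.mem_nhds hx')),
    eventually_chart hx₁ (e.open_source.mem_nhds hx)] with u hu hu'
  simp [e.left_inv hu', e'.left_inv hu]

lemma StrictDiffAt.mdifferentiableAt (hf : StrictDiffAt f x) (hfc : ContinuousAt f x) :
    MDifferentiableAt (𝓡 2) (𝓡 2) f x := by
  set e := chartAt Plane x
  set e' := chartAt Plane (f x)
  have hx : x ∈ e.source := mem_chart_source Plane x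
  have hx' : f x ∈ e'.source := mem_chart_source Plane (f x)
  obtain ⟨L, hL⟩ := hf e (chart_mem_atlas _ _) e' (chart_mem_atlas _ _) hx hx'
  have h1 : MDifferentiableAt (𝓡 2) 𝓘(ℝ, Plane) ((e' ∘ f ∘ e.symm) ∘ e) x :=
    (hL.hasFDerivAt.differentiableAt.mdifferentiableAt).comp x
      (mdifferentiableAt_atlas (chart_mem_atlas _ _) hx)
  have h2 : ((e' ∘ f ∘ e.symm) ∘ e) x = e' (f x) := by simp [e.left_inv hx]
  have h3 : MDifferentiableAt 𝓘(ℝ, Plane) (𝓡 2) e'.symm (((e' ∘ f ∘ e.symm) ∘ e) x) := by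
    rw [h2]
    exact mdifferentiableAt_atlas_symm (chart_mem_atlas _ _) (e'.map_source hx')
  refine (h3.comp x h1).congr_of_eventuallyEq ?_
  filter_upwards [hfc.eventually_mem (e'.open_source.mem_nhds hx'),
    e.open_source.mem_nhds hx] with u hu hu'
  simp [e.left_inv hu', e'.left_inv hu]

lemma cderiv_comp_tderiv (hf : MDifferentiableAt (𝓡 2) (𝓡 2) f x) (he : e ∈ atlas Plane X)
    (he' : e' ∈ atlas Plane X) (hx : x ∈ e.source) (hx' : f x ∈ e'.source) :
    (cderiv e' (f x)).comp (tderiv f x) = (fderiv ℝ (e' ∘ f ∘ e.symm) (e x)).comp (cderiv e x) := by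
  have h1 := (mdifferentiableAt_atlas he' hx').comp x hf
  ext1 v
  have h2 := mfderiv_eq_fderiv_chart he hx h1 v
  rw [mfderiv_comp x (mdifferentiableAt_atlas he' hx') hf] at h2
  exact h2

lemma tderiv_comp (hg : MDifferentiableAt (𝓡 2) (𝓡 2) g (f x))
    (hf : MDifferentiableAt (𝓡 2) (𝓡 2) f x) :
    tderiv (g ∘ f) x = (tderiv g (f x)).comp (tderiv f x) :=
  mfderiv_comp x hg hf

/-- Tangent vectors at `x` are read in the preferred chart at `x`, so the differential of another
chart is the derivative of a transition map. -/
lemma cderiv_chartAt (he : e ∈ atlas Plane X) (hx : x ∈ e.source) :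
    cderiv e x = fderiv ℝ (e ∘ (chartAt Plane x).symm) (chartAt Plane x x) := by
  unfold cderiv
  rw [(mdifferentiableAt_atlas he hx).mfderiv]
  simp only [mfld_simps, fderivWithin_univ]
  rfl

lemma det_comp_plane (A B : Plane →L[ℝ] Plane) :
    LinearMap.det ((A.comp B : Plane →L[ℝ] Plane) : Plane →ₗ[ℝ] Plane) =
      LinearMap.det (A : Plane →ₗ[ℝ] Plane) * LinearMap.det (B : Plane →ₗ[ℝ] Plane) := by
  rw [← LinearMap.det_comp]
  rfl

lemma cderiv_bijective (he : e ∈ atlas Plane X) (hx : x ∈ e.source) :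
    Function.Bijective (cderiv e x) :=
  (mdifferentiable_of_mem_atlas (I := 𝓡 2) he).mfderiv_bijective hx

/-- The value of a density in the preferred chart. -/
def SmoothDensity.at (ρ : SmoothDensity (univ : Set X)) (x : X) : ℝ :=
  ρ.toFun (chartAt Plane x) (chartAt Plane x x)

lemma SmoothDensity.at_pos (ρ : SmoothDensity (univ : Set X)) (x : X) : 0 < ρ.at x :=
  ρ.pos _ (chart_mem_atlas _ _) _ ⟨mem_chart_target Plane x, mem_univ _⟩

lemma SmoothDensity.at_eq (ρ : SmoothDensity (univ : Set X)) (he : e ∈ atlas Plane X)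
    (hx : x ∈ e.source) :
    ρ.at x = |LinearMap.det (cderiv e x : Plane →ₗ[ℝ] Plane)| * ρ.toFun e (e x) := by
  rw [cderiv_chartAt he hx]
  exact ρ.transform _ (chart_mem_atlas _ _) e he x ⟨⟨mem_univ _, mem_chart_source Plane x⟩, hx⟩

/-- The divergence of `W` with respect to `ρ` is `b`, in all charts. -/
def HasDivergence (ρ : SmoothDensity (univ : Set X)) (W : ∀ x : X, TangentSpace (𝓡 2) x)
    (b : X → ℝ) : Prop :=
  ∀ e ∈ atlas Plane X, ∀ x ∈ e.source, LinearMap.trace ℝ Plane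
    (fderiv ℝ (fun y => ρ.toFun e y • chartField W e y) (e x) : Plane →ₗ[ℝ] Plane) =
      b x * ρ.toFun e (e x)

lemma trace_fderiv_smul {r : Plane → ℝ} {F : Plane → Plane} {y : Plane}
    (hr : DifferentiableAt ℝ r y) (hF : DifferentiableAt ℝ F y) :
    LinearMap.trace ℝ Plane (fderiv ℝ (fun y => r y • F y) y : Plane →ₗ[ℝ] Plane) =
      r y * LinearMap.trace ℝ Plane (fderiv ℝ F y : Plane →ₗ[ℝ] Plane) + fderiv ℝ r y (F y) := by
  rw [fderiv_fun_smul hr hF]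
  have h1 : fderiv ℝ r y (F y) = F y 0 * fderiv ℝ r y (EuclideanSpace.single 0 1) +
      F y 1 * fderiv ℝ r y (EuclideanSpace.single 1 1) := by
    conv_lhs => rw [plane_eq (F y)]
    simp
  rw [trace_plane, trace_plane, h1]
  simp
  ring

lemma SmoothDensity.differentiableAt (ρ : SmoothDensity (univ : Set X)) (he : e ∈ atlas Plane X)
    {y : Plane} (hy : y ∈ e.target) : DifferentiableAt ℝ (ρ.toFun e) y := by
  have := ρ.smooth e he
  simp only [preimage_univ, inter_univ] at this
  exact (this.contDiffAt (e.open_target.mem_nhds hy)).differentiableAt (by simp)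

/-- Differentiability of `f`, which multiplies the density by `c`. -/
def HasJacobian (ρ : SmoothDensity (univ : Set X)) (f : X → X) (x : X) (c : ℝ) : Prop :=
  StrictDiffAt f x ∧ |LinearMap.det (tderiv f x : Plane →ₗ[ℝ] Plane)| * ρ.at (f x) = c * ρ.at x

lemma HasJacobian.comp {ρ : SmoothDensity (univ : Set X)} {c d : ℝ}
    (hg : HasJacobian ρ g (f x) d) (hf : HasJacobian ρ f x c) (hfc : ContinuousAt f x)
    (hgc : ContinuousAt g (f x)) : HasJacobian ρ (g ∘ f) x (d * c) := by
  refine ⟨hg.1.comp hf.1 hfc, ?_⟩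
  rw [tderiv_comp (hg.1.mdifferentiableAt hgc) (hf.1.mdifferentiableAt hfc), det_comp_plane,
    abs_mul]
  have h1 := hg.2
  have h2 := hf.2
  calc _ = |LinearMap.det (tderiv f x : Plane →ₗ[ℝ] Plane)| *
        (|LinearMap.det (tderiv g (f x) : Plane →ₗ[ℝ] Plane)| * ρ.at (g (f x))) := by
          simp only [Function.comp]; ring
    _ = d * (c * ρ.at x) := by rw [h1, ← h2]; ring
    _ = _ := by ring

/-- Liouville's formula, for small times. -/
lemma IsFlowOf.exists_hasJacobian_local (hφ : IsFlowOf φ W) (hW : SmoothFieldOn W univ)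
    (ρ : SmoothDensity (univ : Set X)) {b : X → ℝ} (hb : Continuous b) (hdiv : HasDivergence ρ W b)
    (x₀ : X) : ∃ δ > 0, ∃ U ∈ 𝓝 x₀, ∀ x ∈ U, ∀ t ∈ Icc (0 : ℝ) δ,
      HasJacobian ρ (φ t) x (Real.exp (orbInt φ b t x)) := by
  set e := chartAt Plane x₀
  have he : e ∈ atlas Plane X := chart_mem_atlas _ _
  have hx₀ : x₀ ∈ e.source := mem_chart_source Plane x₀
  obtain ⟨r₁, K, M, hB₁⟩ := exists_fieldBounds (contDiffAt_chartField hW he (e.map_source hx₀))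
  obtain ⟨r₂, hr₂, hr₂t⟩ := Metric.mem_nhds_iff.1 (e.open_target.mem_nhds (e.map_source hx₀))
  set r := min r₁ r₂
  have hr : 0 < r := lt_min hB₁.r_pos hr₂
  have hB : FieldBounds (chartField W e) (e x₀) r K M := hB₁.mono hr (min_le_left _ _)
  have hrt : ball (e x₀) r ⊆ e.target := (ball_subset_ball (min_le_right _ _)).trans hr₂t
  have hK := hB.K_pos
  have hN : e.source ∩ e ⁻¹' ball (e x₀) r ∈ 𝓝 x₀ := inter_mem (e.open_source.mem_nhds hx₀)
    ((e.continuousAt hx₀).preimage_mem_nhds (ball_mem_nhds _ hr))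
  have hcont : ContinuousAt (fun q : ℝ × X => φ q.1 q.2) (0, x₀) :=
    (φ.cont'.continuousAt (x := (0, x₀)))
  have hev : ∀ᶠ q in 𝓝 ((0 : ℝ), x₀), φ q.1 q.2 ∈ e.source ∩ e ⁻¹' ball (e x₀) r := by
    refine hcont.eventually_mem ?_
    simpa using hN
  rw [nhds_prod_eq] at hev
  obtain ⟨pa, hpa, pb, hpb, hab⟩ := Filter.eventually_prod_iff.1 hev
  obtain ⟨δ₁, hδ₁, hδ₁'⟩ := Metric.eventually_nhds_iff.1 hpa
  -- The first bound keeps trajectories in the ball with uniform bounds; the second is the smallness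
  -- required to solve the linearized equation.
  set δ := min (δ₁ / 2) (1 / (2 * K))
  have hδ : 0 < δ := lt_min (by positivity) (by positivity)
  have hδK : 2 * K * δ ≤ 1 := by
    calc 2 * K * δ ≤ 2 * K * (1 / (2 * K)) :=
          mul_le_mul_of_nonneg_left (min_le_right _ _) (by positivity)
      _ = 1 := by field_simp
  obtain ⟨U₀, hU₀, hU₀o, hxU₀⟩ := mem_nhds_iff.1 hpb
  have hstay : ∀ y ∈ U₀, ∀ s ∈ Icc (0 : ℝ) δ, φ s y ∈ e.source ∧ e (φ s y) ∈ ball (e x₀) r := by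
    intro y hy s hs
    refine hab (hδ₁' ?_) (hU₀ hy)
    rw [Real.dist_eq, sub_zero, abs_of_nonneg hs.1]
    have := hs.2.trans (min_le_left _ _)
    linarith
  set U : Set Plane := e.target ∩ e.symm ⁻¹' U₀
  have hUo : IsOpen U := e.isOpen_inter_preimage_symm hU₀o
  have hΦ : ∀ y ∈ U, ∀ s ∈ Icc 0 δ, e (φ s (e.symm y)) ∈ ball (e x₀) r ∧
      HasDerivAt (fun s => e (φ s (e.symm y))) (chartField W e (e (φ s (e.symm y)))) s :=
    fun y hy s hs => ⟨(hstay _ hy.2 s hs).2,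
      hφ.hasDerivAt_chart he s (e.symm y) (hstay _ hy.2 s hs).1⟩
  have h0 : ∀ y ∈ U, e (φ 0 (e.symm y)) = y := fun y hy => by
    rw [Flow.map_zero_apply, e.right_inv hy.1]
  refine ⟨δ, hδ, U₀ ∩ e.source, inter_mem (hU₀o.mem_nhds hxU₀) (e.open_source.mem_nhds hx₀), ?_⟩
  intro x hx t ht
  have hxU : e x ∈ U := ⟨e.map_source hx.2, by simpa [e.left_inv hx.2] using hx.1⟩
  obtain ⟨Y, hY0, hY⟩ := hB.exists_linearized (Φ := fun s y => e (φ s (e.symm y))) hΦ hδ.le hδK hxU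
  have hstrict : HasStrictFDerivAt (e ∘ φ t ∘ e.symm) (Y t) (e x) :=
    hB.hasStrictFDerivAt_flow (Φ := fun s y => e (φ s (e.symm y))) hUo hΦ h0 hxU hY0 hY ht
  have hφc : ContinuousAt (φ t) x := (φ.continuous_toFun t).continuousAt
  have hxt : φ t x ∈ e.source := (hstay x hx.1 t ht).1
  have hsd : StrictDiffAt (φ t) x := StrictDiffAt.of_exists hφc he he hx.2 hxt hstrict
  refine ⟨hsd, ?_⟩
  -- Determinant times density times `exp (-∫ b)` is constant: the trace of the linearized equation
  -- plus the derivative of the density along the field is the divergence `b` times the density.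
  have hconst : ∀ s ∈ Icc (0 : ℝ) δ, HasDerivWithinAt (fun s =>
      LinearMap.det (Y s : Plane →ₗ[ℝ] Plane) * ρ.toFun e (e (φ s x)) *
        Real.exp (-orbInt φ b s x)) 0 (Icc 0 δ) s := by
    intro s hs
    have hs' := hstay x hx.1 s hs
    have hY' := hY s hs
    simp only [e.left_inv hx.2] at hY'
    have h1 := hasDerivWithinAt_det hY'
    have h2 : HasDerivAt (fun s => ρ.toFun e (e (φ s x)))
        (fderiv ℝ (ρ.toFun e) (e (φ s x)) (chartField W e (e (φ s x)))) s :=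
      (ρ.differentiableAt he (e.map_source hs'.1)).hasFDerivAt.comp_hasDerivAt s
        (hφ.hasDerivAt_chart he s x hs'.1)
    have h3 := (hasDerivAt_orbInt (φ := φ) hb s x).neg.exp
    have h4 := hdiv e he (φ s x) hs'.1
    rw [trace_fderiv_smul (ρ.differentiableAt he (e.map_source hs'.1))
      ((contDiffAt_chartField hW he (e.map_source hs'.1)).differentiableAt (by simp))] at h4
    refine ((h1.mul h2.hasDerivWithinAt).mul h3.hasDerivWithinAt).congr_deriv ?_
    simp only [Pi.mul_apply, Pi.neg_apply]
    linear_combination (LinearMap.det (Y s : Plane →ₗ[ℝ] Plane) *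
      Real.exp (-orbInt φ b s x)) * h4
  have hc := constant_of_derivWithin_zero (fun s hs => (hconst s hs).differentiableWithinAt)
    (fun s hs => (hconst s (Ico_subset_Icc_self hs)).derivWithin
      (uniqueDiffOn_Icc hδ s (Ico_subset_Icc_self hs))) t ht
  simp only [hY0, Flow.map_zero_apply] at hc
  have hdet : LinearMap.det ((ContinuousLinearMap.id ℝ Plane : Plane →L[ℝ] Plane) :
      Plane →ₗ[ℝ] Plane) = 1 := LinearMap.det_id
  rw [hdet, show orbInt φ b 0 x = 0 by simp [orbInt], neg_zero, Real.exp_zero, one_mul, mul_one,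
    Real.exp_neg, ← div_eq_mul_inv, div_eq_iff (Real.exp_pos _).ne'] at hc
  have hcomp := cderiv_comp_tderiv (hsd.mdifferentiableAt hφc) he he hx.2 hxt
  rw [hstrict.hasFDerivAt.fderiv] at hcomp
  have hdets := congrArg (fun A : Plane →L[ℝ] Plane => |LinearMap.det (A : Plane →ₗ[ℝ] Plane)|)
    hcomp
  simp only [det_comp_plane, abs_mul] at hdets
  have hpos1 := ρ.pos e he _ ⟨e.map_source hx.2, mem_univ _⟩
  have hpos2 := ρ.pos e he _ ⟨e.map_source hxt, mem_univ _⟩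
  have hc' := congrArg abs hc
  rw [abs_mul, abs_mul, abs_of_pos hpos1, abs_of_pos hpos2, abs_of_pos (Real.exp_pos _)] at hc'
  rw [ρ.at_eq he hx.2, ρ.at_eq he hxt]
  linear_combination ρ.toFun e (e (φ t x)) * hdets +
    |LinearMap.det (cderiv e x : Plane →ₗ[ℝ] Plane)| * hc'

variable [CompactSpace X]

/-- Differentiability of the flow and Liouville's formula. -/
lemma IsFlowOf.hasJacobian (hφ : IsFlowOf φ W) (hW : SmoothFieldOn W univ)
    (ρ : SmoothDensity (univ : Set X)) {b : X → ℝ} (hb : Continuous b) (hdiv : HasDivergence ρ W b)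
    {t : ℝ} (ht : 0 ≤ t) (x : X) : HasJacobian ρ (φ t) x (Real.exp (orbInt φ b t x)) := by
  choose δ hδ U hU hJ using hφ.exists_hasJacobian_local hW ρ hb hdiv
  obtain ⟨s, hs⟩ := CompactSpace.elim_nhds_subcover U hU
  -- Compactness gives one time step `d` valid at all points; larger times are reached by
  -- composition, using that both the Jacobian and the exponential are multiplicative cocycles.
  obtain ⟨d, hd, hds⟩ : ∃ d > 0, ∀ y ∈ s, d ≤ δ y := by
    rcases s.eq_empty_or_nonempty with rfl | hne
    · exact ⟨1, one_pos, by simp⟩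
    · exact ⟨s.inf' hne δ, (Finset.lt_inf'_iff hne).2 fun y _ => hδ y,
        fun y hy => Finset.inf'_le _ hy⟩
  have hloc : ∀ x, ∀ t ∈ Icc 0 d, HasJacobian ρ (φ t) x (Real.exp (orbInt φ b t x)) := by
    intro x t ht
    have hx : x ∈ ⋃ y ∈ s, U y := by rw [hs]; trivial
    simp only [mem_iUnion] at hx
    obtain ⟨y, hy, hxy⟩ := hx
    exact hJ y x hxy t ⟨ht.1, ht.2.trans (hds y hy)⟩
  have hcomp : ∀ s t, (∀ x, HasJacobian ρ (φ s) x (Real.exp (orbInt φ b s x))) →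
      (∀ x, HasJacobian ρ (φ t) x (Real.exp (orbInt φ b t x))) →
      ∀ x, HasJacobian ρ (φ (s + t)) x (Real.exp (orbInt φ b (s + t) x)) := by
    intro s t h1 h2 x
    have h3 := (h2 (φ s x)).comp (h1 x) (φ.continuous_toFun s).continuousAt
      (φ.continuous_toFun t).continuousAt
    rw [← Real.exp_add] at h3
    convert h3 using 2
    · ext y
      rw [add_comm]
      exact Flow.map_add φ t s y
    · rw [add_comm s t, orbInt_add hb, add_comm]
  have hn : ∀ n : ℕ, ∀ u ∈ Icc (0 : ℝ) 1, ∀ x,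
      HasJacobian ρ (φ (n * (u * d))) x (Real.exp (orbInt φ b (n * (u * d)) x)) := by
    intro n u hu
    have hud : u * d ∈ Icc 0 d := ⟨mul_nonneg hu.1 hd.le, by nlinarith [hu.2]⟩
    induction n with
    | zero =>
      intro x
      have := hloc x 0 ⟨le_rfl, hd.le⟩
      simpa using this
    | succ n ih =>
      have := hcomp _ _ ih (fun x => hloc x _ hud)
      convert this using 3
      · push_cast; ring_nf
      · push_cast; ring_nf
  obtain ⟨n, hn'⟩ := exists_nat_gt (t / d)
  have hn0 : (0 : ℝ) < n := lt_of_le_of_lt (by positivity) hn'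
  have := hn n (t / d / n) ⟨by positivity, by rw [div_le_one hn0]; exact hn'.le⟩ x
  rwa [show (n : ℝ) * (t / d / n * d) = t by field_simp] at this

end FlowOnSurface

/-! ### Eigenvalues in the plane and a quadratic Lyapunov form. -/

section PlaneLinear

/-- The trace of an endomorphism of the plane. -/
abbrev ptr (L : Plane →L[ℝ] Plane) : ℝ := LinearMap.trace ℝ Plane (L : Plane →ₗ[ℝ] Plane)

/-- The determinant of an endomorphism of the plane. -/
abbrev pdet (L : Plane →L[ℝ] Plane) : ℝ := LinearMap.det (L : Plane →ₗ[ℝ] Plane)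

lemma mem_eigenvalues (L : Plane →L[ℝ] Plane) (μ : ℂ) :
    μ ∈ eigenvalues L ↔ μ ^ 2 - ptr L * μ + pdet L = 0 := by
  have h : LinearMap.charpoly (L : Plane →ₗ[ℝ] Plane) =
      Polynomial.X ^ 2 - Polynomial.C (ptr L) * Polynomial.X + Polynomial.C (pdet L) := by
    rw [← LinearMap.charpoly_toMatrix (L : Plane →ₗ[ℝ] Plane)
      (EuclideanSpace.basisFun (Fin 2) ℝ).toBasis, Matrix.charpoly_fin_two, LinearMap.det_toMatrix,
      ← LinearMap.trace_eq_matrix_trace]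
  unfold eigenvalues
  rw [mem_ofPred_eq, h]
  simp

lemma mem_eigenvalues_iff (L : Plane →L[ℝ] Plane) (x y : ℝ) :
    (⟨x, y⟩ : ℂ) ∈ eigenvalues L ↔
      x ^ 2 - y ^ 2 - ptr L * x + pdet L = 0 ∧ y * (2 * x - ptr L) = 0 := by
  rw [mem_eigenvalues, Complex.ext_iff]
  simp only [pow_two, Complex.add_re, Complex.sub_re, Complex.mul_re, Complex.ofReal_re,
    Complex.ofReal_im, Complex.add_im, Complex.sub_im, Complex.mul_im, Complex.zero_re,
    Complex.zero_im]
  constructor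
  · rintro ⟨h1, h2⟩
    exact ⟨by linarith, by linarith⟩
  · rintro ⟨h1, h2⟩
    exact ⟨by linarith, by linarith⟩

lemma exists_real_eigenvalues {L : Plane →L[ℝ] Plane} (hD : 0 ≤ ptr L ^ 2 - 4 * pdet L) :
    ∃ r s : ℝ, (⟨r, 0⟩ : ℂ) ∈ eigenvalues L ∧ (⟨s, 0⟩ : ℂ) ∈ eigenvalues L ∧ r + s = ptr L ∧
      r * s = pdet L := by
  have hs := Real.sq_sqrt hD
  refine ⟨(ptr L + √(ptr L ^ 2 - 4 * pdet L)) / 2, (ptr L - √(ptr L ^ 2 - 4 * pdet L)) / 2,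
    ?_, ?_, by ring, by nlinarith⟩
  · rw [mem_eigenvalues_iff]
    exact ⟨by nlinarith, by ring⟩
  · rw [mem_eigenvalues_iff]
    exact ⟨by nlinarith, by ring⟩

lemma exists_complex_eigenvalue {L : Plane →L[ℝ] Plane} (hD : ptr L ^ 2 - 4 * pdet L < 0) :
    ∃ y : ℝ, (⟨ptr L / 2, y⟩ : ℂ) ∈ eigenvalues L := by
  have hs := Real.sq_sqrt (show 0 ≤ -(ptr L ^ 2 - 4 * pdet L) by linarith)
  refine ⟨√(-(ptr L ^ 2 - 4 * pdet L)) / 2, ?_⟩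
  rw [mem_eigenvalues_iff]
  exact ⟨by nlinarith, by ring⟩

/-- Real eigenvalues have the trace as sum and the determinant as product, while non-real ones have
half the trace as real part; the sign of the discriminant separates the cases. -/
lemma eigenvalues_neg_iff (L : Plane →L[ℝ] Plane) :
    (∀ μ ∈ eigenvalues L, μ.re < 0) ↔ 0 < pdet L ∧ ptr L < 0 := by
  constructor
  · intro h
    rcases le_or_gt 0 (ptr L ^ 2 - 4 * pdet L) with hD | hD
    · obtain ⟨r, s, hr, hs, h1, h2⟩ := exists_real_eigenvalues hD
      have hr' : r < 0 := h _ hr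
      have hs' : s < 0 := h _ hs
      exact ⟨by rw [← h2]; exact mul_pos_of_neg_of_neg hr' hs', by linarith⟩
    · obtain ⟨y, hy⟩ := exists_complex_eigenvalue hD
      have : ptr L / 2 < 0 := h _ hy
      exact ⟨by nlinarith [sq_nonneg (ptr L)], by linarith⟩
  · rintro ⟨h1, h2⟩ ⟨x, y⟩ hμ
    rw [mem_eigenvalues_iff] at hμ
    simp only
    obtain ⟨h3, h4⟩ := hμ
    rcases mul_eq_zero.1 h4 with rfl | h4
    · by_contra! hx
      nlinarith [sq_nonneg x, mul_nonneg hx (neg_nonneg.2 h2.le)]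
    · linarith

lemma eigenvalues_pos_iff (L : Plane →L[ℝ] Plane) :
    (∀ μ ∈ eigenvalues L, 0 < μ.re) ↔ 0 < pdet L ∧ 0 < ptr L := by
  constructor
  · intro h
    rcases le_or_gt 0 (ptr L ^ 2 - 4 * pdet L) with hD | hD
    · obtain ⟨r, s, hr, hs, h1, h2⟩ := exists_real_eigenvalues hD
      have hr' : 0 < r := h _ hr
      have hs' : 0 < s := h _ hs
      exact ⟨by rw [← h2]; exact mul_pos hr' hs', by linarith⟩
    · obtain ⟨y, hy⟩ := exists_complex_eigenvalue hD
      have : 0 < ptr L / 2 := h _ hy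
      exact ⟨by nlinarith [sq_nonneg (ptr L)], by linarith⟩
  · rintro ⟨h1, h2⟩ ⟨x, y⟩ hμ
    rw [mem_eigenvalues_iff] at hμ
    simp only
    obtain ⟨h3, h4⟩ := hμ
    rcases mul_eq_zero.1 h4 with rfl | h4
    · by_contra! hx
      nlinarith [sq_nonneg x, mul_nonneg (neg_nonneg.2 hx) h2.le]
    · linarith

lemma eigenvalues_saddle_iff (L : Plane →L[ℝ] Plane) :
    ((∀ μ ∈ eigenvalues L, μ.re ≠ 0) ∧ (∃ μ ∈ eigenvalues L, μ.re < 0) ∧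
      ∃ μ ∈ eigenvalues L, 0 < μ.re) ↔ pdet L < 0 := by
  constructor
  · rintro ⟨-, ⟨⟨x, y⟩, h1, h2⟩, ⟨z, w⟩, h3, h4⟩
    rw [mem_eigenvalues_iff] at h1 h3
    simp only at h2 h4
    obtain ⟨h5, h6⟩ := h1
    obtain ⟨h7, h8⟩ := h3
    rcases mul_eq_zero.1 h6 with rfl | h6
    · rcases mul_eq_zero.1 h8 with rfl | h8
      · have : (z - x) * (z + x - ptr L) = 0 := by linear_combination h7 - h5
        rcases mul_eq_zero.1 this with h9 | h9
        · linarith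
        · have h10 : pdet L = x * z := by linear_combination h5 - x * h9
          rw [h10]
          exact mul_neg_of_neg_of_pos h2 h4
      · have h9 : ptr L = 2 * z := by linarith
        rw [h9] at h5 h7
        nlinarith [sq_nonneg w, sq_nonneg (x - z), mul_pos_of_neg_of_neg h2 (neg_neg_of_pos h4)]
    · have h9 : ptr L = 2 * x := by linarith
      rcases mul_eq_zero.1 h8 with rfl | h8
      · rw [h9] at h5 h7
        nlinarith [sq_nonneg y, sq_nonneg (x - z), mul_pos_of_neg_of_neg h2 (neg_neg_of_pos h4)]
      · linarith
  · intro h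
    have hD : 0 ≤ ptr L ^ 2 - 4 * pdet L := by nlinarith [sq_nonneg (ptr L)]
    obtain ⟨r, s, hr, hs, h1, h2⟩ := exists_real_eigenvalues hD
    have hne : ∀ μ ∈ eigenvalues L, μ.re ≠ 0 := by
      rintro ⟨x, y⟩ hμ (rfl : x = 0)
      rw [mem_eigenvalues_iff] at hμ
      nlinarith [hμ.1, sq_nonneg y]
    refine ⟨hne, ?_⟩
    rw [← h2] at h
    rcases mul_neg_iff.1 h with ⟨h3, h4⟩ | ⟨h3, h4⟩
    · exact ⟨⟨_, hs, h4⟩, ⟨_, hr, h3⟩⟩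
    · exact ⟨⟨_, hr, h3⟩, ⟨_, hs, h4⟩⟩

lemma pdet_ne_zero_of_hyperbolic {L : Plane →L[ℝ] Plane} (h : ∀ μ ∈ eigenvalues L, μ.re ≠ 0) :
    pdet L ≠ 0 ∧ (0 < pdet L → ptr L ≠ 0) := by
  constructor
  · intro h0
    refine h ⟨0, 0⟩ ?_ rfl
    rw [mem_eigenvalues_iff, h0]
    simp
  · intro h0 h1
    obtain ⟨y, hy⟩ := exists_complex_eigenvalue (L := L) (by rw [h1]; linarith)
    exact h _ hy (by simp [h1])

/-- The operator `tr - L` is the adjugate of `L`; it enters the form `lyap` because it turns `L v`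
back into a multiple of `v`. -/
lemma cayley_hamilton (L : Plane →L[ℝ] Plane) (v : Plane) :
    ptr L • L v - L (L v) = pdet L • v := by
  have h0 := apply_plane L v 0
  have h1 := apply_plane L v 1
  ext i
  simp only [PiLp.sub_apply, PiLp.smul_apply, smul_eq_mul, ptr, pdet, trace_plane, det_plane]
  rw [apply_plane L (L v) i]
  fin_cases i
  · simp only [Fin.zero_eta, h0, h1]; ring
  · simp only [Fin.mk_one, h0, h1]; ring

/-- A quadratic form that is monotone along the flow of a linear field. -/
def lyap (L : Plane →L[ℝ] Plane) (v : Plane) : ℝ :=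
  pdet L * ‖v‖ ^ 2 + ‖ptr L • v - L v‖ ^ 2

/-- The derivative of the form at `v` in the direction `u`. -/
def dlyap (L : Plane →L[ℝ] Plane) (v u : Plane) : ℝ :=
  pdet L * (2 * inner ℝ v u) + 2 * inner ℝ (ptr L • v - L v) (ptr L • u - L u)

lemma hasDerivAt_lyap (L : Plane →L[ℝ] Plane) {v : ℝ → Plane} {u : Plane} {t : ℝ}
    (hv : HasDerivAt v u t) : HasDerivAt (fun s => lyap L (v s)) (dlyap L (v t) u) t :=
  (hv.norm_sq.const_mul (pdet L)).add
    ((hv.const_smul (ptr L)).sub (L.hasFDerivAt.comp_hasDerivAt t hv)).norm_sq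

/-- The second square was chosen for this: its derivative contributes `2 det ⟨tr v - L v, v⟩`, which
cancels the term `⟨v, L v⟩` of the first. The result has the sign of `det * tr`, so the form is
strictly monotone at nodes, foci and saddles alike, without diagonalization. -/
lemma dlyap_self (L : Plane →L[ℝ] Plane) (v : Plane) :
    dlyap L v (L v) = 2 * (pdet L * ptr L) * ‖v‖ ^ 2 := by
  unfold dlyap
  rw [cayley_hamilton, inner_smul_right, inner_sub_left, inner_smul_left, real_inner_self_eq_norm_sq,
    real_inner_comm v (L v)]
  simp
  ring

lemma dlyap_add (L : Plane →L[ℝ] Plane) (v u w : Plane) :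
    dlyap L v (u + w) = dlyap L v u + dlyap L v w := by
  unfold dlyap
  rw [show ptr L • (u + w) - L (u + w) = (ptr L • u - L u) + (ptr L • w - L w) by
    rw [map_add, smul_add]; abel, inner_add_right, inner_add_right]
  ring

lemma exists_lyap_bounds (L : Plane →L[ℝ] Plane) : ∃ C > 0, ∀ v u : Plane,
    |dlyap L v u| ≤ C * (‖v‖ * ‖u‖) ∧ |lyap L v| ≤ C * ‖v‖ ^ 2 := by
  set A : Plane →L[ℝ] Plane := ptr L • ContinuousLinearMap.id ℝ Plane - L
  have hA : ∀ v, ptr L • v - L v = A v := fun v => by simp [A]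
  refine ⟨2 * (|pdet L| + ‖A‖ ^ 2) + 1, by positivity, fun v u => ⟨?_, ?_⟩⟩
  · unfold dlyap
    rw [hA, hA]
    have h1 := abs_real_inner_le_norm v u
    have h2 : |inner ℝ (A v) (A u)| ≤ ‖A‖ ^ 2 * (‖v‖ * ‖u‖) := by
      refine (abs_real_inner_le_norm _ _).trans ?_
      calc ‖A v‖ * ‖A u‖ ≤ (‖A‖ * ‖v‖) * (‖A‖ * ‖u‖) :=
            mul_le_mul (A.le_opNorm v) (A.le_opNorm u) (norm_nonneg _) (by positivity)
        _ = _ := by ring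
    refine (abs_add_le _ _).trans ?_
    rw [abs_mul, abs_mul, abs_mul, abs_two]
    have h3 := mul_le_mul_of_nonneg_left h1 (abs_nonneg (pdet L))
    have h4 : 0 ≤ ‖v‖ * ‖u‖ := by positivity
    nlinarith
  · unfold lyap
    rw [hA]
    have h2 : ‖A v‖ ^ 2 ≤ ‖A‖ ^ 2 * ‖v‖ ^ 2 := by
      rw [← mul_pow]
      exact pow_le_pow_left₀ (norm_nonneg _) (A.le_opNorm v) 2
    refine (abs_add_le _ _).trans ?_
    rw [abs_mul, abs_of_nonneg (sq_nonneg ‖v‖), abs_of_nonneg (sq_nonneg ‖A v‖)]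
    nlinarith [sq_nonneg ‖v‖, sq_nonneg ‖A‖, abs_nonneg (pdet L),
      mul_nonneg (abs_nonneg (pdet L)) (sq_nonneg ‖v‖), mul_nonneg (sq_nonneg ‖A‖) (sq_nonneg ‖v‖)]

/-- Near a singular point, the form is monotone along the flow of a field with non-degenerate
linear part. -/
lemma exists_dlyap_bound {F : Plane → Plane} {p : Plane} {L : Plane →L[ℝ] Plane}
    (hF : HasFDerivAt F L p) (h0 : F p = 0) {σ : ℝ} (hσ : |σ| = 1)
    (hL : 0 < σ * (pdet L * ptr L)) :
    ∃ c > 0, ∀ᶠ y in 𝓝 p, c * ‖y - p‖ ^ 2 ≤ σ * dlyap L (y - p) (F y) := by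
  obtain ⟨C, hC, hb⟩ := exists_lyap_bounds L
  -- The linear part provides twice this constant; the remainder of `F` near `p` is allowed to
  -- consume half of it.
  refine ⟨σ * (pdet L * ptr L), hL, ?_⟩
  filter_upwards [hF.isLittleO.def (show 0 < σ * (pdet L * ptr L) / C by positivity)] with y hy
  rw [h0, sub_zero] at hy
  have h1 : F y = L (y - p) + (F y - L (y - p)) := by abel
  rw [h1, dlyap_add, dlyap_self, mul_add]
  have h2 := (hb (y - p) (F y - L (y - p))).1
  have h3 : |σ * dlyap L (y - p) (F y - L (y - p))| ≤ σ * (pdet L * ptr L) * ‖y - p‖ ^ 2 := by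
    rw [abs_mul, hσ, one_mul]
    refine h2.trans ?_
    calc C * (‖y - p‖ * ‖F y - L (y - p)‖)
        ≤ C * (‖y - p‖ * (σ * (pdet L * ptr L) / C * ‖y - p‖)) := by gcongr
      _ = _ := by field_simp
  have h4 := neg_le_of_abs_le h3
  nlinarith

end PlaneLinear

/-! ### Isolation and asymptotic stability of singular points. -/

section FixedPoints

open Metric

variable {X : Type*} [TopologicalSpace X] [ChartedSpace Plane X] [IsManifold (𝓡 2) ∞ X]
  {W : ∀ x : X, TangentSpace (𝓡 2) x} {φ : Flow ℝ X} {x : X}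

lemma hasFDerivAt_chartField (hW : SmoothFieldOn W univ) (x : X) :
    HasFDerivAt (chartField W (chartAt Plane x)) (linearization W x) (chartAt Plane x x) :=
  ((contDiffAt_chartField hW (chart_mem_atlas _ _) (mem_chart_target Plane x)).differentiableAt
    (by simp)).hasFDerivAt

lemma chartField_chartAt_eq_zero (h : W x = 0) :
    chartField W (chartAt Plane x) (chartAt Plane x x) = 0 :=
  (chartField_eq_zero_iff (chart_mem_atlas _ _) (mem_chart_source Plane x)).2 h

lemma linearization_neg : linearization (-W) x = -linearization W x := by
  unfold linearization
  rw [chartField_neg]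
  exact fderiv_neg

lemma pdet_neg (L : Plane →L[ℝ] Plane) : pdet (-L) = pdet L := by
  unfold pdet
  rw [det_plane, det_plane]
  simp

/-- A singular point with `det ≠ 0 ≠ trace` is isolated as an invariant set. -/
lemma IsFlowOf.isolated (hφ : IsFlowOf φ W) (hW : SmoothFieldOn W univ) (hx : W x = 0)
    (hd : pdet (linearization W x) ≠ 0) (ht : ptr (linearization W x) ≠ 0) :
    ∃ N ∈ 𝓝 x, ∀ y, (∀ t, φ t y ∈ N) → y = x := by
  set e := chartAt Plane x
  set p := e x
  set L := linearization W x
  have he : e ∈ atlas Plane X := chart_mem_atlas _ _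
  have hxe : x ∈ e.source := mem_chart_source Plane x
  obtain ⟨σ, hσ, hσL⟩ : ∃ σ : ℝ, |σ| = 1 ∧ 0 < σ * (pdet L * ptr L) := by
    rcases lt_or_gt_of_ne (mul_ne_zero hd ht) with h | h
    · exact ⟨-1, by simp, by linarith⟩
    · exact ⟨1, by simp, by linarith⟩
  obtain ⟨c, hc, hcb⟩ := exists_dlyap_bound (hasFDerivAt_chartField hW x)
    (chartField_chartAt_eq_zero hx) hσ hσL
  obtain ⟨C, hC, hb⟩ := exists_lyap_bounds L
  have h1 : ∀ᶠ y in 𝓝 p, c * ‖y - p‖ ^ 2 ≤ σ * dlyap L (y - p) (chartField W e y) ∧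
      y ∈ ball p 1 := hcb.and (ball_mem_nhds p one_pos)
  refine ⟨_, inter_mem (e.open_source.mem_nhds hxe) ((e.continuousAt hxe).eventually h1), ?_⟩
  intro y hy
  set v : ℝ → Plane := fun t => e (φ t y) - p
  have hv : ∀ t, HasDerivAt v (chartField W e (e (φ t y))) t := fun t =>
    (hφ.hasDerivAt_chart he t y (hy t).1).sub_const p
  -- Along an orbit that stays near the singular point, `g` is bounded and satisfies `g' ≥ (c / C)
  -- |g|`.
  set g : ℝ → ℝ := fun t => σ * lyap L (v t)
  have hg : ∀ t, HasDerivAt g (σ * dlyap L (v t) (chartField W e (e (φ t y)))) t := fun t =>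
    (hasDerivAt_lyap L (hv t)).const_mul σ
  have hg1 : ∀ t, c * ‖v t‖ ^ 2 ≤ σ * dlyap L (v t) (chartField W e (e (φ t y))) :=
    fun t => (hy t).2.1
  have hgC : ∀ t, |g t| ≤ C * ‖v t‖ ^ 2 := fun t => by
    rw [abs_mul, hσ, one_mul]
    exact (hb (v t) 0).2
  have hv1 : ∀ t, ‖v t‖ ≤ 1 := fun t => by
    have := (hy t).2.2
    rw [mem_ball, dist_eq_norm] at this
    exact this.le
  have hgb : ∀ t, |g t| ≤ C := fun t => (hgC t).trans
    (mul_le_of_le_one_right hC.le (pow_le_one₀ (norm_nonneg _) (hv1 t)))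
  have hgd : ∀ t, c / C * |g t| ≤ deriv g t := fun t => by
    rw [(hg t).deriv]
    refine le_trans ?_ (hg1 t)
    calc c / C * |g t| ≤ c / C * (C * ‖v t‖ ^ 2) := by gcongr; exact hgC t
      _ = _ := by field_simp
  have hgdiff : Differentiable ℝ g := fun t => (hg t).differentiableAt
  have hmono : Monotone g := monotone_of_deriv_nonneg hgdiff fun t =>
    le_trans (by positivity) (hgd t)
  -- A positive value would force at least linear growth in the future and a negative one at least
  -- linear decrease in the past, against the bound `|g| ≤ C`. The time `2 * C / k + 1`, with `k`
  -- the slope, exceeds what the bound permits.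
  have hz : ∀ t, g t = 0 := by
    intro t₀
    by_contra hne
    have hk : 0 < c / C * |g t₀| := by positivity
    rcases lt_or_gt_of_ne hne with hneg | hpos
    · have key := (convex_Iic t₀).mul_sub_le_image_sub_of_le_deriv (f := g) (C := c / C * |g t₀|)
        hgdiff.continuous.continuousOn hgdiff.differentiableOn (fun t ht => by
          rw [interior_Iic] at ht
          refine le_trans ?_ (hgd t)
          have h2 := hmono (mem_Iio.1 ht).le
          rw [abs_of_neg hneg, abs_of_neg (lt_of_le_of_lt h2 hneg)]
          gcongr) (t₀ - 2 * C / (c / C * |g t₀|) - 1) (mem_Iic.2 (by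
            have : 0 ≤ 2 * C / (c / C * |g t₀|) := by positivity
            linarith)) t₀ (mem_Iic.2 le_rfl) (by
            have : 0 ≤ 2 * C / (c / C * |g t₀|) := by positivity
            linarith)
      have h3 : c / C * |g t₀| * (2 * C / (c / C * |g t₀|)) = 2 * C := by field_simp
      have h4 := abs_le.1 (hgb t₀)
      have h5 := abs_le.1 (hgb (t₀ - 2 * C / (c / C * |g t₀|) - 1))
      nlinarith
    · have key := (convex_Ici t₀).mul_sub_le_image_sub_of_le_deriv (f := g) (C := c / C * |g t₀|)
        hgdiff.continuous.continuousOn hgdiff.differentiableOn (fun t ht => by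
          rw [interior_Ici] at ht
          refine le_trans ?_ (hgd t)
          have h2 := hmono (mem_Ioi.1 ht).le
          rw [abs_of_pos hpos, abs_of_pos (lt_of_lt_of_le hpos h2)]
          gcongr) t₀ (mem_Ici.2 le_rfl) (t₀ + 2 * C / (c / C * |g t₀|) + 1) (mem_Ici.2 (by
            have : 0 ≤ 2 * C / (c / C * |g t₀|) := by positivity
            linarith)) (by
            have : 0 ≤ 2 * C / (c / C * |g t₀|) := by positivity
            linarith)
      have h3 : c / C * |g t₀| * (2 * C / (c / C * |g t₀|)) = 2 * C := by field_simp
      have h4 := abs_le.1 (hgb t₀)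
      have h5 := abs_le.1 (hgb (t₀ + 2 * C / (c / C * |g t₀|) + 1))
      nlinarith
  -- The form may be indefinite, so `g = 0` alone does not locate the orbit; its derivative does,
  -- since it dominates `c ‖v‖²`.
  have hd0 : deriv g 0 = 0 := by
    rw [show g = fun _ => (0 : ℝ) from funext hz]
    simp
  have h2 := hg1 0
  rw [← (hg 0).deriv, hd0] at h2
  have h3 : ‖v 0‖ = 0 := by
    by_contra h3
    have : 0 < c * ‖v 0‖ ^ 2 := by positivity
    linarith
  have h4 : e y = e x := by
    have := norm_eq_zero.1 h3
    simpa [v, sub_eq_zero] using this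
  have h5 := (hy 0).1
  rw [Flow.map_zero_apply] at h5
  exact e.injOn h5 hxe h4

variable [T2Space X]

/-- A singular point with `det > 0 > trace` is asymptotically stable. -/
lemma IsFlowOf.asympStable_singleton (hφ : IsFlowOf φ W) (hW : SmoothFieldOn W univ) (hx : W x = 0)
    (hd : 0 < pdet (linearization W x)) (ht : ptr (linearization W x) < 0) :
    AsympStable φ {x} := by
  set e := chartAt Plane x
  set p := e x
  set L := linearization W x
  have he : e ∈ atlas Plane X := chart_mem_atlas _ _
  have hxe : x ∈ e.source := mem_chart_source Plane x
  obtain ⟨c, hc, hcb⟩ := exists_dlyap_bound (hasFDerivAt_chartField hW x)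
    (chartField_chartAt_eq_zero hx) (σ := -1) (by simp) (by nlinarith)
  obtain ⟨C, hC, hb⟩ := exists_lyap_bounds L
  obtain ⟨r, hr, hrb⟩ := Metric.eventually_nhds_iff_ball.1
    (hcb.and (e.open_target.mem_nhds (e.map_source hxe)))
  -- As the determinant is positive, the form controls the distance to the singular point from
  -- above; small sublevel sets are small neighbourhoods.
  have hlow : ∀ v, pdet L * ‖v‖ ^ 2 ≤ lyap L v := fun v => by
    unfold lyap
    nlinarith [sq_nonneg ‖ptr L • v - L v‖]
  have hcl : Continuous (lyap L) := by
    unfold lyap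
    fun_prop
  -- closed neighbourhoods
  have hcomp : ∀ s q, s < r → IsClosed (e.symm '' (closedBall p s ∩ {u | lyap L (u - p) ≤ q})) := by
    intro s q hs
    refine IsCompact.isClosed (IsCompact.image_of_continuousOn ?_ ?_)
    · refine (isCompact_closedBall p s).inter_right (isClosed_le ?_ continuous_const)
      exact hcl.comp (continuous_id.sub continuous_const)
    · exact e.continuousOn_symm.mono fun u hu =>
        (hrb u (closedBall_subset_ball hs hu.1)).2
  -- As long as the orbit stays in the sublevel set the form decays at the rate `c / C`; a first
  -- exit time then shows that it never leaves.
  have key : ∀ s, 0 < s → s < r → ∀ y ∈ e.source, e y ∈ ball p s →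
      lyap L (e y - p) < pdet L * s ^ 2 → ∀ t, 0 ≤ t →
      φ t y ∈ e.source ∧ e (φ t y) ∈ ball p s ∧ lyap L (e (φ t y) - p) ≤
        lyap L (e y - p) * Real.exp (-(c / C * t)) := by
    intro s hs hsr y hye hys hyq
    set U : Set X := e.source ∩ e ⁻¹' (ball p s ∩ {u | lyap L (u - p) < pdet L * s ^ 2})
    have hU : IsOpen U := e.isOpen_inter_preimage (isOpen_ball.inter (isOpen_lt
      (hcl.comp (continuous_id.sub continuous_const)) continuous_const))
    have hdecay : ∀ t, 0 ≤ t → (∀ u, 0 ≤ u → u < t → φ u y ∈ U) → φ t y ∈ e.source →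
        lyap L (e (φ t y) - p) ≤ lyap L (e y - p) * Real.exp (-(c / C * t)) := by
      intro t ht0 hut hte
      have hte' : ∀ u ∈ Icc 0 t, φ u y ∈ e.source := by
        intro u hu
        rcases hu.2.lt_or_eq with h | rfl
        · exact (hut u hu.1 h).1
        · exact hte
      have hd' : ∀ u ∈ Icc 0 t, HasDerivAt (fun u => lyap L (e (φ u y) - p) * Real.exp (c / C * u))
          (dlyap L (e (φ u y) - p) (chartField W e (e (φ u y))) * Real.exp (c / C * u) +
            lyap L (e (φ u y) - p) * (Real.exp (c / C * u) * (c / C))) u := by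
        intro u hu
        have h1 := hasDerivAt_lyap L ((hφ.hasDerivAt_chart he u y (hte' u hu)).sub_const p)
        have h2 : HasDerivAt (fun u => Real.exp (c / C * u)) (Real.exp (c / C * u) * (c / C)) u := by
          simpa using ((hasDerivAt_id u).const_mul (c / C)).exp
        exact h1.mul h2
      have hanti := antitoneOn_of_deriv_nonpos (convex_Icc 0 t)
        (fun u hu => (hd' u hu).continuousAt.continuousWithinAt)
        (fun u hu => (hd' u (interior_subset hu)).differentiableAt.differentiableWithinAt)
        (fun u hu => by
          rw [(hd' u (interior_subset hu)).deriv]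
          rw [interior_Icc] at hu
          have h1 := hut u hu.1.le hu.2
          have h2 := (hrb _ (ball_subset_ball hsr.le h1.2.1)).1
          have h3 := (hb (e (φ u y) - p) 0).2
          have h4 : lyap L (e (φ u y) - p) * (c / C) ≤ c * ‖e (φ u y) - p‖ ^ 2 := by
            calc lyap L (e (φ u y) - p) * (c / C) ≤ (C * ‖e (φ u y) - p‖ ^ 2) * (c / C) :=
                  mul_le_mul_of_nonneg_right ((le_abs_self _).trans h3) (by positivity)
              _ = _ := by field_simp
          have h5 := Real.exp_pos (c / C * u)
          have h6 : dlyap L (e (φ u y) - p) (chartField W e (e (φ u y))) +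
            lyap L (e (φ u y) - p) * (c / C) ≤ 0 := by linarith
          nlinarith) (left_mem_Icc.2 ht0) (right_mem_Icc.2 ht0) ht0
      simp only [Flow.map_zero_apply, mul_zero, Real.exp_zero, mul_one] at hanti
      rw [Real.exp_neg, ← div_eq_mul_inv, le_div_iff₀ (Real.exp_pos _)]
      exact hanti
    have hstay : ∀ t, 0 ≤ t → φ t y ∈ U := by
      by_contra! hcon
      obtain ⟨t₁, ht₁, ht₁U⟩ := hcon
      set S : Set ℝ := Ici 0 ∩ (fun t => φ t y) ⁻¹' Uᶜ
      have hS : IsClosed S := isClosed_Ici.inter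
        (hU.isClosed_compl.preimage (φ.continuous continuous_id continuous_const))
      have hSb : BddBelow S := ⟨0, fun t ht => ht.1⟩
      have hmem : sInf S ∈ S := hS.csInf_mem ⟨t₁, ht₁, ht₁U⟩ hSb
      set τ := sInf S
      have hbef : ∀ u, 0 ≤ u → u < τ → φ u y ∈ U := fun u hu0 hu => by
        by_contra h
        exact absurd (csInf_le hSb ⟨hu0, h⟩) (not_le.2 hu)
      have hyU : y ∈ U := ⟨hye, hys, hyq⟩
      have hτ0 : 0 < τ := by
        rcases (show (0 : ℝ) ≤ τ from hmem.1).lt_or_eq with h | h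
        · exact h
        · exact absurd (by simpa [← h] using hyU) hmem.2
      -- The form does not exceed its initial value before the exit, which confines the orbit to a
      -- ball of strictly smaller radius. The limit at the exit time then lies in a compact part of
      -- the open set `U`, including inside the chart.
      obtain ⟨s', hs'0, hs's, hqs⟩ : ∃ s', 0 ≤ s' ∧ s' < s ∧
          ∀ v : Plane, lyap L v ≤ lyap L (e y - p) → ‖v‖ ≤ s' := by
        have hq0 : 0 ≤ lyap L (e y - p) := le_trans (by positivity) (hlow _)
        refine ⟨√(lyap L (e y - p) / pdet L), Real.sqrt_nonneg _, ?_, fun v hv => ?_⟩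
        · rw [Real.sqrt_lt' hs, div_lt_iff₀ hd]
          linarith
        · refine Real.le_sqrt_of_sq_le ?_
          rw [le_div_iff₀ hd]
          linarith [hlow v]
      have hle : ∀ u, 0 ≤ u → u < τ → φ u y ∈ e.symm '' (closedBall p s' ∩
          {w | lyap L (w - p) ≤ lyap L (e y - p)}) := by
        intro u hu0 hu
        have h1 := hdecay u hu0 (fun w hw0 hw => hbef w hw0 (hw.trans hu)) (hbef u hu0 hu).1
        have h2 : lyap L (e (φ u y) - p) ≤ lyap L (e y - p) := by
          refine h1.trans (mul_le_of_le_one_right (le_trans (by positivity) (hlow _)) ?_)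
          rw [Real.exp_le_one_iff]
          have : 0 ≤ c / C * u := by positivity
          linarith
        refine ⟨e (φ u y), ⟨?_, h2⟩, e.left_inv (hbef u hu0 hu).1⟩
        rw [mem_closedBall, dist_eq_norm]
        exact hqs _ h2
      have hlim : φ τ y ∈ e.symm '' (closedBall p s' ∩
          {w | lyap L (w - p) ≤ lyap L (e y - p)}) := by
        have h1 : Tendsto (fun t => φ t y) (𝓝[<] τ) (𝓝 (φ τ y)) :=
          ((φ.continuous continuous_id continuous_const).tendsto τ).mono_left nhdsWithin_le_nhds
        refine (hcomp s' _ (hs's.trans hsr)).mem_of_tendsto h1 ?_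
        filter_upwards [Ioo_mem_nhdsLT hτ0] with u hu
        exact hle u hu.1.le hu.2
      obtain ⟨w, ⟨hw1, hw2⟩, hw3⟩ := hlim
      have hwt : w ∈ e.target := (hrb w (closedBall_subset_ball (hs's.trans hsr) hw1)).2
      refine hmem.2 ?_
      show φ τ y ∈ U
      rw [← hw3]
      refine ⟨e.map_target hwt, ?_⟩
      rw [mem_preimage, e.right_inv hwt]
      exact ⟨closedBall_subset_ball hs's hw1, lt_of_le_of_lt hw2 hyq⟩
    intro t ht0
    exact ⟨(hstay t ht0).1, (hstay t ht0).2.1, hdecay t ht0 (fun u hu _ => hstay u hu) (hstay t ht0).1⟩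
  have hopen : ∀ s, 0 < s → ∃ U : Set X, IsOpen U ∧ {x} ⊆ U ∧ ∀ y ∈ U, y ∈ e.source ∧
      e y ∈ ball p s ∧ lyap L (e y - p) < pdet L * s ^ 2 := by
    intro s hs
    refine ⟨e.source ∩ e ⁻¹' (ball p s ∩ {u | lyap L (u - p) < pdet L * s ^ 2}),
      e.isOpen_inter_preimage (isOpen_ball.inter (isOpen_lt
      (hcl.comp (continuous_id.sub continuous_const)) continuous_const)), ?_, fun y hy => hy⟩
    rw [singleton_subset_iff]
    refine ⟨hxe, mem_ball_self hs, ?_⟩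
    have : lyap L (e x - p) = 0 := by simp [p, lyap]
    rw [mem_ofPred_eq, this]
    positivity
  constructor
  · intro V hV hxV
    have h1 : ∀ᶠ u in 𝓝 p, e.symm u ∈ V :=
      eventually_chart hxe (hV.mem_nhds (hxV (mem_singleton x)))
    obtain ⟨s, hs, hsV⟩ := Metric.eventually_nhds_iff_ball.1 h1
    have hs' : 0 < min s (r / 2) := lt_min hs (by positivity)
    obtain ⟨U, hU, hxU, hUs⟩ := hopen _ hs'
    refine ⟨U, hU, hxU, fun y hy t ht0 => ?_⟩
    obtain ⟨h2, h3, h4⟩ := hUs y hy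
    obtain ⟨h5, h6, -⟩ := key _ hs' (lt_of_le_of_lt (min_le_right _ _) (by linarith)) y h2 h3 h4 t ht0
    have := hsV _ (ball_subset_ball (min_le_left _ _) h6)
    rwa [e.left_inv h5] at this
  · obtain ⟨U, hU, hxU, hUs⟩ := hopen (r / 2) (by positivity)
    refine ⟨U, hU, hxU, fun y hy => ?_⟩
    obtain ⟨h2, h3, h4⟩ := hUs y hy
    have hk := key (r / 2) (by positivity) (by linarith) y h2 h3 h4
    unfold ToFut
    rw [nhdsSet_singleton]
    have hlim : Tendsto (fun t => lyap L (e y - p) * Real.exp (-(c / C * t)) / pdet L) atTop (𝓝 0) := by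
      have h5 : Tendsto (fun t => Real.exp (-(c / C * t))) atTop (𝓝 0) :=
        Real.tendsto_exp_neg_atTop_nhds_zero.comp
          (tendsto_id.const_mul_atTop (show 0 < c / C by positivity))
      simpa using (h5.const_mul (lyap L (e y - p))).div_const (pdet L)
    have hsq : Tendsto (fun t => ‖e (φ t y) - p‖ ^ 2) atTop (𝓝 0) := by
      refine squeeze_zero' (Eventually.of_forall fun t => sq_nonneg _) ?_ hlim
      filter_upwards [eventually_ge_atTop 0] with t ht0
      rw [le_div_iff₀ hd]
      have := hlow (e (φ t y) - p)
      linarith [(hk t ht0).2.2]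
    have hn : Tendsto (fun t => ‖e (φ t y) - p‖) atTop (𝓝 0) := by
      have := hsq.sqrt
      simpa [Real.sqrt_sq] using this
    have he' : Tendsto (fun t => e (φ t y)) atTop (𝓝 p) := tendsto_iff_norm_sub_tendsto_zero.2 hn
    refine ((e.tendsto_symm hxe).comp he').congr' ?_
    filter_upwards [eventually_ge_atTop 0] with t ht0
    exact e.left_inv (hk t ht0).1

end FixedPoints

/-! ### Asymptotic stability of attracting cycles. -/

section Cycles

open Metric

/-- One step of the return map near a periodic orbit with transverse contraction. -/
lemma exists_contraction_step {E : Type*} [NormedAddCommGroup E] [NormedSpace ℝ E] {P : E → E}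
    {L : E →L[ℝ] E} {γ : ℝ → E} {p w : E} {m : ℝ} (hP : HasStrictFDerivAt P L p)
    (hγ : HasStrictDerivAt γ w 0) (hγ0 : γ 0 = p) (hw : w ≠ 0)
    (hL : ∀ v, ∃ c : ℝ, L v = m • v + c • w) (hm : |m| < 1) (hinv : ∀ᶠ s in 𝓝 0, P (γ s) = γ s)
    {O : Set E} (hO : O ∈ 𝓝 p) :
    ∃ κ C r : ℝ, 0 ≤ κ ∧ κ < 1 ∧ 0 < C ∧ 0 < r ∧ ∀ y s, |s| ≤ r → ‖y - γ s‖ ≤ r →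
      y ∈ O ∧ ∃ s', |s' - s| ≤ C * ‖y - γ s‖ ∧ ‖P y - γ s'‖ ≤ κ * ‖y - γ s‖ := by
  choose c hc using hL
  have hwn : 0 < ‖w‖ := norm_pos_iff.2 hw
  set C := (‖L‖ + |m|) / ‖w‖ + 1
  have hC : 0 < C := by positivity
  have hcC : ∀ v, |c v| ≤ C * ‖v‖ := by
    intro v
    have h1 : c v • w = L v - m • v := by rw [hc v]; abel
    have h2 : |c v| * ‖w‖ ≤ (‖L‖ + |m|) * ‖v‖ := by
      rw [← Real.norm_eq_abs, ← norm_smul, h1, add_mul]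
      refine (norm_sub_le _ _).trans (add_le_add (L.le_opNorm v) ?_)
      rw [norm_smul, Real.norm_eq_abs]
    rw [← le_div_iff₀ hwn] at h2
    refine h2.trans ?_
    rw [mul_div_right_comm]
    gcongr
    exact (lt_add_one _).le
  -- Chosen so that `|m| + ε * (1 + C)` is the midpoint `(1 + |m|) / 2` between `|m|` and `1`, which
  -- is the contraction ratio.
  set ε := (1 - |m|) / (2 * (1 + C))
  have hε : 0 < ε := div_pos (by linarith) (by positivity)
  have hPε := hP.isLittleO.def hε
  have hγε := hγ.isLittleO.def hε
  rw [nhds_prod_eq] at hPε hγε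
  obtain ⟨A, hA, hA'⟩ := (Filter.eventually_prod_self_iff
    (r := fun y z => ‖P y - P z - L (y - z)‖ ≤ ε * ‖y - z‖)).1 hPε
  obtain ⟨B, hB, hB'⟩ := (Filter.eventually_prod_self_iff
    (r := fun y z => ‖γ y - γ z - (y - z) • w‖ ≤ ε * ‖y - z‖)).1 hγε
  obtain ⟨r₁, hr₁, hr₁A⟩ := Metric.mem_nhds_iff.1 (inter_mem hA hO)
  obtain ⟨r₂, hr₂, hr₂B⟩ := Metric.mem_nhds_iff.1 (inter_mem hB hinv)
  have hγc : ContinuousAt γ 0 := hγ.hasDerivAt.continuousAt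
  obtain ⟨r₃, hr₃, hr₃'⟩ := Metric.continuousAt_iff.1 hγc (r₁ / 2) (by positivity)
  obtain ⟨r, hr, h1, h2, h3⟩ : ∃ r : ℝ, 0 < r ∧ r < r₁ / 2 ∧ r + C * r < r₂ ∧ r < r₃ := by
    refine ⟨min (r₁ / 2) (min (r₂ / (1 + C)) r₃) / 2, by positivity, ?_, ?_, ?_⟩
    · have := min_le_left (r₁ / 2) (min (r₂ / (1 + C)) r₃)
      linarith
    · have h1 := (min_le_right (r₁ / 2) (min (r₂ / (1 + C)) r₃)).trans (min_le_left _ _)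
      have h2 : min (r₁ / 2) (min (r₂ / (1 + C)) r₃) / 2 < r₂ / (1 + C) := by
        have : 0 < r₂ / (1 + C) := by positivity
        linarith
      rw [lt_div_iff₀ (by positivity)] at h2
      linarith
    · have h1 := (min_le_right (r₁ / 2) (min (r₂ / (1 + C)) r₃)).trans (min_le_right _ _)
      linarith
  refine ⟨(1 + |m|) / 2, C, r, by positivity, by linarith, hC, hr, fun y s hs hy => ?_⟩
  have hγs : dist (γ s) p < r₁ / 2 := by
    have := hr₃' (x := s) (by rw [Real.dist_eq, sub_zero]; exact lt_of_le_of_lt hs h3)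
    rwa [hγ0] at this
  have hyp : dist y p < r₁ := by
    have h4 := dist_triangle y (γ s) p
    have h5 : dist y (γ s) ≤ r := by rwa [dist_eq_norm]
    linarith
  obtain ⟨hyA, hyO⟩ := hr₁A (mem_ball.2 hyp)
  have hsA : γ s ∈ A := (hr₁A (mem_ball.2 (by linarith))).1
  set v := y - γ s
  have hcv := hcC v
  have hsc : |s + c v| < r₂ := by
    refine (abs_add_le _ _).trans_lt ?_
    have : C * ‖v‖ ≤ C * r := by gcongr
    linarith
  have hsr : |s| < r₂ := by
    have : 0 < C * r := by positivity
    linarith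
  have hs1 := hr₂B (show s ∈ ball 0 r₂ by rwa [mem_ball, Real.dist_eq, sub_zero])
  have hs2 := hr₂B (show s + c v ∈ ball 0 r₂ by rwa [mem_ball, Real.dist_eq, sub_zero])
  -- Moving the reference point along the orbit by `c v` absorbs the component of `L v` along the
  -- field; only the transverse factor `m` remains. No cross-section or return time is needed.
  refine ⟨hyO, s + c v, by rwa [add_sub_cancel_left], ?_⟩
  have e1 := hA' _ hyA _ hsA
  have e2 := hB' _ hs2.1 _ hs1.1
  simp only [add_sub_cancel_left] at e2
  rw [show P (γ s) = γ s from hs1.2] at e1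
  have e3 : P y - γ (s + c v) = m • v + ((P y - γ s - L v) - (γ (s + c v) - γ s - c v • w)) := by
    rw [hc v]
    abel
  have e4 : ‖γ (s + c v) - γ s - c v • w‖ ≤ ε * (C * ‖v‖) := by
    refine e2.trans ?_
    rw [Real.norm_eq_abs]
    gcongr
  rw [e3]
  calc _ ≤ ‖m • v‖ + (‖P y - γ s - L v‖ + ‖γ (s + c v) - γ s - c v • w‖) :=
        (norm_add_le _ _).trans (add_le_add_right (norm_sub_le _ _) _)
    _ ≤ |m| * ‖v‖ + (ε * ‖v‖ + ε * (C * ‖v‖)) := by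
        rw [norm_smul, Real.norm_eq_abs]
        gcongr
    _ = (|m| + ε * (1 + C)) * ‖v‖ := by ring
    _ = (1 + |m|) / 2 * ‖v‖ := by
        congr 1
        simp only [ε]
        field_simp
        ring

variable {X : Type*} [TopologicalSpace X]

lemma exists_reduce_period {φ : Flow ℝ X} {x : X} {T : ℝ} (hT : 0 < T) (hx : φ T x = x) (t : ℝ) :
    ∃ s ∈ Icc 0 T, φ s x = φ t x := by
  have hn : ∀ n : ℤ, φ (n * T) x = x := by
    have h1 : ∀ n : ℕ, φ (n * T) x = x := by
      intro n
      induction n with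
      | zero => simp
      | succ n ih =>
        push_cast
        rw [add_mul, one_mul, Flow.map_add, hx, ih]
    rintro (n | n)
    · simpa using h1 n
    · have h2 := h1 (n + 1)
      calc φ (((Int.negSucc n : ℤ) : ℝ) * T) x = φ (-(((n + 1 : ℕ) : ℝ) * T)) x := by
            congr 1; push_cast; ring_nf
        _ = x := by
            conv_lhs => rw [← h2]
            exact flow_neg_apply _ _ _
  refine ⟨t - ⌊t / T⌋ * T, ⟨?_, ?_⟩, ?_⟩
  · have := Int.floor_le (t / T)
    rw [le_div_iff₀ hT] at this
    linarith
  · have := Int.lt_floor_add_one (t / T)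
    rw [div_lt_iff₀ hT] at this
    linarith
  · conv_rhs => rw [← sub_add_cancel t (⌊t / T⌋ * T), Flow.map_add, hn]

lemma isCompact_orb_of_periodic {φ : Flow ℝ X} {x : X} {T : ℝ} (hT : 0 < T) (hx : φ T x = x) :
    IsCompact (orb φ x) := by
  have : orb φ x = (fun t => φ t x) '' Icc 0 T := by
    ext y
    constructor
    · rintro ⟨t, rfl⟩
      obtain ⟨s, hs, h⟩ := exists_reduce_period hT hx t
      exact ⟨s, hs, h⟩
    · rintro ⟨s, -, h⟩
      exact ⟨s, h⟩
  rw [this]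
  exact isCompact_Icc.image (φ.continuous continuous_id continuous_const)

lemma isOpen_stay (φ : Flow ℝ X) {V : Set X} (hV : IsOpen V) (T : ℝ) :
    IsOpen {z | ∀ t ∈ Icc (0 : ℝ) T, φ t z ∈ V} := by
  rw [isOpen_iff_mem_nhds]
  intro z hz
  exact isCompact_Icc.eventually_forall_of_forall_eventually
    (K := Icc (0 : ℝ) T) (x₀ := z) (P := fun y t => φ t y ∈ V) fun t ht =>
      (φ.continuous continuous_snd continuous_fst).continuousAt.eventually_mem
        (hV.mem_nhds (hz t ht))

variable [ChartedSpace Plane X] [IsManifold (𝓡 2) ∞ X]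
  {W : ∀ x : X, TangentSpace (𝓡 2) x} {φ : Flow ℝ X} {x : X}

/-- The value of a vector field, as an element of the model plane. -/
def fieldAt (W : ∀ x : X, TangentSpace (𝓡 2) x) (x : X) : Plane := W x

/-- Near a periodic orbit with transverse contraction, the iterates of the time `T` map track the
orbit. -/
lemma IsFlowOf.exists_tracking (hφ : IsFlowOf φ W) (hW : SmoothFieldOn W univ) {T m : ℝ}
    (hxT : φ T x = x) (hWx : W x ≠ 0) (hsd : StrictDiffAt (φ T) x) (hm : |m| < 1)
    (hmul : ∀ v : Plane, ∃ c : ℝ, tderiv (φ T) x v = m • v + c • fieldAt W x)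
    {O : Set X} (hO : O ∈ 𝓝 x) :
    ∃ Q ∈ 𝓝 x, ∃ κ r : ℝ, 0 ≤ κ ∧ κ < 1 ∧ (∀ s, |s| ≤ r → φ s x ∈ (chartAt Plane x).source) ∧
      ∀ y ∈ Q, ∀ n : ℕ, φ (n * T) y ∈ (chartAt Plane x).source ∩ O ∧ ∃ s, |s| ≤ r ∧
        ‖chartAt Plane x (φ (n * T) y) - chartAt Plane x (φ s x)‖ ≤ κ ^ n * r := by
  set e := chartAt Plane x
  have he : e ∈ atlas Plane X := chart_mem_atlas _ _
  have hxe : x ∈ e.source := mem_chart_source Plane x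
  have hxTe : φ T x ∈ e.source := by rwa [hxT]
  have hφc : Continuous (φ T) := φ.continuous_toFun T
  obtain ⟨L, hL⟩ := hsd e he e he hxe hxTe
  have hcomp := cderiv_comp_tderiv (hsd.mdifferentiableAt hφc.continuousAt) he he hxe hxTe
  rw [hL.hasFDerivAt.fderiv] at hcomp
  have hcc : cderiv e (φ T x) = cderiv e x := by
    rw [hxT]
  rw [hcc] at hcomp
  have hwe : cderiv e x (fieldAt W x) = chartField W e (e x) := (chartField_apply hxe).symm
  have hLm : ∀ v, ∃ c : ℝ, L v = m • v + c • chartField W e (e x) := by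
    intro v
    obtain ⟨u, rfl⟩ := (cderiv_bijective he hxe).2 v
    obtain ⟨c, hc⟩ := hmul u
    refine ⟨c, ?_⟩
    rw [← ContinuousLinearMap.comp_apply, ← hcomp, ContinuousLinearMap.comp_apply, hc, map_add,
      map_smul, map_smul, hwe]
  have hcont : Continuous fun s => φ s x := φ.continuous continuous_id continuous_const
  have hs0 : ∀ᶠ s in 𝓝 (0 : ℝ), φ s x ∈ e.source :=
    hcont.continuousAt.eventually_mem (e.open_source.mem_nhds (by simpa using hxe))
  have hγ0 : e (φ 0 x) = e x := by simp
  have hγ : HasStrictDerivAt (fun s => e (φ s x)) (chartField W e (e x)) 0 := by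
    have h1 := hasStrictDerivAt_of_hasDerivAt_of_continuousAt (x := (0 : ℝ))
      (f := fun s => e (φ s x)) (f' := fun s => chartField W e (e (φ s x)))
      (hs0.mono fun s hs => hφ.hasDerivAt_chart he s x hs) (by
        have h2 : ContinuousAt (chartField W e) (e (φ 0 x)) := by
          rw [hγ0]
          exact (contDiffAt_chartField hW he (e.map_source hxe)).continuousAt
        have h3 : ContinuousAt (fun s => e (φ s x)) 0 :=
          ContinuousAt.comp (f := fun s => φ s x) (g := e) (e.continuousAt (by simpa using hxe))
            hcont.continuousAt
        exact ContinuousAt.comp (f := fun s => e (φ s x)) h2 h3)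
    rwa [hγ0] at h1
  have hinv : ∀ᶠ s in 𝓝 (0 : ℝ), (e ∘ φ T ∘ e.symm) (e (φ s x)) = e (φ s x) := by
    filter_upwards [hs0] with s hs
    simp only [Function.comp, e.left_inv hs]
    rw [← Flow.map_add, add_comm, Flow.map_add, hxT]
  have hO' : e.symm ⁻¹' (O ∩ φ T ⁻¹' e.source) ∈ 𝓝 (e x) :=
    eventually_chart hxe (inter_mem hO (hφc.continuousAt.preimage_mem_nhds
      (e.open_source.mem_nhds hxTe)))
  obtain ⟨κ, C, r₁, hκ, hκ1, hC, hr₁, hstep⟩ := exists_contraction_step hL hγ hγ0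
    (fun h => hWx ((chartField_eq_zero_iff he hxe).1 h)) hLm hm hinv hO'
  obtain ⟨r₂, hr₂, hr₂s⟩ := Metric.eventually_nhds_iff.1 hs0
  set r := min r₁ (r₂ / 2)
  have hr : 0 < r := lt_min hr₁ (by positivity)
  have hrs : ∀ s, |s| ≤ r → φ s x ∈ e.source := fun s hs => hr₂s (by
    rw [Real.dist_eq, sub_zero]
    have := hs.trans (min_le_right _ _)
    linarith)
  have hκ' : 0 < 1 - κ := by linarith
  -- The reference times drift by at most `C * κ ^ k * r₀` at step `k`; this radius keeps the sum of
  -- the geometric series below `r`.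
  set r₀ := min r ((1 - κ) * r / C)
  have hr₀ : 0 < r₀ := lt_min hr (by positivity)
  have hr₀r : C * r₀ ≤ (1 - κ) * r := by
    have := min_le_right r ((1 - κ) * r / C)
    rw [le_div_iff₀ hC] at this
    linarith
  refine ⟨e.source ∩ e ⁻¹' ball (e x) r₀, inter_mem (e.open_source.mem_nhds hxe)
    ((e.continuousAt hxe).preimage_mem_nhds (ball_mem_nhds _ hr₀)), κ, r, hκ, hκ1, hrs, ?_⟩
  intro y hy
  -- The first inequality is the partial sum of the geometric series of drifts, multiplied by `1 -
  -- κ`.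
  have hind : ∀ n : ℕ, φ (n * T) y ∈ e.source ∧ ∃ s, (1 - κ) * |s| ≤ C * r₀ * (1 - κ ^ n) ∧
      ‖e (φ (n * T) y) - e (φ s x)‖ ≤ κ ^ n * r₀ := by
    intro n
    induction n with
    | zero =>
      refine ⟨by simpa using hy.1, 0, by simp, ?_⟩
      have := hy.2
      rw [mem_preimage, mem_ball, dist_eq_norm] at this
      simpa using this.le
    | succ n ih =>
      obtain ⟨h1, s, hs, h2⟩ := ih
      have hκn : κ ^ n ≤ 1 := pow_le_one₀ hκ hκ1.le
      have hκn0 : 0 ≤ κ ^ n := pow_nonneg hκ n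
      have h3 : |s| ≤ r := by
        have h4 : C * r₀ * (1 - κ ^ n) ≤ (1 - κ) * r := by
          have : 0 ≤ C * r₀ := by positivity
          nlinarith
        exact le_of_mul_le_mul_left (hs.trans h4) hκ'
      have h5 : κ ^ n * r₀ ≤ r := (mul_le_of_le_one_left hr₀.le hκn).trans (min_le_left _ _)
      obtain ⟨h6, s', h7, h8⟩ := hstep (e (φ (n * T) y)) s (h3.trans (min_le_left _ _))
        ((h2.trans h5).trans (min_le_left _ _))
      rw [mem_preimage, e.left_inv h1] at h6
      have h9 : φ T (φ (n * T) y) = φ ((n + 1 : ℕ) * T) y := by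
        rw [← Flow.map_add]
        congr 1
        push_cast
        ring
      simp only [Function.comp, e.left_inv h1] at h8
      rw [h9] at h8
      refine ⟨by rw [← h9]; exact h6.2, s', ?_, ?_⟩
      · have h10 : |s'| ≤ |s' - s| + |s| := by
          simpa using abs_add_le (s' - s) s
        have h11 : |s' - s| ≤ C * (κ ^ n * r₀) := h7.trans (by gcongr)
        calc (1 - κ) * |s'| ≤ (1 - κ) * (C * (κ ^ n * r₀) + |s|) := by
              gcongr
              linarith
          _ ≤ (1 - κ) * (C * (κ ^ n * r₀)) + C * r₀ * (1 - κ ^ n) := by linarith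
          _ = _ := by ring
      · calc _ ≤ κ * (κ ^ n * r₀) := h8.trans (by gcongr)
          _ = _ := by ring
  intro n
  obtain ⟨h1, s, hs, h2⟩ := hind n
  have hκn : κ ^ n ≤ 1 := pow_le_one₀ hκ hκ1.le
  have hκn0 : 0 ≤ κ ^ n := pow_nonneg hκ n
  have h3 : |s| ≤ r := by
    have h4 : C * r₀ * (1 - κ ^ n) ≤ (1 - κ) * r := by
      have : 0 ≤ C * r₀ := by positivity
      nlinarith
    exact le_of_mul_le_mul_left (hs.trans h4) hκ'
  have h4 : κ ^ n * r₀ ≤ κ ^ n * r := by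
    gcongr
    exact min_le_left _ _
  have h5 : κ ^ n * r ≤ r := mul_le_of_le_one_left hr.le hκn
  obtain ⟨h6, -⟩ := hstep (e (φ (n * T) y)) s (h3.trans (min_le_left _ _))
    (((h2.trans h4).trans h5).trans (min_le_left _ _))
  rw [mem_preimage, e.left_inv h1] at h6
  exact ⟨⟨h1, h6.1⟩, s, h3, h2.trans h4⟩

/-- A periodic orbit with transverse contraction is asymptotically stable. -/
lemma IsFlowOf.asympStable_orb (hφ : IsFlowOf φ W) (hW : SmoothFieldOn W univ) {T m : ℝ}
    (hT : 0 < T) (hxT : φ T x = x) (hWx : W x ≠ 0) (hsd : StrictDiffAt (φ T) x) (hm : |m| < 1)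
    (hmul : ∀ v : Plane, ∃ c : ℝ, tderiv (φ T) x v = m • v + c • fieldAt W x) :
    AsympStable φ (orb φ x) := by
  have hsplit : ∀ t, 0 ≤ t → ∃ n : ℕ, ∃ u ∈ Icc 0 T, t = u + n * T := by
    intro t ht
    refine ⟨⌊t / T⌋₊, t - ⌊t / T⌋₊ * T, ⟨?_, ?_⟩, by ring⟩
    · have := Nat.floor_le (div_nonneg ht hT.le)
      rw [le_div_iff₀ hT] at this
      linarith
    · have := Nat.lt_floor_add_one (t / T)
      rw [div_lt_iff₀ hT] at this
      linarith
  constructor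
  · intro V hV hxV
    set N := {z | ∀ t ∈ Icc (0 : ℝ) T, φ t z ∈ V}
    have hN : IsOpen N := isOpen_stay φ hV T
    have hxN : ∀ s, φ s x ∈ N := fun s t _ => hxV (inv_orb φ x t _ ⟨s, rfl⟩)
    obtain ⟨Q, hQ, κ, r, -, -, -, hQt⟩ := hφ.exists_tracking hW hxT hWx hsd hm hmul
      (hN.mem_nhds (by simpa using hxN 0))
    -- Points that stay in `V` for one period and reach the tracking neighbourhood `Q` within it.
    -- Afterwards the iterates of the time `T` map remain in `N`, which controls the times in
    -- between.
    refine ⟨⋃ s ∈ Icc 0 T, N ∩ φ s ⁻¹' interior Q, isOpen_biUnion fun s _ =>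
      hN.inter (isOpen_interior.preimage (φ.continuous_toFun s)), ?_, ?_⟩
    · rintro _ ⟨t, rfl⟩
      obtain ⟨u, hu, hut⟩ := exists_reduce_period hT hxT t
      refine mem_iUnion₂.2 ⟨T - u, ⟨by linarith [hu.2], by linarith [hu.1]⟩, hxN t, ?_⟩
      simp only [mem_preimage, ← hut]
      rw [← Flow.map_add, sub_add_cancel, hxT]
      exact mem_interior_iff_mem_nhds.2 hQ
    · intro y hy t ht
      obtain ⟨s, hs, hyN, hyQ⟩ := mem_iUnion₂.1 hy
      rcases le_or_gt t T with htT | htT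
      · exact hyN t ⟨ht, htT⟩
      · obtain ⟨n, u, hu, hut⟩ := hsplit (t - s) (by linarith [hs.2])
        have h1 := (hQt _ (interior_subset hyQ) n).1.2 u hu
        rw [← Flow.map_add, ← Flow.map_add, ← hut, sub_add_cancel] at h1
        exact h1
  · obtain ⟨Q, hQ, κ, r, hκ, hκ1, hrs, hQt⟩ := hφ.exists_tracking hW hxT hWx hsd hm hmul
      univ_mem
    set e := chartAt Plane x
    have hconv : ∀ y ∈ Q, ToFut φ y (orb φ x) := by
      intro y hy O hO
      rw [mem_map]
      obtain ⟨V, hV, hxV, hVO⟩ := mem_nhdsSet_iff_exists.1 hO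
      set N := {z | ∀ t ∈ Icc (0 : ℝ) T, φ t z ∈ V}
      have hN : IsOpen N := isOpen_stay φ hV T
      have hcont : ContinuousOn (fun s => e (φ s x)) (Icc (-r) r) :=
        e.continuousOn.comp (φ.continuous continuous_id continuous_const).continuousOn
          fun s hs => hrs s (abs_le.2 hs)
      -- The tracked arc is compact and lies in the open set of points staying in `V` for a period;
      -- once `κ ^ n * r` is less than `δ`, so do the iterates.
      obtain ⟨δ, hδ, hδG⟩ := (isCompact_Icc.image_of_continuousOn hcont).exists_thickening_subset_open
        (e.isOpen_inter_preimage_symm hN) (by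
          rintro _ ⟨s, hs, rfl⟩
          have h1 := hrs s (abs_le.2 hs)
          refine ⟨e.map_source h1, ?_⟩
          simp only [mem_preimage, e.left_inv h1]
          exact fun t _ => hxV (inv_orb φ x t _ ⟨s, rfl⟩))
      have hlim : Tendsto (fun n : ℕ => κ ^ n * r) atTop (𝓝 0) := by
        simpa using (tendsto_pow_atTop_nhds_zero_of_lt_one hκ hκ1).mul_const r
      obtain ⟨n₀, hn₀⟩ := eventually_atTop.1 (hlim.eventually_lt_const hδ)
      filter_upwards [eventually_ge_atTop ((n₀ + 1) * T)] with t ht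
      have hn₀T : 0 ≤ (n₀ + 1) * T := by positivity
      obtain ⟨n, u, hu, hut⟩ := hsplit t (hn₀T.trans ht)
      have hn : n₀ ≤ n := by
        have h1 : (n₀ + 1) * T ≤ (n + 1) * T := by linarith [hu.2]
        have h2 := le_of_mul_le_mul_right h1 hT
        exact_mod_cast (add_le_add_iff_right 1).1 h2
      obtain ⟨⟨h1, -⟩, s, hs, h2⟩ := hQt y hy n
      have h3 : e (φ (n * T) y) ∈ e.target ∩ e.symm ⁻¹' N := by
        refine hδG (mem_thickening_iff.2 ⟨_, ⟨s, abs_le.1 hs, rfl⟩, ?_⟩)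
        rw [dist_eq_norm]
        exact lt_of_le_of_lt h2 (hn₀ n hn)
      have h4 := h3.2
      rw [mem_preimage, e.left_inv h1] at h4
      have h5 := h4 u hu
      rw [← Flow.map_add, ← hut] at h5
      exact hVO h5
    refine ⟨⋃ s : ℝ, φ s ⁻¹' interior Q, isOpen_iUnion fun s =>
      isOpen_interior.preimage (φ.continuous_toFun s), ?_, ?_⟩
    · rintro _ ⟨t, rfl⟩
      refine mem_iUnion.2 ⟨-t, ?_⟩
      rw [mem_preimage, flow_neg_apply]
      exact mem_interior_iff_mem_nhds.2 hQ
    · intro y hy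
      obtain ⟨s, hs⟩ := mem_iUnion.1 hy
      have := (hconv _ (interior_subset hs)).shift (-s)
      rwa [flow_neg_apply] at this

end Cycles

/-! ### Morse–Smale fields whose divergence does not vanish at singular points. -/

section FoliationData

variable {X : Type*} [TopologicalSpace X] [ChartedSpace Plane X] [IsManifold (𝓡 2) ∞ X]

/-- A smooth vector field `W` with flow `φ` and divergence `-a`, where `a` does not vanish at the
singular points. -/
structure FoliationData (W : ∀ x : X, TangentSpace (𝓡 2) x) (φ : Flow ℝ X)
    (ρ : SmoothDensity (univ : Set X)) (a : X → ℝ) : Prop where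
  smooth : SmoothFieldOn W univ
  flow : IsFlowOf φ W
  continuous : Continuous a
  divergence : HasDivergence ρ W (-a)
  ne_zero : ∀ x, W x = 0 → a x ≠ 0

variable {W : ∀ x : X, TangentSpace (𝓡 2) x} {φ : Flow ℝ X}
  {ρ : SmoothDensity (univ : Set X)} {a : X → ℝ} {x : X}

lemma det_area (L : Plane →L[ℝ] Plane) (u v : Plane) :
    L u 0 * L v 1 - L u 1 * L v 0 = pdet L * (u 0 * v 1 - u 1 * v 0) := by
  unfold pdet
  rw [det_plane, apply_plane L u 0, apply_plane L u 1, apply_plane L v 0, apply_plane L v 1]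
  ring

lemma norm_sq_plane_pos {w : Plane} (hw : w ≠ 0) : 0 < w 0 * w 0 + w 1 * w 1 := by
  by_contra! h
  refine hw ?_
  have h0 : w 0 = 0 := by nlinarith [mul_self_nonneg (w 0), mul_self_nonneg (w 1)]
  have h1 : w 1 = 0 := by nlinarith [mul_self_nonneg (w 0), mul_self_nonneg (w 1)]
  ext i
  fin_cases i
  · simpa using h0
  · simpa using h1

/-- For an endomorphism that fixes `w`, the induced multiplication on the quotient line is the
determinant. -/
lemma quotient_multiplier_iff {L : Plane →L[ℝ] Plane} {w : Plane} (hw : w ≠ 0) (hLw : L w = w)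
    (m : ℝ) : (∀ v, ∃ c : ℝ, L v = m • v + c • w) ↔ pdet L = m := by
  have hpos := norm_sq_plane_pos hw
  constructor
  · intro h
    -- Test on the vector orthogonal to `w`: as `L` fixes `w`, the area of the image with `w` is
    -- scaled both by the determinant and by `m`.
    obtain ⟨c, hc⟩ := h !₂[-(w 1), w 0]
    have h1 := det_area L w !₂[-(w 1), w 0]
    rw [hLw, hc] at h1
    simp at h1
    have h2 : (pdet L - m) * (w 0 * w 0 + w 1 * w 1) = 0 := by linear_combination -h1
    rcases mul_eq_zero.1 h2 with h3 | h3
    · linarith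
    · exact absurd h3 hpos.ne'
  · rintro rfl v
    have hS : w 0 ^ 2 + w 1 ^ 2 ≠ 0 := by
      rw [pow_two, pow_two]
      exact hpos.ne'
    have hS' : w 1 ^ 2 + w 0 ^ 2 ≠ 0 := by rwa [add_comm]
    have h1 := det_area L w v
    rw [hLw] at h1
    refine ⟨((L v 0 - pdet L * v 0) * w 0 + (L v 1 - pdet L * v 1) * w 1) /
      (w 0 * w 0 + w 1 * w 1), ?_⟩
    ext i
    fin_cases i
    · simp only [Fin.zero_eta, PiLp.add_apply, PiLp.smul_apply, smul_eq_mul]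
      field_simp
      linear_combination (-(w 1)) * h1
    · simp only [Fin.mk_one, PiLp.add_apply, PiLp.smul_apply, smul_eq_mul]
      field_simp
      linear_combination (w 0) * h1

/-- Differentiate at `t = 0` the identity that `φ T` after `φ t` equals `φ (t + T)`. -/
lemma IsFlowOf.tderiv_field [T2Space X] (hφ : IsFlowOf φ W) {T : ℝ} {x : X}
    (h : MDifferentiableAt (𝓡 2) (𝓡 2) (φ T) x) :
    tderiv (φ T) x (fieldAt W x) = fieldAt W (φ T x) := by
  set e := chartAt Plane (φ T x)
  have he : e ∈ atlas Plane X := chart_mem_atlas _ _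
  have hxe : φ T x ∈ e.source := mem_chart_source Plane _
  have h0 : MDifferentiableAt (𝓡 2) 𝓘(ℝ, Plane) (e ∘ φ T) (φ 0 x) := by
    rw [Flow.map_zero_apply]
    exact (mdifferentiableAt_atlas he hxe).comp x h
  have h1 := hφ.hasDerivAt 0 x h0
  have h2 := hφ.hasDerivAt T x (f := e) (mdifferentiableAt_atlas he hxe)
  have h3 : HasDerivAt (fun t => (e ∘ φ T) (φ t x))
      (mfderiv (𝓡 2) 𝓘(ℝ, Plane) e (φ T x) (W (φ T x))) 0 := by
    have h4 := HasDerivAt.comp_add_const 0 T (by rw [zero_add]; exact h2)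
    refine h4.congr_of_eventuallyEq (Eventually.of_forall fun t => ?_)
    simp only [Function.comp]
    rw [← Flow.map_add, add_comm]
  have h4 := h1.unique h3
  rw [Flow.map_zero_apply, mfderiv_comp x (mdifferentiableAt_atlas he hxe) h] at h4
  exact (cderiv_bijective he hxe).1 h4

/-- One direction is uniqueness of integral curves, the other the derivative of a constant curve. -/
lemma IsFlowOf.eq_zero_iff [T2Space X] (hφ : IsFlowOf φ W) (hW : SmoothFieldOn W univ) (x : X) :
    W x = 0 ↔ ∀ t, φ t x = x := by
  constructor
  · intro h t
    have h1 := isMIntegralCurve_Ioo_eq_of_contMDiff_boundaryless (t₀ := 0)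
      ((contMDiffOn_univ.1 hW).of_le (by simp)) (hφ x) (isMIntegralCurve_const h) (by simp)
    exact congrFun h1 t
  · intro h
    have he : chartAt Plane x ∈ atlas Plane X := chart_mem_atlas _ _
    have hx : φ 0 x ∈ (chartAt Plane x).source := by simp
    have h1 := hφ.hasDerivAt_chart he 0 x hx
    simp only [h] at h1
    have h2 := h1.unique (hasDerivAt_const _ _)
    exact (chartField_eq_zero_iff he (mem_chart_source Plane x)).1 h2

namespace FoliationData

lemma reverse (h : FoliationData W φ ρ a) : FoliationData (-W) φ.reverse ρ (-a) where
  smooth := by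
    have := h.smooth
    unfold SmoothFieldOn at this ⊢
    exact ContMDiffOn.neg_section this
  flow := h.flow.reverse
  continuous := h.continuous.neg
  divergence e he x hx := by
    have h1 := h.divergence e he x hx
    rw [chartField_neg]
    simp only [Pi.neg_apply, smul_neg] at h1 ⊢
    rw [fderiv_fun_neg, show ((-fderiv ℝ (fun y => ρ.toFun e y • chartField W e y) (e x) :
      Plane →L[ℝ] Plane) : Plane →ₗ[ℝ] Plane) = -(fderiv ℝ (fun y => ρ.toFun e y •
        chartField W e y) (e x) : Plane →ₗ[ℝ] Plane) from rfl, map_neg, h1]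
    ring
  ne_zero x hx := neg_ne_zero.2 (h.ne_zero x (neg_eq_zero.1 hx))

/-- Where the field vanishes, the derivative of the density does not contribute and the divergence
is the trace. -/
lemma ptr_linearization (h : FoliationData W φ ρ a) (hx : W x = 0) :
    ptr (linearization W x) = -a x := by
  have he : chartAt Plane x ∈ atlas Plane X := chart_mem_atlas _ _
  have hxe := mem_chart_source Plane x
  have h1 := h.divergence _ he x hxe
  rw [trace_fderiv_smul (ρ.differentiableAt he (mem_chart_target Plane x))
    (hasFDerivAt_chartField h.smooth x).differentiableAt, chartField_chartAt_eq_zero hx, map_zero,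
    add_zero, mul_comm] at h1
  exact mul_right_cancel₀ (ρ.at_pos x).ne' h1

lemma isAttractingPoint_iff (h : FoliationData W φ ρ a) : IsAttractingPoint W x ↔
    W x = 0 ∧ 0 < pdet (linearization W x) ∧ 0 < a x := by
  unfold IsAttractingPoint
  refine and_congr_right fun h0 => ?_
  rw [eigenvalues_neg_iff, h.ptr_linearization h0, neg_lt_zero]

lemma isRepellingPoint_iff (h : FoliationData W φ ρ a) : IsRepellingPoint W x ↔
    W x = 0 ∧ 0 < pdet (linearization W x) ∧ a x < 0 := by
  unfold IsRepellingPoint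
  refine and_congr_right fun h0 => ?_
  rw [eigenvalues_pos_iff, h.ptr_linearization h0, neg_pos]

lemma _root_.DegreeZero.isSaddle_iff : IsSaddle W x ↔ W x = 0 ∧ pdet (linearization W x) < 0 := by
  unfold IsSaddle IsHyperbolicPoint
  rw [and_assoc, eigenvalues_saddle_iff]

lemma isWeaklyStableSaddle_iff (h : FoliationData W φ ρ a) : IsWeaklyStableSaddle W x ↔
    W x = 0 ∧ pdet (linearization W x) < 0 ∧ 0 < a x := by
  unfold IsWeaklyStableSaddle
  rw [isSaddle_iff, and_assoc]
  refine and_congr_right fun h0 => and_congr_right fun _ => ?_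
  have := h.ptr_linearization h0
  unfold ptr at this
  rw [this, neg_lt_zero]

lemma isWeaklyUnstableSaddle_iff (h : FoliationData W φ ρ a) : IsWeaklyUnstableSaddle W x ↔
    W x = 0 ∧ pdet (linearization W x) < 0 ∧ a x < 0 := by
  unfold IsWeaklyUnstableSaddle
  rw [isSaddle_iff, and_assoc]
  refine and_congr_right fun h0 => and_congr_right fun _ => ?_
  have := h.ptr_linearization h0
  unfold ptr at this
  rw [this, neg_pos]

lemma isHyperbolicPoint_cases (h : FoliationData W φ ρ a) (hx : IsHyperbolicPoint W x) :
    IsAttractingPoint W x ∨ IsRepellingPoint W x ∨ IsSaddle W x := by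
  rw [h.isAttractingPoint_iff, h.isRepellingPoint_iff, isSaddle_iff]
  obtain ⟨h1, h2⟩ := pdet_ne_zero_of_hyperbolic hx.2
  have h3 := h.ne_zero x hx.1
  rcases lt_or_gt_of_ne h1 with h4 | h4
  · exact Or.inr (Or.inr ⟨hx.1, h4⟩)
  · rcases lt_or_gt_of_ne h3 with h5 | h5
    · exact Or.inr (Or.inl ⟨hx.1, h4, h5⟩)
    · exact Or.inl ⟨hx.1, h4, h5⟩

/-- `x` lies on a cycle with least period `T`. -/
def _root_.DegreeZero.OnCycle (W : ∀ x : X, TangentSpace (𝓡 2) x) (φ : Flow ℝ X) (x : X) (T : ℝ) :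
    Prop :=
  W x ≠ 0 ∧ 0 < T ∧ φ T x = x ∧ ∀ s, 0 < s → s < T → φ s x ≠ x

lemma _root_.DegreeZero.OnCycle.unique {T T' : ℝ} (h : OnCycle W φ x T) (h' : OnCycle W φ x T') :
    T = T' := by
  rcases lt_trichotomy T T' with h1 | h1 | h1
  · exact absurd h.2.2.1 (h'.2.2.2 T h.2.1 h1)
  · exact h1
  · exact absurd h'.2.2.1 (h.2.2.2 T' h'.2.1 h1)

variable [CompactSpace X] [T2Space X]

lemma hasJacobian (h : FoliationData W φ ρ a) {t : ℝ} (ht : 0 ≤ t) (x : X) :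
    HasJacobian ρ (φ t) x (Real.exp (-orbInt φ a t x)) := by
  rw [← orbInt_neg]
  exact h.flow.hasJacobian h.smooth ρ h.continuous.neg h.divergence ht x

lemma mdifferentiableAt (h : FoliationData W φ ρ a) {t : ℝ} (ht : 0 ≤ t) (x : X) :
    MDifferentiableAt (𝓡 2) (𝓡 2) (φ t) x :=
  (h.hasJacobian ht x).1.mdifferentiableAt (φ.continuous_toFun t).continuousAt

lemma multiplier_iff (h : FoliationData W φ ρ a) {T : ℝ} (hT : OnCycle W φ x T) (m : ℝ) :
    (∀ v : Plane, ∃ c : ℝ, tderiv (φ T) x v = m • v + c • fieldAt W x) ↔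
      pdet (tderiv (φ T) x) = m := by
  have h1 : tderiv (φ T) x (fieldAt W x) = fieldAt W x := by
    rw [h.flow.tderiv_field (h.mdifferentiableAt hT.2.1.le x), hT.2.2.1]
  exact quotient_multiplier_iff (w := fieldAt W x) hT.1 h1 m

/-- After a period the density is compared with itself at the same point, so its Jacobian is the
determinant of the differential, up to sign. -/
lemma abs_pdet (h : FoliationData W φ ρ a) {T : ℝ} (hT : OnCycle W φ x T) :
    |pdet (tderiv (φ T) x)| = Real.exp (-orbInt φ a T x) := by
  have h1 := (h.hasJacobian hT.2.1.le x).2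
  rw [hT.2.2.1] at h1
  exact mul_right_cancel₀ (ρ.at_pos x).ne' h1

lemma hasMultiplier_iff (h : FoliationData W φ ρ a) (m : ℝ) : HasMultiplier W φ x m ↔
    ∃ T, OnCycle W φ x T ∧ pdet (tderiv (φ T) x) = m := by
  constructor
  · rintro ⟨h1, T, h2, h3, h4, h5⟩
    have hT : OnCycle W φ x T := ⟨h1, h2, h3, h4⟩
    exact ⟨T, hT, (h.multiplier_iff hT m).1 h5⟩
  · rintro ⟨T, hT, hm⟩
    exact ⟨hT.1, T, hT.2.1, hT.2.2.1, hT.2.2.2, (h.multiplier_iff hT m).2 hm⟩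

/-- Translates every condition on the absolute value of a multiplier into one on the integral of `a`
over a least period; the sign of the multiplier, which depends on orientation, is irrelevant. -/
lemma exists_multiplier_iff (h : FoliationData W φ ρ a) (p : ℝ → Prop) :
    (∃ m, HasMultiplier W φ x m ∧ p |m|) ↔
      ∃ T, OnCycle W φ x T ∧ p (Real.exp (-orbInt φ a T x)) := by
  simp only [h.hasMultiplier_iff]
  constructor
  · rintro ⟨m, ⟨T, hT, rfl⟩, hm⟩
    exact ⟨T, hT, h.abs_pdet hT ▸ hm⟩
  · rintro ⟨T, hT, hm⟩
    exact ⟨_, ⟨T, hT, rfl⟩, (h.abs_pdet hT).symm ▸ hm⟩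

lemma onHyperbolicCycle_iff (h : FoliationData W φ ρ a) : OnHyperbolicCycle W φ x ↔
    ∃ T, OnCycle W φ x T ∧ orbInt φ a T x ≠ 0 := by
  unfold OnHyperbolicCycle
  rw [h.exists_multiplier_iff (fun r => r ≠ 1)]
  simp [Real.exp_eq_one_iff]

lemma onAttractingCycle_iff (h : FoliationData W φ ρ a) : OnAttractingCycle W φ x ↔
    ∃ T, OnCycle W φ x T ∧ 0 < orbInt φ a T x := by
  unfold OnAttractingCycle
  rw [h.exists_multiplier_iff (fun r => r < 1)]
  simp [Real.exp_lt_one_iff]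

lemma onRepellingCycle_iff (h : FoliationData W φ ρ a) : OnRepellingCycle W φ x ↔
    ∃ T, OnCycle W φ x T ∧ orbInt φ a T x < 0 := by
  unfold OnRepellingCycle
  rw [h.exists_multiplier_iff (fun r => 1 < r)]
  simp [Real.one_lt_exp_iff]

lemma _root_.DegreeZero.OnCycle.reverse {T : ℝ} (h : OnCycle W φ x T) :
    OnCycle (-W) φ.reverse x T := by
  have h1 : ∀ s, φ.reverse s x = x ↔ φ s x = x := by
    intro s
    rw [Flow.reverse_apply]
    constructor
    · intro h
      conv_lhs => rw [← h]
      exact flow_apply_neg _ _ _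
    · intro h
      conv_lhs => rw [← h]
      exact flow_neg_apply _ _ _
  refine ⟨neg_ne_zero.2 h.1, h.2.1, (h1 T).2 h.2.2.1, fun s hs hsT => ?_⟩
  rw [Ne, h1]
  exact h.2.2.2 s hs hsT

lemma _root_.DegreeZero.onCycle_reverse {T : ℝ} :
    OnCycle (-W) φ.reverse x T ↔ OnCycle W φ x T := by
  refine ⟨fun h => ?_, fun h => h.reverse⟩
  have := h.reverse
  rwa [reverse_reverse, neg_neg] at this

lemma _root_.DegreeZero.OnCycle.orbInt_reverse {T : ℝ} (h : OnCycle W φ x T) :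
    orbInt φ.reverse (-a) T x = -orbInt φ a T x := by
  rw [orbInt_neg, ← DegreeZero.orbInt_reverse]
  congr 2
  conv_lhs => rw [← h.2.2.1]
  exact flow_neg_apply _ _ _

lemma onAttractingCycle_reverse (h : FoliationData W φ ρ a) :
    OnAttractingCycle (-W) φ.reverse x ↔ OnRepellingCycle W φ x := by
  rw [h.reverse.onAttractingCycle_iff, h.onRepellingCycle_iff]
  refine exists_congr fun T => ?_
  rw [onCycle_reverse]
  refine and_congr_right fun hT => ?_
  rw [hT.orbInt_reverse, neg_pos]

lemma onRepellingCycle_reverse (h : FoliationData W φ ρ a) :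
    OnRepellingCycle (-W) φ.reverse x ↔ OnAttractingCycle W φ x := by
  rw [h.reverse.onRepellingCycle_iff, h.onAttractingCycle_iff]
  refine exists_congr fun T => ?_
  rw [onCycle_reverse]
  refine and_congr_right fun hT => ?_
  rw [hT.orbInt_reverse, neg_lt_zero]

lemma isAttractingPoint_reverse (h : FoliationData W φ ρ a) :
    IsAttractingPoint (-W) x ↔ IsRepellingPoint W x := by
  rw [h.reverse.isAttractingPoint_iff, h.isRepellingPoint_iff, linearization_neg, pdet_neg]
  simp

lemma isRepellingPoint_reverse (h : FoliationData W φ ρ a) :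
    IsRepellingPoint (-W) x ↔ IsAttractingPoint W x := by
  rw [h.reverse.isRepellingPoint_iff, h.isAttractingPoint_iff, linearization_neg, pdet_neg]
  simp

lemma isWeaklyStableSaddle_reverse (h : FoliationData W φ ρ a) :
    IsWeaklyStableSaddle (-W) x ↔ IsWeaklyUnstableSaddle W x := by
  rw [h.reverse.isWeaklyStableSaddle_iff, h.isWeaklyUnstableSaddle_iff, linearization_neg, pdet_neg]
  simp

lemma isWeaklyUnstableSaddle_reverse (h : FoliationData W φ ρ a) :
    IsWeaklyUnstableSaddle (-W) x ↔ IsWeaklyStableSaddle W x := by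
  rw [h.reverse.isWeaklyUnstableSaddle_iff, h.isWeaklyStableSaddle_iff, linearization_neg, pdet_neg]
  simp

/-- The attracting points and cycles. -/
def _root_.DegreeZero.attractingSet (W : ∀ x : X, TangentSpace (𝓡 2) x) (φ : Flow ℝ X) : Set X :=
  {x | OnAttractingCycle W φ x} ∪ {x | IsAttractingPoint W x}

/-- The repelling points and cycles. -/
def _root_.DegreeZero.repellingSet (W : ∀ x : X, TangentSpace (𝓡 2) x) (φ : Flow ℝ X) : Set X :=
  {x | OnRepellingCycle W φ x} ∪ {x | IsRepellingPoint W x}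

lemma attractingSet_reverse (h : FoliationData W φ ρ a) :
    attractingSet (-W) φ.reverse = repellingSet W φ := by
  ext x
  exact or_congr h.onAttractingCycle_reverse h.isAttractingPoint_reverse

lemma repellingSet_reverse (h : FoliationData W φ ρ a) :
    repellingSet (-W) φ.reverse = attractingSet W φ := by
  ext x
  exact or_congr h.onRepellingCycle_reverse h.isRepellingPoint_reverse

lemma onCycle_flow (h : FoliationData W φ ρ a) {T : ℝ} (hT : OnCycle W φ x T) (t : ℝ) :
    OnCycle W φ (φ t x) T := by
  have h1 : ∀ s, φ s (φ t x) = φ t x ↔ φ s x = x := by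
    intro s
    rw [← Flow.map_add, add_comm, Flow.map_add]
    exact (φ.toHomeomorph t).injective.eq_iff
  refine ⟨?_, hT.2.1, (h1 T).2 hT.2.2.1, fun s hs hsT => ?_⟩
  · intro h0
    have h2 := (h.flow.eq_zero_iff h.smooth _).1 h0 (-t)
    rw [flow_neg_apply] at h2
    rw [← h2] at h0
    exact hT.1 h0
  · rw [Ne, h1]
    exact hT.2.2.2 s hs hsT

lemma orbInt_flow (h : FoliationData W φ ρ a) {T : ℝ} (hT : OnCycle W φ x T) (t : ℝ) :
    orbInt φ a T (φ t x) = orbInt φ a T x := by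
  have h1 := orbInt_add (φ := φ) h.continuous T t x
  have h2 := orbInt_add (φ := φ) h.continuous t T x
  rw [hT.2.2.1, add_comm t T] at h2
  linarith

lemma flow_of_eq_zero (h : FoliationData W φ ρ a) (hx : W x = 0) (t : ℝ) : φ t x = x :=
  (h.flow.eq_zero_iff h.smooth x).1 hx t

lemma inv_attractingSet (h : FoliationData W φ ρ a) : Inv φ (attractingSet W φ) := by
  rintro t x (hx | hx)
  · left
    obtain ⟨T, hT, hTp⟩ := h.onAttractingCycle_iff.1 hx
    exact h.onAttractingCycle_iff.2 ⟨T, h.onCycle_flow hT t, by rwa [h.orbInt_flow hT]⟩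
  · right
    rwa [h.flow_of_eq_zero hx.1 t]

lemma inv_repellingSet (h : FoliationData W φ ρ a) : Inv φ (repellingSet W φ) := by
  have := h.reverse.inv_attractingSet.reverse
  rwa [h.attractingSet_reverse, reverse_reverse] at this

lemma orb_of_eq_zero (h : FoliationData W φ ρ a) (hx : W x = 0) : orb φ x = {x} := by
  ext y
  simp only [orb, h.flow_of_eq_zero hx, mem_range, mem_singleton_iff]
  exact ⟨fun ⟨_, h⟩ => h.symm, fun h => ⟨0, h.symm⟩⟩

lemma compact_stable (h : FoliationData W φ ρ a) (hx : x ∈ attractingSet W φ) :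
    IsCompact (orb φ x) ∧ AsympStable φ (orb φ x) := by
  rcases hx with hx | hx
  · obtain ⟨T, hT, hTp⟩ := h.onAttractingCycle_iff.1 hx
    refine ⟨isCompact_orb_of_periodic hT.2.1 hT.2.2.1, ?_⟩
    refine h.flow.asympStable_orb h.smooth hT.2.1 hT.2.2.1 hT.1 (h.hasJacobian hT.2.1.le x).1
      (m := pdet (tderiv (φ T) x)) ?_ ((h.multiplier_iff hT _).2 rfl)
    rw [h.abs_pdet hT, Real.exp_lt_one_iff]
    linarith
  · have hx' := h.isAttractingPoint_iff.1 hx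
    rw [h.orb_of_eq_zero hx.1]
    refine ⟨isCompact_singleton, h.flow.asympStable_singleton h.smooth hx.1 hx'.2.1 ?_⟩
    rw [h.ptr_linearization hx.1]
    linarith [hx'.2.2]

lemma nonwandering_of_mem (h : FoliationData W φ ρ a)
    (hx : x ∈ (attractingSet W φ ∪ repellingSet W φ) ∪ {x | IsSaddle W x}) :
    x ∈ nonwandering φ := by
  have h0 : W x = 0 → x ∈ nonwandering φ := fun h0 =>
    mem_nonwandering_of_periodic one_pos (h.flow_of_eq_zero h0 1)
  rcases hx with ((hx | hx) | (hx | hx)) | hx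
  · obtain ⟨T, hT, -⟩ := h.onAttractingCycle_iff.1 hx
    exact mem_nonwandering_of_periodic hT.2.1 hT.2.2.1
  · exact h0 hx.1
  · obtain ⟨T, hT, -⟩ := h.onRepellingCycle_iff.1 hx
    exact mem_nonwandering_of_periodic hT.2.1 hT.2.2.1
  · exact h0 hx.1
  · exact h0 hx.1.1

/-- The structure of the non-wandering set of a Morse–Smale field. -/
lemma hyperbolicData (h : FoliationData W φ ρ a) (hMS : IsMorseSmaleField W φ) :
    HyperbolicData φ (attractingSet W φ) (repellingSet W φ) {x | IsSaddle W x} where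
  inv_A := h.inv_attractingSet
  inv_R := h.inv_repellingSet
  compact_A x hx := (h.compact_stable hx).1
  compact_R x hx := by
    rw [← h.attractingSet_reverse] at hx
    have := (h.reverse.compact_stable hx).1
    rwa [orb_reverse] at this
  stable_A x hx := (h.compact_stable hx).2
  stable_R x hx := by
    rw [← h.attractingSet_reverse] at hx
    have := (h.reverse.compact_stable hx).2
    rwa [orb_reverse] at this
  fixed x hx t := h.flow_of_eq_zero (isSaddle_iff.1 hx).1 t
  isolated x hx := by
    have hx' := isSaddle_iff.1 hx
    refine h.flow.isolated h.smooth hx'.1 hx'.2.ne ?_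
    rw [h.ptr_linearization hx'.1]
    exact neg_ne_zero.2 (h.ne_zero x hx'.1)
  nonwandering_eq := by
    ext x
    refine ⟨fun hx => ?_, h.nonwandering_of_mem⟩
    rcases hMS.1 x hx with h1 | h1
    · rcases h.isHyperbolicPoint_cases h1 with h2 | h2 | h2
      · exact Or.inl (Or.inl (Or.inr h2))
      · exact Or.inl (Or.inr (Or.inr h2))
      · exact Or.inr h2
    · obtain ⟨T, hT, hne⟩ := h.onHyperbolicCycle_iff.1 h1
      rcases lt_or_gt_of_ne hne with h2 | h2
      · exact Or.inl (Or.inr (Or.inl (h.onRepellingCycle_iff.2 ⟨T, hT, h2⟩)))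
      · exact Or.inl (Or.inl (Or.inl (h.onAttractingCycle_iff.2 ⟨T, hT, h2⟩)))
  AR := by
    rw [Set.disjoint_left]
    rintro x (hx | hx) (hx' | hx')
    · obtain ⟨T, hT, h1⟩ := h.onAttractingCycle_iff.1 hx
      obtain ⟨T', hT', h2⟩ := h.onRepellingCycle_iff.1 hx'
      rw [hT.unique hT'] at h1
      linarith
    · obtain ⟨T, hT, h1⟩ := h.onAttractingCycle_iff.1 hx
      exact hT.1 hx'.1
    · obtain ⟨T, hT, h1⟩ := h.onRepellingCycle_iff.1 hx'
      exact hT.1 hx.1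
    · have h1 := h.isAttractingPoint_iff.1 hx
      have h2 := h.isRepellingPoint_iff.1 hx'
      linarith [h1.2.2, h2.2.2]
  AS := by
    rw [Set.disjoint_left]
    rintro x (hx | hx) hx'
    · obtain ⟨T, hT, h1⟩ := h.onAttractingCycle_iff.1 hx
      exact hT.1 (isSaddle_iff.1 hx').1
    · have h1 := h.isAttractingPoint_iff.1 hx
      have h2 := isSaddle_iff.1 hx'
      linarith [h1.2.1, h2.2]
  RS := by
    rw [Set.disjoint_left]
    rintro x (hx | hx) hx'
    · obtain ⟨T, hT, h1⟩ := h.onRepellingCycle_iff.1 hx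
      exact hT.1 (isSaddle_iff.1 hx').1
    · have h1 := h.isRepellingPoint_iff.1 hx
      have h2 := isSaddle_iff.1 hx'
      linarith [h1.2.1, h2.2]
  no_connection x p hp q hq hxp hxq := by
    by_cases hx : W x = 0
    · have h1 : x = p := by
        unfold ToPast at hxp
        rw [nhdsSet_singleton] at hxp
        simp only [h.flow_of_eq_zero hx] at hxp
        exact tendsto_nhds_unique tendsto_const_nhds hxp
      rw [h1]
      exact hp
    · refine absurd ⟨?_, ?_⟩ (hMS.2 x p q hx hp hq)
      · unfold ToPast at hxp
        rwa [nhdsSet_singleton] at hxp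
      · unfold ToFut at hxq
        rwa [nhdsSet_singleton] at hxq

lemma isMorseDecomposition (h : FoliationData W φ ρ a) (hMS : IsMorseSmaleField W φ) :
    IsMorseDecomposition φ (attractingSet W φ) {x | IsWeaklyStableSaddle W x}
      {x | IsWeaklyUnstableSaddle W x} (repellingSet W φ) := by
  refine (h.hyperbolicData hMS).isMorseDecomposition ?_ ?_
  · ext x
    simp only [mem_union, Set.mem_ofPred_eq, isSaddle_iff, h.isWeaklyStableSaddle_iff,
      h.isWeaklyUnstableSaddle_iff]
    constructor
    · rintro ⟨h0, h1⟩
      rcases lt_or_gt_of_ne (h.ne_zero x h0) with h2 | h2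
      · exact Or.inr ⟨h0, h1, h2⟩
      · exact Or.inl ⟨h0, h1, h2⟩
    · rintro (h0 | h0) <;> exact ⟨h0.1, h0.2.1⟩
  · rw [Set.disjoint_left]
    intro x hx hx'
    have h1 := h.isWeaklyStableSaddle_iff.1 hx
    have h2 := h.isWeaklyUnstableSaddle_iff.1 hx'
    linarith [h1.2.2, h2.2.2]

lemma sink_eq (h : FoliationData W φ ρ a) (hMS : IsMorseSmaleField W φ) :
    IsMorseDecomposition.sink φ (attractingSet W φ) {x | IsWeaklyStableSaddle W x} =
      sinkSet W φ :=
  (h.hyperbolicData hMS).sink_eq fun _ hx => hx.1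

lemma source_eq (h : FoliationData W φ ρ a) (hMS : IsMorseSmaleField W φ) :
    IsMorseDecomposition.sink φ.reverse (repellingSet W φ) {x | IsWeaklyUnstableSaddle W x} =
      sourceSet W φ := by
  rw [(h.hyperbolicData hMS).reverse.sink_eq fun _ hx => hx.1]
  unfold sourceSet repellingSet
  congr 1
  refine iUnion₂_congr fun p _ => ?_
  ext x
  have h1 : ToPast φ.reverse x {p} ↔ ToFut φ x {p} := toPast_reverse_iff
  unfold ToPast ToFut at h1
  rw [nhdsSet_singleton] at h1
  exact h1

lemma isAttractorRepeller (h : FoliationData W φ ρ a) (hMS : IsMorseSmaleField W φ) :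
    IsAttractorRepeller φ (sinkSet W φ) (sourceSet W φ) := by
  rw [← h.sink_eq hMS, ← h.source_eq hMS]
  exact (h.isMorseDecomposition hMS).isAttractorRepeller

lemma orbInt_of_eq_zero (h : FoliationData W φ ρ a) (hx : W x = 0) (t : ℝ) :
    orbInt φ a t x = t * a x := by
  unfold orbInt
  simp [h.flow_of_eq_zero hx]

/-- Outside the source the future tends to attracting elements or weakly stable saddles. There the
integral is positive over a period of a cycle, and over unit time at a fixed point, where it is `a`.
-/
lemma exists_orbInt_pos (h : FoliationData W φ ρ a) (hMS : IsMorseSmaleField W φ)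
    (hx : x ∉ sourceSet W φ) : ∃ t, 0 < t ∧ 0 < orbInt φ a t x := by
  have hM := h.isMorseDecomposition hMS
  refine DegreeZero.exists_orbInt_pos h.continuous (hM.closed_A.union hM.closed_P)
    (fun t x hx => hx.imp (hM.inv_A t x) (hM.inv_P t x)) ?_ (x := x) ?_
  · rintro y ((hy | hy) | hy)
    · obtain ⟨T, hT, h1⟩ := h.onAttractingCycle_iff.1 hy
      exact ⟨T, hT.2.1, h1⟩
    · have h1 := h.isAttractingPoint_iff.1 hy
      exact ⟨1, one_pos, by rw [h.orbInt_of_eq_zero h1.1, one_mul]; exact h1.2.2⟩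
    · have h1 := h.isWeaklyStableSaddle_iff.1 hy
      exact ⟨1, one_pos, by rw [h.orbInt_of_eq_zero h1.1, one_mul]; exact h1.2.2⟩
  · rw [← h.source_eq hMS] at hx
    have hx' : ¬ ToFut φ x (repellingSet W φ ∪ {x | IsWeaklyUnstableSaddle W x}) := fun h1 =>
      hx (toPast_reverse_iff.2 h1)
    rcases hM.toFut_cases x with h1 | h1 | h1 | h1
    · exact h1.mono subset_union_left
    · exact h1.mono subset_union_right
    · exact absurd (h1.mono subset_union_right) hx'
    · exact absurd (h1.mono subset_union_left) hx'

end FoliationData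

end FoliationData

/-! ### Uniqueness of the weakly hyperbolic simple structure. -/

section Uniqueness

variable {X : Type*} [TopologicalSpace X] [ChartedSpace Plane X] [IsManifold (𝓡 2) ∞ X]
  {W W₀ : ∀ x : X, TangentSpace (𝓡 2) x} {φ φ₀ : Flow ℝ X}
  {ρ ρ₀ : SmoothDensity (univ : Set X)} {a a₀ : X → ℝ} {x : X}

/-- The derivative of a function along a vector field. -/
def lieDeriv (W : ∀ x : X, TangentSpace (𝓡 2) x) (g : X → ℝ) (x : X) : ℝ :=
  mfderiv (𝓡 2) 𝓘(ℝ) g x (W x)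

lemma lieDeriv_of_eq_zero (g : X → ℝ) (hx : W x = 0) : lieDeriv W g x = 0 := by
  unfold lieDeriv
  rw [hx]
  exact map_zero (mfderiv (𝓡 2) 𝓘(ℝ) g x)

lemma IsFlowOf.hasDerivAt_lieDeriv (hφ : IsFlowOf φ W) {g : X → ℝ} (t : ℝ) (x : X)
    (hg : MDifferentiableAt (𝓡 2) 𝓘(ℝ) g (φ t x)) :
    HasDerivAt (fun t => g (φ t x)) (lieDeriv W g (φ t x)) t :=
  hφ.hasDerivAt t x hg

lemma IsSimpleStructure.reverse {Kp Km : Set X} (h : IsSimpleStructure φ Kp Km) :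
    IsSimpleStructure φ.reverse Km Kp := by
  refine ⟨h.2.1, ?_, h.2.2.1.symm, fun x hx hx' => ?_⟩
  · unfold IsRepellor
    rw [reverse_reverse]
    exact h.1
  · obtain ⟨h1, h2⟩ := h.2.2.2 x hx' hx
    exact ⟨toPast_iff.1 h2, toPast_reverse_iff.2 h1⟩

namespace FoliationData

/-- The orbit integrals of `a` over an invariant set near which `a < W g`. -/
lemma orbInt_lt [T2Space X] (h : FoliationData W φ ρ a) {V K : Set X} (hKV : K ⊆ V) (hK : Inv φ K)
    {g : X → ℝ} (hg : ∀ x ∈ V, MDifferentiableAt (𝓡 2) 𝓘(ℝ) g x ∧ a x < lieDeriv W g x)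
    (hx : x ∈ K) {T : ℝ} (hT : 0 < T) : orbInt φ a T x < g (φ T x) - g x := by
  have h1 : ∀ t, HasDerivAt (fun t => g (φ t x) - orbInt φ a t x)
      (lieDeriv W g (φ t x) - a (φ t x)) t := fun t =>
    (h.flow.hasDerivAt_lieDeriv t x (hg _ (hKV (hK t x hx))).1).sub
      (hasDerivAt_orbInt h.continuous t x)
  have h2 : StrictMono fun t => g (φ t x) - orbInt φ a t x :=
    strictMono_of_deriv_pos fun t => by
      rw [(h1 t).deriv]
      have := (hg _ (hKV (hK t x hx))).2
      linarith
  have h3 := h2 hT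
  simp at h3
  linarith

variable [CompactSpace X] [T2Space X]

/-- An attractor of a simple structure, the repeller of which is weakly hyperbolic, contains the
sink. -/
lemma sinkSet_subset (h : FoliationData W φ ρ a) (hMS : IsMorseSmaleField W φ) {Kp Km V : Set X}
    (hK : IsSimpleStructure φ Kp Km) (hV : Km ⊆ V) {g : X → ℝ}
    (hg : ∀ x ∈ V, MDifferentiableAt (𝓡 2) 𝓘(ℝ) g x ∧ a x < lieDeriv W g x) :
    sinkSet W φ ⊆ Kp := by
  have hKm : Inv φ Km := by
    have h1 : Inv φ.reverse Km := fun t x hx => by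
      rw [← hK.2.1.2.1 t]
      exact mem_image_of_mem _ hx
    have := h1.reverse
    rwa [reverse_reverse] at this
  have hKmc : IsClosed Km := hK.2.1.1.isClosed
  have hM := h.isMorseDecomposition hMS
  -- On `Km` the integral of `a` over a period is less than a difference of values of `g` at the
  -- same point, that is negative, while on these elements it is positive.
  have hA : ∀ y ∈ attractingSet W φ ∪ {x | IsWeaklyStableSaddle W x}, y ∉ Km := by
    rintro y ((hy | hy) | hy) hyK
    · obtain ⟨T, hT, h1⟩ := h.onAttractingCycle_iff.1 hy
      have h2 := h.orbInt_lt hV hKm hg hyK hT.2.1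
      rw [hT.2.2.1] at h2
      linarith
    · have h1 := h.isAttractingPoint_iff.1 hy
      have h2 := h.orbInt_lt hV hKm hg hyK one_pos
      rw [h.orbInt_of_eq_zero h1.1, h.flow_of_eq_zero h1.1] at h2
      linarith [h1.2.2]
    · have h1 := h.isWeaklyStableSaddle_iff.1 hy
      have h2 := h.orbInt_lt hV hKm hg hyK one_pos
      rw [h.orbInt_of_eq_zero h1.1, h.flow_of_eq_zero h1.1] at h2
      linarith [h1.2.2]
  rw [← h.sink_eq hMS]
  intro x hx
  have hx' : ToPast φ x (attractingSet W φ ∪ {x | IsWeaklyStableSaddle W x}) := hx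
  have hcl := hM.closed_A.union hM.closed_P
  have hdisj : Disjoint (attractingSet W φ ∪ {x | IsWeaklyStableSaddle W x}) Km :=
    Set.disjoint_left.2 hA
  -- A point outside `Kp` has its past tending to `Km`, whereas here it tends to a closed set
  -- disjoint from `Km`.
  by_contra hxp
  by_cases hxm : x ∈ Km
  · exact hx'.not_disjoint (hKm.toPast hxm) hcl hKmc hdisj
  · exact hx'.not_disjoint (hK.2.2.2 x hxp hxm).2 hcl hKmc hdisj

lemma lieDeriv_neg_field (g : X → ℝ) (x : X) : lieDeriv (-W) g x = -lieDeriv W g x :=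
  map_neg (mfderiv (𝓡 2) 𝓘(ℝ) g x) (W x)

/-- The reversal of a Morse–Smale field. -/
lemma morseSmale_reverse (h : FoliationData W φ ρ a) (hMS : IsMorseSmaleField W φ) :
    IsMorseSmaleField (-W) φ.reverse := by
  have hs : ∀ x, IsSaddle (-W) x ↔ IsSaddle W x := fun x => by
    rw [isSaddle_iff, isSaddle_iff, linearization_neg, pdet_neg]
    simp
  constructor
  · intro x hx
    have h1 : x ∈ nonwandering φ := by
      rw [← nonwandering_reverse]
      exact hx
    rcases hMS.1 x h1 with h2 | h2
    · left
      rcases h.isHyperbolicPoint_cases h2 with h3 | h3 | h3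
      · have := h.isRepellingPoint_reverse.2 h3
        exact ⟨this.1, fun μ hμ => (this.2 μ hμ).ne'⟩
      · have := h.isAttractingPoint_reverse.2 h3
        exact ⟨this.1, fun μ hμ => (this.2 μ hμ).ne⟩
      · exact ((hs x).2 h3).1
    · right
      obtain ⟨T, hT, h3⟩ := h.onHyperbolicCycle_iff.1 h2
      refine h.reverse.onHyperbolicCycle_iff.2 ⟨T, hT.reverse, ?_⟩
      rw [hT.orbInt_reverse]
      exact neg_ne_zero.2 h3
  · rintro x p q hx hp hq ⟨h1, h2⟩
    refine hMS.2 x q p (fun h0 => hx (by simp [h0])) ((hs q).1 hq) ((hs p).1 hp) ⟨?_, ?_⟩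
    · have h3 : ToFut φ.reverse x {q} := by
        unfold ToFut
        rw [nhdsSet_singleton]
        exact h2
      have h4 := toPast_iff.2 h3
      unfold ToPast at h4
      rwa [nhdsSet_singleton] at h4
    · have h3 : ToPast φ.reverse x {p} := by
        unfold ToPast
        rw [nhdsSet_singleton]
        exact h1
      have h4 := toPast_reverse_iff.1 h3
      unfold ToFut at h4
      rwa [nhdsSet_singleton] at h4

lemma sinkSet_reverse (h : FoliationData W φ ρ a) (hMS : IsMorseSmaleField W φ) :
    sinkSet (-W) φ.reverse = sourceSet W φ := by
  rw [← h.reverse.sink_eq (h.morseSmale_reverse hMS), ← h.source_eq hMS, h.attractingSet_reverse]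
  simp only [h.isWeaklyStableSaddle_reverse]

lemma sourceSet_reverse (h : FoliationData W φ ρ a) (hMS : IsMorseSmaleField W φ) :
    sourceSet (-W) φ.reverse = sinkSet W φ := by
  rw [← h.reverse.source_eq (h.morseSmale_reverse hMS), ← h.sink_eq hMS, h.repellingSet_reverse,
    reverse_reverse]
  simp only [h.isWeaklyUnstableSaddle_reverse]

/-- Uniqueness of the weakly hyperbolic simple structure. -/
lemma simpleStructure_unique (h : FoliationData W φ ρ a) (hMS : IsMorseSmaleField W φ)
    {Kp Km Vp Vm : Set X} (hK : IsSimpleStructure φ Kp Km) (hVp : Kp ⊆ Vp) (hVm : Km ⊆ Vm)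
    {gp gm : X → ℝ}
    (hgp : ∀ x ∈ Vp, MDifferentiableAt (𝓡 2) 𝓘(ℝ) gp x ∧ lieDeriv W gp x < a x)
    (hgm : ∀ x ∈ Vm, MDifferentiableAt (𝓡 2) 𝓘(ℝ) gm x ∧ a x < lieDeriv W gm x) :
    Kp = sinkSet W φ ∧ Km = sourceSet W φ := by
  have h1 := h.sinkSet_subset hMS hK hVm hgm
  have h2 : sourceSet W φ ⊆ Km := by
    rw [← h.sinkSet_reverse hMS]
    -- Time reversal exchanges `Kp` and `Km`, sink and source, and changes the signs of `a` and of
    -- the derivative along the field.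
    refine h.reverse.sinkSet_subset (h.morseSmale_reverse hMS) hK.reverse hVp (g := gp)
      fun x hx => ⟨(hgp x hx).1, ?_⟩
    rw [lieDeriv_neg_field, Pi.neg_apply]
    linarith [(hgp x hx).2]
  have hAR := h.isAttractorRepeller hMS
  have hinv : Inv φ Kp := fun t x hx => by
    rw [← hK.1.2.1 t]
    exact mem_image_of_mem _ hx
  have hinv' : Inv φ Km := by
    have h1 : Inv φ.reverse Km := fun t x hx => by
      rw [← hK.2.1.2.1 t]
      exact mem_image_of_mem _ hx
    have := h1.reverse
    rwa [reverse_reverse] at this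
  constructor
  -- An extra point of `Kp` would have its past tending both to the source, contained in `Km`, and
  -- to the closed invariant set `Kp`, disjoint from `Km`.
  · refine Subset.antisymm (fun x hx => ?_) h1
    by_contra hxs
    have hxr : x ∉ sourceSet W φ := fun h3 => Set.disjoint_left.1 hK.2.2.1 hx (h2 h3)
    exact (hAR.toPast x hxs hxr).not_disjoint (hinv.toPast hx) hAR.closed_L hK.1.1.isClosed
      (hK.2.2.1.symm.mono_left h2)
  · refine Subset.antisymm (fun x hx => ?_) h2
    by_contra hxs
    have hxr : x ∉ sinkSet W φ := fun h3 => Set.disjoint_left.1 hK.2.2.1 (h1 h3) hx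
    exact (hAR.toFut x hxr hxs).not_disjoint (hinv'.toFut hx) hAR.closed_K hK.2.1.1.isClosed
      (hK.2.2.1.mono_left h1)

end FoliationData

end Uniqueness

/-! ### Invariance of the Morse–Smale property under positive rescaling. -/

section TimeChange

variable {X : Type*} [TopologicalSpace X] [ChartedSpace Plane X] [IsManifold (𝓡 2) ∞ X]
  {W W₀ : ∀ x : X, TangentSpace (𝓡 2) x} {φ φ₀ : Flow ℝ X}
  {ρ ρ₀ : SmoothDensity (univ : Set X)} {a a₀ u g : X → ℝ} {x : X}
  [CompactSpace X] [T2Space X]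

lemma exists_pos_lower_bound (hu : Continuous u) (hpos : ∀ x, 0 < u x) :
    ∃ c > 0, ∀ x, c ≤ u x := by
  rcases isEmpty_or_nonempty X with h | h
  · exact ⟨1, one_pos, fun x => h.elim x⟩
  · obtain ⟨x, -, hx⟩ := isCompact_univ.exists_isMinOn (univ_nonempty (α := X)) hu.continuousOn
    exact ⟨u x, hpos x, fun y => hx (mem_univ y)⟩

/-- The flow of `u W₀` is a time change of the flow of `W₀`. -/
lemma exists_timeChange (hW : SmoothFieldOn W univ) (hφ : IsFlowOf φ W) (hφ₀ : IsFlowOf φ₀ W₀)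
    (hu : Continuous u) (hpos : ∀ x, 0 < u x) (hWu : ∀ x, W x = u x • W₀ x) (x : X) :
    ∃ τ : ℝ ≃o ℝ, τ 0 = 0 ∧ ∀ t, φ t x = φ₀ (τ t) x ∧ HasDerivAt τ (u (φ t x)) t := by
  have hui : Continuous fun y => (u y)⁻¹ := hu.inv₀ fun y => (hpos y).ne'
  -- The new time as a function of the old one; its inverse is the reparametrization.
  set σ : ℝ → ℝ := fun s => orbInt φ₀ (fun y => (u y)⁻¹) s x
  have hσ : ∀ s, HasDerivAt σ (u (φ₀ s x))⁻¹ s := fun s => hasDerivAt_orbInt hui s x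
  have hmono : StrictMono σ := strictMono_of_deriv_pos fun s => by
    rw [(hσ s).deriv]
    exact inv_pos.2 (hpos _)
  have hσc : Continuous σ := continuous_iff_continuousAt.2 fun s => (hσ s).continuousAt
  obtain ⟨c, hc, hcu⟩ := exists_pos_lower_bound hui fun y => inv_pos.2 (hpos y)
  -- `1 / u` is bounded below by compactness, so `σ` grows at least linearly in both directions and
  -- is onto.
  have hlin : Monotone fun s => σ s - c * s := by
    have h1 : ∀ s, HasDerivAt (fun s => σ s - c * s) ((u (φ₀ s x))⁻¹ - c) s := fun s =>
      ((hσ s).sub ((hasDerivAt_id s).const_mul c)).congr_deriv (by simp)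
    refine monotone_of_deriv_nonneg (fun s => (h1 s).differentiableAt) fun s => ?_
    rw [(h1 s).deriv]
    linarith [hcu (φ₀ s x)]
  have hσ0 : σ 0 = 0 := by simp [σ]
  have htop : Tendsto σ atTop atTop := by
    refine tendsto_atTop_mono' atTop ?_ (tendsto_id.const_mul_atTop hc)
    filter_upwards [eventually_ge_atTop 0] with s hs
    have := hlin hs
    simp only [hσ0, mul_zero, sub_zero, sub_nonneg] at this
    exact this
  have hbot : Tendsto σ atBot atBot := by
    refine tendsto_atBot_mono' atBot ?_ (tendsto_id.const_mul_atBot hc)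
    filter_upwards [eventually_le_atBot 0] with s hs
    have := hlin hs
    simp only [hσ0, mul_zero, sub_zero] at this
    simpa using this
  have hsurj : Function.Surjective σ := hσc.surjective htop hbot
  set E : ℝ ≃o ℝ := StrictMono.orderIsoOfSurjective σ hmono hsurj
  have hE : ∀ s, E s = σ s := fun s => rfl
  have hτ0 : E.symm 0 = 0 := by
    rw [OrderIso.symm_apply_eq, hE, hσ0]
  have hτ : ∀ t, HasDerivAt E.symm (u (φ₀ (E.symm t) x)) t := by
    intro t
    have h1 := HasDerivAt.of_local_left_inverse (f := σ) (g := E.symm)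
      E.symm.continuous.continuousAt (hσ (E.symm t)) (inv_ne_zero (hpos _).ne')
      (Eventually.of_forall fun s => E.apply_symm_apply s)
    rwa [inv_inv] at h1
  have hcurve : IsMIntegralCurve (fun t => φ₀ (E.symm t) x) W := by
    intro t
    have h1 := (hφ₀ x (E.symm t)).comp t (hτ t).hasFDerivAt.hasMFDerivAt
    have key : ∀ (w : Plane) (c : ℝ), (ContinuousLinearMap.smulRight (1 : ℝ →L[ℝ] ℝ) w).comp
        (ContinuousLinearMap.toSpanSingleton ℝ c) =
          ContinuousLinearMap.smulRight (1 : ℝ →L[ℝ] ℝ) (c • w) := by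
      intro w c
      ext
      simp
    have h2 := key (W₀ (φ₀ (E.symm t) x)) (u (φ₀ (E.symm t) x))
    rw [hWu]
    exact h1.congr_mfderiv h2
  have heq := isMIntegralCurve_Ioo_eq_of_contMDiff_boundaryless (t₀ := 0)
      ((contMDiffOn_univ.1 hW).of_le (by simp)) (hφ x) hcurve (by simp [hτ0])
  refine ⟨E.symm, hτ0, fun t => ?_⟩
  have h1 : φ t x = φ₀ (E.symm t) x := congrFun heq t
  exact ⟨h1, by rw [h1]; exact hτ t⟩

lemma chartField_smul (hWu : ∀ x, W x = u x • W₀ x) (e : OpenPartialHomeomorph X Plane)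
    (y : Plane) : chartField W e y = u (e.symm y) • chartField W₀ e y := by
  unfold chartField
  rw [hWu]
  exact map_smul (mfderiv (𝓡 2) 𝓘(ℝ, Plane) e (e.symm y)) _ _

lemma linearization_smul (hW₀ : SmoothFieldOn W₀ univ) (hu : MDifferentiable (𝓡 2) 𝓘(ℝ) u)
    (hWu : ∀ x, W x = u x • W₀ x) (hx : W₀ x = 0) :
    linearization W x = u x • linearization W₀ x := by
  unfold linearization
  rw [show chartField W (chartAt Plane x) = fun y => u ((chartAt Plane x).symm y) •
    chartField W₀ (chartAt Plane x) y from funext (chartField_smul hWu _)]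
  have h1 : DifferentiableAt ℝ (fun y => u ((chartAt Plane x).symm y)) (chartAt Plane x x) := by
    have h2 := (hu ((chartAt Plane x).symm (chartAt Plane x x))).comp _
      (mdifferentiableAt_atlas_symm (chart_mem_atlas _ _) (mem_chart_target Plane x))
    exact h2.differentiableAt
  rw [fderiv_fun_smul h1 (hasFDerivAt_chartField hW₀ x).differentiableAt,
    chartField_chartAt_eq_zero hx, (chartAt Plane x).left_inv (mem_chart_source Plane x)]
  simp

lemma pdet_smul (c : ℝ) (L : Plane →L[ℝ] Plane) : pdet (c • L) = c ^ 2 * pdet L := by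
  unfold pdet
  rw [det_plane, det_plane]
  simp
  ring

/-- Morse–Smale fields remain Morse–Smale if they are multiplied by a positive function. -/
lemma FoliationData.morseSmale_of_smul (h₀ : FoliationData W₀ φ₀ ρ₀ a₀) (h : FoliationData W φ ρ a)
    (hMS : IsMorseSmaleField W₀ φ₀) (hu : Continuous u) (hud : MDifferentiable (𝓡 2) 𝓘(ℝ) u)
    (hpos : ∀ x, 0 < u x) (hWu : ∀ x, W x = u x • W₀ x) (hg : MDifferentiable (𝓡 2) 𝓘(ℝ) g)
    (ha : ∀ x, a x = u x * (a₀ x - lieDeriv W₀ g x)) : IsMorseSmaleField W φ := by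
  have hz : ∀ x, W x = 0 ↔ W₀ x = 0 := fun x => by
    rw [hWu, smul_eq_zero]
    simp [(hpos x).ne']
  have hdet : ∀ x, W₀ x = 0 → pdet (linearization W x) =
      u x ^ 2 * pdet (linearization W₀ x) := fun x hx => by
    rw [linearization_smul h₀.smooth hud hWu hx, pdet_smul]
  have haz : ∀ x, W₀ x = 0 → a x = u x * a₀ x := fun x hx => by
    rw [ha x, lieDeriv_of_eq_zero g hx, sub_zero]
  have hsad : ∀ x, IsSaddle W x ↔ IsSaddle W₀ x := fun x => by
    rw [isSaddle_iff, isSaddle_iff, hz]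
    refine and_congr_right fun hx => ?_
    rw [hdet x hx, mul_neg_iff]
    have := pow_pos (hpos x) 2
    constructor
    · rintro (h1 | h1)
      · exact h1.2
      · linarith [h1.1]
    · exact fun h1 => Or.inl ⟨this, h1⟩
  choose τ hτ0 hτ using exists_timeChange h.smooth h.flow h₀.flow hu hpos hWu
  obtain ⟨c, hc, hcu⟩ := exists_pos_lower_bound hu hpos
  -- The bound is uniform in `x`: late times for the new flow are late for the old one, so wandering
  -- neighbourhoods persist although the reparametrization depends on the point.
  have hlin : ∀ x t, 0 ≤ t → c * t ≤ τ x t := by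
    intro x t ht
    have h1 : ∀ s, HasDerivAt (fun s => τ x s - c * s) (u (φ s x) - c) s := fun s =>
      ((hτ x s).2.sub ((hasDerivAt_id s).const_mul c)).congr_deriv (by simp)
    have h2 : Monotone fun s => τ x s - c * s :=
      monotone_of_deriv_nonneg (fun s => (h1 s).differentiableAt) fun s => by
        rw [(h1 s).deriv]
        linarith [hcu (φ s x)]
    have := h2 ht
    simp only [hτ0, mul_zero, sub_zero, sub_nonneg] at this
    exact this
  -- The two integrals differ by the variation of `g`, which vanishes on a closed orbit; so
  -- hyperbolicity of cycles is preserved.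
  have hint : ∀ x t, orbInt φ a t x = orbInt φ₀ a₀ (τ x t) x - (g (φ t x) - g x) := by
    intro x t
    have h1 : ∀ t, HasDerivAt (fun t => orbInt φ₀ a₀ (τ x t) x - (g (φ t x) - g x) -
        orbInt φ a t x) 0 t := by
      intro t
      have h2 : HasDerivAt (fun t => orbInt φ₀ a₀ (τ x t) x) (a₀ (φ₀ (τ x t) x) * u (φ t x)) t :=
        (hasDerivAt_orbInt h₀.continuous (τ x t) x).comp t (hτ x t).2
      have h3 := h.flow.hasDerivAt_lieDeriv t x (hg (φ t x))
      have h4 := hasDerivAt_orbInt (φ := φ) h.continuous t x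
      refine ((h2.sub (h3.sub_const (g x))).sub h4).congr_deriv ?_
      have h5 : lieDeriv W g (φ t x) = u (φ t x) * lieDeriv W₀ g (φ t x) := by
        unfold lieDeriv
        rw [hWu]
        exact map_smul (mfderiv (𝓡 2) 𝓘(ℝ) g (φ t x)) _ _
      rw [← (hτ x t).1, ha, h5]
      ring
    have h2 := is_const_of_deriv_eq_zero (fun t => (h1 t).differentiableAt)
      (fun t => (h1 t).deriv) t 0
    simp only [hτ0, orbInt_zero, Flow.map_zero_apply, sub_self] at h2
    linarith
  constructor
  · intro x hx
    have hx₀ : ¬ IsWandering φ₀ x := by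
      rintro ⟨U, hU, hev⟩
      refine hx ⟨U, hU, ?_⟩
      obtain ⟨t₀, ht₀⟩ := eventually_atTop.1 hev
      filter_upwards [eventually_ge_atTop (max 0 (t₀ / c))] with t ht
      refine eq_empty_iff_forall_notMem.2 ?_
      rintro _ ⟨⟨y, hy, rfl⟩, hyU⟩
      have h1 : t₀ ≤ τ y t := by
        refine le_trans ?_ (hlin y t ((le_max_left _ _).trans ht))
        have := (le_max_right _ _).trans ht
        rw [div_le_iff₀ hc] at this
        linarith
      rw [(hτ y t).1] at hyU
      exact eq_empty_iff_forall_notMem.1 (ht₀ _ h1) _ ⟨⟨y, hy, rfl⟩, hyU⟩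
    rcases hMS.1 x hx₀ with h1 | h1
    · left
      have h2 := pow_pos (hpos x) 2
      rcases h₀.isHyperbolicPoint_cases h1 with h3 | h3 | h3
      · have h4 := h₀.isAttractingPoint_iff.1 h3
        have h5 : IsAttractingPoint W x := h.isAttractingPoint_iff.2 ⟨(hz x).2 h4.1, by
          rw [hdet x h4.1]; exact mul_pos h2 h4.2.1, by
          rw [haz x h4.1]; exact mul_pos (hpos x) h4.2.2⟩
        exact ⟨h5.1, fun μ hμ => (h5.2 μ hμ).ne⟩
      · have h4 := h₀.isRepellingPoint_iff.1 h3
        have h5 : IsRepellingPoint W x := h.isRepellingPoint_iff.2 ⟨(hz x).2 h4.1, by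
          rw [hdet x h4.1]; exact mul_pos h2 h4.2.1, by
          rw [haz x h4.1]; exact mul_neg_of_pos_of_neg (hpos x) h4.2.2⟩
        exact ⟨h5.1, fun μ hμ => (h5.2 μ hμ).ne'⟩
      · exact ((hsad x).2 h3).1
    · right
      obtain ⟨T₀, hT₀, h2⟩ := h₀.onHyperbolicCycle_iff.1 h1
      have hfix : φ ((τ x).symm T₀) x = x := by
        rw [(hτ x _).1, OrderIso.apply_symm_apply, hT₀.2.2.1]
      have hsymm0 : (τ x).symm 0 = 0 := by
        rw [OrderIso.symm_apply_eq, hτ0]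
      refine h.onHyperbolicCycle_iff.2 ⟨(τ x).symm T₀, ⟨fun h3 => hT₀.1 ((hz x).1 h3), ?_, hfix,
        fun s hs hsT => ?_⟩, ?_⟩
      · rw [← hsymm0]
        exact (τ x).symm.strictMono hT₀.2.1
      · rw [(hτ x s).1]
        refine hT₀.2.2.2 _ ?_ ?_
        · have := (τ x).strictMono hs
          rwa [hτ0] at this
        · have := (τ x).strictMono hsT
          rwa [OrderIso.apply_symm_apply] at this
      · rw [hint, hfix, OrderIso.apply_symm_apply, sub_self, sub_zero]
        exact h2
  · rintro x p q hx hp hq ⟨h1, h2⟩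
    have heq : ∀ s, φ₀ s x = φ ((τ x).symm s) x := fun s => by
      rw [(hτ x _).1, OrderIso.apply_symm_apply]
    refine hMS.2 x p q (fun h3 => hx ((hz x).2 h3)) ((hsad p).1 hp) ((hsad q).1 hq) ⟨?_, ?_⟩
    · exact (Tendsto.comp h1 (τ x).symm.tendsto_atBot).congr fun s => (heq s).symm
    · exact (Tendsto.comp h2 (τ x).symm.tendsto_atTop).congr fun s => (heq s).symm

end TimeChange

/-! ### Lipschitz regularity of weighted averages. -/

section LocallyLipschitz

open Metric

variable {X : Type*} [TopologicalSpace X] [ChartedSpace Plane X] [IsManifold (𝓡 2) ∞ X]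
  {W : ∀ x : X, TangentSpace (𝓡 2) x} {φ : Flow ℝ X}
  {e : OpenPartialHomeomorph X Plane} {x : X}
  {E G : Type*} [NormedAddCommGroup E] [NormedSpace ℝ E] [NormedAddCommGroup G] [NormedSpace ℝ G]

/-- Functions that are Lipschitz near a point, in charts. -/
def LocLipAt (F : X → E) (x : X) : Prop :=
  ∀ e ∈ atlas Plane X, x ∈ e.source →
    ∃ K, ∃ s ∈ 𝓝 (e x), LipschitzOnWith K (F ∘ e.symm) s

lemma LocLipAt.comp_strictDiffAt {F : X → E} {f : X → X} (hF : LocLipAt F (f x))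
    (hf : StrictDiffAt f x) (hfc : ContinuousAt f x) : LocLipAt (F ∘ f) x := by
  intro e he hx
  set e' := chartAt Plane (f x)
  have he' : e' ∈ atlas Plane X := chart_mem_atlas _ _
  have hx' : f x ∈ e'.source := mem_chart_source Plane (f x)
  obtain ⟨K, s, hs, hK⟩ := hF e' he' hx'
  obtain ⟨L, hL⟩ := hf e he e' he' hx hx'
  obtain ⟨K', t, ht, hK'⟩ := hL.exists_lipschitzOnWith
  have h1 : ∀ᶠ u in 𝓝 (e x), f (e.symm u) ∈ e'.source :=
    eventually_chart hx (hfc.eventually_mem (e'.open_source.mem_nhds hx'))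
  have h2 : ∀ᶠ u in 𝓝 (e x), (e' ∘ f ∘ e.symm) u ∈ s := by
    refine hL.continuousAt.eventually_mem ?_
    simpa [e.left_inv hx] using hs
  refine ⟨K * K', _, inter_mem ht (inter_mem h1 h2), ?_⟩
  have h3 := hK.comp (hK'.mono inter_subset_left) (fun u hu => hu.2.2 :
    MapsTo (e' ∘ f ∘ e.symm) (t ∩ ({u | f (e.symm u) ∈ e'.source} ∩
      {u | (e' ∘ f ∘ e.symm) u ∈ s})) s)
  intro u hu v hv
  have := h3 hu hv
  simpa [e'.left_inv hu.2.1, e'.left_inv hv.2.1] using this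

lemma LocLipAt.of_exists {F : X → E} (he : e ∈ atlas Plane X) (hx : x ∈ e.source)
    (hF : ∃ K, ∃ s ∈ 𝓝 (e x), LipschitzOnWith K (F ∘ e.symm) s) : LocLipAt F x := by
  intro e' he' hx'
  obtain ⟨K, s, hs, hK⟩ := hF
  have hc := contDiffAt_transition he' he hx' hx
  obtain ⟨K', t, ht, hK'⟩ := (hc.of_le (m := 1) (by norm_cast)).exists_lipschitzOnWith
  have h1 : ∀ᶠ u in 𝓝 (e' x), e'.symm u ∈ e.source :=
    eventually_chart hx' (e.open_source.mem_nhds hx)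
  have h2 : ∀ᶠ u in 𝓝 (e' x), (e ∘ e'.symm) u ∈ s := by
    refine hc.continuousAt.eventually_mem ?_
    simpa [e'.left_inv hx'] using hs
  refine ⟨K * K', _, inter_mem ht (inter_mem h1 h2), ?_⟩
  have h3 := hK.comp (hK'.mono inter_subset_left) (fun u hu => hu.2.2 :
    MapsTo (e ∘ e'.symm) (t ∩ ({u | e'.symm u ∈ e.source} ∩ {u | (e ∘ e'.symm) u ∈ s})) s)
  intro u hu v hv
  have := h3 hu hv
  simpa [e.left_inv hu.2.1, e.left_inv hv.2.1] using this

lemma LocLipAt.of_contDiffAt {F : X → E}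
    (hF : ∀ e ∈ atlas Plane X, x ∈ e.source → ContDiffAt ℝ 1 (F ∘ e.symm) (e x)) :
    LocLipAt F x :=
  fun e he hx => (hF e he hx).exists_lipschitzOnWith

lemma _root_.ContMDiffAt.contDiffAt_chart {n : ℕ∞} {F : X → E}
    (hF : ContMDiffAt (𝓡 2) 𝓘(ℝ, E) n F x) (he : e ∈ atlas Plane X) (hx : x ∈ e.source) :
    ContDiffAt ℝ n (F ∘ e.symm) (e x) := by
  have h1 := ((contMDiffOn_atlas_symm he).contMDiffAt (e.open_target.mem_nhds
    (e.map_source hx))).of_le (m := n) (by exact_mod_cast le_top)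
  have h2 : ContMDiffAt (𝓡 2) 𝓘(ℝ, E) n F (e.symm (e x)) := by rwa [e.left_inv hx]
  exact (h2.comp (e x) h1).contDiffAt

lemma LocLipAt.prodMk {F : X → E} {H : X → G} (hF : LocLipAt F x) (hH : LocLipAt H x) :
    LocLipAt (fun x => (F x, H x)) x := by
  intro e he hx
  obtain ⟨K, s, hs, hK⟩ := hF e he hx
  obtain ⟨K', s', hs', hK'⟩ := hH e he hx
  exact ⟨_, _, inter_mem hs hs', (hK.mono inter_subset_left).prodMk (hK'.mono inter_subset_right)⟩

lemma LocLipAt.comp_contDiffAt {F : X → E} {Φ : E → G} (hF : LocLipAt F x)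
    (hΦ : ContDiffAt ℝ 1 Φ (F x)) : LocLipAt (Φ ∘ F) x := by
  intro e he hx
  obtain ⟨K, s, hs, hK⟩ := hF e he hx
  obtain ⟨K', t, ht, hK'⟩ := hΦ.exists_lipschitzOnWith
  have hc : ContinuousAt (F ∘ e.symm) (e x) := hK.continuousOn.continuousAt hs
  have h2 : ∀ᶠ u in 𝓝 (e x), (F ∘ e.symm) u ∈ t := by
    refine hc.eventually_mem ?_
    simpa [e.left_inv hx] using ht
  exact ⟨K' * K, _, inter_mem hs h2, hK'.comp (hK.mono inter_subset_left) fun u hu => hu.2⟩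

/-- In a chart the divergence is a quotient of smooth functions. This supplies the regularity of
`a`, which `FoliationData` only requires to be continuous. -/
lemma HasDivergence.contDiffAt {ρ : SmoothDensity (univ : Set X)} {b : X → ℝ}
    (h : HasDivergence ρ W b) (hW : SmoothFieldOn W univ) (he : e ∈ atlas Plane X)
    (hx : x ∈ e.source) : ContDiffAt ℝ ∞ (b ∘ e.symm) (e x) := by
  have hρ : ContDiffAt ℝ ∞ (ρ.toFun e) (e x) := by
    have := ρ.smooth e he
    simp only [preimage_univ, inter_univ] at this
    exact this.contDiffAt (e.open_target.mem_nhds (e.map_source hx))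
  have h1 : ContDiffAt ℝ ∞ (fun y => ρ.toFun e y • chartField W e y) (e x) :=
    hρ.smul (contDiffAt_chartField hW he (e.map_source hx))
  have h2 : ContDiffAt ℝ ∞ (fderiv ℝ fun y => ρ.toFun e y • chartField W e y) (e x) :=
    h1.fderiv_right (m := ∞) (by norm_cast)
  have h3 : ContDiffAt ℝ ∞ (fun u => LinearMap.trace ℝ Plane
      (fderiv ℝ (fun y => ρ.toFun e y • chartField W e y) u : Plane →ₗ[ℝ] Plane) /
        ρ.toFun e u) (e x) := by
    refine ContDiffAt.div ?_ hρ (ρ.pos e he _ ⟨e.map_source hx, mem_univ _⟩).ne'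
    simp only [trace_plane]
    have hi : ∀ i : Fin 2, ContDiffAt ℝ ∞ (fun u =>
        fderiv ℝ (fun y => ρ.toFun e y • chartField W e y) u (EuclideanSpace.single i 1) i)
        (e x) := fun i => by
      have h4 : ContDiffAt ℝ ∞ (fun u =>
        fderiv ℝ (fun y => ρ.toFun e y • chartField W e y) u (EuclideanSpace.single i (1 : ℝ)))
        (e x) := h2.clm_apply contDiffAt_const
      exact (contDiff_piLp_apply (p := 2) (𝕜 := ℝ) (E := fun _ : Fin 2 => ℝ)
        (i := i)).contDiffAt.comp (e x) h4
    exact (hi 0).add (hi 1)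
  refine h3.congr_of_eventuallyEq ?_
  filter_upwards [e.open_target.mem_nhds (e.map_source hx)] with u hu
  have h5 := h e he (e.symm u) (e.map_target hu)
  rw [e.right_inv hu] at h5
  rw [h5]
  exact (mul_div_cancel_right₀ _ (ρ.pos e he _ ⟨hu, mem_univ _⟩).ne').symm

/-- The flow is Lipschitz in a chart for small times. -/
lemma IsFlowOf.exists_lipschitz (hφ : IsFlowOf φ W) (hW : SmoothFieldOn W univ)
    (he : e ∈ atlas Plane X) (hx : x ∈ e.source) {N : Set X} (hN : N ∈ 𝓝 x) :
    ∃ C, 0 ≤ C ∧ ∃ δ > 0, ∃ U : Set Plane, IsOpen U ∧ e x ∈ U ∧ U ⊆ e.target ∧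
      ∀ s ∈ Icc (0 : ℝ) δ, ∀ u ∈ U, φ s (e.symm u) ∈ N ∩ e.source ∧ ∀ v ∈ U,
        ‖e (φ s (e.symm u)) - e (φ s (e.symm v))‖ ≤ C * ‖u - v‖ := by
  obtain ⟨r, K, M, hB⟩ := exists_fieldBounds (contDiffAt_chartField hW he (e.map_source hx))
  have hN' : N ∩ e.source ∩ e ⁻¹' ball (e x) r ∈ 𝓝 x :=
    inter_mem (inter_mem hN (e.open_source.mem_nhds hx))
      ((e.continuousAt hx).preimage_mem_nhds (ball_mem_nhds _ hB.r_pos))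
  have hcont : ContinuousAt (fun q : ℝ × X => φ q.1 q.2) (0, x) :=
    (φ.cont'.continuousAt (x := (0, x)))
  have hev : ∀ᶠ q in 𝓝 ((0 : ℝ), x), φ q.1 q.2 ∈ N ∩ e.source ∩ e ⁻¹' ball (e x) r := by
    refine hcont.eventually_mem ?_
    simpa using hN'
  rw [nhds_prod_eq] at hev
  obtain ⟨pa, hpa, pb, hpb, hab⟩ := Filter.eventually_prod_iff.1 hev
  obtain ⟨δ₁, hδ₁, hδ₁'⟩ := Metric.eventually_nhds_iff.1 hpa
  obtain ⟨U₀, hU₀, hU₀o, hxU₀⟩ := mem_nhds_iff.1 hpb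
  have hstay : ∀ y ∈ U₀, ∀ s ∈ Icc (0 : ℝ) (δ₁ / 2), φ s y ∈ N ∩ e.source ∩ e ⁻¹' ball (e x) r := by
    intro y hy s hs
    refine hab (hδ₁' ?_) (hU₀ hy)
    rw [Real.dist_eq, sub_zero, abs_of_nonneg hs.1]
    linarith [hs.2]
  have hΦ : ∀ y ∈ e.target ∩ e.symm ⁻¹' U₀, ∀ s ∈ Icc 0 (δ₁ / 2),
      e (φ s (e.symm y)) ∈ ball (e x) r ∧
      HasDerivAt (fun s => e (φ s (e.symm y))) (chartField W e (e (φ s (e.symm y)))) s :=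
    fun y hy s hs => ⟨(hstay _ hy.2 s hs).2,
      hφ.hasDerivAt_chart he s (e.symm y) (hstay _ hy.2 s hs).1.2⟩
  have h0 : ∀ y ∈ e.target ∩ e.symm ⁻¹' U₀, e (φ 0 (e.symm y)) = y := fun y hy => by
    rw [Flow.map_zero_apply, e.right_inv hy.1]
  refine ⟨Real.exp (K * (δ₁ / 2)), (Real.exp_pos _).le, δ₁ / 2, by positivity,
    e.target ∩ e.symm ⁻¹' U₀, e.isOpen_inter_preimage_symm hU₀o,
    ⟨e.map_source hx, by simpa [e.left_inv hx] using hxU₀⟩, inter_subset_left,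
    fun s hs u hu => ⟨(hstay _ hu.2 s hs).1, fun v hv => ?_⟩⟩
  refine (hB.norm_flow_sub_le (Φ := fun s y => e (φ s (e.symm y))) hΦ h0 hu hv hs).trans ?_
  rw [mul_comm]
  have h1 : K * s ≤ K * (δ₁ / 2) := mul_le_mul_of_nonneg_left hs.2 hB.K_pos.le
  gcongr

lemma abs_exp_sub_exp_le {p q B : ℝ} (hp : |p| ≤ B) (hq : |q| ≤ B) :
    |Real.exp p - Real.exp q| ≤ Real.exp B * |p - q| := by
  have := (convex_Icc (-B) B).norm_image_sub_le_of_norm_hasDerivWithin_le (f := Real.exp)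
    (f' := Real.exp) (C := Real.exp B) (fun x _ => (Real.hasDerivAt_exp x).hasDerivWithinAt)
    (fun x hx => by
      rw [Real.norm_eq_abs, abs_of_pos (Real.exp_pos x)]
      exact Real.exp_le_exp.2 hx.2) (abs_le.1 hq) (abs_le.1 hp)
  simpa using this

lemma abs_integral_sub_le {p q : ℝ → ℝ} (hp : Continuous p) (hq : Continuous q) {T C : ℝ}
    (hT : 0 ≤ T) (h : ∀ s ∈ Icc 0 T, |p s - q s| ≤ C) :
    |(∫ s in (0 : ℝ)..T, p s) - ∫ s in (0 : ℝ)..T, q s| ≤ T * C := by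
  rw [← intervalIntegral.integral_sub (hp.intervalIntegrable _ _) (hq.intervalIntegrable _ _)]
  have := intervalIntegral.norm_integral_le_of_norm_le_const (a := 0) (b := T) (C := C)
    (f := fun s => p s - q s) (fun s hs => by
      rw [uIoc_of_le hT] at hs
      exact h s (Ioc_subset_Icc_self hs))
  rw [sub_zero, abs_of_nonneg hT, mul_comm] at this
  exact this

/-- Orbit integrals and weighted averages are Lipschitz, for small times. -/
lemma IsFlowOf.exists_locLip [CompactSpace X] (hφ : IsFlowOf φ W) (hW : SmoothFieldOn W univ) {a f₀ : X → ℝ}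
    (ha : Continuous a) (hf₀ : Continuous f₀) {A : ℝ} (hA : ∀ x, |a x| ≤ A)
    (hf₁ : ∀ x, |f₀ x| ≤ 1) (haL : ∀ x, LocLipAt a x)
    (hfL : ∀ x, LocLipAt f₀ x) (x : X) : ∃ δ > 0, ∃ U ∈ 𝓝 x, ∀ y ∈ U, ∀ t ∈ Icc (0 : ℝ) δ,
      LocLipAt (fun y => Real.exp (orbInt φ a t y)) y ∧ LocLipAt (weightedAverage φ a f₀ t) y := by
  set e := chartAt Plane x
  have he : e ∈ atlas Plane X := chart_mem_atlas _ _
  have hx : x ∈ e.source := mem_chart_source Plane x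
  obtain ⟨K₁, s₁, hs₁, hK₁⟩ := haL x e he hx
  obtain ⟨K₂, s₂, hs₂, hK₂⟩ := hfL x e he hx
  obtain ⟨C, hC, δ, hδ, U, hU, hxU, hUt, hst⟩ := hφ.exists_lipschitz hW he hx
    ((e.continuousAt hx).preimage_mem_nhds (inter_mem hs₁ hs₂))
  have hA0 : 0 ≤ A := (abs_nonneg _).trans (hA x)
  -- Four Lipschitz bounds, uniform for times up to `δ`: for `a` and `f₀` along trajectories, then
  -- for the exponential weight, then for the average by splitting a difference of products.
  have key₁ : ∀ s ∈ Icc 0 δ, ∀ u ∈ U, ∀ v ∈ U,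
      |a (φ s (e.symm u)) - a (φ s (e.symm v))| ≤ K₁ * C * ‖u - v‖ := by
    intro s hs u hu v hv
    have h1 := hst s hs u hu
    have h2 := hst s hs v hv
    have h3 := hK₁.dist_le_mul _ h1.1.1.1 _ h2.1.1.1
    simp only [Function.comp, e.left_inv h1.1.2, e.left_inv h2.1.2] at h3
    rw [Real.dist_eq, dist_eq_norm] at h3
    refine h3.trans ?_
    rw [mul_assoc]
    exact mul_le_mul_of_nonneg_left (h1.2 v hv) K₁.2
  have key₂ : ∀ s ∈ Icc 0 δ, ∀ u ∈ U, ∀ v ∈ U,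
      |f₀ (φ s (e.symm u)) - f₀ (φ s (e.symm v))| ≤ K₂ * C * ‖u - v‖ := by
    intro s hs u hu v hv
    have h1 := hst s hs u hu
    have h2 := hst s hs v hv
    have h3 := hK₂.dist_le_mul _ h1.1.1.2 _ h2.1.1.2
    simp only [Function.comp, e.left_inv h1.1.2, e.left_inv h2.1.2] at h3
    rw [Real.dist_eq, dist_eq_norm] at h3
    refine h3.trans ?_
    rw [mul_assoc]
    exact mul_le_mul_of_nonneg_left (h1.2 v hv) K₂.2
  have horb : ∀ t ∈ Icc 0 δ, ∀ y, |orbInt φ a t y| ≤ A * δ := fun t ht y =>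
    (abs_orbInt_le hA t ht.1 y).trans (mul_le_mul_of_nonneg_left ht.2 hA0)
  have hca : ∀ y, Continuous fun s => a (φ s y) := fun y =>
    ha.comp (φ.continuous continuous_id continuous_const)
  have hcf : ∀ y, Continuous fun s => f₀ (φ s y) := fun y =>
    hf₀.comp (φ.continuous continuous_id continuous_const)
  have hco : ∀ y, Continuous fun s => Real.exp (orbInt φ a s y) := fun y =>
    Real.continuous_exp.comp ((continuous_orbInt ha).comp (continuous_id.prodMk continuous_const))
  have key₃ : ∀ t ∈ Icc 0 δ, ∀ u ∈ U, ∀ v ∈ U,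
      |Real.exp (orbInt φ a t (e.symm u)) - Real.exp (orbInt φ a t (e.symm v))| ≤
        Real.exp (A * δ) * (δ * (K₁ * C)) * ‖u - v‖ := by
    intro t ht u hu v hv
    have h1 : |orbInt φ a t (e.symm u) - orbInt φ a t (e.symm v)| ≤ t * (K₁ * C * ‖u - v‖) :=
      abs_integral_sub_le (hca _) (hca _) ht.1 fun s hs =>
        key₁ s ⟨hs.1, hs.2.trans ht.2⟩ u hu v hv
    have h2 : t * (K₁ * C * ‖u - v‖) ≤ δ * (K₁ * C * ‖u - v‖) :=
      mul_le_mul_of_nonneg_right ht.2 (by positivity)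
    calc _ ≤ Real.exp (A * δ) * |orbInt φ a t (e.symm u) - orbInt φ a t (e.symm v)| :=
          abs_exp_sub_exp_le (horb t ht _) (horb t ht _)
      _ ≤ Real.exp (A * δ) * (δ * (K₁ * C * ‖u - v‖)) :=
          mul_le_mul_of_nonneg_left (h1.trans h2) (Real.exp_pos _).le
      _ = _ := by ring
  set D := Real.exp (A * δ) * (δ * (K₁ * C)) + Real.exp (A * δ) * (K₂ * C) with hD
  have key₄ : ∀ t ∈ Icc 0 δ, ∀ u ∈ U, ∀ v ∈ U,
      |weightedAverage φ a f₀ t (e.symm u) - weightedAverage φ a f₀ t (e.symm v)| ≤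
        δ * D * ‖u - v‖ := by
    intro t ht u hu v hv
    have h1 : |weightedAverage φ a f₀ t (e.symm u) - weightedAverage φ a f₀ t (e.symm v)| ≤
        t * (D * ‖u - v‖) := by
      refine abs_integral_sub_le ((hco _).mul (hcf _)) ((hco _).mul (hcf _)) ht.1 fun s hs => ?_
      have hs' : s ∈ Icc 0 δ := ⟨hs.1, hs.2.trans ht.2⟩
      set E₁ := Real.exp (orbInt φ a s (e.symm u))
      set E₂ := Real.exp (orbInt φ a s (e.symm v)) with hE₂
      set F₁ := f₀ (φ s (e.symm u))
      set F₂ := f₀ (φ s (e.symm v))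
      have h3 : |E₂| ≤ Real.exp (A * δ) := by
        rw [hE₂, abs_of_pos (Real.exp_pos _)]
        exact Real.exp_le_exp.2 (abs_le.1 (horb s hs' _)).2
      have h4 : |(E₁ - E₂) * F₁| ≤ Real.exp (A * δ) * (δ * (K₁ * C)) * ‖u - v‖ * 1 := by
        rw [abs_mul]
        exact mul_le_mul (key₃ s hs' u hu v hv) (hf₁ _) (abs_nonneg _) (by positivity)
      have h5 : |E₂ * (F₁ - F₂)| ≤ Real.exp (A * δ) * (K₂ * C * ‖u - v‖) := by
        rw [abs_mul]
        exact mul_le_mul h3 (key₂ s hs' u hu v hv) (abs_nonneg _) (Real.exp_pos _).le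
      calc |E₁ * F₁ - E₂ * F₂| = |(E₁ - E₂) * F₁ + E₂ * (F₁ - F₂)| := by ring_nf
        _ ≤ _ := abs_add_le _ _
        _ ≤ _ := add_le_add h4 h5
        _ = D * ‖u - v‖ := by rw [hD]; ring
    refine h1.trans ?_
    rw [mul_assoc]
    exact mul_le_mul_of_nonneg_right ht.2 (by positivity)
  refine ⟨δ, hδ, e.source ∩ e ⁻¹' U, inter_mem (e.open_source.mem_nhds hx)
    ((e.continuousAt hx).preimage_mem_nhds (hU.mem_nhds hxU)), fun y hy t ht => ⟨?_, ?_⟩⟩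
  · refine LocLipAt.of_exists he hy.1 ⟨⟨Real.exp (A * δ) * (δ * (K₁ * C)), by positivity⟩, U,
      hU.mem_nhds hy.2, LipschitzOnWith.of_dist_le_mul fun u hu v hv => ?_⟩
    rw [Real.dist_eq, dist_eq_norm]
    exact key₃ t ht u hu v hv
  · refine LocLipAt.of_exists he hy.1 ⟨⟨δ * D, by positivity⟩, U, hU.mem_nhds hy.2,
      LipschitzOnWith.of_dist_le_mul fun u hu v hv => ?_⟩
    rw [Real.dist_eq, dist_eq_norm]
    exact key₄ t ht u hu v hv

/-- The cocycle relation that reduces a long average to short ones, composed with the strictly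
differentiable short-time flow. -/
lemma weightedAverage_add {a f₀ : X → ℝ} (ha : Continuous a) (hf₀ : Continuous f₀) (t T : ℝ)
    (x : X) : weightedAverage φ a f₀ (t + T) x = weightedAverage φ a f₀ t x +
      Real.exp (orbInt φ a t x) * weightedAverage φ a f₀ T (φ t x) := by
  have hc : ∀ y, Continuous fun s => Real.exp (orbInt φ a s y) * f₀ (φ s y) := fun y =>
    (Real.continuous_exp.comp ((continuous_orbInt ha).comp
      (continuous_id.prodMk continuous_const))).mul
      (hf₀.comp (φ.continuous continuous_id continuous_const))
  unfold weightedAverage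
  rw [← intervalIntegral.integral_add_adjacent_intervals ((hc x).intervalIntegrable 0 t)
    ((hc x).intervalIntegrable t (t + T)), ← intervalIntegral.integral_const_mul]
  congr 1
  have := intervalIntegral.integral_comp_add_right (a := 0) (b := T)
    (fun s => Real.exp (orbInt φ a s x) * f₀ (φ s x)) t
  rw [zero_add, add_comm T t] at this
  rw [← this]
  refine intervalIntegral.integral_congr fun s _ => ?_
  rw [orbInt_add ha, Flow.map_add, Real.exp_add, mul_assoc]

/-- Weighted averages of Lipschitz functions are Lipschitz. -/
lemma FoliationData.locLipAt_weightedAverage [CompactSpace X] [T2Space X] {ρ : SmoothDensity (univ : Set X)}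
    {a f₀ : X → ℝ} (h : FoliationData W φ ρ a)
    (hf₀ : Continuous f₀) (hf₁ : ∀ x, |f₀ x| ≤ 1) (hfL : ∀ x, LocLipAt f₀ x) {T : ℝ} (hT : 0 ≤ T)
    (x : X) : LocLipAt (weightedAverage φ a f₀ T) x := by
  have ha := h.continuous
  obtain ⟨A, -, hA⟩ := exists_abs_le ha
  have haL : ∀ x, LocLipAt a x := fun x => LocLipAt.of_contDiffAt fun e he hx => by
    have h1 := (h.divergence.contDiffAt h.smooth he hx).neg
    have h2 : (fun y => -((-a) ∘ e.symm) y) = a ∘ e.symm := by ext; simp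
    rw [h2] at h1
    exact h1.of_le (by norm_cast)
  choose δ hδ U hU hL using h.flow.exists_locLip h.smooth ha hf₀ hA hf₁ haL hfL
  obtain ⟨s, hs⟩ := CompactSpace.elim_nhds_subcover U hU
  obtain ⟨d, hd, hds⟩ : ∃ d > 0, ∀ y ∈ s, d ≤ δ y := by
    rcases s.eq_empty_or_nonempty with rfl | hne
    · exact ⟨1, one_pos, by simp⟩
    · obtain ⟨y, hy, hy'⟩ := s.exists_min_image δ hne
      exact ⟨δ y, hδ y, hy'⟩
  have hloc : ∀ t ∈ Icc 0 d, ∀ y, LocLipAt (fun y => Real.exp (orbInt φ a t y)) y ∧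
      LocLipAt (weightedAverage φ a f₀ t) y := by
    intro t ht y
    obtain ⟨z, hz, hyz⟩ := mem_iUnion₂.1 (hs.ge (mem_univ y))
    exact hL z y hyz t ⟨ht.1, ht.2.trans (hds z hz)⟩
  obtain ⟨n, hn⟩ := exists_nat_gt (T / d)
  have hn0 : (0 : ℝ) < n := lt_of_le_of_lt (by positivity) hn
  have ht : T / n ∈ Icc 0 d := by
    refine ⟨by positivity, ?_⟩
    rw [div_le_iff₀ hn0]
    rw [div_lt_iff₀ hd] at hn
    linarith
  -- The step `T / n` is within the uniform short time `d`; add one step at a time.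
  have hind : ∀ (k : ℕ) (x : X), LocLipAt (weightedAverage φ a f₀ (k * (T / n))) x := by
    intro k
    induction k with
    | zero => exact fun x => by simpa using (hloc 0 ⟨le_rfl, hd.le⟩ x).2
    | succ k ih =>
      intro x
      have h1 : (((k + 1 : ℕ) : ℝ)) * (T / n) = T / n + k * (T / n) := by push_cast; ring
      rw [h1]
      have hsd : StrictDiffAt (φ (T / n)) x := (h.hasJacobian ht.1 x).1
      have h2 := (ih (φ (T / n) x)).comp_strictDiffAt hsd (φ.continuous_toFun _).continuousAt
      have h3 := ((hloc _ ht x).2.prodMk ((hloc _ ht x).1.prodMk h2)).comp_contDiffAt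
        (Φ := fun p : ℝ × ℝ × ℝ => p.1 + p.2.1 * p.2.2) (by fun_prop)
      have h4 : (fun p : ℝ × ℝ × ℝ => p.1 + p.2.1 * p.2.2) ∘ (fun x =>
          (weightedAverage φ a f₀ (T / n) x, Real.exp (orbInt φ a (T / n) x),
            (weightedAverage φ a f₀ (k * (T / n)) ∘ φ (T / n)) x)) =
          weightedAverage φ a f₀ (T / n + k * (T / n)) := by
        ext y
        exact (weightedAverage_add ha hf₀ _ _ y).symm
      rwa [h4] at h3
  have := hind n x
  rwa [mul_div_cancel₀ _ hn0.ne'] at this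

end LocallyLipschitz

/-! ### Friedrichs mollification along a vector field. -/

section Mollification

open Metric MeasureTheory

variable {E : Type*} [NormedAddCommGroup E] [NormedSpace ℝ E] [FiniteDimensional ℝ E]
  [MeasurableSpace E] [BorelSpace E]

open scoped Convolution in
/-- Mollification commutes with differentiation along a continuous field, up to a small error. -/
lemma exists_mollification {f : E → ℝ} {K : NNReal} (hf : LipschitzWith K f) {F : E → E} {b : E → ℝ}
    {p : E} {R : ℝ} (hR : 0 < R) (hF : ContinuousOn F (closedBall p R))
    (hb : ContinuousOn b (closedBall p R))
    (hd : ∀ w ∈ ball p R, DifferentiableAt ℝ f w → fderiv ℝ f w (F w) = b w) {ε : ℝ} (hε : 0 < ε) :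
    ∃ g, ContDiff ℝ ∞ g ∧ ∀ y ∈ ball p (R / 2), |g y - f y| ≤ ε ∧
      |fderiv ℝ g y (F y) - b y| ≤ ε := by
  -- Dividing by `K + 1` instead of `K` covers a vanishing Lipschitz constant.
  have hK1 : (0 : ℝ) < K + 1 := by positivity
  obtain ⟨δ₁, hδ₁, h1⟩ := Metric.uniformContinuousOn_iff.1
    ((isCompact_closedBall p R).uniformContinuousOn_of_continuous hF) (ε / (2 * (K + 1)))
    (by positivity)
  obtain ⟨δ₂, hδ₂, h2⟩ := Metric.uniformContinuousOn_iff.1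
    ((isCompact_closedBall p R).uniformContinuousOn_of_continuous hb) (ε / 2) (by positivity)
  -- The four bounds control the oscillation of `F`, that of `b`, the error in the values of `f`,
  -- and the requirement that `y - z` stay in the large ball.
  set δ := min (min δ₁ δ₂) (min (ε / (K + 1)) (R / 2))
  have hδ : 0 < δ := lt_min (lt_min hδ₁ hδ₂) (lt_min (by positivity) (by positivity))
  let φ : ContDiffBump (0 : E) := ⟨δ / 2, δ, by positivity, by linarith⟩
  set μ : Measure E := Measure.addHaar
  set η := φ.normed μ
  have hη0 : ∀ z, 0 ≤ η z := fun z => φ.nonneg_normed z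
  have hηi : Integrable η μ := φ.integrable_normed
  have hη1 : ∫ z, η z ∂μ = 1 := φ.integral_normed
  have hηs : ∀ z, η z ≠ 0 → ‖z‖ < δ := by
    intro z hz
    have h3 : z ∈ Function.support (φ.normed μ) := hz
    rw [φ.support_normed_eq] at h3
    simpa using h3
  set g : E → ℝ := η ⋆[ContinuousLinearMap.lsmul ℝ ℝ, μ] f with hg
  have hgs : ContDiff ℝ ∞ g := (φ.hasCompactSupport_normed (μ := μ)).contDiff_convolution_left _
    φ.contDiff_normed hf.continuous.locallyIntegrable
  have hcc : ∀ (q : E → ℝ), Continuous q → Integrable (fun z => η z * q z) μ := fun q hq =>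
    (φ.continuous_normed.mul hq).integrable_of_hasCompactSupport
      (φ.hasCompactSupport_normed (μ := μ)).mul_right
  refine ⟨g, hgs, fun y hy => ⟨?_, ?_⟩⟩
  · have h3 := φ.dist_normed_convolution_le (μ := μ) (x₀ := y) (ε := ε)
      hf.continuous.aestronglyMeasurable (fun x hx => by
        refine (hf.dist_le_mul x y).trans ?_
        have h4 : dist x y ≤ ε / (K + 1) := (mem_ball.1 hx).le.trans
          ((min_le_right _ _).trans (min_le_left _ _))
        calc (K : ℝ) * dist x y ≤ (K + 1) * (ε / (K + 1)) :=
              mul_le_mul (by linarith) h4 dist_nonneg hK1.le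
          _ = ε := by field_simp)
    rwa [Real.dist_eq] at h3
  · set v := F y
    have hyR : y ∈ closedBall p R := (ball_subset_closedBall.trans
      (closedBall_subset_closedBall (by linarith))) hy
    -- Rademacher's theorem; the exceptional set remains null after reflection and translation.
    have hae : ∀ᵐ z ∂μ, DifferentiableAt ℝ f (y - z) :=
      (quasiMeasurePreserving_sub_left_of_right_invariant μ y).ae hf.ae_differentiableAt
    -- Differentiate under the integral in the direction `v = F y` frozen at `y`; the Lipschitz
    -- bound of `f` provides the dominating function.
    have hder := hasDerivAt_integral_of_dominated_loc_of_lip (μ := μ) (x₀ := (0 : ℝ)) (s := univ)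
      (F := fun t z => η z * f (y + t • v - z)) (F' := fun z => η z * lineDeriv ℝ f (y - z) v)
      (bound := fun z => η z * (K * ‖v‖)) univ_mem
      (Eventually.of_forall fun t => (φ.continuous_normed.mul
        (hf.continuous.comp (by fun_prop))).aestronglyMeasurable)
      (hcc _ (hf.continuous.comp (by fun_prop)))
      ((φ.continuous_normed.measurable.mul ((measurable_lineDeriv hf.continuous).comp
        (by fun_prop))).aestronglyMeasurable)
      (Eventually.of_forall fun z => by
        refine LipschitzOnWith.of_dist_le_mul fun s _ t _ => ?_
        rw [Real.dist_eq, ← mul_sub, abs_mul, abs_of_nonneg (hη0 z), Real.coe_nnabs,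
          abs_of_nonneg (mul_nonneg (hη0 z) (by positivity)), mul_assoc]
        refine mul_le_mul_of_nonneg_left ?_ (hη0 z)
        have h3 := hf.dist_le_mul (y + s • v - z) (y + t • v - z)
        rw [Real.dist_eq] at h3
        refine h3.trans (le_of_eq ?_)
        rw [dist_eq_norm, show y + s • v - z - (y + t • v - z) = (s - t) • v by module, norm_smul,
          Real.dist_eq, Real.norm_eq_abs]
        ring)
      (hηi.mul_const _)
      (by
        filter_upwards [hae] with z hz
        have h3 := (hz.lineDifferentiableAt (v := v)).hasLineDerivAt
        have h4 : HasDerivAt (fun t : ℝ => f (y - z + t • v)) (lineDeriv ℝ f (y - z) v) 0 := h3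
        refine (h4.const_mul (η z)).congr_of_eventuallyEq (Eventually.of_forall fun t => ?_)
        simp only
        congr 2
        module)
    have hgd : HasDerivAt (fun t : ℝ => g (y + t • v)) (fderiv ℝ g y v) 0 := by
      have h3 : HasFDerivAt g (fderiv ℝ g y) (y + (0 : ℝ) • v) := by
        simpa using (hgs.differentiable (by simp) y).hasFDerivAt
      have h4 : HasDerivAt (fun t : ℝ => y + t • v) v 0 := by
        simpa using ((hasDerivAt_id (0 : ℝ)).smul_const v).const_add y
      exact h3.comp_hasDerivAt (0 : ℝ) h4
    have hgd' : HasDerivAt (fun t : ℝ => g (y + t • v))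
        (∫ z, η z * lineDeriv ℝ f (y - z) v ∂μ) 0 := hder.2
    rw [hgd.unique hgd']
    have h3 : (∫ z, η z * lineDeriv ℝ f (y - z) v ∂μ) - b y =
        ∫ z, (η z * lineDeriv ℝ f (y - z) v - η z * b y) ∂μ := by
      rw [integral_sub hder.1 (hηi.mul_const _), integral_mul_const, hη1, one_mul]
    rw [h3]
    have h4 := norm_integral_le_of_norm_le (μ := μ) (g := fun z => η z * ε) (hηi.mul_const ε)
      (f := fun z => η z * lineDeriv ℝ f (y - z) v - η z * b y) (by
        filter_upwards [hae] with z hz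
        rw [← mul_sub, norm_mul, Real.norm_eq_abs, abs_of_nonneg (hη0 z)]
        by_cases hz0 : η z = 0
        · simp [hz0]
        refine mul_le_mul_of_nonneg_left ?_ (hη0 z)
        have hzδ := hηs z hz0
        have hzd : dist (y - z) y < δ := by simpa [dist_eq_norm] using hzδ
        have hw : y - z ∈ ball p R := by
          have h5 := dist_triangle (y - z) y p
          have h6 : δ ≤ R / 2 := (min_le_right _ _).trans (min_le_right _ _)
          have h7 := mem_ball.1 hy
          exact mem_ball.2 (by linarith)
        have hF' : dist v (F (y - z)) < ε / (2 * (K + 1)) := by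
          rw [dist_comm]
          exact h1 _ (ball_subset_closedBall hw) y hyR
            (hzd.trans_le ((min_le_left _ _).trans (min_le_left _ _)))
        have hb' : dist (b (y - z)) (b y) < ε / 2 := h2 _ (ball_subset_closedBall hw) y hyR
            (hzd.trans_le ((min_le_left _ _).trans (min_le_right _ _)))
        -- The derivative along the true field at `y - z` is `b (y - z)`; freezing the direction
        -- costs at most `K` times the oscillation of `F`.
        have h8 : lineDeriv ℝ f (y - z) v = b (y - z) + fderiv ℝ f (y - z) (v - F (y - z)) := by
          rw [hz.lineDeriv_eq_fderiv, map_sub, hd _ hw hz]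
          ring
        have h9 : ‖fderiv ℝ f (y - z) (v - F (y - z))‖ ≤ ε / 2 := by
          refine ((fderiv ℝ f (y - z)).le_opNorm _).trans ?_
          rw [← dist_eq_norm]
          calc _ ≤ (K : ℝ) * (ε / (2 * (K + 1))) :=
                mul_le_mul (norm_fderiv_le_of_lipschitz ℝ hf) hF'.le dist_nonneg K.2
            _ ≤ (K + 1) * (ε / (2 * (K + 1))) :=
                mul_le_mul_of_nonneg_right (by linarith) (by positivity)
            _ = ε / 2 := by field_simp
        rw [h8, show b (y - z) + fderiv ℝ f (y - z) (v - F (y - z)) - b y =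
          (b (y - z) - b y) + fderiv ℝ f (y - z) (v - F (y - z)) by ring]
        rw [Real.dist_eq] at hb'
        refine (norm_add_le _ _).trans ?_
        rw [Real.norm_eq_abs (b (y - z) - b y)]
        linarith)
    rwa [integral_mul_const, hη1, one_mul, Real.norm_eq_abs] at h4

end Mollification

/-! ### Smooth approximation and the solution of `W g + a g > 0`. -/

section Smoothing

open Metric

variable {X : Type*} [TopologicalSpace X] [ChartedSpace Plane X] [IsManifold (𝓡 2) ∞ X]
  {W : ∀ x : X, TangentSpace (𝓡 2) x} {φ : Flow ℝ X} {ρ : SmoothDensity (univ : Set X)}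
  {e : OpenPartialHomeomorph X Plane} {x : X} {f g a : X → ℝ}

lemma lieDeriv_eq_chart (he : e ∈ atlas Plane X) (hx : x ∈ e.source)
    (hf : MDifferentiableAt (𝓡 2) 𝓘(ℝ) f x) :
    lieDeriv W f x = fderiv ℝ (f ∘ e.symm) (e x) (chartField W e (e x)) :=
  mfderiv_field_eq he hx hf

lemma lieDeriv_congr (h : f =ᶠ[𝓝 x] g) : lieDeriv W f x = lieDeriv W g x := by
  exact congrArg (fun L : Plane →L[ℝ] ℝ => L (W x)) h.mfderiv_eq

lemma lieDeriv_const (c : ℝ) : lieDeriv W (fun _ : X => c) x = 0 := by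
  unfold lieDeriv
  rw [mfderiv_const]
  rfl

lemma differentiableAt_chart (he : e ∈ atlas Plane X) (hx : x ∈ e.source)
    (hf : MDifferentiableAt (𝓡 2) 𝓘(ℝ) f x) : DifferentiableAt ℝ (f ∘ e.symm) (e x) := by
  have h1 := mdifferentiableAt_atlas_symm he (e.map_source hx)
  have h2 : MDifferentiableAt (𝓡 2) 𝓘(ℝ) f (e.symm (e x)) := by rwa [e.left_inv hx]
  exact (h2.comp (e x) h1).differentiableAt

lemma lieDeriv_mul (hf : MDifferentiableAt (𝓡 2) 𝓘(ℝ) f x)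
    (hg : MDifferentiableAt (𝓡 2) 𝓘(ℝ) g x) :
    lieDeriv W (fun x => f x * g x) x = f x * lieDeriv W g x + g x * lieDeriv W f x := by
  have he := chart_mem_atlas Plane x
  have hx := mem_chart_source Plane x
  have hfg : MDifferentiableAt (𝓡 2) 𝓘(ℝ) (fun x => f x * g x) x := hf.mul hg
  rw [lieDeriv_eq_chart he hx hfg, lieDeriv_eq_chart he hx hf, lieDeriv_eq_chart he hx hg]
  have h1 := fderiv_mul (differentiableAt_chart he hx hf) (differentiableAt_chart he hx hg)
  have h2 : (fun x => f x * g x) ∘ (chartAt Plane x).symm =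
    (f ∘ (chartAt Plane x).symm) * (g ∘ (chartAt Plane x).symm) := rfl
  rw [h2, h1]
  simp [(chartAt Plane x).left_inv hx]

lemma lieDeriv_sum {ι : Type*} {s : Finset ι} {F : ι → X → ℝ}
    (hF : ∀ i ∈ s, MDifferentiableAt (𝓡 2) 𝓘(ℝ) (F i) x) :
    lieDeriv W (fun x => ∑ i ∈ s, F i x) x = ∑ i ∈ s, lieDeriv W (F i) x := by
  have he := chart_mem_atlas Plane x
  have hx := mem_chart_source Plane x
  have hs : MDifferentiableAt (𝓡 2) 𝓘(ℝ) (fun x => ∑ i ∈ s, F i x) x := by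
    classical
    induction s using Finset.induction_on with
    | empty => simpa using mdifferentiableAt_const
    | insert i t hi ih =>
      simp only [Finset.sum_insert hi]
      exact (hF i (Finset.mem_insert_self _ _)).add
        (ih fun j hj => hF j (Finset.mem_insert_of_mem hj))
  rw [lieDeriv_eq_chart he hx hs]
  have h2 : (fun x => ∑ i ∈ s, F i x) ∘ (chartAt Plane x).symm =
    fun y => ∑ i ∈ s, (F i ∘ (chartAt Plane x).symm) y := by ext; simp
  rw [h2, fderiv_fun_sum fun i hi => differentiableAt_chart he hx (hF i hi),
    sum_apply]
  exact Finset.sum_congr rfl fun i hi => (lieDeriv_eq_chart he hx (hF i hi)).symm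

lemma continuous_lieDeriv (hW : SmoothFieldOn W univ) (hf : ContMDiff (𝓡 2) 𝓘(ℝ) ∞ f) :
    Continuous (lieDeriv W f) := by
  rw [continuous_iff_continuousAt]
  intro x
  set e := chartAt Plane x
  have he : e ∈ atlas Plane X := chart_mem_atlas _ _
  have hx : x ∈ e.source := mem_chart_source Plane x
  have h1 : ContDiffAt ℝ ∞ (f ∘ e.symm) (e x) := hf.contMDiffAt.contDiffAt_chart he hx
  have h2 : ContinuousAt (fderiv ℝ (f ∘ e.symm)) (e x) :=
    (h1.fderiv_right (m := 0) (by norm_cast)).continuousAt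
  have h3 := (contDiffAt_chartField hW he (e.map_source hx)).continuousAt
  have h4 : ContinuousAt ((fun y => fderiv ℝ (f ∘ e.symm) y (chartField W e y)) ∘ e) x :=
    (h2.clm_apply h3).comp (e.continuousAt hx)
  refine h4.congr ?_
  filter_upwards [e.open_source.mem_nhds hx] with y hy
  exact (lieDeriv_eq_chart he hy (hf.mdifferentiableAt (by simp))).symm

lemma LocLipAt.continuousAt (hf : LocLipAt f x) : ContinuousAt f x := by
  set e := chartAt Plane x
  have hx : x ∈ e.source := mem_chart_source Plane x
  obtain ⟨K, s, hs, hK⟩ := hf e (chart_mem_atlas _ _) hx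
  have h1 : ContinuousAt ((f ∘ e.symm) ∘ e) x :=
    (hK.continuousOn.continuousAt hs).comp (e.continuousAt hx)
  refine h1.congr ?_
  filter_upwards [e.open_source.mem_nhds hx] with y hy
  simp [e.left_inv hy]

/-- Local smooth approximation of a Lipschitz function together with its derivative along the
flow. -/
lemma IsFlowOf.exists_local_approx (hφ : IsFlowOf φ W) (hW : SmoothFieldOn W univ)
    (hf : LocLipAt f x) {b : X → ℝ} (hb : Continuous b)
    (hfb : ∀ x, HasDerivAt (fun t => f (φ t x)) (b x) 0) :
    ∃ V : Set X, IsOpen V ∧ x ∈ V ∧ ∀ ε > 0, ∃ g : X → ℝ,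
      (∀ y ∈ V, ContMDiffAt (𝓡 2) 𝓘(ℝ) ∞ g y) ∧
      ∀ y ∈ V, |g y - f y| ≤ ε ∧ |lieDeriv W g y - b y| ≤ ε := by
  set e := chartAt Plane x
  have he : e ∈ atlas Plane X := chart_mem_atlas _ _
  have hx : x ∈ e.source := mem_chart_source Plane x
  obtain ⟨K, s, hs, hK⟩ := hf e he hx
  obtain ⟨R, hR, hRs⟩ := nhds_basis_closedBall.mem_iff.1
    (inter_mem hs (e.open_target.mem_nhds (e.map_source hx)))
  obtain ⟨f', hf', hff'⟩ := (hK.mono (hRs.trans inter_subset_left)).extend_real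
  have ht : closedBall (e x) R ⊆ e.target := hRs.trans inter_subset_right
  have hF : ContinuousOn (chartField W e) (closedBall (e x) R) :=
    (contDiffOn_chartField_univ hW he).continuousOn.mono ht
  have hbc : ContinuousOn (b ∘ e.symm) (closedBall (e x) R) :=
    hb.comp_continuousOn (e.continuousOn_symm.mono ht)
  -- At a point of differentiability the chain rule along the trajectory identifies the directional
  -- derivative with the derivative along the flow, which is known to exist everywhere.
  have hd : ∀ w ∈ ball (e x) R, DifferentiableAt ℝ f' w →
      fderiv ℝ f' w (chartField W e w) = (b ∘ e.symm) w := by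
    intro w hw hdw
    have hwt := ht (ball_subset_closedBall hw)
    have h0 : e (φ 0 (e.symm w)) = w := by rw [Flow.map_zero_apply, e.right_inv hwt]
    have hs0 : φ 0 (e.symm w) ∈ e.source := by
      rw [Flow.map_zero_apply]
      exact e.map_target hwt
    have h1 := hφ.hasDerivAt_chart he 0 (e.symm w) hs0
    rw [h0] at h1
    have h2 : HasFDerivAt f' (fderiv ℝ f' w) (e (φ 0 (e.symm w))) := by
      rw [h0]
      exact hdw.hasFDerivAt
    have h3 := h2.comp_hasDerivAt (0 : ℝ) h1
    refine (h3.congr_of_eventuallyEq ?_).unique (hfb (e.symm w))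
    have hc : Continuous fun t => φ t (e.symm w) := φ.continuous continuous_id continuous_const
    have h4 : ∀ᶠ t in 𝓝 (0 : ℝ), e (φ t (e.symm w)) ∈ ball (e x) R := by
      refine h1.continuousAt.eventually_mem ?_
      rw [h0]
      exact isOpen_ball.mem_nhds hw
    filter_upwards [h4, hc.continuousAt.eventually_mem (e.open_source.mem_nhds hs0)] with t ht hts
    simp only [Function.comp]
    rw [← hff' (ball_subset_closedBall ht)]
    simp [e.left_inv hts]
  refine ⟨e.source ∩ e ⁻¹' ball (e x) (R / 2), e.isOpen_inter_preimage isOpen_ball,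
    ⟨hx, mem_ball_self (by positivity)⟩, fun ε hε => ?_⟩
  obtain ⟨g, hg, hga⟩ := exists_mollification hf' hR hF hbc hd hε
  have hgs : ∀ y ∈ e.source, ContMDiffAt (𝓡 2) 𝓘(ℝ) ∞ (g ∘ e) y := fun y hy =>
    hg.contMDiff.contMDiffAt.comp y ((contMDiffOn_atlas he).contMDiffAt (e.open_source.mem_nhds hy))
  refine ⟨g ∘ e, fun y hy => hgs y hy.1, fun y hy => ?_⟩
  obtain ⟨h1, h2⟩ := hga (e y) hy.2
  have h3 := hff' ((ball_subset_closedBall.trans (closedBall_subset_closedBall (by linarith))) hy.2)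
  rw [lieDeriv_eq_chart he hy.1 ((hgs y hy.1).mdifferentiableAt (by simp))]
  have h4 : (g ∘ e) ∘ e.symm =ᶠ[𝓝 (e y)] g := by
    filter_upwards [e.open_target.mem_nhds (e.map_source hy.1)] with u hu
    simp [e.right_inv hu]
  rw [h4.fderiv_eq]
  simp only [Function.comp, e.left_inv hy.1] at h1 h2 h3 ⊢
  rw [h3]
  exact ⟨h1, h2⟩

variable [CompactSpace X] [T2Space X]

/-- Smooth approximation of a Lipschitz function together with its derivative along the flow. -/
lemma IsFlowOf.exists_approx (hφ : IsFlowOf φ W) (hW : SmoothFieldOn W univ)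
    (hf : ∀ x, LocLipAt f x) {b : X → ℝ} (hb : Continuous b)
    (hfb : ∀ x, HasDerivAt (fun t => f (φ t x)) (b x) 0) {ε : ℝ} (hε : 0 < ε) :
    ∃ g : X → ℝ, ContMDiff (𝓡 2) 𝓘(ℝ) ∞ g ∧
      ∀ y, |g y - f y| ≤ ε ∧ |lieDeriv W g y - b y| ≤ ε := by
  choose V hVo hxV hV using fun x => hφ.exists_local_approx hW (hf x) hb hfb
  obtain ⟨s, hs⟩ := CompactSpace.elim_nhds_subcover V fun x => (hVo x).mem_nhds (hxV x)
  obtain ⟨χ, hχ⟩ := SmoothPartitionOfUnity.exists_isSubordinate (𝓡 2) isClosed_univ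
    (fun i : s => V i) (fun i => hVo i) (fun x _ => by
      obtain ⟨z, hz, hxz⟩ := mem_iUnion₂.1 (hs.ge (mem_univ x))
      exact mem_iUnion.2 ⟨⟨z, hz⟩, hxz⟩)
  have hχs : ∀ i, ContMDiff (𝓡 2) 𝓘(ℝ) ∞ (χ i) := fun i => (χ i).contMDiff
  have hχd : ∀ i x, MDifferentiableAt (𝓡 2) 𝓘(ℝ) (χ i) x := fun i x =>
    (hχs i).mdifferentiableAt (by simp)
  have hχ1 : ∀ x, ∑ i, χ i x = 1 := fun x => by
    rw [← finsum_eq_sum_of_fintype]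
    exact χ.sum_eq_one (mem_univ x)
  -- Hence the terms where `W` hits the partition functions can be written with `G i - f`, which is
  -- small, in place of `G i`.
  have hχ0 : ∀ x, ∑ i, lieDeriv W (χ i) x = 0 := fun x => by
    rw [← lieDeriv_sum fun i _ => hχd i x]
    simp only [hχ1]
    exact lieDeriv_const 1
  choose A hA0 hA using fun i => exists_abs_le (continuous_lieDeriv hW (hχs i))
  have hAs : 0 ≤ ∑ i, A i := Finset.sum_nonneg fun i _ => (hA0 i).le
  -- The derivative error is at most `ε'` from the local derivatives plus `ε' * ∑ A i` from the
  -- partition functions.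
  set ε' := ε / (1 + ∑ i, A i)
  have hε' : 0 < ε' := by positivity
  choose G hGs hG using fun x => hV x ε' hε'
  have hoff : ∀ (i : s) x, x ∉ V i → χ i =ᶠ[𝓝 x] 0 := fun i x hx =>
    notMem_tsupport_iff_eventuallyEq.1 fun hcon => hx (hχ i hcon)
  have hs' : ∀ i : s, ContMDiff (𝓡 2) 𝓘(ℝ) ∞ fun x => χ i x * G i x := fun i =>
    χ.contMDiff_smul fun x hx => hGs i x (hχ i hx)
  have hl : ∀ (i : s) x, lieDeriv W (fun x => χ i x * G i x) x =
      χ i x * lieDeriv W (G i) x + G i x * lieDeriv W (χ i) x := by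
    intro i x
    by_cases hx : x ∈ V i
    · exact lieDeriv_mul (hχd i x) ((hGs i x hx).mdifferentiableAt (by simp))
    · have h1 := hoff i x hx
      have h2 : (fun x => χ i x * G i x) =ᶠ[𝓝 x] fun _ => (0 : ℝ) := by
        filter_upwards [h1] with y hy
        simp [hy]
      have h3 : χ i =ᶠ[𝓝 x] fun _ => (0 : ℝ) := h1
      rw [lieDeriv_congr h2, lieDeriv_congr h3, lieDeriv_const, h1.self_of_nhds]
      simp
  have hsmooth : ContMDiff (𝓡 2) 𝓘(ℝ) ∞ fun x => ∑ i : s, χ i x * G i x :=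
    contMDiff_finsetSum fun i _ => hs' i
  have hb1 : ∀ (i : s) x, |χ i x * (G i x - f x)| ≤ χ i x * ε' := by
    intro i x
    rw [abs_mul, abs_of_nonneg (χ.nonneg i x)]
    by_cases hx : x ∈ V i
    · exact mul_le_mul_of_nonneg_left (hG i x hx).1 (χ.nonneg i x)
    · rw [(hoff i x hx).self_of_nhds]
      simp
  have hb2 : ∀ (i : s) x, |χ i x * (lieDeriv W (G i) x - b x) +
      (G i x - f x) * lieDeriv W (χ i) x| ≤ χ i x * ε' + A i * ε' := by
    intro i x
    by_cases hx : x ∈ V i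
    · refine (abs_add_le _ _).trans (add_le_add ?_ ?_)
      · rw [abs_mul, abs_of_nonneg (χ.nonneg i x)]
        exact mul_le_mul_of_nonneg_left (hG i x hx).2 (χ.nonneg i x)
      · rw [abs_mul, mul_comm]
        exact mul_le_mul (hA i x) (hG i x hx).1 (abs_nonneg _) (hA0 i).le
    · have h1 := hoff i x hx
      have h3 : χ i =ᶠ[𝓝 x] fun _ => (0 : ℝ) := h1
      rw [lieDeriv_congr h3, lieDeriv_const, h1.self_of_nhds]
      simp only [Pi.zero_apply, zero_mul, mul_zero, add_zero, abs_zero, zero_add]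
      exact mul_nonneg (hA0 i).le hε'.le
  have hle : ε' ≤ ε := div_le_self hε.le (by linarith)
  refine ⟨_, hsmooth, fun x => ⟨?_, ?_⟩⟩
  · have h1 : ∑ i : s, χ i x * G i x - f x = ∑ i : s, χ i x * (G i x - f x) := by
      simp only [mul_sub, Finset.sum_sub_distrib, ← Finset.sum_mul, hχ1, one_mul]
    rw [h1]
    refine (Finset.abs_sum_le_sum_abs _ _).trans ((Finset.sum_le_sum fun i _ => hb1 i x).trans ?_)
    rw [← Finset.sum_mul, hχ1, one_mul]
    exact hle
  · have h1 : lieDeriv W (fun x => ∑ i : s, χ i x * G i x) x - b x =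
        ∑ i : s, (χ i x * (lieDeriv W (G i) x - b x) + (G i x - f x) * lieDeriv W (χ i) x) := by
      rw [lieDeriv_sum fun i _ => (hs' i).mdifferentiableAt (by simp)]
      simp only [hl, mul_sub, sub_mul, Finset.sum_add_distrib, Finset.sum_sub_distrib,
        ← Finset.sum_mul, ← Finset.mul_sum, hχ1, hχ0]
      ring
    rw [h1]
    refine (Finset.abs_sum_le_sum_abs _ _).trans ((Finset.sum_le_sum fun i _ => hb2 i x).trans ?_)
    rw [Finset.sum_add_distrib, ← Finset.sum_mul, ← Finset.sum_mul, hχ1, ← add_mul]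
    refine le_of_eq ?_
    simp only [ε']
    field_simp

/-- The smooth solution of the differential inequality `W g + a g > 0`. -/
lemma FoliationData.exists_escape (h : FoliationData W φ ρ a) (hMS : IsMorseSmaleField W φ) :
    ∃ g : X → ℝ, ContMDiff (𝓡 2) 𝓘(ℝ) ∞ g ∧ (∀ x, 0 < lieDeriv W g x + a x * g x) ∧
      (∀ x ∈ sinkSet W φ, 0 < g x) ∧ ∀ x ∈ sourceSet W φ, g x < 0 := by
  have hAR := h.isAttractorRepeller hMS
  have ha := h.continuous
  obtain ⟨f₁, hf₁0, hf₁1, hf₁⟩ := exists_contMDiffMap_zero_one_nhds_of_isClosed (𝓡 2) (n := ⊤)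
    hAR.closed_L hAR.closed_K hAR.disjoint.symm
  obtain ⟨Np, hNp, hKN, hNp1⟩ := eventually_nhdsSet_iff_exists.1 hf₁1
  obtain ⟨Nm, hNm, hLN, hNm0⟩ := eventually_nhdsSet_iff_exists.1 hf₁0
  set f₀ : X → ℝ := fun x => 2 * f₁ x - 1
  have hf₀s : ContMDiff (𝓡 2) 𝓘(ℝ) ∞ f₀ :=
    (contMDiff_const.mul f₁.contMDiff).sub contMDiff_const
  have hf₀c : Continuous f₀ := hf₀s.continuous
  have h1 : ∀ x ∈ Np, f₀ x = 1 := fun x hx => by simp only [f₀, hNp1 x hx]; norm_num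
  have h2 : ∀ x ∈ Nm, f₀ x = -1 := fun x hx => by simp only [f₀, hNm0 x hx]; norm_num
  have h3 : ∀ x, |f₀ x| ≤ 1 := fun x => by
    have := hf₁ x
    exact abs_le.2 ⟨by linarith [this.1], by linarith [this.2]⟩
  -- The negativity in the past outside the sink is the positivity statement for the reversed flow,
  -- whose source is the sink.
  obtain ⟨T, hT, hT1, hT2⟩ := hAR.exists_time ha (fun x hx => h.exists_orbInt_pos hMS hx)
    (fun x hx => by
      rw [← h.sourceSet_reverse hMS] at hx
      obtain ⟨t, ht, hx⟩ := h.reverse.exists_orbInt_pos (h.morseSmale_reverse hMS) hx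
      rw [orbInt_neg] at hx
      exact ⟨t, ht, by linarith⟩) hNp hNm hKN hLN
  set f := weightedAverage φ a f₀ T with hfdef
  have hL : ∀ x, LocLipAt f x := h.locLipAt_weightedAverage hf₀c h3
    (fun x => LocLipAt.of_contDiffAt fun e he hx =>
      (hf₀s.contMDiffAt.contDiffAt_chart he hx).of_le (by norm_cast)) hT.le
  have hfc : Continuous f := continuous_iff_continuousAt.2 fun x => (hL x).continuousAt
  have hce : Continuous fun x => Real.exp (orbInt φ a T x) :=
    Real.continuous_exp.comp ((continuous_orbInt ha).comp (continuous_const.prodMk continuous_id))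
  set d : X → ℝ := fun x => Real.exp (orbInt φ a T x) * f₀ (φ T x) - f₀ x with hd
  have hdc : Continuous d := (hce.mul (hf₀c.comp (φ.continuous_toFun T))).sub hf₀c
  obtain ⟨m, hm, hdm⟩ := exists_pos_lower_bound hdc fun x => weightedAverage_pos h1 h2 h3 hT1 hT2 x
  have hcs : ∀ y, Continuous fun s => Real.exp (orbInt φ a s y) := fun y =>
    Real.continuous_exp.comp ((continuous_orbInt ha).comp (continuous_id.prodMk continuous_const))
  have hexp : ∀ x, 0 < ∫ s in (0 : ℝ)..T, Real.exp (orbInt φ a s x) := fun x =>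
    intervalIntegral.intervalIntegral_pos_of_pos ((hcs x).intervalIntegrable _ _)
      (fun s => Real.exp_pos _) hT
  -- The sink is invariant, so `f₀ = 1` along its orbits and the average is an integral of
  -- exponentials.
  have hfK : ∀ x ∈ sinkSet W φ, 0 < f x := fun x hx => by
    have h4 : f x = ∫ s in (0 : ℝ)..T, Real.exp (orbInt φ a s x) :=
      intervalIntegral.integral_congr fun s _ => by
        simp only [h1 _ (hKN (hAR.inv_K s x hx)), mul_one]
    rw [h4]
    exact hexp x
  have hfL : ∀ x ∈ sourceSet W φ, 0 < -f x := fun x hx => by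
    have h4 : f x = ∫ s in (0 : ℝ)..T, -Real.exp (orbInt φ a s x) :=
      intervalIntegral.integral_congr fun s _ => by
        simp only [h2 _ (hLN (hAR.inv_L s x hx)), mul_neg, mul_one]
    rw [h4, intervalIntegral.integral_neg, neg_neg]
    exact hexp x
  obtain ⟨m₁, hm₁, hfm₁⟩ := hAR.closed_K.isCompact.exists_forall_le' hfc.continuousOn hfK
  obtain ⟨m₂, hm₂, hfm₂⟩ := hAR.closed_L.isCompact.exists_forall_le' hfc.neg.continuousOn hfL
  obtain ⟨A, hA0, hA⟩ := exists_abs_le ha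
  -- The approximation changes `W f + a f` by at most `(1 + A) * ε`, half of its minimum, and does
  -- not alter the signs on sink and source.
  set ε := min (m / (2 * (1 + A))) (min (m₁ / 2) (m₂ / 2))
  have hε : 0 < ε := lt_min (by positivity) (lt_min (by positivity) (by positivity))
  obtain ⟨g, hgs, hg⟩ := h.flow.exists_approx h.smooth hL (hdc.sub (ha.mul hfc))
    (fun x => hasDerivAt_weightedAverage ha hf₀c T x) hε
  refine ⟨g, hgs, fun x => ?_, fun x hx => ?_, fun x hx => ?_⟩
  · obtain ⟨h4, h5⟩ := hg x
    have h6 : |a x * (g x - f x)| ≤ A * ε := by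
      rw [abs_mul]
      exact mul_le_mul (hA x) h4 (abs_nonneg _) hA0.le
    have h7 : (1 + A) * ε ≤ m / 2 := by
      calc (1 + A) * ε ≤ (1 + A) * (m / (2 * (1 + A))) :=
            mul_le_mul_of_nonneg_left (min_le_left _ _) (by positivity)
        _ = m / 2 := by field_simp
    have h8 := (abs_le.1 h5).1
    have h9 := (abs_le.1 h6).1
    have h10 := hdm x
    simp only [Pi.sub_apply, Pi.mul_apply] at h8
    nlinarith
  · have h4 := (abs_le.1 (hg x).1).1
    have h5 := hfm₁ x hx
    have h6 : ε ≤ m₁ / 2 := (min_le_right _ _).trans (min_le_left _ _)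
    linarith
  · have h4 := (abs_le.1 (hg x).1).2
    have h5 : m₂ ≤ -f x := hfm₂ x hx
    have h6 : ε ≤ m₂ / 2 := (min_le_right _ _).trans (min_le_right _ _)
    linarith

end Smoothing

/-! ### Linear symplectic algebra and the Liouville form. -/

section Symplectic

/-- The symplectic form `dp ∧ dq` of the model space. -/
def symp (u v : Plane × CoPlane) : ℝ := u.2 v.1 - v.2 u.1

/-- The Liouville form `p dq` on `E × E*`. -/
def liouvilleForm (E : Type*) [NormedAddCommGroup E] [NormedSpace ℝ E] :
    (E × (E →L[ℝ] ℝ)) →L[ℝ] (E × (E →L[ℝ] ℝ)) →L[ℝ] ℝ :=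
  ((ContinuousLinearMap.compL ℝ (E × (E →L[ℝ] ℝ)) E ℝ).flip
    (ContinuousLinearMap.fst ℝ E (E →L[ℝ] ℝ))).comp (ContinuousLinearMap.snd ℝ E (E →L[ℝ] ℝ))

/-- The Liouville form of the model space. -/
def liouville (u : Plane × CoPlane) : (Plane × CoPlane) →L[ℝ] ℝ := liouvilleForm Plane u

lemma liouville_apply (u v : Plane × CoPlane) : liouville u v = u.2 v.1 := rfl

/-- The Hamiltonian vector of a linear form. -/
def hamLin (α : (Plane × CoPlane) →L[ℝ] ℝ) : Plane × CoPlane :=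
  (∑ i : Fin 2, α (0, EuclideanSpace.proj i) • EuclideanSpace.single i (1 : ℝ),
    -(α.comp (ContinuousLinearMap.inl ℝ Plane CoPlane)))

lemma coplane_eq (p : CoPlane) : p = p (EuclideanSpace.single 0 1) • EuclideanSpace.proj 0 +
    p (EuclideanSpace.single 1 1) • EuclideanSpace.proj 1 := by
  ext v
  conv_lhs => rw [plane_eq v]
  simp
  ring

/-- This relation and the nondegeneracy of `symp` characterize the Hamiltonian vector without
coordinates. -/
lemma symp_hamLin (α : (Plane × CoPlane) →L[ℝ] ℝ) (v : Plane × CoPlane) :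
    symp (hamLin α) v = -α v := by
  have h1 : α v = α (v.1, 0) + α (0, v.2) := by
    rw [← map_add]
    simp
  have h2 : α (0, v.2) = v.2 (EuclideanSpace.single 0 1) * α (0, EuclideanSpace.proj 0) +
      v.2 (EuclideanSpace.single 1 1) * α (0, EuclideanSpace.proj 1) := by
    have h3 : ((0, v.2) : Plane × CoPlane) =
        v.2 (EuclideanSpace.single 0 1) • ((0, EuclideanSpace.proj 0) : Plane × CoPlane) +
        v.2 (EuclideanSpace.single 1 1) • ((0, EuclideanSpace.proj 1) : Plane × CoPlane) := by
      refine Prod.ext (by simp) ?_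
      simpa using coplane_eq v.2
    rw [h3, map_add, map_smul, map_smul, smul_eq_mul, smul_eq_mul]
  rw [h1, h2]
  simp [symp, hamLin]
  ring

lemma symp_neg_swap (u v : Plane × CoPlane) : symp u v = -symp v u := by
  simp [symp]

lemma symp_add_left (u u' v : Plane × CoPlane) : symp (u + u') v = symp u v + symp u' v := by
  simp [symp]
  ring

lemma symp_smul_left (c : ℝ) (u v : Plane × CoPlane) : symp (c • u) v = c * symp u v := by
  simp [symp]
  ring

lemma symp_sub_left (u u' v : Plane × CoPlane) : symp (u - u') v = symp u v - symp u' v := by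
  simp [symp]
  ring

lemma symp_eq_zero {u : Plane × CoPlane} (h : ∀ v, symp u v = 0) : u = 0 := by
  refine Prod.ext ?_ ?_
  · ext i
    have := h (0, EuclideanSpace.proj i)
    simpa [symp] using this
  · ext v
    have := h (v, 0)
    simpa [symp] using this

lemma hamLin_ne_zero {α : (Plane × CoPlane) →L[ℝ] ℝ} (hα : α ≠ 0) : hamLin α ≠ 0 := by
  intro h
  refine hα (ContinuousLinearMap.ext fun v => ?_)
  have := symp_hamLin α v
  rw [h] at this
  simp only [symp, Prod.fst_zero, Prod.snd_zero, map_zero, zero_apply] at this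
  simpa using this.symm

/-- The exterior derivative commutes with pullback. -/
lemma curl_pullback {V V' : Type*} [NormedAddCommGroup V] [NormedSpace ℝ V]
    [NormedAddCommGroup V'] [NormedSpace ℝ V'] {T : V → V'} {A : V → V →L[ℝ] ℝ}
    {B : V' → V' →L[ℝ] ℝ} {x : V} (hT : ContDiffAt ℝ 2 T x) (hB : DifferentiableAt ℝ B (T x))
    (hAB : ∀ᶠ y in 𝓝 x, A y = (B (T y)).comp (fderiv ℝ T y)) (u v : V) :
    fderiv ℝ A x u v - fderiv ℝ A x v u =
      fderiv ℝ B (T x) (fderiv ℝ T x u) (fderiv ℝ T x v) -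
        fderiv ℝ B (T x) (fderiv ℝ T x v) (fderiv ℝ T x u) := by
  have hT1 : DifferentiableAt ℝ T x := hT.differentiableAt (by simp)
  have hT2 : DifferentiableAt ℝ (fderiv ℝ T) x :=
    (hT.fderiv_right (m := 1) (by norm_num)).differentiableAt (by simp)
  have h1 : HasFDerivAt (fun y => (B (T y)).comp (fderiv ℝ T y)) _ x :=
    (hB.hasFDerivAt.comp x hT1.hasFDerivAt).clm_comp hT2.hasFDerivAt
  have h2 : HasFDerivAt A _ x := h1.congr_of_eventuallyEq hAB
  -- The second derivatives of `T` are symmetric and drop out of the antisymmetrization.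
  have hsym := (hT.isSymmSndFDerivAt (by simp)).eq u v
  rw [h2.fderiv]
  simp [hsym]

/-- The hypotheses say that the cross product of `(b₁, -b₀, -k)` with the nonzero vector `(w₀, w₁,
a)` vanishes, so the vectors are proportional; `r` is their scalar product divided by the squared
norm. -/
lemma exists_ratio_of_cross {w₀ w₁ a b₀ b₁ k : ℝ} (hn : w₀ ^ 2 + w₁ ^ 2 + a ^ 2 ≠ 0)
    (h1 : w₀ * b₀ + w₁ * b₁ = 0) (h2 : k * w₁ = a * b₀) (h3 : k * w₀ = -(a * b₁)) :
    ∃ r, b₀ = -(r * w₁) ∧ b₁ = r * w₀ ∧ k = -(a * r) := by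
  have hr : (w₀ * b₁ - w₁ * b₀ - a * k) / (w₀ ^ 2 + w₁ ^ 2 + a ^ 2) *
      (w₀ ^ 2 + w₁ ^ 2 + a ^ 2) = w₀ * b₁ - w₁ * b₀ - a * k := div_mul_cancel₀ _ hn
  refine ⟨(w₀ * b₁ - w₁ * b₀ - a * k) / (w₀ ^ 2 + w₁ ^ 2 + a ^ 2), mul_right_cancel₀ hn ?_,
    mul_right_cancel₀ hn ?_, mul_right_cancel₀ hn ?_⟩
  · linear_combination w₁ * hr + w₀ * h1 - a * h2
  · linear_combination (-w₀) * hr + w₁ * h1 + a * h3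
  · linear_combination a * hr + w₁ * h2 + w₀ * h3

/-- A vector of the kernel of a linear form, in terms of three independent vectors. -/
lemma exists_coords_of_ker {α : (Plane × CoPlane) →L[ℝ] ℝ} {E : Plane × CoPlane}
    {D : Plane →L[ℝ] Plane × CoPlane} (hα : α ≠ 0) (hαE : α E = 0) (hαD : ∀ v, α (D v) = 0)
    (hinj : ∀ (t : ℝ) v, t • E + D v = 0 → t = 0 ∧ v = 0) {u : Plane × CoPlane} (hu : α u = 0) :
    ∃ (t : ℝ) (v : Plane), u = t • E + D v := by
  let L : ℝ × Plane →ₗ[ℝ] Plane × CoPlane :=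
    (LinearMap.toSpanSingleton ℝ _ E).coprod (D : Plane →ₗ[ℝ] Plane × CoPlane)
  have hL : ∀ q, L q = q.1 • E + D q.2 := fun q => rfl
  have hLi : Function.Injective L := by
    rw [injective_iff_map_eq_zero]
    intro q hq
    obtain ⟨h1, h2⟩ := hinj q.1 q.2 hq
    exact Prod.ext h1 h2
  have hle : LinearMap.range L ≤ LinearMap.ker (α : Plane × CoPlane →ₗ[ℝ] ℝ) := by
    rintro _ ⟨q, rfl⟩
    rw [LinearMap.mem_ker, hL]
    simp [hαE, hαD]
  have h3 : Module.finrank ℝ (LinearMap.range L) = 3 := by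
    rw [LinearMap.finrank_range_of_inj hLi]
    simp
  have h4 : Module.finrank ℝ (LinearMap.ker (α : Plane × CoPlane →ₗ[ℝ] ℝ)) = 3 := by
    have h5 := LinearMap.finrank_range_add_finrank_ker (α : Plane × CoPlane →ₗ[ℝ] ℝ)
    have h6 : LinearMap.range (α : Plane × CoPlane →ₗ[ℝ] ℝ) = ⊤ := by
      rw [LinearMap.range_eq_top]
      refine LinearMap.surjective fun h7 => hα (ContinuousLinearMap.ext fun v => ?_)
      exact LinearMap.congr_fun h7 v
    rw [h6, Hamiltonian.finrank_canon] at h5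
    simp at h5
    omega
  have h5 := Submodule.eq_of_le_of_finrank_eq hle (h3.trans h4.symm)
  have h6 : u ∈ LinearMap.range L := by
    rw [h5]
    exact hu
  obtain ⟨q, hq⟩ := h6
  exact ⟨q.1, q.2, hq.symm⟩

lemma curl_pullback_linear {V V' : Type*} [NormedAddCommGroup V] [NormedSpace ℝ V]
    [NormedAddCommGroup V'] [NormedSpace ℝ V'] (B : V' →L[ℝ] V' →L[ℝ] ℝ) {T : V → V'}
    {A : V → V →L[ℝ] ℝ} {x : V} (hT : ContDiffAt ℝ 2 T x)
    (hA : ∀ᶠ y in 𝓝 x, A y = (B (T y)).comp (fderiv ℝ T y)) (u v : V) :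
    fderiv ℝ A x u v - fderiv ℝ A x v u = B (fderiv ℝ T x u) (fderiv ℝ T x v) -
      B (fderiv ℝ T x v) (fderiv ℝ T x u) := by
  have h := curl_pullback hT B.differentiableAt hA u v
  rwa [B.fderiv] at h

/-- The exterior derivative of a pullback of the Liouville form. -/
lemma curl_pullback_liouville {V : Type*} [NormedAddCommGroup V] [NormedSpace ℝ V]
    {T : V → Plane × CoPlane} {A : V → V →L[ℝ] ℝ} {x : V} (hT : ContDiffAt ℝ 2 T x)
    (hA : ∀ᶠ y in 𝓝 x, A y = (liouville (T y)).comp (fderiv ℝ T y)) (u v : V) :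
    fderiv ℝ A x u v - fderiv ℝ A x v u = symp (fderiv ℝ T x u) (fderiv ℝ T x v) :=
  curl_pullback_linear (liouvilleForm Plane) hT hA u v

lemma curl_liouville {x : Plane × CoPlane} (u v : Plane × CoPlane) :
    fderiv ℝ liouville x u v - fderiv ℝ liouville x v u = symp u v := by
  have h := curl_pullback_liouville (T := id) (A := liouville) (x := x) contDiffAt_id
    (Eventually.of_forall fun y => by rw [fderiv_id]; rfl) u v
  rwa [fderiv_id] at h

/-- The Liouville form pulled back to the plane, in terms of a local symplectic basis: `w` is the
projected Hamiltonian vector, `a` its component along the Euler vector. -/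
lemma exists_ratio {α : (Plane × CoPlane) →L[ℝ] ℝ} {E : Plane × CoPlane}
    {D : Plane →L[ℝ] Plane × CoPlane} {w : Plane} {a : ℝ} (hα : α ≠ 0) (hαE : α E = 0)
    (hαD : ∀ v, α (D v) = 0) (hinj : ∀ (t : ℝ) v, t • E + D v = 0 → t = 0 ∧ v = 0)
    (hX : hamLin α = a • E + D w) {β : Plane →L[ℝ] ℝ} (hβ : ∀ v, β v = symp E (D v)) {κ : ℝ}
    (hκ : κ = symp (D (EuclideanSpace.single 0 1)) (D (EuclideanSpace.single 1 1))) :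
    ∃ r ≠ 0, (∀ v, β v = r * (w 0 * v 1 - w 1 * v 0)) ∧ κ = -(a * r) := by
  have hD : ∀ u v, symp (D u) (D v) = κ * (u 0 * v 1 - u 1 * v 0) := by
    intro u v
    rw [hκ]
    conv_lhs => rw [plane_eq u, plane_eq v]
    simp only [symp, map_add, map_smul, Prod.fst_add, Prod.snd_add, Prod.smul_fst, Prod.smul_snd,
      add_apply, smul_apply, smul_eq_mul]
    ring
  have hEE : symp E E = 0 := by simp [symp]
  have hw : D w = hamLin α - a • E := by rw [hX]; abel
  have h1 : β w = 0 := by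
    rw [hβ, symp_neg_swap, hw, symp_sub_left, symp_smul_left, symp_hamLin, hαE, hEE]
    simp
  -- Contract `symp` with `D w`, which is the Hamiltonian vector minus `a E`: the Hamiltonian vector
  -- pairs to zero with vectors killed by `α`. Together with `β w = 0` this gives the three
  -- cross-product relations.
  have h2 : ∀ v, κ * (w 0 * v 1 - w 1 * v 0) = -(a * β v) := by
    intro v
    rw [← hD, hw, symp_sub_left, symp_smul_left, symp_hamLin, hαD, ← hβ]
    ring
  have hβv : ∀ v, β v = v 0 * β (EuclideanSpace.single 0 1) +
      v 1 * β (EuclideanSpace.single 1 1) := fun v => by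
    conv_lhs => rw [plane_eq v]
    simp
  set β₀ := β (EuclideanSpace.single 0 1) with hβ₀
  set β₁ := β (EuclideanSpace.single 1 1) with hβ₁
  have h3 := h2 (EuclideanSpace.single 0 1)
  have h4 := h2 (EuclideanSpace.single 1 1)
  rw [hβv] at h1
  simp [← hβ₀, ← hβ₁] at h3 h4
  have hne : 0 < w 0 ^ 2 + w 1 ^ 2 + a ^ 2 := by
    by_contra! hcon
    have h5 : a = 0 := by nlinarith [sq_nonneg (w 0), sq_nonneg (w 1), sq_nonneg a]
    have h6 : w 0 = 0 := by nlinarith [sq_nonneg (w 0), sq_nonneg (w 1), sq_nonneg a]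
    have h7 : w 1 = 0 := by nlinarith [sq_nonneg (w 0), sq_nonneg (w 1), sq_nonneg a]
    refine hamLin_ne_zero hα ?_
    rw [hX, h5, plane_eq w, h6, h7]
    simp
  obtain ⟨r, e0, e1, e2⟩ := exists_ratio_of_cross hne.ne' h1 h3 h4
  refine ⟨r, fun hr0 => ?_, fun v => ?_, e2⟩
  -- If `r = 0`, then `symp` vanishes identically on the hyperplane spanned by `E` and the image of
  -- `D`. But the radical of `symp` on that hyperplane is only the line of the Hamiltonian vector,
  -- so `E` and `D e₀` would be dependent.
  · rw [hr0] at e0 e1 e2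
    simp only [zero_mul, mul_zero, neg_zero] at e0 e1 e2
    have hβ0 : ∀ v, symp E (D v) = 0 := fun v => by rw [← hβ, hβv, e0, e1]; ring
    have hDD : ∀ u v, symp (D u) (D v) = 0 := fun u v => by rw [hD, e2]; ring
    obtain ⟨n, hn⟩ : ∃ n, α n = 1 := by
      obtain ⟨m, hm⟩ : ∃ m, α m ≠ 0 := by
        by_contra! hcon
        exact hα (ContinuousLinearMap.ext hcon)
      exact ⟨(α m)⁻¹ • m, by simp [hm]⟩
    -- A vector orthogonal to the hyperplane is determined by its pairing with one transverse vector
    -- `n`, normalized by `α n = 1`.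
    have key : ∀ u, symp u E = 0 → (∀ v, symp u (D v) = 0) → u = -(symp u n) • hamLin α := by
      intro u hu hu'
      rw [← sub_eq_zero]
      refine symp_eq_zero fun v => ?_
      obtain ⟨t, q, hv⟩ := exists_coords_of_ker hα hαE hαD hinj (u := v - α v • n) (by simp [hn])
      have h5 : symp (v - α v • n) u = 0 := by
        rw [hv, symp_add_left, symp_smul_left, symp_neg_swap E, symp_neg_swap (D q), hu, hu']
        simp
      rw [symp_sub_left, symp_smul_left, symp_neg_swap v, symp_neg_swap n] at h5
      rw [symp_sub_left, symp_smul_left, symp_hamLin]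
      linear_combination -h5
    have k1 := key E hEE hβ0
    have k2 := key (D (EuclideanSpace.single 0 1)) (by rw [symp_neg_swap, hβ0, neg_zero])
      fun v => hDD _ v
    set μ := symp E n
    set ν := symp (D (EuclideanSpace.single 0 1)) n
    have k3 : ν • E + D (-μ • EuclideanSpace.single 0 1) = 0 := by
      rw [map_smul, k2]
      nth_rw 1 [k1]
      module
    have k4 := (hinj _ _ k3).2
    have k5 : μ = 0 := by simpa using k4
    rw [k5, neg_zero, zero_smul] at k1
    have k6 := hinj 1 0 (by rw [k1]; simp)
    exact one_ne_zero k6.1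
  · rw [hβv, e0, e1]
    ring

end Symplectic

/-! ### Canonical coordinates and invariance of the Poisson bracket. -/

section CanonicalCharts

open Hamiltonian

variable {M : Type*} [TopologicalSpace M] [ChartedSpace Plane M] [IsManifold (𝓡 2) ∞ M]
  {z₀ z₁ z : Cotangent M} {f g : Cotangent M → ℝ}

lemma canon_fst (hz : z ∈ (canon z₀).source) :
    (canon z₀ z).1 = chartAt Plane z₀.proj z.proj := by
  rw [canon_apply z₀ z hz]

/-- The momentum coordinates are the components of the covector in the coordinate frame. -/
lemma canon_snd_cderiv (hz : z ∈ (canon z₀).source) (v : Plane) :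
    (canon z₀ z).2 (cderiv (chartAt Plane z₀.proj) z.proj v) =
      (z.2 : TangentSpace (𝓡 2) z.proj →L[ℝ] ℝ) v := by
  have hm := (canon_source z₀ z).1 hz
  have h1 : (canon z₀ z).2 = ContinuousLinearMap.inCoordinates Plane (TangentSpace (𝓡 2) (M := M)) ℝ
      (Trivial M ℝ) z₀.proj z.proj z₀.proj z.proj z.2 := by
    simp only [canon, FiberBundle.chartedSpace_chartAt, mfld_simps]
    rfl
  have h2 : cderiv (chartAt Plane z₀.proj) z.proj =
      (trivializationAt Plane (TangentSpace (𝓡 2) (M := M)) z₀.proj).continuousLinearMapAt ℝ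
        z.proj := (TangentBundle.continuousLinearMapAt_trivializationAt hm).symm
  rw [h1, h2]
  unfold ContinuousLinearMap.inCoordinates
  have h3 : z.proj ∈ (trivializationAt Plane (TangentSpace (𝓡 2) (M := M)) z₀.proj).baseSet := hm
  have h4 := (trivializationAt Plane (TangentSpace (𝓡 2) (M := M))
    z₀.proj).symmL_continuousLinearMapAt (R := ℝ) h3 v
  exact (congrArg (fun w => (trivializationAt ℝ (Trivial M ℝ) z₀.proj).continuousLinearMapAt ℝ z.proj
    (z.2 w)) h4).trans (by simp)

lemma mem_canon_self (z : Cotangent M) : z ∈ (canon z).source :=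
  mem_chart_source (ModelProd Plane CoPlane) z

/-- The differential of a function, in canonical coordinates. -/
def dcan (z₀ : Cotangent M) (f : Cotangent M → ℝ) (z : Cotangent M) : (Plane × CoPlane) →L[ℝ] ℝ :=
  fderiv ℝ (f ∘ (canon z₀).symm) (canon z₀ z)

lemma mfderiv_cot_eq (hf : MDifferentiableAt cotModel 𝓘(ℝ) f z) :
    (mfderiv cotModel 𝓘(ℝ) f z : Plane × CoPlane →L[ℝ] ℝ) = dcan z f z := by
  have hr : range (cotModel : ModelWithCorners ℝ (Plane × CoPlane) _) = univ :=
    ModelWithCorners.Boundaryless.range_eq_univ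
  have h1 : fderivWithin ℝ (writtenInExtChartAt cotModel 𝓘(ℝ, ℝ) z f) (range cotModel)
      (extChartAt cotModel z z) = dcan z f z := by
    rw [hr, fderivWithin_univ]
    rfl
  unfold mfderiv
  exact (if_pos hf).trans h1

lemma poisson_eq_dcan_self (hf : MDifferentiableAt cotModel 𝓘(ℝ) f z)
    (hg : MDifferentiableAt cotModel 𝓘(ℝ) g z) :
    poisson f g z = dcan z g z (hamLin (dcan z f z)) := by
  have h1 : hamVec f z = hamLin (dcan z f z) := by
    rw [← mfderiv_cot_eq hf]
    rfl
  unfold poisson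
  rw [h1]
  exact congrArg (fun L : Plane × CoPlane →L[ℝ] ℝ => L (hamLin (dcan z f z))) (mfderiv_cot_eq hg)

lemma contDiffAt_canon_transition (h₀ : z ∈ (canon z₀).source) (h₁ : z ∈ (canon z₁).source) :
    ContDiffAt ℝ ∞ (canon z₁ ∘ (canon z₀).symm) (canon z₀ z) := by
  have h2 := canon_symm_smoothAt z₀ _ ((canon z₀).map_source h₀)
  have h3 : ContMDiffAt cotModel 𝓘(ℝ, Plane × CoPlane) ∞ (canon z₁)
      ((canon z₀).symm (canon z₀ z)) := by
    rw [(canon z₀).left_inv h₀]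
    exact canon_smoothAt z₁ z h₁
  exact (h3.comp _ h2).contDiffAt

lemma eventually_canon {p : Cotangent M → Prop} (hz : z ∈ (canon z₀).source)
    (h : ∀ᶠ w in 𝓝 z, p w) : ∀ᶠ u in 𝓝 (canon z₀ z), p ((canon z₀).symm u) :=
  ((canon z₀).tendsto_symm hz).eventually h

/-- The transition maps between canonical charts preserve the Liouville form. -/
lemma liouville_transition (h₀ : z ∈ (canon z₀).source) (h₁ : z ∈ (canon z₁).source) :
    liouville (canon z₀ z) = (liouville (canon z₁ z)).comp
      (fderiv ℝ (canon z₁ ∘ (canon z₀).symm) (canon z₀ z)) := by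
  have hm₀ := (canon_source z₀ z).1 h₀
  have hm₁ := (canon_source z₁ z).1 h₁
  have he₀ := chart_mem_atlas Plane z₀.proj
  have he₁ := chart_mem_atlas Plane z₁.proj
  have hT := (contDiffAt_canon_transition h₀ h₁).differentiableAt (by simp)
  have hθ := (contDiffAt_transition he₀ he₁ hm₀ hm₁).differentiableAt (by simp)
  rw [← canon_fst h₀] at hθ
  -- The position part of the transition is the chart change on the base and does not involve the
  -- momentum; the covector itself is independent of the chart, so its pairing with the base
  -- displacement is too.
  have h2 : (fun u => (canon z₁ ((canon z₀).symm u)).1) =ᶠ[𝓝 (canon z₀ z)]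
      fun u => (chartAt Plane z₁.proj ∘ (chartAt Plane z₀.proj).symm) u.1 := by
    filter_upwards [(canon z₀).open_target.mem_nhds ((canon z₀).map_source h₀),
      eventually_canon h₀ ((canon z₁).open_source.mem_nhds h₁)] with u hu hu'
    rw [canon_fst hu']
    have h3 : u.1 = chartAt Plane z₀.proj ((canon z₀).symm u).proj := by
      conv_lhs => rw [← (canon z₀).right_inv hu]
      exact canon_fst ((canon z₀).map_target hu)
    simp only [Function.comp]
    rw [h3, (chartAt Plane z₀.proj).left_inv
      ((canon_source z₀ _).1 ((canon z₀).map_target hu))]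
  have h4 : HasFDerivAt (fun u => (canon z₁ ((canon z₀).symm u)).1)
      ((fderiv ℝ (chartAt Plane z₁.proj ∘ (chartAt Plane z₀.proj).symm) (canon z₀ z).1).comp
        (ContinuousLinearMap.fst ℝ Plane CoPlane)) (canon z₀ z) :=
    (hθ.hasFDerivAt.comp (canon z₀ z) hasFDerivAt_fst).congr_of_eventuallyEq h2
  have h5 : HasFDerivAt (fun u => (canon z₁ ((canon z₀).symm u)).1)
      ((ContinuousLinearMap.fst ℝ Plane CoPlane).comp
        (fderiv ℝ (canon z₁ ∘ (canon z₀).symm) (canon z₀ z))) (canon z₀ z) :=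
    (hasFDerivAt_fst (p := (canon z₁ ∘ (canon z₀).symm) (canon z₀ z))).comp (canon z₀ z)
      hT.hasFDerivAt
  have h6 := h5.unique h4
  refine ContinuousLinearMap.ext fun δ => ?_
  have h7 : (fderiv ℝ (canon z₁ ∘ (canon z₀).symm) (canon z₀ z) δ).1 =
      fderiv ℝ (chartAt Plane z₁.proj ∘ (chartAt Plane z₀.proj).symm) (canon z₀ z).1 δ.1 :=
    congrArg (fun L : Plane × CoPlane →L[ℝ] Plane => L δ) h6
  obtain ⟨v, hv⟩ := (cderiv_bijective he₀ hm₀).2 δ.1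
  have h8 : fderiv ℝ (chartAt Plane z₁.proj ∘ (chartAt Plane z₀.proj).symm) (canon z₀ z).1
      (cderiv (chartAt Plane z₀.proj) z.proj v) = cderiv (chartAt Plane z₁.proj) z.proj v := by
    rw [canon_fst h₀]
    exact (mfderiv_eq_fderiv_chart he₀ hm₀ (mdifferentiableAt_atlas he₁ hm₁) v).symm
  rw [ContinuousLinearMap.comp_apply, liouville_apply, liouville_apply, h7, ← hv, h8,
    canon_snd_cderiv h₀, canon_snd_cderiv h₁]

/-- The transition maps between canonical charts are symplectic. -/
lemma symp_transition (h₀ : z ∈ (canon z₀).source) (h₁ : z ∈ (canon z₁).source)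
    (u v : Plane × CoPlane) :
    symp (fderiv ℝ (canon z₁ ∘ (canon z₀).symm) (canon z₀ z) u)
      (fderiv ℝ (canon z₁ ∘ (canon z₀).symm) (canon z₀ z) v) = symp u v := by
  have h1 : ∀ᶠ y in 𝓝 (canon z₀ z), liouville y =
      (liouville ((canon z₁ ∘ (canon z₀).symm) y)).comp
        (fderiv ℝ (canon z₁ ∘ (canon z₀).symm) y) := by
    filter_upwards [(canon z₀).open_target.mem_nhds ((canon z₀).map_source h₀),
      eventually_canon h₀ ((canon z₁).open_source.mem_nhds h₁)] with y hy hy'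
    have := liouville_transition ((canon z₀).map_target hy) hy'
    rwa [(canon z₀).right_inv hy] at this
  rw [← curl_pullback_liouville ((contDiffAt_canon_transition h₀ h₁).of_le (by norm_cast)) h1 u v]
  exact curl_liouville u v

lemma fderiv_transition_comp (h₀ : z ∈ (canon z₀).source) (h₁ : z ∈ (canon z₁).source)
    (v : Plane × CoPlane) : fderiv ℝ (canon z₁ ∘ (canon z₀).symm) (canon z₀ z)
      (fderiv ℝ (canon z₀ ∘ (canon z₁).symm) (canon z₁ z) v) = v := by
  have h2 := (contDiffAt_canon_transition h₀ h₁).differentiableAt (by simp)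
  have h3 := (contDiffAt_canon_transition h₁ h₀).differentiableAt (by simp)
  have h4 : (canon z₀ ∘ (canon z₁).symm) (canon z₁ z) = canon z₀ z := by
    simp [(canon z₁).left_inv h₁]
  rw [← h4] at h2
  have h5 := h2.hasFDerivAt.comp (canon z₁ z) h3.hasFDerivAt
  have h6 : HasFDerivAt ((canon z₁ ∘ (canon z₀).symm) ∘ canon z₀ ∘ (canon z₁).symm)
      (ContinuousLinearMap.id ℝ (Plane × CoPlane)) (canon z₁ z) := by
    refine (hasFDerivAt_id _).congr_of_eventuallyEq ?_
    filter_upwards [(canon z₁).open_target.mem_nhds ((canon z₁).map_source h₁),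
      eventually_canon h₁ ((canon z₀).open_source.mem_nhds h₀)] with u hu hu'
    simp [(canon z₀).left_inv hu', (canon z₁).right_inv hu]
  have h7 := h5.unique h6
  rw [h4] at h7
  exact congrArg (fun L : Plane × CoPlane →L[ℝ] Plane × CoPlane => L v) h7

lemma differentiableAt_canon {E : Type*} [NormedAddCommGroup E] [NormedSpace ℝ E]
    {f : Cotangent M → E} (h₀ : z ∈ (canon z₀).source)
    (hf : MDifferentiableAt cotModel 𝓘(ℝ, E) f z) :
    DifferentiableAt ℝ (f ∘ (canon z₀).symm) (canon z₀ z) := by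
  have h2 := (canon_symm_smoothAt z₀ _ ((canon z₀).map_source h₀)).mdifferentiableAt (by simp)
  have h3 : MDifferentiableAt cotModel 𝓘(ℝ, E) f ((canon z₀).symm (canon z₀ z)) := by
    rwa [(canon z₀).left_inv h₀]
  exact (h3.comp _ h2).differentiableAt

lemma dcan_transition (h₀ : z ∈ (canon z₀).source) (h₁ : z ∈ (canon z₁).source)
    (hf : MDifferentiableAt cotModel 𝓘(ℝ) f z) :
    dcan z₀ f z = (dcan z₁ f z).comp
      (fderiv ℝ (canon z₁ ∘ (canon z₀).symm) (canon z₀ z)) := by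
  have h2 := (contDiffAt_canon_transition h₀ h₁).differentiableAt (by simp)
  have h3 := differentiableAt_canon h₁ hf
  have h4 : (canon z₁ ∘ (canon z₀).symm) (canon z₀ z) = canon z₁ z := by
    simp [(canon z₀).left_inv h₀]
  rw [← h4] at h3
  have h5 := h3.hasFDerivAt.comp (canon z₀ z) h2.hasFDerivAt
  have h6 : f ∘ (canon z₀).symm =ᶠ[𝓝 (canon z₀ z)]
      (f ∘ (canon z₁).symm) ∘ canon z₁ ∘ (canon z₀).symm := by
    filter_upwards [eventually_canon h₀ ((canon z₁).open_source.mem_nhds h₁)] with u hu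
    simp [(canon z₁).left_inv hu]
  have h7 := (h5.congr_of_eventuallyEq h6).fderiv
  rw [h4] at h7
  exact h7

/-- Transitions preserve `symp` and pull back differentials, hence they carry one solution of the
nondegenerate equation defining the Hamiltonian vector to the other. -/
lemma hamLin_transition (h₀ : z ∈ (canon z₀).source) (h₁ : z ∈ (canon z₁).source)
    (hf : MDifferentiableAt cotModel 𝓘(ℝ) f z) :
    fderiv ℝ (canon z₁ ∘ (canon z₀).symm) (canon z₀ z) (hamLin (dcan z₀ f z)) =
      hamLin (dcan z₁ f z) := by
  rw [← sub_eq_zero]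
  refine symp_eq_zero fun v => ?_
  rw [← fderiv_transition_comp h₀ h₁ v, symp_sub_left, symp_transition h₀ h₁, symp_hamLin,
    symp_hamLin, dcan_transition h₀ h₁ hf]
  simp

/-- The Poisson bracket, in arbitrary canonical coordinates. -/
lemma poisson_eq_dcan (h₀ : z ∈ (canon z₀).source) (hf : MDifferentiableAt cotModel 𝓘(ℝ) f z)
    (hg : MDifferentiableAt cotModel 𝓘(ℝ) g z) :
    poisson f g z = dcan z₀ g z (hamLin (dcan z₀ f z)) := by
  rw [poisson_eq_dcan_self hf hg, ← hamLin_transition h₀ (mem_canon_self z) hf,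
    dcan_transition h₀ (mem_canon_self z) hg]
  rfl

end CanonicalCharts

/-! ### Local lifts of charts to the energy shell. -/

section Lifts

open Hamiltonian

variable {M : Type*} [TopologicalSpace M] [ChartedSpace Plane M] [IsManifold (𝓡 2) ∞ M]
  {h : Hamiltonian M} {z₀ z : Cotangent M} {f g : Cotangent M → ℝ}
  {e : OpenPartialHomeomorph h.Z Plane} {s : Plane → Cotangent M} {y : Plane}

/-- The Euler vector `p ∂_p`, in canonical coordinates. -/
def eulerVec (z₀ z : Cotangent M) : Plane × CoPlane := (0, (canon z₀ z).2)

lemma hasDerivAt_dil (hz : z ∈ (canon z₀).source) (hf : MDifferentiableAt cotModel 𝓘(ℝ) f z) :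
    HasDerivAt (fun r => f (dil r z)) (dcan z₀ f z (eulerVec z₀ z)) 1 := by
  have h1 : HasDerivAt (fun r : ℝ => (((canon z₀ z).1, r • (canon z₀ z).2) : Plane × CoPlane))
      (eulerVec z₀ z) 1 := by
    have h2 := (hasDerivAt_id (1 : ℝ)).smul_const (canon z₀ z).2
    rw [one_smul] at h2
    exact (hasDerivAt_const (1 : ℝ) (canon z₀ z).1).prodMk h2
  have h3 : HasFDerivAt (f ∘ (canon z₀).symm) (dcan z₀ f z)
      ((canon z₀ z).1, (1 : ℝ) • (canon z₀ z).2) := by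
    rw [one_smul]
    exact (differentiableAt_canon hz hf).hasFDerivAt
  refine (h3.comp_hasDerivAt (1 : ℝ) h1).congr_of_eventuallyEq (Eventually.of_forall fun r => ?_)
  have h4 : dil r z ∈ (canon z₀).source := (canon_source _ _).2 ((canon_source z₀ z).1 hz)
  simp only [Function.comp]
  rw [← canon_dil z₀ z hz, (canon z₀).left_inv h4]

lemma fderiv_comp_eq_dcan (hz : s y ∈ (canon z₀).source)
    (hs : ContMDiffAt 𝓘(ℝ, Plane) cotModel ∞ s y)
    (hf : MDifferentiableAt cotModel 𝓘(ℝ) f (s y)) :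
    fderiv ℝ (f ∘ s) y = (dcan z₀ f (s y)).comp (fderiv ℝ (canon z₀ ∘ s) y) := by
  have h1 : ContDiffAt ℝ ∞ (canon z₀ ∘ s) y := ((canon_smoothAt z₀ _ hz).comp y hs).contDiffAt
  have h2 := (differentiableAt_canon hz hf).hasFDerivAt.comp y
    (h1.differentiableAt (by simp)).hasFDerivAt
  refine (h2.congr_of_eventuallyEq ?_).fderiv
  filter_upwards [hs.continuousAt.eventually_mem ((canon z₀).open_source.mem_nhds hz)] with x hx
  simp [(canon z₀).left_inv hx]

lemma contMDiffAt_dil {r : Plane → ℝ} (hr : ContDiffAt ℝ ∞ r y)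
    (hs : ContMDiffAt 𝓘(ℝ, Plane) cotModel ∞ s y) :
    ContMDiffAt 𝓘(ℝ, Plane) cotModel ∞ (fun x => dil (r x) (s x)) y := by
  have hz := mem_canon_self (s y)
  have h1 : ContDiffAt ℝ ∞ (canon (s y) ∘ s) y := ((canon_smoothAt _ _ hz).comp y hs).contDiffAt
  have h2 : ContDiffAt ℝ ∞ (fun x => (((canon (s y) ∘ s) x).1, r x • ((canon (s y) ∘ s) x).2)) y :=
    (contDiffAt_fst.comp y h1).prodMk (hr.smul (contDiffAt_snd.comp y h1))
  have hd : ∀ (w : Cotangent M) (t : ℝ), w ∈ (canon (s y)).source →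
      dil t w ∈ (canon (s y)).source := fun w t hw =>
    (canon_source _ _).2 ((canon_source (s y) w).1 hw)
  have h3 : (((canon (s y) ∘ s) y).1, r y • ((canon (s y) ∘ s) y).2) ∈ (canon (s y)).target := by
    rw [Function.comp, ← canon_dil _ _ hz]
    exact (canon (s y)).map_source (hd _ _ hz)
  refine ((canon_symm_smoothAt (s y) _ h3).comp y h2.contMDiffAt).congr_of_eventuallyEq ?_
  filter_upwards [hs.continuousAt.eventually_mem ((canon (s y)).open_source.mem_nhds hz)] with x hx
  simp only [Function.comp]
  rw [← canon_dil _ _ hx, (canon (s y)).left_inv (hd _ _ hx)]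

namespace Hamiltonian

lemma mdifferentiableAt_toFun (hz : z ∈ h.shellSet) :
    MDifferentiableAt cotModel 𝓘(ℝ) h.toFun z :=
  (h.smooth.contMDiffAt (isOpen_ne_zero.mem_nhds hz.1)).mdifferentiableAt (by simp)

lemma dcan_toFun_ne_zero (hz : z ∈ h.shellSet) (hz₀ : z ∈ (canon z₀).source) :
    dcan z₀ h.toFun z ≠ 0 := by
  intro h0
  refine canon_ham_fderiv h z hz ?_
  have h1 := dcan_transition (mem_canon_self z) hz₀ (mdifferentiableAt_toFun hz)
  rw [h0, ContinuousLinearMap.zero_comp] at h1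
  exact h1

/-- Smooth local lifts of a chart of `Z₀` to the energy shell. -/
structure IsLift (h : Hamiltonian M) (e : OpenPartialHomeomorph h.Z Plane) (s : Plane → Cotangent M)
    (y : Plane) : Prop where
  chart : e ∈ h.smoothCharts
  mem : y ∈ e.target
  smooth : ContMDiffAt 𝓘(ℝ, Plane) cotModel ∞ s y
  lift : ∀ᶠ x in 𝓝 y, ∃ hs : s x ∈ h.shellSet, h.proj ⟨s x, hs⟩ = e.symm x

/-- `g` is differentiable at `z` and extends, near `z`, the function `f` on the energy shell. -/
def IsWeakExt (h : Hamiltonian M) (f : h.Shell → ℝ) (g : Cotangent M → ℝ) (z : Cotangent M) :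
    Prop :=
  MDifferentiableAt cotModel 𝓘(ℝ) g z ∧ ∀ᶠ w in 𝓝 z, ∀ hw : w ∈ h.shellSet, g w = f ⟨w, hw⟩

lemma IsLocalExt.isWeakExt {f : h.Shell → ℝ} {g : Cotangent M → ℝ} {z : h.Shell}
    (hg : h.IsLocalExt f g z) : h.IsWeakExt f g z.1 :=
  ⟨hg.1.mdifferentiableAt (by simp), hg.2⟩

lemma isWeakExt_toFun (hz : z ∈ h.shellSet) : h.IsWeakExt (fun _ => 0) h.toFun z :=
  ⟨mdifferentiableAt_toFun hz, Eventually.of_forall fun _ hw => hw.2⟩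

lemma continuousAt_dil (z : Cotangent M) : ContinuousAt (fun r : ℝ => dil r z) 1 := by
  have hz := mem_canon_self z
  have h1 : ContinuousAt (fun r : ℝ => (((canon z z).1, r • (canon z z).2) : Plane × CoPlane)) 1 := by
    fun_prop
  have h2 : (((canon z z).1, (1 : ℝ) • (canon z z).2) : Plane × CoPlane) = canon z z := by
    rw [one_smul]
  have h3 : ContinuousAt (canon z).symm ((canon z z).1, (1 : ℝ) • (canon z z).2) := by
    rw [h2]
    exact (canon z).continuousAt_symm ((canon z).map_source hz)
  refine (ContinuousAt.comp (f := fun r : ℝ => ((canon z z).1, r • (canon z z).2)) h3 h1).congr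
    (Eventually.of_forall fun r => ?_)
  have h4 : dil r z ∈ (canon z).source := (canon_source _ _).2 ((canon_source z z).1 hz)
  simp only [Function.comp]
  rw [← canon_dil z z hz, (canon z).left_inv h4]

/-- The derivative of a function on the shell along the Euler field. -/
lemma IsWeakExt.dcan_euler {f : h.Shell → ℝ} (hf : h.IsWeakExt f g z) (hz : z ∈ h.shellSet)
    (hz₀ : z ∈ (canon z₀).source) {q : ℝ → ℝ} {d : ℝ} (hq : HasDerivAt q d 1)
    (hfq : ∀ (r : ℝ) (hr : 0 < r), f ⟨dil r z, h.dil_mem_shellSet hz hr⟩ = q r) :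
    dcan z₀ g z (eulerVec z₀ z) = d := by
  refine (hasDerivAt_dil hz₀ hf.1).unique (hq.congr_of_eventuallyEq ?_)
  have h1 : ∀ᶠ r in 𝓝 (1 : ℝ), ∀ hw : dil r z ∈ h.shellSet, g (dil r z) = f ⟨dil r z, hw⟩ := by
    refine (continuousAt_dil z).eventually
      (p := fun w => ∀ hw : w ∈ h.shellSet, g w = f ⟨w, hw⟩) ?_
    beta_reduce
    rw [dil_one]
    exact hf.2
  filter_upwards [h1, lt_mem_nhds (zero_lt_one' ℝ)] with r hr hr0
  rw [hr (h.dil_mem_shellSet hz hr0), hfq r hr0]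

namespace IsLift

lemma mem_shell (hs : h.IsLift e s y) : s y ∈ h.shellSet := hs.lift.self_of_nhds.1

lemma proj_eq (hs : h.IsLift e s y) : h.proj ⟨s y, hs.mem_shell⟩ = e.symm y :=
  hs.lift.self_of_nhds.2

/-- Differentials of extensions along the lift see only values on the shell; together with the Euler
direction this covers the tangent space of the shell. -/
lemma dcan_eq (hs : h.IsLift e s y) {f : h.Shell → ℝ} (hg : h.IsWeakExt f g (s y))
    (hz₀ : s y ∈ (canon z₀).source) {q : Plane → ℝ}
    (hq : ∀ᶠ x in 𝓝 y, ∀ hx : s x ∈ h.shellSet, h.proj ⟨s x, hx⟩ = e.symm x →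
      f ⟨s x, hx⟩ = q x) (v : Plane) :
    dcan z₀ g (s y) (fderiv ℝ (canon z₀ ∘ s) y v) = fderiv ℝ q y v := by
  have h1 : g ∘ s =ᶠ[𝓝 y] q := by
    filter_upwards [hs.lift, hs.smooth.continuousAt.eventually hg.2, hq] with x hx hgx hqx
    obtain ⟨hx1, hx2⟩ := hx
    rw [← hqx hx1 hx2, ← hgx hx1]
    rfl
  rw [← h1.fderiv_eq, fderiv_comp_eq_dcan hz₀ hs.smooth hg.1]
  rfl

lemma dcan_toFun_euler (hz : z ∈ h.shellSet) (hz₀ : z ∈ (canon z₀).source) :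
    dcan z₀ h.toFun z (eulerVec z₀ z) = 0 :=
  (isWeakExt_toFun hz).dcan_euler hz hz₀ (q := fun _ => 0) (hasDerivAt_const _ _) fun _ _ => rfl

lemma dcan_toFun_lift (hs : h.IsLift e s y) (hz₀ : s y ∈ (canon z₀).source) (v : Plane) :
    dcan z₀ h.toFun (s y) (fderiv ℝ (canon z₀ ∘ s) y v) = 0 := by
  rw [hs.dcan_eq (isWeakExt_toFun hs.mem_shell) hz₀ (q := fun _ => 0)
    (Eventually.of_forall fun _ _ _ => rfl)]
  simp

/-- The components of a chart, as functions on the cotangent bundle. -/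
lemma exists_coord (hs : h.IsLift e s y) (i : Fin 2) : ∃ g : Cotangent M → ℝ,
    h.IsLocalExt (fun w => e (h.proj w) i) g ⟨s y, hs.mem_shell⟩ := by
  have h1 : h.proj ⟨s y, hs.mem_shell⟩ ∈ e.source := by
    rw [hs.proj_eq]
    exact e.map_target hs.mem
  obtain ⟨G, hG, hGe⟩ := hs.chart.1 _ h1
  refine ⟨fun w => G w i, ?_, ?_⟩
  · have h2 : ContDiff ℝ ∞ fun v : Plane => v i :=
      contDiff_piLp_apply (p := 2) (𝕜 := ℝ) (E := fun _ : Fin 2 => ℝ) (i := i)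
    exact h2.contMDiff.contMDiffAt.comp _ hG
  · filter_upwards [hGe] with w hw hw'
    rw [hw hw']

lemma dcan_coord_lift (hs : h.IsLift e s y) (hz₀ : s y ∈ (canon z₀).source) {i : Fin 2}
    (hg : h.IsWeakExt (fun w => e (h.proj w) i) g (s y)) (v : Plane) :
    dcan z₀ g (s y) (fderiv ℝ (canon z₀ ∘ s) y v) = v i := by
  rw [hs.dcan_eq hg hz₀ (q := fun x => x i)]
  · have h1 : HasFDerivAt (fun x : Plane => x i) (EuclideanSpace.proj i : Plane →L[ℝ] ℝ) y :=
      (EuclideanSpace.proj i : Plane →L[ℝ] ℝ).hasFDerivAt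
    rw [h1.fderiv]
    rfl
  · filter_upwards [e.open_target.mem_nhds hs.mem] with x hx _ hx2
    rw [hx2, e.right_inv hx]

lemma proj_dil (hz : z ∈ h.shellSet) {r : ℝ} (hr : 0 < r) :
    h.proj ⟨dil r z, h.dil_mem_shellSet hz hr⟩ = h.proj ⟨z, hz⟩ := by
  refine Quotient.sound (s := h.dilSetoid) (h.dilSetoid.iseqv.symm ?_)
  exact ⟨r, hr, rfl⟩

lemma dcan_comp_proj_euler {f : h.Z → ℝ} (hg : h.IsWeakExt (fun w => f (h.proj w)) g z)
    (hz : z ∈ h.shellSet) (hz₀ : z ∈ (canon z₀).source) :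
    dcan z₀ g z (eulerVec z₀ z) = 0 :=
  hg.dcan_euler hz hz₀ (q := fun _ => f (h.proj ⟨z, hz⟩)) (hasDerivAt_const _ _) fun r hr => by
    simp only [proj_dil hz hr]

/-- The chart coordinates are invariant under dilations, so their differentials kill the Euler
vector and read off `v`; then `t = 0` because the momentum does not vanish. -/
lemma injective (hs : h.IsLift e s y) (hz₀ : s y ∈ (canon z₀).source) (t : ℝ) (v : Plane)
    (h0 : t • eulerVec z₀ (s y) + fderiv ℝ (canon z₀ ∘ s) y v = 0) : t = 0 ∧ v = 0 := by
  have hv : v = 0 := by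
    ext i
    obtain ⟨g, hg⟩ := hs.exists_coord i
    have h1 := congrArg (dcan z₀ g (s y)) h0
    rw [map_add, map_smul, dcan_comp_proj_euler (f := fun ζ => e ζ i) hg.isWeakExt hs.mem_shell hz₀,
      hs.dcan_coord_lift hz₀ hg.isWeakExt] at h1
    simpa using h1
  refine ⟨?_, hv⟩
  rw [hv, map_zero, add_zero, smul_eq_zero] at h0
  refine h0.resolve_right fun h2 => ?_
  exact (canon_snd_ne z₀ _ hz₀).2 hs.mem_shell.1 (congrArg Prod.snd h2)

/-- The Hamiltonian vector field is tangent to the shell. -/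
lemma exists_hamLin_eq (hs : h.IsLift e s y) (hz₀ : s y ∈ (canon z₀).source) :
    ∃ (t : ℝ) (v : Plane), hamLin (dcan z₀ h.toFun (s y)) =
      t • eulerVec z₀ (s y) + fderiv ℝ (canon z₀ ∘ s) y v := by
  refine exists_coords_of_ker (dcan_toFun_ne_zero hs.mem_shell hz₀)
    (dcan_toFun_euler hs.mem_shell hz₀) (hs.dcan_toFun_lift hz₀) (hs.injective hz₀) ?_
  -- Tangency is the antisymmetry of `symp`: the differential of the Hamiltonian vanishes on its own
  -- Hamiltonian vector.
  have h1 := symp_hamLin (dcan z₀ h.toFun (s y)) (hamLin (dcan z₀ h.toFun (s y)))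
  have h2 := symp_neg_swap (hamLin (dcan z₀ h.toFun (s y))) (hamLin (dcan z₀ h.toFun (s y)))
  linarith

end IsLift

/-- Every point of the shell lies on a local lift. -/
lemma exists_isLift (z : h.Shell) {e : OpenPartialHomeomorph h.Z Plane} (he : e ∈ h.smoothCharts)
    (hz : h.proj z ∈ e.source) : ∃ s, h.IsLift e s (e (h.proj z)) ∧ s (e (h.proj z)) = z.1 := by
  obtain ⟨s, hs, hse⟩ := he.2 _ (e.map_source hz)
  obtain ⟨h1, h2⟩ := hse.self_of_nhds
  rw [e.left_inv hz] at h2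
  obtain ⟨r, hr, hrz⟩ := (Quotient.exact h2 : h.dilSetoid.r _ _)
  refine ⟨fun x => dil r (s x), ⟨he, e.map_source hz, contMDiffAt_dil contDiffAt_const hs, ?_⟩,
    hrz.symm⟩
  filter_upwards [hse] with x hx
  obtain ⟨h3, h4⟩ := hx
  exact ⟨h.dil_mem_shellSet h3 hr, by rw [IsLift.proj_dil h3 hr, h4]⟩

/-- The difference of two extensions extends `0`, so its differential vanishes on the Euler vector
and along the lift, which span the Hamiltonian vector. -/
lemma IsLift.poisson_eq {f : h.Shell → ℝ} {g' : Cotangent M → ℝ} (hs : h.IsLift e s y)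
    (hg : h.IsWeakExt f g (s y)) (hg' : h.IsWeakExt f g' (s y)) :
    poisson h.toFun g (s y) = poisson h.toFun g' (s y) := by
  have hz₀ := mem_canon_self (s y)
  have hsub : h.IsWeakExt (fun _ => 0) (fun w => g w - g' w) (s y) := by
    refine ⟨hg.1.sub hg'.1, ?_⟩
    filter_upwards [hg.2, hg'.2] with w h1 h2 hw
    rw [h1 hw, h2 hw, sub_self]
  obtain ⟨t, v, hX⟩ := hs.exists_hamLin_eq hz₀
  have h1 : poisson h.toFun (fun w => g w - g' w) (s y) = 0 := by
    rw [poisson_eq_dcan hz₀ (mdifferentiableAt_toFun hs.mem_shell) hsub.1, hX, map_add, map_smul,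
      hsub.dcan_euler hs.mem_shell hz₀ (q := fun _ => 0) (hasDerivAt_const _ _) fun _ _ => rfl,
      hs.dcan_eq hsub hz₀ (q := fun _ => 0) (Eventually.of_forall fun _ _ _ => rfl)]
    simp
  have h2 : poisson h.toFun (fun w => g w - g' w) (s y) =
      poisson h.toFun g (s y) - poisson h.toFun g' (s y) := by
    rw [poisson_eq_dcan hz₀ (mdifferentiableAt_toFun hs.mem_shell) hsub.1,
      poisson_eq_dcan hz₀ (mdifferentiableAt_toFun hs.mem_shell) hg.1,
      poisson_eq_dcan hz₀ (mdifferentiableAt_toFun hs.mem_shell) hg'.1]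
    have h3 : dcan (s y) (fun w => g w - g' w) (s y) = dcan (s y) g (s y) - dcan (s y) g' (s y) :=
      fderiv_sub (differentiableAt_canon hz₀ hg.1) (differentiableAt_canon hz₀ hg'.1)
    rw [h3]
    rfl
  linarith

/-- The derivative along the Hamiltonian vector field depends only on the values on the shell. -/
lemma IsWeakExt.poisson_eq {f : h.Shell → ℝ} {g' : Cotangent M → ℝ} (hg : h.IsWeakExt f g z)
    (hg' : h.IsWeakExt f g' z) (hz : z ∈ h.shellSet) :
    poisson h.toFun g z = poisson h.toFun g' z := by
  obtain ⟨e, he, hez⟩ := h.exists_smoothChart (h.proj ⟨z, hz⟩)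
  obtain ⟨s, hs, hsz⟩ := exists_isLift ⟨z, hz⟩ he hez
  have h1 : s (e (h.proj ⟨z, hz⟩)) = z := hsz
  have h2 := hs.poisson_eq (f := f) (g := g) (g' := g') (by rwa [h1]) (by rwa [h1])
  rwa [h1] at h2

end Hamiltonian

end Lifts

/-! ### Scales, generators and the decomposition `𝒳_h = W + a E`. -/

section Scales

open Hamiltonian

variable {M : Type*} [TopologicalSpace M] [ChartedSpace Plane M] [IsManifold (𝓡 2) ∞ M]
  {h : Hamiltonian M} {z₀ : Cotangent M} {c : h.Shell → ℝ} {V : Set h.Z}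
  {W : ∀ ζ : h.Z, TangentSpace (𝓡 2) ζ}
  {e e' : OpenPartialHomeomorph h.Z Plane} {s : Plane → Cotangent M} {y : Plane}

namespace Hamiltonian

/-- Positive functions on the cone over `V`, smooth and homogeneous of degree one. -/
structure IsScale (h : Hamiltonian M) (V : Set h.Z) (c : h.Shell → ℝ) : Prop where
  pos : ∀ z, h.proj z ∈ V → 0 < c z
  smooth : ∀ z, h.proj z ∈ V → h.ShellSmoothAt c z
  homogeneous : ∀ z : h.Shell, h.proj z ∈ V → ∀ (r : ℝ) (hr : 0 < r),
    c ⟨dil r z.1, h.dil_mem_shellSet z.2 hr⟩ = r * c z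

/-- `W` is over `V` the projection of `c 𝒳_h`. -/
structure IsGenerator (h : Hamiltonian M) (W : ∀ ζ : h.Z, TangentSpace (𝓡 2) ζ) (V : Set h.Z)
    (c : h.Shell → ℝ) : Prop where
  smooth : SmoothFieldOn W V
  scale : h.IsScale V c
  deriv : ∀ z, h.proj z ∈ V → ∀ f : h.Z → ℝ, ContMDiffAt (𝓡 2) 𝓘(ℝ) ∞ f (h.proj z) →
    ∃ d, h.HasHamDerivAt (fun w => f (h.proj w)) d z ∧ lieDeriv W f (h.proj z) = c z * d

lemma Generates.exists_isGenerator (hW : h.Generates W V) : ∃ c, h.IsGenerator W V c := by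
  obtain ⟨h1, c, hc⟩ := hW
  exact ⟨c, h1, ⟨fun z hz => (hc z hz).1, fun z hz => (hc z hz).2.1,
    fun z hz => (hc z hz).2.2.1⟩, fun z hz => (hc z hz).2.2.2⟩

lemma proj_surjective (h : Hamiltonian M) : Function.Surjective h.proj := Quotient.exists_rep

lemma exists_dil_of_proj_eq {z w : h.Shell} (hzw : h.proj z = h.proj w) :
    ∃ (r : ℝ) (hr : 0 < r), w = ⟨dil r z.1, h.dil_mem_shellSet z.2 hr⟩ := by
  obtain ⟨r, hr, hw⟩ := (Quotient.exact hzw : h.dilSetoid.r _ _)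
  exact ⟨r, hr, Subtype.ext hw⟩

lemma IsScale.exists_unit (hc : h.IsScale univ c) (ζ : h.Z) :
    ∃ z : h.Shell, h.proj z = ζ ∧ c z = 1 := by
  obtain ⟨z, hz⟩ := h.proj_surjective ζ
  have h1 := hc.pos z (mem_univ _)
  refine ⟨⟨dil (c z)⁻¹ z.1, h.dil_mem_shellSet z.2 (inv_pos.2 h1)⟩, ?_, ?_⟩
  · rw [IsLift.proj_dil z.2 (inv_pos.2 h1), hz]
  · rw [hc.homogeneous z (mem_univ _) _ (inv_pos.2 h1), inv_mul_cancel₀ h1.ne']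

/-- The section of the energy shell on which the scale is one. -/
def IsScale.unit (hc : h.IsScale univ c) (ζ : h.Z) : h.Shell := (hc.exists_unit ζ).choose

lemma IsScale.proj_unit (hc : h.IsScale univ c) (ζ : h.Z) : h.proj (hc.unit ζ) = ζ :=
  (hc.exists_unit ζ).choose_spec.1

lemma IsScale.apply_unit (hc : h.IsScale univ c) (ζ : h.Z) : c (hc.unit ζ) = 1 :=
  (hc.exists_unit ζ).choose_spec.2

lemma IsScale.eq_unit (hc : h.IsScale univ c) (z : h.Shell) : (hc.unit (h.proj z)).1 =
    dil (c z)⁻¹ z.1 := by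
  obtain ⟨r, hr, h1⟩ := exists_dil_of_proj_eq (hc.proj_unit (h.proj z)).symm
  have h2 := hc.homogeneous z (mem_univ _) r hr
  rw [← h1, hc.apply_unit] at h2
  rw [h1]
  exact congrArg (fun t => dil t z.1) (eq_inv_of_mul_eq_one_left h2.symm)

/-- The section, in a chart of `Z₀`. -/
def IsScale.lift (hc : h.IsScale univ c) (e : OpenPartialHomeomorph h.Z Plane) (y : Plane) :
    Cotangent M := (hc.unit (e.symm y)).1

lemma IsLift.contDiffAt_comp {f : h.Shell → ℝ} {g : Cotangent M → ℝ} (hs : h.IsLift e s y)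
    (hg : h.IsLocalExt f g ⟨s y, hs.mem_shell⟩) : ContDiffAt ℝ ∞ (g ∘ s) y :=
  (hg.1.comp y hs.smooth).contDiffAt

/-- Any smooth local lift, rescaled by the inverse of the value of `c` on it, is the section `c =
1`; smoothness of the section follows. -/
lemma IsScale.isLift (hc : h.IsScale univ c) (he : e ∈ h.smoothCharts) (hy : y ∈ e.target) :
    h.IsLift e (hc.lift e) y := by
  have h1 : h.proj (hc.unit (e.symm y)) = e.symm y := hc.proj_unit _
  obtain ⟨s, hs, hsy⟩ := exists_isLift (hc.unit (e.symm y)) he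
    (by rw [h1]; exact e.map_target hy)
  rw [h1, e.right_inv hy] at hs hsy
  obtain ⟨g, hg⟩ := hc.smooth ⟨s y, hs.mem_shell⟩ (mem_univ _)
  have h2 := hs.contDiffAt_comp hg
  have h3 : (g ∘ s) y ≠ 0 := by
    show g (s y) ≠ 0
    rw [hg.2.self_of_nhds hs.mem_shell]
    exact (hc.pos _ (mem_univ _)).ne'
  refine ⟨he, hy, (contMDiffAt_dil (h2.inv h3) hs.smooth).congr_of_eventuallyEq ?_,
    Eventually.of_forall fun x => ⟨(hc.unit (e.symm x)).2, hc.proj_unit _⟩⟩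
  filter_upwards [hs.lift, hs.smooth.continuousAt.eventually hg.2] with x hx hgx
  obtain ⟨hx1, hx2⟩ := hx
  have h4 := hc.eq_unit ⟨s x, hx1⟩
  rw [hx2] at h4
  exact h4.trans (congrArg (fun t => dil t⁻¹ (s x)) (hgx hx1).symm)

/-- A smooth local extension of a scale at a point of the section. -/
def IsScale.ext (hc : h.IsScale univ c) (ζ : h.Z) : Cotangent M → ℝ :=
  (hc.smooth (hc.unit ζ) (mem_univ _)).choose

lemma IsScale.isLocalExt (hc : h.IsScale univ c) (ζ : h.Z) :
    h.IsLocalExt c (hc.ext ζ) (hc.unit ζ) :=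
  (hc.smooth (hc.unit ζ) (mem_univ _)).choose_spec

/-- The derivative of the scale along the Hamiltonian vector field, on the section. -/
def IsScale.growth (hc : h.IsScale univ c) (ζ : h.Z) : ℝ :=
  poisson h.toFun (hc.ext ζ) (hc.unit ζ).1

lemma IsScale.growth_eq (hc : h.IsScale univ c) {ζ : h.Z} {g : Cotangent M → ℝ}
    (hg : h.IsWeakExt c g (hc.unit ζ).1) : hc.growth ζ = poisson h.toFun g (hc.unit ζ).1 :=
  (hc.isLocalExt ζ).isWeakExt.poisson_eq hg (hc.unit ζ).2

lemma HasHamDerivAt.eq_poisson {f : h.Shell → ℝ} {d : ℝ} {z : h.Shell} {g : Cotangent M → ℝ}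
    (hd : h.HasHamDerivAt f d z) (hg : h.IsWeakExt f g z.1) : d = poisson h.toFun g z.1 := by
  obtain ⟨g', hg', rfl⟩ := hd
  exact hg'.isWeakExt.poisson_eq hg z.2

lemma IsGenerator.chartField_apply (hW : h.IsGenerator W V c) (he : e ∈ h.smoothCharts)
    {z : h.Shell} (hz : h.proj z ∈ V) (hze : h.proj z ∈ e.source) (i : Fin 2)
    {g : Cotangent M → ℝ} (hg : h.IsWeakExt (fun w => e (h.proj w) i) g z.1) :
    chartField W e (e (h.proj z)) i = c z * poisson h.toFun g z.1 := by
  have h1 : ContMDiffAt (𝓡 2) 𝓘(ℝ, Plane) ∞ e (h.proj z) :=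
    (contMDiffOn_atlas he).contMDiffAt (e.open_source.mem_nhds hze)
  have h2 : ContMDiffAt (𝓡 2) 𝓘(ℝ) ∞ (fun ζ => e ζ i) (h.proj z) :=
    (EuclideanSpace.proj (𝕜 := ℝ) i : Plane →L[ℝ] ℝ).contMDiff.contMDiffAt.comp _ h1
  obtain ⟨d, hd, hdW⟩ := hW.deriv z hz _ h2
  rw [← hd.eq_poisson hg, ← hdW, lieDeriv_eq_chart he hze (h2.mdifferentiableAt (by simp))]
  have h3 : HasFDerivAt ((fun ζ => e ζ i) ∘ e.symm) (EuclideanSpace.proj i : Plane →L[ℝ] ℝ)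
      (e (h.proj z)) := by
    refine (EuclideanSpace.proj i : Plane →L[ℝ] ℝ).hasFDerivAt.congr_of_eventuallyEq ?_
    filter_upwards [e.open_target.mem_nhds (e.map_source hze)] with x hx
    simp [e.right_inv hx]
  rw [h3.fderiv]
  rfl

/-- The Hamiltonian vector along the section: its projection is `W`, and its component along the
Euler vector is the growth of the scale. -/
lemma IsGenerator.hamLin_eq (hW : h.IsGenerator W univ c) (he : e ∈ h.smoothCharts)
    (hy : y ∈ e.target) (hz₀ : hW.scale.lift e y ∈ (canon z₀).source) :
    hamLin (dcan z₀ h.toFun (hW.scale.lift e y)) =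
      hW.scale.growth (e.symm y) • eulerVec z₀ (hW.scale.lift e y) +
        fderiv ℝ (canon z₀ ∘ hW.scale.lift e) y (chartField W e y) := by
  have hs := hW.scale.isLift he hy
  have hm := mdifferentiableAt_toFun hs.mem_shell
  obtain ⟨t, v, hX⟩ := hs.exists_hamLin_eq hz₀
  have hC : h.IsWeakExt c (hW.scale.ext (e.symm y)) (hW.scale.lift e y) :=
    (hW.scale.isLocalExt (e.symm y)).isWeakExt
  have hc1 : c ⟨hW.scale.lift e y, hs.mem_shell⟩ = 1 := hW.scale.apply_unit _
  -- Evaluate on `c`: it is constant along the section and, being of degree one, has Euler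
  -- derivative `1` there.
  have ht : t = hW.scale.growth (e.symm y) := by
    have h1 := poisson_eq_dcan hz₀ hm hC.1
    rw [hX, map_add, map_smul, hs.dcan_eq hC hz₀ (q := fun _ => 1)
      (Eventually.of_forall fun x _ _ => hW.scale.apply_unit _),
      hC.dcan_euler hs.mem_shell hz₀ (q := fun r => r) (hasDerivAt_id 1)
      fun r hr => by
        rw [hW.scale.homogeneous ⟨_, hs.mem_shell⟩ (mem_univ _) r hr, hc1, mul_one]] at h1
    have h2 : t = poisson h.toFun (hW.scale.ext (e.symm y)) (hW.scale.lift e y) := by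
      simpa using h1.symm
    exact h2
  -- Evaluate on the chart coordinates, which have Euler derivative `0`; on the section the factor
  -- `c` in the definition of `W` is `1`.
  have hv : v = chartField W e y := by
    ext i
    obtain ⟨g, hg⟩ := hs.exists_coord i
    have h1 := poisson_eq_dcan hz₀ hm hg.isWeakExt.1
    rw [hX, map_add, map_smul, IsLift.dcan_comp_proj_euler (f := fun ζ => e ζ i) hg.isWeakExt
      hs.mem_shell hz₀, hs.dcan_coord_lift hz₀ hg.isWeakExt, smul_zero, zero_add] at h1
    have h2 := hW.chartField_apply he (z := ⟨_, hs.mem_shell⟩) (mem_univ _)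
      (by rw [hs.proj_eq]; exact e.map_target hy) i hg.isWeakExt
    rw [hs.proj_eq, e.right_inv hy] at h2
    rw [h2, hc1, one_mul, h1]
  rw [hX, ht, hv]

lemma contDiff_hamLin : ContDiff ℝ ∞ hamLin := by
  unfold hamLin
  fun_prop

lemma contDiffAt_dcan {f : Cotangent M → ℝ} (hs : h.IsLift e s y)
    (hz₀ : s y ∈ (canon z₀).source) (hf : ContMDiffAt cotModel 𝓘(ℝ) ∞ f (s y)) :
    ContDiffAt ℝ ∞ (fun x => dcan z₀ f (s x)) y := by
  have h1 : ContDiffAt ℝ ∞ (f ∘ (canon z₀).symm) (canon z₀ (s y)) := by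
    have h2 := canon_symm_smoothAt z₀ _ ((canon z₀).map_source hz₀)
    have h3 : ContMDiffAt cotModel 𝓘(ℝ) ∞ f ((canon z₀).symm (canon z₀ (s y))) := by
      rwa [(canon z₀).left_inv hz₀]
    exact (h3.comp _ h2).contDiffAt
  have h4 : ContDiffAt ℝ ∞ (canon z₀ ∘ s) y :=
    ((canon_smoothAt z₀ _ hz₀).comp y hs.smooth).contDiffAt
  exact ((h1.fderiv_right (m := ∞) (by norm_cast)).comp y h4 :)

/-- The growth of a scale is smooth. -/
lemma IsScale.contDiffAt_growth (hc : h.IsScale univ c) (he : e ∈ h.smoothCharts)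
    (hy : y ∈ e.target) : ContDiffAt ℝ ∞ (hc.growth ∘ e.symm) y := by
  have hs := hc.isLift he hy
  have hz := mem_canon_self (hc.lift e y)
  -- The growth is defined with an extension chosen separately at each point. Since it does not
  -- depend on that choice, this one extension computes it in a whole neighbourhood.
  obtain ⟨g, hg⟩ := hc.smooth (hc.unit (e.symm y)) (mem_univ _)
  have h1 := contDiffAt_dcan hs hz hg.1
  have h2 := contDiffAt_dcan hs hz (h.smooth.contMDiffAt (isOpen_ne_zero.mem_nhds hs.mem_shell.1))
  have h3 := h1.clm_apply (contDiff_hamLin.contDiffAt.comp y h2)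
  refine h3.congr_of_eventuallyEq ?_
  have hcs := hs.smooth.continuousAt
  have h4 : ∀ᶠ w in 𝓝 (hc.lift e y), MDifferentiableAt cotModel 𝓘(ℝ) g w := by
    have h5 : ContMDiffAt cotModel 𝓘(ℝ) 1 g (hc.lift e y) := hg.1.of_le (by norm_cast)
    filter_upwards [(contMDiffAt_iff_contMDiffAt_nhds (by simp)).1 h5] with w hw
    exact hw.mdifferentiableAt (by simp)
  filter_upwards [hcs.eventually_mem ((canon (hc.lift e y)).open_source.mem_nhds hz),
    hcs.eventually h4, hcs.eventually (eventually_eventually_nhds.2 hg.2)] with x hx1 hx2 hx3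
  have h6 : h.IsWeakExt c g (hc.unit (e.symm x)).1 := ⟨hx2, hx3⟩
  exact (hc.growth_eq h6).trans
    (poisson_eq_dcan hx1 (mdifferentiableAt_toFun (hc.unit (e.symm x)).2) hx2)

lemma IsScale.continuous_growth (hc : h.IsScale univ c) : Continuous hc.growth := by
  rw [continuous_iff_continuousAt]
  intro ζ
  have h1 := (hc.contDiffAt_growth (chart_mem_atlas Plane ζ)
    (mem_chart_target Plane ζ)).continuousAt
  refine (h1.comp ((chartAt Plane ζ).continuousAt (mem_chart_source Plane ζ))).congr ?_
  filter_upwards [(chartAt Plane ζ).open_source.mem_nhds (mem_chart_source Plane ζ)] with x hx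
  simp [(chartAt Plane ζ).left_inv hx]

end Hamiltonian

end Scales

/-! ### The Liouville density, for which the divergence of `W` is `-a`. -/

section LiouvilleDensity

open Hamiltonian

variable {M : Type*} [TopologicalSpace M] [ChartedSpace Plane M] [IsManifold (𝓡 2) ∞ M]
  {h : Hamiltonian M} {z₀ : Cotangent M} {c : h.Shell → ℝ}
  {W : ∀ ζ : h.Z, TangentSpace (𝓡 2) ζ}
  {e e' : OpenPartialHomeomorph h.Z Plane} {s : Plane → Cotangent M} {y : Plane}

/-- The pullback of the Liouville form by a map from the plane. -/
def liouvillePullback (s : Plane → Cotangent M) (y : Plane) : Plane →L[ℝ] ℝ :=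
  (liouville (canon (s y) (s y))).comp (fderiv ℝ (canon (s y) ∘ s) y)

/-- The definition uses a canonical chart that varies with the point; invariance of the Liouville
form allows a fixed one, in which the form can be differentiated. -/
lemma liouvillePullback_eq (hs : ContMDiffAt 𝓘(ℝ, Plane) cotModel ∞ s y)
    (hz₀ : s y ∈ (canon z₀).source) :
    liouvillePullback s y = (liouville (canon z₀ (s y))).comp (fderiv ℝ (canon z₀ ∘ s) y) := by
  have hz := mem_canon_self (s y)
  have h1 : ContDiffAt ℝ ∞ (canon (s y) ∘ s) y := ((canon_smoothAt _ _ hz).comp y hs).contDiffAt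
  have h2 := ((contDiffAt_canon_transition hz hz₀).differentiableAt (by simp)).hasFDerivAt.comp y
    (h1.differentiableAt (by simp)).hasFDerivAt
  have h3 : canon z₀ ∘ s =ᶠ[𝓝 y] (canon z₀ ∘ (canon (s y)).symm) ∘ canon (s y) ∘ s := by
    filter_upwards [hs.continuousAt.eventually_mem ((canon (s y)).open_source.mem_nhds hz)]
      with x hx
    simp [(canon (s y)).left_inv hx]
  rw [h3.fderiv_eq, h2.fderiv, liouvillePullback, liouville_transition hz hz₀]
  rfl

lemma eventually_liouvillePullback (hs : ∀ᶠ x in 𝓝 y, ContMDiffAt 𝓘(ℝ, Plane) cotModel ∞ s x)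
    (hz₀ : s y ∈ (canon z₀).source) : ∀ᶠ x in 𝓝 y, liouvillePullback s x =
      (liouville ((canon z₀ ∘ s) x)).comp (fderiv ℝ (canon z₀ ∘ s) x) := by
  filter_upwards [hs, hs.self_of_nhds.continuousAt.eventually_mem
    ((canon z₀).open_source.mem_nhds hz₀)] with x hx hx'
  exact liouvillePullback_eq hx hx'

lemma contDiffAt_pullback_linear {V V' : Type*} [NormedAddCommGroup V] [NormedSpace ℝ V]
    [NormedAddCommGroup V'] [NormedSpace ℝ V'] (B : V' →L[ℝ] V' →L[ℝ] ℝ) {T : V → V'} {x : V}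
    (hT : ContDiffAt ℝ ∞ T x) : ContDiffAt ℝ ∞ (fun y => (B (T y)).comp (fderiv ℝ T y)) x :=
  (B.contDiff.contDiffAt.comp x hT).clm_comp (hT.fderiv_right (m := ∞) (by norm_cast))

lemma contDiffAt_liouvillePullback
    (hs : ∀ᶠ x in 𝓝 y, ContMDiffAt 𝓘(ℝ, Plane) cotModel ∞ s x) :
    ContDiffAt ℝ ∞ (liouvillePullback s) y := by
  have hz := mem_canon_self (s y)
  have h1 : ContDiffAt ℝ ∞ (canon (s y) ∘ s) y :=
    ((canon_smoothAt _ _ hz).comp y hs.self_of_nhds).contDiffAt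
  exact (contDiffAt_pullback_linear (liouvilleForm Plane) h1).congr_of_eventuallyEq
    (eventually_liouvillePullback hs hz)

/-- The exterior derivative of a form in the plane. -/
def planeCurl (β : Plane → Plane →L[ℝ] ℝ) (y : Plane) : ℝ :=
  fderiv ℝ β y (EuclideanSpace.single 0 1) (EuclideanSpace.single 1 1) -
    fderiv ℝ β y (EuclideanSpace.single 1 1) (EuclideanSpace.single 0 1)

lemma contDiffAt_planeCurl {β : Plane → Plane →L[ℝ] ℝ} (hβ : ContDiffAt ℝ ∞ β y) :
    ContDiffAt ℝ ∞ (planeCurl β) y := by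
  have h1 : ContDiffAt ℝ ∞ (fderiv ℝ β) y := hβ.fderiv_right (by norm_cast)
  exact ((h1.clm_apply contDiffAt_const).clm_apply contDiffAt_const).sub
    ((h1.clm_apply contDiffAt_const).clm_apply contDiffAt_const)

/-- The exterior derivative is a 2-form in the plane, so pulling back multiplies it by the
determinant. -/
lemma planeCurl_pullback {A B : Plane → Plane →L[ℝ] ℝ} {T : Plane → Plane}
    (hT : ContDiffAt ℝ ∞ T y) (hB : DifferentiableAt ℝ B (T y))
    (hAB : ∀ᶠ x in 𝓝 y, A x = (B (T x)).comp (fderiv ℝ T x)) :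
    planeCurl A y = pdet (fderiv ℝ T y) * planeCurl B (T y) := by
  have h1 := curl_pullback (hT.of_le (by norm_cast)) hB hAB (EuclideanSpace.single 0 1)
    (EuclideanSpace.single 1 1)
  have h2 : ∀ u v : Plane, fderiv ℝ B (T y) u v - fderiv ℝ B (T y) v u =
      planeCurl B (T y) * (u 0 * v 1 - u 1 * v 0) := by
    intro u v
    conv_lhs => rw [plane_eq u, plane_eq v]
    simp only [map_add, map_smul, add_apply, smul_apply, smul_eq_mul, planeCurl]
    ring
  rw [h2, det_area] at h1
  unfold planeCurl at h1 ⊢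
  rw [h1]
  simp
  ring

namespace Hamiltonian

lemma IsScale.eventually_lift (hc : h.IsScale univ c) (he : e ∈ h.smoothCharts)
    (hy : y ∈ e.target) :
    ∀ᶠ x in 𝓝 y, ContMDiffAt 𝓘(ℝ, Plane) cotModel ∞ (hc.lift e) x := by
  filter_upwards [e.open_target.mem_nhds hy] with x hx
  exact (hc.isLift he hx).smooth

/-- The Liouville form on the section, in a chart. -/
def IsScale.form (hc : h.IsScale univ c) (e : OpenPartialHomeomorph h.Z Plane) :
    Plane → Plane →L[ℝ] ℝ := liouvillePullback (hc.lift e)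

lemma IsScale.contDiffAt_form (hc : h.IsScale univ c) (he : e ∈ h.smoothCharts)
    (hy : y ∈ e.target) : ContDiffAt ℝ ∞ (hc.form e) y :=
  contDiffAt_liouvillePullback (hc.eventually_lift he hy)

/-- The signed density `r` for which the Liouville form is the contraction of `r dy` with `W`, and
its differential is `-a r dy`. -/
def IsGenerator.ratio (hW : h.IsGenerator W univ c) (e : OpenPartialHomeomorph h.Z Plane)
    (y : Plane) : ℝ :=
  (hW.scale.form e y (EuclideanSpace.single 1 1) * chartField W e y 0 -
    hW.scale.form e y (EuclideanSpace.single 0 1) * chartField W e y 1 -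
    hW.scale.growth (e.symm y) * planeCurl (hW.scale.form e) y) /
  (chartField W e y 0 ^ 2 + chartField W e y 1 ^ 2 + hW.scale.growth (e.symm y) ^ 2)

/-- Apply `exists_ratio` to the section: contracting the symplectic form with the Euler vector gives
the Liouville form, and the symplectic form restricted to the section is its exterior derivative. -/
lemma IsGenerator.form_eq (hW : h.IsGenerator W univ c) (he : e ∈ h.smoothCharts)
    (hy : y ∈ e.target) : ∃ r ≠ 0, (∀ v, hW.scale.form e y v =
        r * (chartField W e y 0 * v 1 - chartField W e y 1 * v 0)) ∧
      planeCurl (hW.scale.form e) y = -(hW.scale.growth (e.symm y) * r) := by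
  have hs := hW.scale.isLift he hy
  have hz := mem_canon_self (hW.scale.lift e y)
  have h1 : ContDiffAt ℝ ∞ (canon (hW.scale.lift e y) ∘ hW.scale.lift e) y :=
    ((canon_smoothAt _ _ hz).comp y hs.smooth).contDiffAt
  refine exists_ratio (dcan_toFun_ne_zero hs.mem_shell hz)
    (IsLift.dcan_toFun_euler hs.mem_shell hz) (hs.dcan_toFun_lift hz) (hs.injective hz)
    (hW.hamLin_eq he hy hz) (fun v => ?_) ?_
  · simp [IsScale.form, liouvillePullback, liouville_apply, symp, eulerVec]
  · exact curl_pullback_liouville (h1.of_le (by norm_cast))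
      (eventually_liouvillePullback (hW.scale.eventually_lift he hy) hz) _ _

/-- Otherwise `𝒳_h = W + a E` would vanish, although `0` is a regular value. So the trace is nonzero
at singular points. -/
lemma IsGenerator.chartField_eq_zero (hW : h.IsGenerator W univ c) (he : e ∈ h.smoothCharts)
    (hy : y ∈ e.target) (hw : chartField W e y = 0) : hW.scale.growth (e.symm y) ≠ 0 := by
  intro h0
  have hs := hW.scale.isLift he hy
  have hz := mem_canon_self (hW.scale.lift e y)
  refine hamLin_ne_zero (dcan_toFun_ne_zero hs.mem_shell hz) ?_
  rw [hW.hamLin_eq he hy hz, hw, h0]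
  simp

lemma IsGenerator.denom_ne_zero (hW : h.IsGenerator W univ c) (he : e ∈ h.smoothCharts)
    (hy : y ∈ e.target) :
    chartField W e y 0 ^ 2 + chartField W e y 1 ^ 2 + hW.scale.growth (e.symm y) ^ 2 ≠ 0 := by
  intro h0
  have h1 : hW.scale.growth (e.symm y) = 0 := by
    nlinarith [sq_nonneg (chartField W e y 0), sq_nonneg (chartField W e y 1),
      sq_nonneg (hW.scale.growth (e.symm y))]
  have h2 : chartField W e y 0 = 0 := by
    nlinarith [sq_nonneg (chartField W e y 0), sq_nonneg (chartField W e y 1),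
      sq_nonneg (hW.scale.growth (e.symm y))]
  have h3 : chartField W e y 1 = 0 := by
    nlinarith [sq_nonneg (chartField W e y 0), sq_nonneg (chartField W e y 1),
      sq_nonneg (hW.scale.growth (e.symm y))]
  refine hW.chartField_eq_zero he hy ?_ h1
  rw [plane_eq (chartField W e y), h2, h3]
  simp

/-- The definition of `ratio` projects onto the vector formed by `W` and `a`, which never vanishes.
This selects the unique `r` by a formula that is smooth across the zeros of `W` and of `a`. -/
lemma IsGenerator.ratio_spec (hW : h.IsGenerator W univ c) (he : e ∈ h.smoothCharts)
    (hy : y ∈ e.target) : hW.ratio e y ≠ 0 ∧ (∀ v, hW.scale.form e y v =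
        hW.ratio e y * (chartField W e y 0 * v 1 - chartField W e y 1 * v 0)) ∧
      planeCurl (hW.scale.form e) y = -(hW.scale.growth (e.symm y) * hW.ratio e y) := by
  obtain ⟨r, hr, h1, h2⟩ := hW.form_eq he hy
  have h3 : hW.ratio e y = r := by
    rw [IsGenerator.ratio, div_eq_iff (hW.denom_ne_zero he hy), h1, h1, h2]
    simp
    ring
  rw [h3]
  exact ⟨hr, h1, h2⟩

lemma contDiffAt_coord {F : Plane → Plane} (hF : ContDiffAt ℝ ∞ F y) (i : Fin 2) :
    ContDiffAt ℝ ∞ (fun x => F x i) y :=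
  (EuclideanSpace.proj (𝕜 := ℝ) i : Plane →L[ℝ] ℝ).contDiff.contDiffAt.comp y hF

lemma IsGenerator.contDiffAt_ratio (hW : h.IsGenerator W univ c) (he : e ∈ h.smoothCharts)
    (hy : y ∈ e.target) : ContDiffAt ℝ ∞ (hW.ratio e) y := by
  have h1 := contDiffAt_chartField hW.smooth he hy
  have h2 := hW.scale.contDiffAt_form he hy
  have h3 : ContDiffAt ℝ ∞ (fun x => hW.scale.growth (e.symm x)) y :=
    hW.scale.contDiffAt_growth he hy
  have h4 := contDiffAt_planeCurl h2
  exact ((((h2.clm_apply contDiffAt_const).mul (contDiffAt_coord h1 0)).sub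
    ((h2.clm_apply contDiffAt_const).mul (contDiffAt_coord h1 1))).sub (h3.mul h4)).div
    ((((contDiffAt_coord h1 0).pow 2).add ((contDiffAt_coord h1 1).pow 2)).add (h3.pow 2))
    (hW.denom_ne_zero he hy)

/-- The lifts in the two charts parametrize the same hypersurface `c = 1`, so the pulled-back forms
correspond under the transition map. -/
lemma IsScale.form_transition (hc : h.IsScale univ c) (he : e ∈ h.smoothCharts)
    (he' : e' ∈ h.smoothCharts) {ζ : h.Z} (hζ : ζ ∈ e.source) (hζ' : ζ ∈ e'.source) :
    ∀ᶠ x in 𝓝 (e ζ), hc.form e x =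
      (hc.form e' ((e' ∘ e.symm) x)).comp (fderiv ℝ (e' ∘ e.symm) x) := by
  have h1 : ∀ᶠ x in 𝓝 (e ζ), hc.lift e x = hc.lift e' ((e' ∘ e.symm) x) := by
    filter_upwards [eventually_chart hζ (e'.open_source.mem_nhds hζ')] with x hx
    simp [IsScale.lift, e'.left_inv hx]
  filter_upwards [eventually_eventually_nhds.2 h1, e.open_target.mem_nhds (e.map_source hζ),
    eventually_chart hζ (e'.open_source.mem_nhds hζ')] with x hx hxt hx'
  have hT := contDiffAt_transition he he' (e.map_target hxt) hx'
  rw [e.right_inv hxt] at hT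
  have h2 : hc.lift e x = hc.lift e' ((e' ∘ e.symm) x) := hx.self_of_nhds
  have h3 := (hc.isLift he' (e'.map_source hx')).smooth
  have hz := mem_canon_self (hc.lift e x)
  have hz' : hc.lift e' ((e' ∘ e.symm) x) ∈ (canon (hc.lift e x)).source := by rwa [← h2]
  have h4 : ContDiffAt ℝ ∞ (canon (hc.lift e x) ∘ hc.lift e') ((e' ∘ e.symm) x) :=
    ((canon_smoothAt _ _ hz').comp _ h3).contDiffAt
  have h5 := (h4.differentiableAt (by simp)).hasFDerivAt.comp x
    (hT.differentiableAt (by simp)).hasFDerivAt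
  have h6 : canon (hc.lift e x) ∘ hc.lift e =ᶠ[𝓝 x]
      (canon (hc.lift e x) ∘ hc.lift e') ∘ e' ∘ e.symm := by
    filter_upwards [hx] with u hu
    exact congrArg _ hu
  have h7 : hc.form e' ((e' ∘ e.symm) x) = _ := liouvillePullback_eq h3 hz'
  rw [h7, IsScale.form, liouvillePullback_eq (hc.isLift he hxt).smooth hz, h6.fderiv_eq, h5.fderiv,
    h2]
  rfl

lemma chartField_transition (he : e ∈ h.smoothCharts) (he' : e' ∈ h.smoothCharts) {ζ : h.Z}
    (hζ : ζ ∈ e.source) (hζ' : ζ ∈ e'.source) :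
    chartField W e' (e' ζ) = fderiv ℝ (e' ∘ e.symm) (e ζ) (chartField W e (e ζ)) := by
  rw [DegreeZero.chartField_apply hζ']
  exact mfderiv_field_eq he hζ (mdifferentiableAt_atlas he' hζ')

/-- Where `W` is nonzero compare the one-forms, evaluated on a vector transverse to `W`. Where `W`
vanishes, `a` does not, and the comparison is between their exterior derivatives. -/
lemma IsGenerator.ratio_transition (hW : h.IsGenerator W univ c) (he : e ∈ h.smoothCharts)
    (he' : e' ∈ h.smoothCharts) {ζ : h.Z} (hζ : ζ ∈ e.source) (hζ' : ζ ∈ e'.source) :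
    hW.ratio e (e ζ) = pdet (fderiv ℝ (e' ∘ e.symm) (e ζ)) * hW.ratio e' (e' ζ) := by
  have hy := e.map_source hζ
  have hy' := e'.map_source hζ'
  obtain ⟨-, h1, h2⟩ := hW.ratio_spec he hy
  obtain ⟨-, h1', h2'⟩ := hW.ratio_spec he' hy'
  have h3 := hW.scale.form_transition he he' hζ hζ'
  have hT := contDiffAt_transition he he' hζ hζ'
  have hTe : (e' ∘ e.symm) (e ζ) = e' ζ := by simp [e.left_inv hζ]
  rw [e.left_inv hζ] at h2
  rw [e'.left_inv hζ'] at h2'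
  by_cases hw : chartField W e (e ζ) = 0
  · have h4 := hW.chartField_eq_zero he hy hw
    rw [e.left_inv hζ] at h4
    have h5 := planeCurl_pullback hT
      ((hTe ▸ hW.scale.contDiffAt_form he' hy').differentiableAt (by simp)) h3
    rw [hTe, h2, h2'] at h5
    refine mul_left_cancel₀ h4 ?_
    linear_combination -h5
  · obtain ⟨v, hv⟩ : ∃ v : Plane, chartField W e (e ζ) 0 * v 1 - chartField W e (e ζ) 1 * v 0 ≠ 0 := by
      by_contra! hcon
      have h4 := hcon (EuclideanSpace.single 0 1)
      have h5 := hcon (EuclideanSpace.single 1 1)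
      simp at h4 h5
      refine hw ?_
      rw [plane_eq (chartField W e (e ζ)), h4, h5]
      simp
    have h4 := congrArg (fun L : Plane →L[ℝ] ℝ => L v) h3.self_of_nhds
    simp only [ContinuousLinearMap.comp_apply, hTe, h1, h1'] at h4
    rw [chartField_transition he he' hζ hζ', det_area] at h4
    refine mul_right_cancel₀ hv ?_
    linear_combination h4

/-- The Liouville density of `Z₀` associated with a generator. -/
def IsGenerator.density (hW : h.IsGenerator W univ c) : SmoothDensity (univ : Set h.Z) where
  toFun e y := |hW.ratio e y|
  smooth e he y hy := ((contDiffAt_abs (hW.ratio_spec he hy.1).1).comp y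
    (hW.contDiffAt_ratio he hy.1)).contDiffWithinAt
  pos e he y hy := abs_pos.2 (hW.ratio_spec he hy.1).1
  transform e he e' he' ζ hζ := by
    rw [hW.ratio_transition he he' hζ.1.2 hζ.2, abs_mul]

/-- The components of `r W` are those of the Liouville form turned by a quarter, so the trace of its
derivative is the exterior derivative `-a r`. Near a point `|r|` is `r` up to a constant sign. -/
lemma IsGenerator.hasDivergence (hW : h.IsGenerator W univ c) :
    HasDivergence hW.density W (-hW.scale.growth) := by
  intro e he ζ hζ
  have hy := e.map_source hζ
  obtain ⟨h0, h1, h2⟩ := hW.ratio_spec he hy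
  rw [e.left_inv hζ] at h2
  obtain ⟨ε, hε, hεr⟩ : ∃ ε : ℝ, |hW.ratio e (e ζ)| = ε * hW.ratio e (e ζ) ∧
      ∀ᶠ x in 𝓝 (e ζ), |hW.ratio e x| = ε * hW.ratio e x := by
    have hc := (hW.contDiffAt_ratio he hy).continuousAt
    rcases lt_or_gt_of_ne h0 with h3 | h3
    · refine ⟨-1, by rw [abs_of_neg h3]; ring, ?_⟩
      filter_upwards [hc.eventually (gt_mem_nhds h3)] with x hx
      rw [abs_of_neg hx]
      ring
    · refine ⟨1, by rw [abs_of_pos h3]; ring, ?_⟩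
      filter_upwards [hc.eventually (lt_mem_nhds h3)] with x hx
      rw [abs_of_pos hx]
      ring
  have hβ : DifferentiableAt ℝ (hW.scale.form e) (e ζ) :=
    (hW.scale.contDiffAt_form he hy).differentiableAt (by simp)
  let L : (Plane →L[ℝ] ℝ) →L[ℝ] Plane :=
    ((ContinuousLinearMap.apply ℝ ℝ (EuclideanSpace.single 1 1 : Plane)).smulRight
      (EuclideanSpace.single 0 1 : Plane)) -
    ((ContinuousLinearMap.apply ℝ ℝ (EuclideanSpace.single 0 1 : Plane)).smulRight
      (EuclideanSpace.single 1 1 : Plane))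
  have hL : ∀ b : Plane →L[ℝ] ℝ, L b = b (EuclideanSpace.single 1 1) • EuclideanSpace.single 0 1 -
      b (EuclideanSpace.single 0 1) • EuclideanSpace.single 1 1 := fun b => rfl
  have h3 : (fun x => hW.density.toFun e x • chartField W e x) =ᶠ[𝓝 (e ζ)]
      fun x => ε • L (hW.scale.form e x) := by
    filter_upwards [hεr, e.open_target.mem_nhds hy] with x hx hxt
    obtain ⟨-, h4, -⟩ := hW.ratio_spec he hxt
    rw [hL, h4, h4]
    show |hW.ratio e x| • _ = _
    rw [hx]
    ext i
    fin_cases i <;> simp <;> ring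
  have h4 : HasFDerivAt (fun x => ε • L (hW.scale.form e x))
      (ε • L.comp (fderiv ℝ (hW.scale.form e) (e ζ))) (e ζ) :=
    (L.hasFDerivAt.comp (e ζ) hβ.hasFDerivAt).const_smul ε
  rw [h3.fderiv_eq, h4.fderiv, trace_plane]
  show _ = -hW.scale.growth ζ * |hW.ratio e (e ζ)|
  rw [hε]
  unfold planeCurl at h2
  simp only [smul_apply, ContinuousLinearMap.comp_apply, hL]
  simp
  linear_combination ε * h2

lemma IsGenerator.foliationData (hW : h.IsGenerator W univ c) {φ : Flow ℝ h.Z}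
    (hφ : IsFlowOf φ W) : FoliationData W φ hW.density hW.scale.growth where
  smooth := hW.smooth
  flow := hφ
  continuous := hW.scale.continuous_growth
  divergence := hW.hasDivergence
  ne_zero ζ hζ := by
    have he := chart_mem_atlas Plane ζ
    have hs := mem_chart_source Plane ζ
    have h1 := hW.chartField_eq_zero he ((chartAt Plane ζ).map_source hs)
      ((chartField_eq_zero_iff he hs).2 hζ)
    rwa [(chartAt Plane ζ).left_inv hs] at h1

end Hamiltonian

end LiouvilleDensity

/-! ### Compactness and separation of `Z₀`. -/

section TopologyOfQuotient

open Hamiltonian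

variable {M : Type*} [TopologicalSpace M] [ChartedSpace Plane M] [IsManifold (𝓡 2) ∞ M]
  {h : Hamiltonian M}

namespace Hamiltonian

lemma canon_target (z₀ : Cotangent M) {u : Plane × CoPlane}
    (hu : u.1 ∈ (chartAt Plane z₀.proj).target) : u ∈ (canon z₀).target := by
  have h1 : (canon z₀).target = (extChartAt cotModel z₀).target := by
    simp [extChartAt, canon, OpenPartialHomeomorph.extend, cotModel]
    rfl
  rw [h1, FiberBundle.extChartAt_target]
  exact ⟨by simpa using ⟨hu, (chartAt Plane z₀.proj).map_target hu⟩, mem_univ _⟩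

lemma continuous_proj : Continuous h.proj := continuous_quot_mk

/-- Over a compact piece of a chart each ray of the shell has a representative with momentum of norm
`1`; these form a compact set, and finitely many pieces cover the base. -/
instance [CompactSpace M] : CompactSpace h.Z := by
  have hloc : ∀ q : M, ∃ K ∈ 𝓝 q, IsCompact K ∧ K ⊆ (chartAt Plane q).source := by
    intro q
    have : LocallyCompactSpace M := ChartedSpace.locallyCompactSpace Plane M
    obtain ⟨K, hK, hKs, hKc⟩ := LocallyCompactSpace.local_compact_nhds q _
      ((chartAt Plane q).open_source.mem_nhds (mem_chart_source Plane q))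
    exact ⟨K, hK, hKc, hKs⟩
  choose K hK hKc hKs using hloc
  have hB : ∀ q : M, ∃ B : Set h.Z, IsCompact B ∧ ∀ z : h.Shell, z.1.proj ∈ K q → h.proj z ∈ B := by
    intro q
    let z₀ : Cotangent M := ⟨q, 0⟩
    let e := chartAt Plane q
    let Q : Set (Plane × CoPlane) := (e '' K q) ×ˢ Metric.sphere (0 : CoPlane) 1
    have hQ : IsCompact Q :=
      ((hKc q).image_of_continuousOn (e.continuousOn.mono (hKs q))).prod (isCompact_sphere _ _)
    have hQt : Q ⊆ (canon z₀).target ∩ {u | u.2 ≠ 0} := by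
      rintro u ⟨⟨x, hx, hxu⟩, hu⟩
      refine ⟨canon_target z₀ ?_, fun h0 => ?_⟩
      · rw [← hxu]
        exact e.map_source (hKs q hx)
      · rw [h0] at hu
        simp at hu
    have hA : IsCompact (Q ∩ (h.toFun ∘ (canon z₀).symm) ⁻¹' {0}) :=
      hQ.of_isClosed_subset (((canon_ham_smooth h z₀).continuousOn.mono hQt).preimage_isClosed_of_isClosed
        hQ.isClosed isClosed_singleton) inter_subset_left
    have hA' := hA.image_of_continuousOn
      ((canon z₀).continuousOn_symm.mono fun u hu => (hQt hu.1).1)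
    have hsub : ∀ z ∈ (canon z₀).symm '' (Q ∩ (h.toFun ∘ (canon z₀).symm) ⁻¹' {0}),
        z ∈ h.shellSet := by
      rintro _ ⟨u, hu, rfl⟩
      refine ⟨?_, hu.2⟩
      rw [← canon_snd_ne z₀ _ ((canon z₀).map_target (hQt hu.1).1),
        (canon z₀).right_inv (hQt hu.1).1]
      exact (hQt hu.1).2
    refine ⟨h.proj '' (Subtype.val ⁻¹' ((canon z₀).symm ''
      (Q ∩ (h.toFun ∘ (canon z₀).symm) ⁻¹' {0}))), ?_, fun z hz => ?_⟩
    · refine IsCompact.image ?_ continuous_proj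
      rw [Topology.IsInducing.subtypeVal.isCompact_iff, image_preimage_eq_inter_range,
        Subtype.range_coe, inter_eq_left.2 hsub]
      exact hA'
    · have hzs : z.1 ∈ (canon z₀).source := (canon_source _ _).2 (hKs q hz)
      have hp : 0 < ‖(canon z₀ z.1).2‖ := norm_pos_iff.2 ((canon_snd_ne z₀ _ hzs).2 z.2.1)
      have hr := inv_pos.2 hp
      have hds : dil ‖(canon z₀ z.1).2‖⁻¹ z.1 ∈ (canon z₀).source :=
        (canon_source _ _).2 (hKs q hz)
      refine ⟨⟨_, h.dil_mem_shellSet z.2 hr⟩,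
        ⟨canon z₀ (dil ‖(canon z₀ z.1).2‖⁻¹ z.1), ⟨?_, ?_⟩, (canon z₀).left_inv hds⟩,
        IsLift.proj_dil z.2 hr⟩
      · rw [canon_dil z₀ _ hzs]
        refine ⟨⟨z.1.proj, hz, (canon_fst hzs).symm⟩, ?_⟩
        simp [norm_smul, hp.ne']
      · show h.toFun _ = 0
        rw [(canon z₀).left_inv hds]
        exact (h.dil_mem_shellSet z.2 hr).2
  choose B hBc hBz using hB
  obtain ⟨t, -, ht⟩ := isCompact_univ.elim_nhds_subcover K fun q _ => hK q
  refine ⟨(t.isCompact_biUnion fun q _ => hBc q).of_isClosed_subset isClosed_univ ?_⟩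
  intro ζ _
  obtain ⟨z, rfl⟩ := h.proj_surjective ζ
  obtain ⟨q, hq, hzq⟩ := mem_iUnion₂.1 (ht (mem_univ z.1.proj))
  exact mem_iUnion₂.2 ⟨q, hq, hBz q z hzq⟩

lemma isOpen_proj_image {A : Set (Cotangent M)} (hA : IsOpen A)
    (hd : ∀ z ∈ A, ∀ r : ℝ, 0 < r → dil r z ∈ A) : IsOpen (h.proj '' {z | z.1 ∈ A}) := by
  have h1 : h.proj ⁻¹' (h.proj '' {z | z.1 ∈ A}) = {z : h.Shell | z.1 ∈ A} := by
    refine Subset.antisymm ?_ (subset_preimage_image _ _)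
    rintro w ⟨z, hz, hzw⟩
    obtain ⟨r, hr, rfl⟩ := exists_dil_of_proj_eq hzw
    exact hd z.1 hz r hr
  have h2 : IsOpen (h.proj ⁻¹' (h.proj '' {z | z.1 ∈ A})) := by
    rw [h1]
    exact hA.preimage continuous_subtype_val
  exact h2

lemma exists_separation {z w : h.Shell} {A B : Set (Cotangent M)} (hA : IsOpen A) (hB : IsOpen B)
    (hdA : ∀ z ∈ A, ∀ r : ℝ, 0 < r → dil r z ∈ A) (hdB : ∀ z ∈ B, ∀ r : ℝ, 0 < r → dil r z ∈ B)
    (hAB : Disjoint A B) (hz : z.1 ∈ A) (hw : w.1 ∈ B) : ∃ u v : Set h.Z, IsOpen u ∧ IsOpen v ∧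
      h.proj z ∈ u ∧ h.proj w ∈ v ∧ Disjoint u v := by
  refine ⟨_, _, isOpen_proj_image hA hdA, isOpen_proj_image hB hdB, ⟨z, hz, rfl⟩, ⟨w, hw, rfl⟩, ?_⟩
  rw [Set.disjoint_left]
  rintro _ ⟨z, hz, rfl⟩ ⟨w, hw, hwz⟩
  obtain ⟨r, hr, rfl⟩ := exists_dil_of_proj_eq hwz.symm
  exact Set.disjoint_left.1 hAB (hdA _ hz r hr) hw

lemma dil_mem_canon {z₀ z : Cotangent M} (hz : z ∈ (canon z₀).source) (r : ℝ) :
    dil r z ∈ (canon z₀).source :=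
  (canon_source z₀ (dil r z)).2 ((canon_source z₀ z).1 hz)

/-- Covectors at the same point with the same direction differ by a dilation. -/
lemma exists_dil_of_direction_eq {z₀ z w : Cotangent M} (hz : z ∈ (canon z₀).source)
    (hw : w ∈ (canon z₀).source) (hz0 : z.2 ≠ 0) (hw0 : w.2 ≠ 0) (hzw : z.proj = w.proj)
    (hd : ‖(canon z₀ z).2‖⁻¹ • (canon z₀ z).2 = ‖(canon z₀ w).2‖⁻¹ • (canon z₀ w).2) :
    ∃ r : ℝ, 0 < r ∧ dil r z = w := by
  have hpz := norm_pos_iff.2 ((canon_snd_ne z₀ z hz).2 hz0)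
  have hpw := norm_pos_iff.2 ((canon_snd_ne z₀ w hw).2 hw0)
  refine ⟨‖(canon z₀ w).2‖ * ‖(canon z₀ z).2‖⁻¹, mul_pos hpw (inv_pos.2 hpz), ?_⟩
  refine (canon z₀).injOn (dil_mem_canon hz _) hw ?_
  rw [canon_dil _ _ hz, mul_smul, hd, smul_smul, mul_inv_cancel₀ hpw.ne', one_smul, canon_fst hz,
    hzw, ← canon_fst hw]

/-- Rays over different base points are separated by conic preimages of open sets of `M`; rays over
one point are separated by the direction of the momentum in a canonical chart. -/
instance [T2Space M] : T2Space h.Z := by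
  refine ⟨fun ζ ζ' hne => ?_⟩
  obtain ⟨z, rfl⟩ := h.proj_surjective ζ
  obtain ⟨w, rfl⟩ := h.proj_surjective ζ'
  by_cases hzw : z.1.proj = w.1.proj
  · have hzs := mem_canon_self z.1
    have hws : w.1 ∈ (canon z.1).source :=
      (canon_source _ _).2 (hzw ▸ (canon_source _ _).1 hzs)
    let N : Cotangent M → CoPlane := fun x => ‖(canon z.1 x).2‖⁻¹ • (canon z.1 x).2
    let S : Set (Cotangent M) := (canon z.1).source ∩ {x | x.2 ≠ 0}
    have hS : IsOpen S := (canon z.1).open_source.inter isOpen_ne_zero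
    have hpc : ContinuousOn (fun x => (canon z.1 x).2) S :=
      continuous_snd.comp_continuousOn ((canon z.1).continuousOn.mono inter_subset_left)
    have hp : ∀ x ∈ S, ‖(canon z.1 x).2‖ ≠ 0 := fun x hx =>
      norm_ne_zero_iff.2 ((canon_snd_ne _ _ hx.1).2 hx.2)
    have hN : ContinuousOn N S := (hpc.norm.inv₀ hp).smul hpc
    have hNd : ∀ x ∈ S, ∀ r : ℝ, 0 < r → dil r x ∈ S ∧ N (dil r x) = N x := by
      intro x hx r hr
      refine ⟨⟨dil_mem_canon hx.1 r, smul_ne_zero hr.ne' hx.2⟩, ?_⟩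
      simp only [N]
      rw [canon_dil _ _ hx.1, norm_smul, smul_smul, Real.norm_of_nonneg hr.le, mul_inv,
        mul_comm r⁻¹, mul_assoc, inv_mul_cancel₀ hr.ne', mul_one]
    have hNne : N z.1 ≠ N w.1 := fun hN' => by
      obtain ⟨r, hr, h1⟩ := exists_dil_of_direction_eq hzs hws z.2.1 w.2.1 hzw hN'
      refine hne ?_
      rw [← IsLift.proj_dil z.2 hr]
      exact congrArg h.proj (Subtype.ext h1)
    obtain ⟨u, v, hu, hv, hzu, hwv, huv⟩ := t2_separation hNne
    refine exists_separation (hN.isOpen_inter_preimage hS hu) (hN.isOpen_inter_preimage hS hv)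
      ?_ ?_ ?_ ⟨⟨hzs, z.2.1⟩, hzu⟩ ⟨⟨hws, w.2.1⟩, hwv⟩
    · intro x hx r hr
      obtain ⟨h1, h2⟩ := hNd x hx.1 r hr
      exact ⟨h1, by rw [mem_preimage, h2]; exact hx.2⟩
    · intro x hx r hr
      obtain ⟨h1, h2⟩ := hNd x hx.1 r hr
      exact ⟨h1, by rw [mem_preimage, h2]; exact hx.2⟩
    · rw [Set.disjoint_left]
      exact fun x hx hx' => Set.disjoint_left.1 huv hx.2 hx'.2
  · obtain ⟨u, v, hu, hv, hzu, hwv, huv⟩ := t2_separation hzw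
    have hpc : Continuous (fun x : Cotangent M => x.proj) := FiberBundle.continuous_proj _ _
    exact exists_separation (hu.preimage hpc) (hv.preimage hpc) (fun _ hx _ _ => hx)
      (fun _ hx _ _ => hx) (huv.preimage _) hzu hwv

end Hamiltonian

end TopologyOfQuotient

/-! ### Homogeneity, escape functions and comparison of generators. -/

section Homogeneity

open Hamiltonian

variable {M : Type*} [TopologicalSpace M] [ChartedSpace Plane M] [IsManifold (𝓡 2) ∞ M]
  {h : Hamiltonian M} {c c' : h.Shell → ℝ} {V : Set h.Z}
  {W W' : ∀ ζ : h.Z, TangentSpace (𝓡 2) ζ} {z : h.Shell}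

/-- The dilations in canonical coordinates. -/
def fiberScale (r : ℝ) : (Plane × CoPlane) →L[ℝ] Plane × CoPlane :=
  (ContinuousLinearMap.fst ℝ Plane CoPlane).prod (r • ContinuousLinearMap.snd ℝ Plane CoPlane)

lemma fiberScale_apply (r : ℝ) (u : Plane × CoPlane) : fiberScale r u = (u.1, r • u.2) := rfl

/-- Dilations multiply the symplectic form by `r`, so they carry Hamiltonian vectors to multiples of
Hamiltonian vectors. -/
lemma fiberScale_hamLin (r : ℝ) (α : (Plane × CoPlane) →L[ℝ] ℝ) :
    fiberScale r (hamLin (α.comp (fiberScale r))) = r • hamLin α := by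
  have h1 : ∀ p : CoPlane, α (0, r • p) = r * α (0, p) := fun p => by
    rw [← smul_eq_mul, ← map_smul]
    simp
  rw [fiberScale_apply]
  refine Prod.ext ?_ ?_
  · simp [hamLin, fiberScale_apply, h1, mul_smul]
  · refine ContinuousLinearMap.ext fun v => ?_
    simp [hamLin, fiberScale_apply]

namespace Hamiltonian

/-- The Hamiltonian derivative of a function of degree one has degree zero. -/
lemma HasHamDerivAt.dil {k : h.Shell → ℝ} {d : ℝ} (hd : h.HasHamDerivAt k d z)
    (hk : ∀ (z : h.Shell) (r : ℝ) (hr : 0 < r), k ⟨dil r z.1, h.dil_mem_shellSet z.2 hr⟩ = r * k z)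
    {r : ℝ} (hr : 0 < r) : h.HasHamDerivAt k d ⟨dil r z.1, h.dil_mem_shellSet z.2 hr⟩ := by
  obtain ⟨G, hG, rfl⟩ := hd
  have hr' := inv_pos.2 hr
  have hz := mem_canon_self z.1
  have hd : ∀ (w : Cotangent M) (t : ℝ), w ∈ (canon z.1).source →
      DegreeZero.dil t w ∈ (canon z.1).source := fun w t hw =>
    (canon_source _ _).2 ((canon_source z.1 w).1 hw)
  have hrz := hd z.1 r hz
  have hrs := h.dil_mem_shellSet z.2 hr
  have hL : ∀ w ∈ (canon z.1).source,
      fiberScale r⁻¹ (canon z.1 w) = canon z.1 (DegreeZero.dil r⁻¹ w) := fun w hw =>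
    (canon_dil z.1 w hw r⁻¹).symm
  have hLz : fiberScale r⁻¹ (canon z.1 (DegreeZero.dil r z.1)) = canon z.1 z.1 := by
    rw [hL _ hrz, dil_dil, inv_mul_cancel₀ hr.ne', dil_one]
  have hGc : ContDiffAt ℝ ∞ (G ∘ (canon z.1).symm) (canon z.1 z.1) := by
    have h2 := canon_symm_smoothAt z.1 _ ((canon z.1).map_source hz)
    have h3 : ContMDiffAt cotModel 𝓘(ℝ) ∞ G ((canon z.1).symm (canon z.1 z.1)) := by
      rw [(canon z.1).left_inv hz]
      exact hG.1
    exact (h3.comp _ h2).contDiffAt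
  -- Transport of the extension `G` to the dilated point; the factor `r` reflects the degree one of
  -- `k` and cancels the conformal factor `r⁻¹` in the bracket.
  let F : Plane × CoPlane → ℝ := fun u => r * (G ∘ (canon z.1).symm) (fiberScale r⁻¹ u)
  have hF : ContDiffAt ℝ ∞ F (canon z.1 (DegreeZero.dil r z.1)) :=
    contDiffAt_const.mul ((hLz ▸ hGc).comp _ (fiberScale r⁻¹).contDiff.contDiffAt)
  have hcont : ContinuousAt (fun w => (canon z.1).symm (fiberScale r⁻¹ (canon z.1 w)))
      (DegreeZero.dil r z.1) := by
    refine ContinuousAt.comp (f := fun w => fiberScale r⁻¹ (canon z.1 w)) ?_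
      ((fiberScale r⁻¹).continuous.continuousAt.comp ((canon z.1).continuousAt hrz))
    rw [hLz]
    exact (canon z.1).continuousAt_symm ((canon z.1).map_source hz)
  have hext : h.IsLocalExt k (F ∘ canon z.1) ⟨DegreeZero.dil r z.1, hrs⟩ := by
    refine ⟨hF.contMDiffAt.comp _ (canon_smoothAt _ _ hrz), ?_⟩
    have h1 : ∀ᶠ w in 𝓝 (DegreeZero.dil r z.1), ∀ hw : (canon z.1).symm (fiberScale r⁻¹ (canon z.1 w))
        ∈ h.shellSet, G ((canon z.1).symm (fiberScale r⁻¹ (canon z.1 w))) = k ⟨_, hw⟩ := by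
      refine hcont.eventually (p := fun w => ∀ hw : w ∈ h.shellSet, G w = k ⟨w, hw⟩) ?_
      beta_reduce
      rw [hLz, (canon z.1).left_inv hz]
      exact hG.2
    filter_upwards [h1, (canon z.1).open_source.mem_nhds hrz] with w hw hws hwh
    have h2 : (canon z.1).symm (fiberScale r⁻¹ (canon z.1 w)) = DegreeZero.dil r⁻¹ w := by
      rw [hL w hws, (canon z.1).left_inv (hd w _ hws)]
    have h3 : G ((canon z.1).symm (fiberScale r⁻¹ (canon z.1 w))) = r⁻¹ * k ⟨w, hwh⟩ := by
      rw [← hk ⟨w, hwh⟩ r⁻¹ hr', hw (by rw [h2]; exact h.dil_mem_shellSet hwh hr')]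
      exact congrArg k (Subtype.ext h2)
    show r * G ((canon z.1).symm (fiberScale r⁻¹ (canon z.1 w))) = k ⟨w, hwh⟩
    rw [h3, mul_inv_cancel_left₀ hr.ne']
  refine ⟨_, hext, ?_⟩
  have hm := mdifferentiableAt_toFun z.2
  have hm' := mdifferentiableAt_toFun hrs
  have hdH := (differentiableAt_canon hz hm).hasFDerivAt
  have e1 : dcan z.1 h.toFun (DegreeZero.dil r z.1) =
      (dcan z.1 h.toFun z.1).comp (fiberScale r⁻¹) := by
    have h1 : h.toFun ∘ (canon z.1).symm =ᶠ[𝓝 (canon z.1 (DegreeZero.dil r z.1))]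
        (h.toFun ∘ (canon z.1).symm) ∘ fiberScale r⁻¹ := by
      filter_upwards [(canon z.1).open_target.mem_nhds ((canon z.1).map_source hrz),
        eventually_canon hrz (isOpen_ne_zero.mem_nhds hrs.1)] with u hu hu'
      have h2 := (canon z.1).map_target hu
      have h3 := hL _ h2
      rw [(canon z.1).right_inv hu] at h3
      simp only [Function.comp]
      rw [h3, (canon z.1).left_inv (hd _ _ h2), h.homogeneous _ hu' _ hr']
    rw [← hLz] at hdH
    have h4 := hdH.comp _ (fiberScale r⁻¹).hasFDerivAt
    unfold dcan
    rw [h1.fderiv_eq, h4.fderiv, hLz]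
  have e2 : dcan z.1 (F ∘ canon z.1) (DegreeZero.dil r z.1) =
      r • (dcan z.1 G z.1).comp (fiberScale r⁻¹) := by
    have h1 : (F ∘ canon z.1) ∘ (canon z.1).symm =ᶠ[𝓝 (canon z.1 (DegreeZero.dil r z.1))] F := by
      filter_upwards [(canon z.1).open_target.mem_nhds ((canon z.1).map_source hrz)] with u hu
      simp [(canon z.1).right_inv hu]
    have h2 := (hGc.differentiableAt (by simp)).hasFDerivAt
    rw [← hLz] at h2
    have h4 := (h2.comp _ (fiberScale r⁻¹).hasFDerivAt).const_mul r
    unfold dcan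
    rw [h1.fderiv_eq]
    refine h4.fderiv.trans ?_
    rw [hLz]
  rw [poisson_eq_dcan hrz hm' (hext.1.mdifferentiableAt (by simp)),
    poisson_eq_dcan hz hm (hG.1.mdifferentiableAt (by simp)), e1, e2, smul_apply,
    ContinuousLinearMap.comp_apply, fiberScale_hamLin, map_smul, smul_eq_mul, smul_eq_mul,
    mul_inv_cancel_left₀ hr.ne']

lemma poisson_mul {f G : Cotangent M → ℝ} {w : Cotangent M} (hw : w ∈ h.shellSet)
    (hf : MDifferentiableAt cotModel 𝓘(ℝ) f w) (hG : MDifferentiableAt cotModel 𝓘(ℝ) G w) :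
    poisson h.toFun (fun w => f w * G w) w =
      f w * poisson h.toFun G w + G w * poisson h.toFun f w := by
  have hz := mem_canon_self w
  have hm := mdifferentiableAt_toFun hw
  have hfG : MDifferentiableAt cotModel 𝓘(ℝ) (fun w => f w * G w) w := hf.mul hG
  rw [poisson_eq_dcan hz hm hfG, poisson_eq_dcan hz hm hf, poisson_eq_dcan hz hm hG]
  have h1 := fderiv_mul (differentiableAt_canon hz hf) (differentiableAt_canon hz hG)
  have h2 : (fun w => f w * G w) ∘ (canon w).symm =
    (f ∘ (canon w).symm) * (G ∘ (canon w).symm) := rfl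
  have h3 : dcan w (fun w => f w * G w) w = f w • dcan w G w + G w • dcan w f w := by
    unfold dcan
    rw [h2, h1]
    simp [(canon w).left_inv hz]
  rw [h3]
  rfl

/-- Escape functions from functions on `Z₀`. -/
lemma IsGenerator.isEscapeFunction [T2Space M] [CompactSpace M] (hW : h.IsGenerator W univ c) {g : h.Z → ℝ}
    (hg : ContMDiff (𝓡 2) 𝓘(ℝ) ∞ g)
    (hpos : ∀ ζ, 0 < lieDeriv W g ζ + hW.scale.growth ζ * g ζ) :
    h.IsEscapeFunction fun z => c z * g (h.proj z) := by
  have hhom : ∀ (z : h.Shell) (r : ℝ) (hr : 0 < r),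
      (fun z => c z * g (h.proj z)) ⟨dil r z.1, h.dil_mem_shellSet z.2 hr⟩ =
        r * (fun z => c z * g (h.proj z)) z := fun z r hr => by
    simp only
    rw [hW.scale.homogeneous z (mem_univ _) r hr, IsLift.proj_dil z.2 hr, mul_assoc]
  have hext : ∀ z : h.Shell, ∃ C G, h.IsLocalExt c C z ∧ h.IsLocalExt (fun w => g (h.proj w)) G z ∧
      h.IsLocalExt (fun z => c z * g (h.proj z)) (fun w => C w * G w) z ∧
      lieDeriv W g (h.proj z) = c z * poisson h.toFun G z.1 := by
    intro z
    obtain ⟨C, hC⟩ := hW.scale.smooth z (mem_univ _)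
    obtain ⟨d, ⟨G, hG, rfl⟩, hd⟩ := hW.deriv z (mem_univ _) g hg.contMDiffAt
    refine ⟨C, G, hC, hG, ⟨hC.1.mul hG.1, ?_⟩, hd⟩
    filter_upwards [hC.2, hG.2] with w h1 h2 hw
    rw [h1 hw, h2 hw]
  refine ⟨fun z => ?_, hhom, ?_⟩
  · obtain ⟨C, G, -, -, hCG, -⟩ := hext z
    exact ⟨_, hCG⟩
  · obtain ⟨δ, hδ, hδl⟩ := exists_pos_lower_bound ((continuous_lieDeriv hW.smooth hg).add
      (hW.scale.continuous_growth.mul hg.continuous)) hpos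
    -- On the section `c = 1`, Leibniz's rule gives the derivative of `g` along `W` plus `g` times
    -- the growth of `c`. The other points of the shell are dilates, and the bracket has degree `0`.
    have hunit : ∀ ζ, h.HasHamDerivAt (fun z => c z * g (h.proj z))
        (lieDeriv W g ζ + hW.scale.growth ζ * g ζ) (hW.scale.unit ζ) := by
      intro ζ
      obtain ⟨C, G, hC, hG, hCG, hd⟩ := hext (hW.scale.unit ζ)
      refine ⟨_, hCG, ?_⟩
      have hu := hW.scale.apply_unit ζ
      rw [hu, hW.scale.proj_unit, one_mul] at hd
      have h1 : C (hW.scale.unit ζ).1 = 1 := (hC.2.self_of_nhds (hW.scale.unit ζ).2).trans hu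
      have h2 : G (hW.scale.unit ζ).1 = g ζ := (hG.2.self_of_nhds (hW.scale.unit ζ).2).trans
        (congrArg g (hW.scale.proj_unit ζ))
      rw [poisson_mul (hW.scale.unit ζ).2 hC.isWeakExt.1 hG.isWeakExt.1, h1, h2, ← hd,
        ← hW.scale.growth_eq hC.isWeakExt, one_mul, mul_comm (g ζ)]
    refine ⟨δ / 2, half_pos hδ, fun z => ⟨_, (half_lt_self hδ).trans_le (hδl (h.proj z)), ?_⟩⟩
    obtain ⟨r, hr, hz⟩ := exists_dil_of_proj_eq (hW.scale.proj_unit (h.proj z))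
    have h1 := (hunit (h.proj z)).dil hhom hr
    rw [← hz] at h1
    exact h1

/-- The quotient of two generators. -/
def IsScale.quotient (hc : h.IsScale univ c) (c' : h.Shell → ℝ) (ζ : h.Z) : ℝ := c' (hc.unit ζ)

lemma IsScale.quotient_pos (hc : h.IsScale univ c) (hc' : h.IsScale V c') {ζ : h.Z} (hζ : ζ ∈ V) :
    0 < hc.quotient c' ζ :=
  hc'.pos _ (by rwa [hc.proj_unit])

lemma IsScale.contDiffAt_quotient (hc : h.IsScale univ c) (hc' : h.IsScale V c')
    {e : OpenPartialHomeomorph h.Z Plane} {y : Plane} (he : e ∈ h.smoothCharts)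
    (hy : y ∈ e.target) (hV : e.symm y ∈ V) : ContDiffAt ℝ ∞ (hc.quotient c' ∘ e.symm) y := by
  have hs := hc.isLift he hy
  obtain ⟨g, hg⟩ := hc'.smooth (hc.unit (e.symm y)) (by rwa [hc.proj_unit])
  refine (hs.contDiffAt_comp hg).congr_of_eventuallyEq ?_
  filter_upwards [hs.smooth.continuousAt.eventually hg.2] with x hx
  exact (hx (hc.unit (e.symm x)).2).symm

lemma IsGenerator.chartField_eq_smul (hW : h.IsGenerator W univ c) (hW' : h.IsGenerator W' V c')
    {e : OpenPartialHomeomorph h.Z Plane} {y : Plane} (he : e ∈ h.smoothCharts)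
    (hy : y ∈ e.target) (hV : e.symm y ∈ V) :
    chartField W' e y = hW.scale.quotient c' (e.symm y) • chartField W e y := by
  have hs := hW.scale.isLift he hy
  have h1 : h.proj (hW.scale.unit (e.symm y)) = e.symm y := hW.scale.proj_unit _
  ext i
  obtain ⟨g, hg⟩ := hs.exists_coord i
  have h2 := hW.chartField_apply he (z := hW.scale.unit (e.symm y)) (mem_univ _)
    (by rw [h1]; exact e.map_target hy) i hg.isWeakExt
  have h3 := hW'.chartField_apply he (z := hW.scale.unit (e.symm y)) (by rwa [h1])
    (by rw [h1]; exact e.map_target hy) i hg.isWeakExt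
  rw [h1, e.right_inv hy] at h2 h3
  rw [hW.scale.apply_unit, one_mul] at h2
  rw [h3, PiLp.smul_apply, h2]
  rfl

lemma IsGenerator.eq_smul (hW : h.IsGenerator W univ c) (hW' : h.IsGenerator W' V c') {ζ : h.Z}
    (hζ : ζ ∈ V) : W' ζ = hW.scale.quotient c' ζ • W ζ := by
  have he := chart_mem_atlas Plane ζ
  have hs := mem_chart_source Plane ζ
  have h1 := hW.chartField_eq_smul hW' he ((chartAt Plane ζ).map_source hs)
    (by rwa [(chartAt Plane ζ).left_inv hs])
  rw [DegreeZero.chartField_apply hs, DegreeZero.chartField_apply hs, (chartAt Plane ζ).left_inv hs]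
    at h1
  refine (mdifferentiable_of_mem_atlas (I := 𝓡 2) he).mfderiv_injective hs (h1.trans ?_)
  exact (map_smul (mfderiv (𝓡 2) 𝓘(ℝ, Plane) (chartAt Plane ζ) ζ) _ _).symm

lemma Generates.mono {V' : Set h.Z} (hW : h.Generates W V) (hV : V' ⊆ V) : h.Generates W V' := by
  obtain ⟨h1, c, hc⟩ := hW
  exact ⟨h1.mono hV, c, fun z hz => hc z (hV hz)⟩

end Hamiltonian

end Homogeneity

/-! ### Divergences under changes of field and density. -/

section Densities

variable {X : Type*} [TopologicalSpace X] [ChartedSpace Plane X] [IsManifold (𝓡 2) ∞ X]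
  {W W' : ∀ x : X, TangentSpace (𝓡 2) x} {V : Set X} {b u v q f : X → ℝ} {x : X}
  {ρ : SmoothDensity (univ : Set X)} {ρ' : SmoothDensity V}

lemma mdifferentiableAt_of_chart {e : OpenPartialHomeomorph X Plane} (he : e ∈ atlas Plane X)
    (hx : x ∈ e.source) (hf : DifferentiableAt ℝ (f ∘ e.symm) (e x)) :
    MDifferentiableAt (𝓡 2) 𝓘(ℝ) f x := by
  refine (hf.mdifferentiableAt.comp x (mdifferentiableAt_atlas he hx)).congr_of_eventuallyEq ?_
  filter_upwards [e.open_source.mem_nhds hx] with y hy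
  simp [e.left_inv hy]

/-- The divergence of a multiple of a vector field with respect to a multiple of a density. -/
lemma HasDivergence.divergence_eq (hρ : HasDivergence ρ W b) (hW : SmoothFieldOn W univ)
    (hpos : 0 < ρ'.toFun (chartAt Plane x) (chartAt Plane x x))
    (hq : MDifferentiableAt (𝓡 2) 𝓘(ℝ) q x) (hq0 : q x ≠ 0)
    (hloc : ∀ᶠ y in 𝓝 (chartAt Plane x x), ρ'.toFun (chartAt Plane x) y •
      chartField W' (chartAt Plane x) y = q ((chartAt Plane x).symm y) •
        (ρ.toFun (chartAt Plane x) y • chartField W (chartAt Plane x) y))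
    (hqx : q x * ρ.toFun (chartAt Plane x) (chartAt Plane x x) =
      u x * ρ'.toFun (chartAt Plane x) (chartAt Plane x x)) :
    divergence ρ' W' x = u x * (b x + lieDeriv W (fun x => Real.log (q x)) x) := by
  set e := chartAt Plane x
  have he : e ∈ atlas Plane X := chart_mem_atlas _ _
  have hx : x ∈ e.source := mem_chart_source Plane x
  have hqd := differentiableAt_chart he hx hq
  have hlog : lieDeriv W (fun x => Real.log (q x)) x = (q x)⁻¹ * lieDeriv W q x := by
    have h1 : HasFDerivAt (fun y => Real.log ((q ∘ e.symm) y)) _ (e x) :=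
      hqd.hasFDerivAt.log (by simpa [e.left_inv hx] using hq0)
    have h2 : MDifferentiableAt (𝓡 2) 𝓘(ℝ) (fun x => Real.log (q x)) x :=
      mdifferentiableAt_of_chart he hx h1.differentiableAt
    rw [lieDeriv_eq_chart he hx h2, lieDeriv_eq_chart he hx hq]
    have h3 := h1.fderiv
    have h4 : (fun x => Real.log (q x)) ∘ e.symm = fun y => Real.log ((q ∘ e.symm) y) := rfl
    rw [h4, h3]
    simp [e.left_inv hx]
  have hF : DifferentiableAt ℝ (fun y => ρ.toFun e y • chartField W e y) (e x) :=
    (ρ.differentiableAt he (e.map_source hx)).smul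
      ((contDiffAt_chartField hW he (e.map_source hx)).differentiableAt (by simp))
  -- Near the point the new density times the new field is `q` times the old product; Leibniz's rule
  -- then produces the logarithmic derivative of `q`.
  have h1 := trace_fderiv_smul hqd hF
  have h2 : (q ∘ e.symm) (e x) = q x := by simp [e.left_inv hx]
  rw [hρ e he x hx, map_smul, ← lieDeriv_eq_chart he hx hq, h2] at h1
  unfold divergence
  rw [div_eq_iff hpos.ne', hlog, EventuallyEq.fderiv_eq hloc]
  refine h1.trans ?_
  rw [smul_eq_mul]
  have h3 : q x * (q x)⁻¹ = 1 := mul_inv_cancel₀ hq0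
  linear_combination (b x + (q x)⁻¹ * lieDeriv W q x) * hqx -
    lieDeriv W q x * ρ.toFun e (e x) * h3

/-- The quotient of two densities. -/
def SmoothDensity.quotient (ρ' : SmoothDensity V) (ρ : SmoothDensity (univ : Set X)) (x : X) : ℝ :=
  ρ'.toFun (chartAt Plane x) (chartAt Plane x x) / ρ.toFun (chartAt Plane x) (chartAt Plane x x)

lemma SmoothDensity.quotient_eq {e : OpenPartialHomeomorph X Plane} (he : e ∈ atlas Plane X)
    (hx : x ∈ e.source) (hV : x ∈ V) :
    ρ'.quotient ρ x = ρ'.toFun e (e x) / ρ.toFun e (e x) := by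
  have he' := chart_mem_atlas Plane x
  have hx' := mem_chart_source Plane x
  have h1 : 0 < ρ'.toFun (chartAt Plane x) (chartAt Plane x x) :=
    ρ'.pos _ he' _ ⟨(chartAt Plane x).map_source hx', by
      rw [mem_preimage, (chartAt Plane x).left_inv hx']; exact hV⟩
  have h2 := ρ'.transform _ he' e he x ⟨⟨hV, hx'⟩, hx⟩
  rw [SmoothDensity.quotient, h2, ρ.transform _ he' e he x ⟨⟨mem_univ _, hx'⟩, hx⟩]
  refine mul_div_mul_left _ _ fun h0 => ?_
  rw [h2, h0, zero_mul] at h1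
  exact lt_irrefl _ h1

lemma SmoothDensity.pos_at {e : OpenPartialHomeomorph X Plane} (he : e ∈ atlas Plane X)
    (hx : x ∈ e.source) (hV : x ∈ V) : 0 < ρ'.toFun e (e x) :=
  ρ'.pos e he _ ⟨e.map_source hx, by rwa [mem_preimage, e.left_inv hx]⟩

/-- Multiplication of a vector field and of a density by functions. -/
lemma HasDivergence.divergence_smul (hρ : HasDivergence ρ W b) (hW : SmoothFieldOn W univ)
    (hV : IsOpen V) (hx : x ∈ V) (hu : MDifferentiableAt (𝓡 2) 𝓘(ℝ) u x) (hu0 : 0 < u x)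
    (hWu : ∀ y ∈ V, W' y = u y • W y) :
    MDifferentiableAt (𝓡 2) 𝓘(ℝ) (fun y => Real.log (u y * ρ'.quotient ρ y)) x ∧
      divergence ρ' W' x =
        u x * (b x + lieDeriv W (fun y => Real.log (u y * ρ'.quotient ρ y)) x) := by
  have he := chart_mem_atlas Plane x
  have hs := mem_chart_source Plane x
  set e := chartAt Plane x
  have hVe : ∀ᶠ y in 𝓝 (e x), y ∈ e.target ∧ e.symm y ∈ V := by
    filter_upwards [e.open_target.mem_nhds (e.map_source hs),
      eventually_chart hs (hV.mem_nhds hx)] with y hy hy'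
    exact ⟨hy, hy'⟩
  have hquot : ∀ᶠ y in 𝓝 (e x), ρ'.quotient ρ (e.symm y) = ρ'.toFun e y / ρ.toFun e y := by
    filter_upwards [hVe] with y hy
    rw [SmoothDensity.quotient_eq he (e.map_target hy.1) hy.2, e.right_inv hy.1]
  have hp := SmoothDensity.pos_at (ρ' := ρ) he hs (mem_univ x)
  have hp' := SmoothDensity.pos_at (ρ' := ρ') he hs hx
  have hquotd : MDifferentiableAt (𝓡 2) 𝓘(ℝ) (ρ'.quotient ρ) x := by
    refine mdifferentiableAt_of_chart he hs ?_
    have h1 : DifferentiableAt ℝ (ρ'.toFun e) (e x) :=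
      ((ρ'.smooth e he).contDiffAt (mem_of_superset hVe fun y hy => hy)).differentiableAt (by simp)
    have h2 : DifferentiableAt ℝ (fun y => ρ'.toFun e y / ρ.toFun e y) (e x) := by
      simp only [div_eq_mul_inv]
      exact h1.mul ((ρ.differentiableAt he (e.map_source hs)).inv hp.ne')
    exact h2.congr_of_eventuallyEq hquot
  have hq : MDifferentiableAt (𝓡 2) 𝓘(ℝ) (fun y => u y * ρ'.quotient ρ y) x := hu.mul hquotd
  have hqx : ρ'.quotient ρ x = ρ'.toFun e (e x) / ρ.toFun e (e x) := rfl
  have hq0 : 0 < u x * ρ'.quotient ρ x := by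
    rw [hqx]
    positivity
  constructor
  · have h1 := (differentiableAt_chart he hs hq).log (by simpa [e.left_inv hs] using hq0.ne')
    exact mdifferentiableAt_of_chart he hs h1
  · refine hρ.divergence_eq (u := u) (q := fun y => u y * ρ'.quotient ρ y) hW hp' hq hq0.ne' ?_ ?_
    · filter_upwards [hVe, hquot] with y hy hy'
      have h1 : chartField W' e y = u (e.symm y) • chartField W e y := by
        unfold chartField
        rw [hWu _ hy.2]
        exact map_smul (mfderiv (𝓡 2) 𝓘(ℝ, Plane) e (e.symm y)) _ _
      have h2 := SmoothDensity.pos_at (ρ' := ρ) he (e.map_target hy.1) (mem_univ _)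
      rw [e.right_inv hy.1] at h2
      rw [h1, hy', smul_smul, smul_smul]
      congr 1
      change ρ'.toFun e y * u (e.symm y) = u (e.symm y) * (ρ'.toFun e y / ρ.toFun e y) *
        ρ.toFun e y
      field_simp
    · rw [hqx]
      change u x * (ρ'.toFun e (e x) / ρ.toFun e (e x)) * ρ.toFun e (e x) = u x * ρ'.toFun e (e x)
      field_simp

/-- The quotient of a density by a positive function. -/
def SmoothDensity.divFun (ρ : SmoothDensity (univ : Set X)) (f : X → ℝ)
    (hf : ContMDiff (𝓡 2) 𝓘(ℝ) ∞ f) : SmoothDensity {x | 0 < f x} where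
  toFun e y := ρ.toFun e y / f (e.symm y)
  smooth e he y hy := by
    have h1 : ContDiffAt ℝ ∞ (f ∘ e.symm) y := by
      have h2 := hf.contMDiffAt.contDiffAt_chart he (e.map_target hy.1)
      rwa [e.right_inv hy.1] at h2
    have h3 : ContDiffAt ℝ ∞ (ρ.toFun e) y :=
      (ρ.smooth e he).contDiffAt (by simpa using e.open_target.mem_nhds hy.1)
    exact (h3.div h1 (ne_of_gt hy.2)).contDiffWithinAt
  pos e he y hy := div_pos (ρ.pos e he y ⟨hy.1, mem_univ _⟩) hy.2
  transform e he e' he' x hx := by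
    rw [ρ.transform e he e' he' x ⟨⟨mem_univ _, hx.1.2⟩, hx.2⟩, e.left_inv hx.1.2,
      e'.left_inv hx.2, mul_div_assoc]

/-- The case `u = 1`, `q = 1 / f` of the general formula. With `b = -a` the result is `-(W f + a f)
/ f`, which is why an escape function gives weak hyperbolicity. -/
lemma HasDivergence.divergence_divFun (hρ : HasDivergence ρ W b) (hW : SmoothFieldOn W univ)
    (hf : ContMDiff (𝓡 2) 𝓘(ℝ) ∞ f) (hx : 0 < f x) :
    divergence (ρ.divFun f hf) W x = b x - (f x)⁻¹ * lieDeriv W f x := by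
  have he := chart_mem_atlas Plane x
  have hs := mem_chart_source Plane x
  have hfd : MDifferentiableAt (𝓡 2) 𝓘(ℝ) f x := hf.contMDiffAt.mdifferentiableAt (by simp)
  have hinv : MDifferentiableAt (𝓡 2) 𝓘(ℝ) (fun x => (f x)⁻¹) x := by
    refine mdifferentiableAt_of_chart he hs ?_
    exact (differentiableAt_chart he hs hfd).inv
      (by simpa [(chartAt Plane x).left_inv hs] using hx.ne')
  have h1 := hρ.divergence_eq (ρ' := ρ.divFun f hf) (W' := W) (u := fun _ => 1)
    (q := fun x => (f x)⁻¹) hW (SmoothDensity.pos_at he hs hx) hinv (inv_ne_zero hx.ne')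
    (Eventually.of_forall fun y => by
      simp only [SmoothDensity.divFun]
      rw [smul_smul, div_eq_inv_mul])
    (by
      simp only [SmoothDensity.divFun]
      rw [(chartAt Plane x).left_inv hs, div_eq_inv_mul, one_mul])
  have h2 : lieDeriv W (fun x => Real.log (f x)⁻¹) x = -((f x)⁻¹ * lieDeriv W f x) := by
    have h3 : HasFDerivAt (fun y => Real.log ((f ∘ (chartAt Plane x).symm) y)⁻¹)
        (-(((f x)⁻¹ : ℝ) • fderiv ℝ (f ∘ (chartAt Plane x).symm) (chartAt Plane x x)))
        (chartAt Plane x x) := by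
      simp only [Real.log_inv]
      have h4 : HasFDerivAt (fun y => Real.log ((f ∘ (chartAt Plane x).symm) y))
          ((f x)⁻¹ • fderiv ℝ (f ∘ (chartAt Plane x).symm) (chartAt Plane x x))
          (chartAt Plane x x) := by
        simpa [(chartAt Plane x).left_inv hs] using (differentiableAt_chart he hs hfd).hasFDerivAt.log
          (by simpa [(chartAt Plane x).left_inv hs] using hx.ne')
      exact h4.neg
    rw [lieDeriv_eq_chart he hs (mdifferentiableAt_of_chart
      (f := fun x => Real.log (f x)⁻¹) he hs h3.differentiableAt),
      lieDeriv_eq_chart he hs hfd]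
    exact congrArg (fun L : Plane →L[ℝ] ℝ => L _) h3.fderiv
  rw [h1, h2]
  ring

end Densities

/-! ### Conclusion for the foliation of `Z₀`. -/

section MainTheorem

open Hamiltonian

variable {M : Type*} [TopologicalSpace M] [ChartedSpace Plane M] [IsManifold (𝓡 2) ∞ M]
  {h : Hamiltonian M} {c c' : h.Shell → ℝ} {V : Set h.Z} {φ φ' : Flow ℝ h.Z}
  {W W' : ∀ ζ : h.Z, TangentSpace (𝓡 2) ζ}

namespace Hamiltonian

lemma IsScale.mdifferentiableAt_quotient (hc : h.IsScale univ c) (hc' : h.IsScale V c') {ζ : h.Z}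
    (hζ : ζ ∈ V) : MDifferentiableAt (𝓡 2) 𝓘(ℝ) (hc.quotient c') ζ := by
  have he := chart_mem_atlas Plane ζ
  have hs := mem_chart_source Plane ζ
  exact mdifferentiableAt_of_chart he hs ((hc.contDiffAt_quotient hc' he
    ((chartAt Plane ζ).map_source hs) (by rwa [(chartAt Plane ζ).left_inv hs])).differentiableAt
    (by simp))

/-- Divergences of the generators, in terms of a given one. -/
lemma IsGenerator.divergence_eq (hW : h.IsGenerator W univ c) (hW' : h.IsGenerator W' V c')
    (hV : IsOpen V) (ρ : SmoothDensity V) {ζ : h.Z} (hζ : ζ ∈ V) :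
    MDifferentiableAt (𝓡 2) 𝓘(ℝ)
      (fun η => Real.log (hW.scale.quotient c' η * ρ.quotient hW.density η)) ζ ∧
    divergence ρ W' ζ = hW.scale.quotient c' ζ * (-hW.scale.growth ζ +
      lieDeriv W (fun η => Real.log (hW.scale.quotient c' η * ρ.quotient hW.density η)) ζ) :=
  hW.hasDivergence.divergence_smul hW.smooth hV hζ
    (hW.scale.mdifferentiableAt_quotient hW'.scale hζ) (hW.scale.quotient_pos hW'.scale hζ)
    fun _ hη => hW.eq_smul hW' hη

/-- The Morse–Smale property does not depend on the generator. -/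
lemma IsGenerator.morseSmale [T2Space M] [CompactSpace M] (hW : h.IsGenerator W univ c)
    (hφ : IsFlowOf φ W) (hMS : IsMorseSmaleField W φ) (hW' : h.IsGenerator W' univ c')
    (hφ' : IsFlowOf φ' W') : IsMorseSmaleField W' φ' := by
  have hud : MDifferentiable (𝓡 2) 𝓘(ℝ) (hW.scale.quotient c') := fun ζ =>
    hW.scale.mdifferentiableAt_quotient hW'.scale (mem_univ ζ)
  refine (hW.foliationData hφ).morseSmale_of_smul (hW'.foliationData hφ') hMS hud.continuous hud
    (fun ζ => hW.scale.quotient_pos hW'.scale (mem_univ ζ)) (fun ζ => hW.eq_smul hW' (mem_univ ζ))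
    (g := fun η => Real.log (hW.scale.quotient c' η * hW'.density.quotient hW.density η))
    (fun ζ => (hW.divergence_eq hW' isOpen_univ hW'.density (mem_univ ζ)).1) fun ζ => ?_
  -- Both generators have their own Liouville density; expressing the divergence of the second
  -- through the first yields `a' = u (a - W g)`, with `g` the logarithm of the total quotient.
  have h1 := (hW.divergence_eq hW' isOpen_univ hW'.density (mem_univ ζ)).2
  have h2 : divergence hW'.density W' ζ = -hW'.scale.growth ζ := by
    unfold divergence
    rw [div_eq_iff (SmoothDensity.pos_at (chart_mem_atlas Plane ζ) (mem_chart_source Plane ζ)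
      (mem_univ ζ)).ne']
    exact hW'.hasDivergence _ (chart_mem_atlas Plane ζ) ζ (mem_chart_source Plane ζ)
  rw [h2] at h1
  linear_combination -h1

/-- The sign of the divergence of an arbitrary local generator and density becomes an inequality
between the growth and a derivative along `W`, because the quotient of the scales is positive. -/
lemma IsGenerator.eq_of_weaklyHyperbolic [T2Space M] [CompactSpace M]
    (hW : h.IsGenerator W univ c) (hφ : IsFlowOf φ W) (hMS : IsMorseSmaleField W φ)
    {Kp Km : Set h.Z} (hK : IsSimpleStructure φ Kp Km) (hp : h.IsWeaklyHyperbolicSink Kp)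
    (hm : h.IsWeaklyHyperbolicSource Km) : Kp = sinkSet W φ ∧ Km = sourceSet W φ := by
  obtain ⟨Vp, Wp, ρp, hVp, hKp, hWp, hdp⟩ := hp
  obtain ⟨Vm, Wm, ρm, hVm, hKm, hWm, hdm⟩ := hm
  obtain ⟨cp, hcp⟩ := hWp.exists_isGenerator
  obtain ⟨cm, hcm⟩ := hWm.exists_isGenerator
  refine (hW.foliationData hφ).simpleStructure_unique hMS hK hKp hKm
    (gp := fun η => Real.log (hW.scale.quotient cp η * ρp.quotient hW.density η))
    (gm := fun η => Real.log (hW.scale.quotient cm η * ρm.quotient hW.density η))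
    (fun ζ hζ => ?_) fun ζ hζ => ?_
  · obtain ⟨h1, h2⟩ := hW.divergence_eq hcp hVp ρp hζ
    have h3 := hdp ζ hζ
    rw [h2] at h3
    have h4 := hW.scale.quotient_pos hcp.scale hζ
    exact ⟨h1, by nlinarith⟩
  · obtain ⟨h1, h2⟩ := hW.divergence_eq hcm hVm ρm hζ
    have h3 := hdm ζ hζ
    rw [h2] at h3
    have h4 := hW.scale.quotient_pos hcm.scale hζ
    exact ⟨h1, by nlinarith⟩

/-- On `g > 0` divide the Liouville density by `g`; the divergence is then `-(W g + a g) / g`. -/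
lemma Generates.weaklyHyperbolicSink (hG : h.Generates W univ) (hW : h.IsGenerator W univ c)
    {g : h.Z → ℝ} (hg : ContMDiff (𝓡 2) 𝓘(ℝ) ∞ g)
    (hpos : ∀ ζ, 0 < lieDeriv W g ζ + hW.scale.growth ζ * g ζ) {K : Set h.Z}
    (hK : ∀ ζ ∈ K, 0 < g ζ) : h.IsWeaklyHyperbolicSink K := by
  refine ⟨{ζ | 0 < g ζ}, W, hW.density.divFun g hg, isOpen_lt continuous_const hg.continuous, hK,
    hG.mono (subset_univ _), fun ζ hζ => ?_⟩
  have hζ' : 0 < g ζ := hζ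
  rw [hW.hasDivergence.divergence_divFun hW.smooth hg hζ']
  have h1 : (-hW.scale.growth) ζ - (g ζ)⁻¹ * lieDeriv W g ζ =
      -((g ζ)⁻¹ * (lieDeriv W g ζ + hW.scale.growth ζ * g ζ)) := by
    show -hW.scale.growth ζ - _ = _
    field_simp
    ring
  rw [h1, neg_lt_zero]
  exact mul_pos (inv_pos.2 hζ') (hpos ζ)

/-- Dividing by `-g` where `g < 0` gives the same quotient, now positive. -/
lemma Generates.weaklyHyperbolicSource (hG : h.Generates W univ) (hW : h.IsGenerator W univ c)
    {g : h.Z → ℝ} (hg : ContMDiff (𝓡 2) 𝓘(ℝ) ∞ g)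
    (hpos : ∀ ζ, 0 < lieDeriv W g ζ + hW.scale.growth ζ * g ζ) {K : Set h.Z}
    (hK : ∀ ζ ∈ K, g ζ < 0) : h.IsWeaklyHyperbolicSource K := by
  have hg' : ContMDiff (𝓡 2) 𝓘(ℝ) ∞ (fun ζ => -g ζ) := hg.neg
  refine ⟨{ζ | 0 < -g ζ}, W, hW.density.divFun _ hg', isOpen_lt continuous_const hg'.continuous,
    fun ζ hζ => neg_pos.2 (hK ζ hζ), hG.mono (subset_univ _), fun ζ hζ => ?_⟩
  have hζ' : 0 < -g ζ := hζ
  rw [hW.hasDivergence.divergence_divFun hW.smooth hg' hζ']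
  have h0 : lieDeriv W (fun ζ => -g ζ) ζ = -lieDeriv W g ζ := by
    have h2 := lieDeriv_mul (W := W) (f := fun _ => (-1 : ℝ)) mdifferentiableAt_const
      (hg.contMDiffAt.mdifferentiableAt (x := ζ) (by simp))
    rw [lieDeriv_const] at h2
    simpa using h2
  have h1 : (-hW.scale.growth) ζ - (-g ζ)⁻¹ * lieDeriv W (fun ζ => -g ζ) ζ =
      (-g ζ)⁻¹ * (lieDeriv W g ζ + hW.scale.growth ζ * g ζ) := by
    rw [h0]
    have h2 : (-g ζ)⁻¹ * (-g ζ) = 1 := inv_mul_cancel₀ hζ'.ne'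
    show -hW.scale.growth ζ - _ = _
    linear_combination (-hW.scale.growth ζ) * (-h2)
  rw [h1]
  exact mul_pos (inv_pos.2 hζ') (hpos ζ)

end Hamiltonian

end MainTheorem

end DegreeZero

end

theorem mainTheorem1 {M : Type*} [TopologicalSpace M] [T2Space M] [CompactSpace M]
    [ConnectedSpace M] [ChartedSpace DegreeZero.Plane M] [IsManifold (𝓡 2) ∞ M]
    (h : DegreeZero.Hamiltonian M) (hMS : h.IsMorseSmale) :
    (∃ k : h.Shell → ℝ, h.IsEscapeFunction k) ∧
    ∀ (W : ∀ ζ : h.Z, TangentSpace (𝓡 2) ζ) (φ : Flow ℝ h.Z),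
      h.Generates W univ → DegreeZero.IsFlowOf φ W →
      ∀ Kp Km : Set h.Z,
        (DegreeZero.IsSimpleStructure φ Kp Km ∧ h.IsWeaklyHyperbolicSink Kp ∧
          h.IsWeaklyHyperbolicSource Km) ↔
        (Kp = DegreeZero.sinkSet W φ ∧ Km = DegreeZero.sourceSet W φ) := by
  obtain ⟨W₀, φ₀, hG₀, hφ₀, hMS₀⟩ := hMS
  obtain ⟨c₀, hW₀⟩ := hG₀.exists_isGenerator
  refine ⟨?_, fun W φ hG hφ Kp Km => ?_⟩
  · obtain ⟨g, hg, hpos, -, -⟩ := (hW₀.foliationData hφ₀).exists_escape hMS₀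
    exact ⟨_, hW₀.isEscapeFunction hg hpos⟩
  · obtain ⟨c, hW⟩ := hG.exists_isGenerator
    -- The hypothesis concerns one generator only; it is transferred to the given one.
    have hMS := hW₀.morseSmale hφ₀ hMS₀ hW hφ
    refine ⟨fun hK => hW.eq_of_weaklyHyperbolic hφ hMS hK.1 hK.2.1 hK.2.2, ?_⟩
    rintro ⟨rfl, rfl⟩
    -- One function serves both ends, by its signs on the sink and on the source.
    obtain ⟨g, hg, hpos, hp, hm⟩ := (hW.foliationData hφ).exists_escape hMS
    exact ⟨((hW.foliationData hφ).isAttractorRepeller hMS).isSimpleStructure,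
      hG.weaklyHyperbolicSink hW hg hpos hp, hG.weaklyHyperbolicSource hW hg hpos hm⟩
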